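/- Let $W(x)=(1+|x|^2/3)^{-1/2}$ on $\mathbb R^3$, and set $E(f)=\int_{\mathbb R^3}\big(\tfrac12|\nabla f|^2-\tfrac16|f|^6+\tfrac14|f|^4\big)dx$, $E^c(f)=\int_{\mathbb R^3}\big(\tfrac12|\nabla f|^2-\tfrac16|f|^6\big)dx$ and $\delta(f)=\big|\|\nabla W\|_{L^2}^2-\|\nabla f\|_{L^2}^2\big|$. By a solution of $$i\partial_t u+\Delta u=|u|^2u-|u|^4u \qquad (\ast)$$ on an open interval $I\ni 0$ we mean a function $u\in C(I,H^1(\mathbb R^3))$ satisfying $(\ast)$ in the sense of distributions, with $u\in L^q(K,H^{1,r}(\mathbb R^3))$ for every compact interval $K\subset I$ and all $2\le q,r\le\infty$ with $\tfrac2q+\tfrac3r=\tfrac32$. Proposition. There exist absolute constants $\delta_0>0$ and $C>0$ with the following property. Let $u$ be a radial solution of $(\ast)$ on an open interval $I\ni0$ with $E(u(0))=E^c(W)$. Write $\delta(t)=\delta(u(t))$ and $I_0=\{t\in I:\delta(t)<\delta_0\}$. Then there are $C^1$ functions $\theta:I_0\to\mathbb R$ and $\mu:I_0\to(0,\infty)$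 such that, writing $$u(t,x)=e^{i\theta(t)}\big[g(t,x)+\mu(t)^{1/2}W(\mu(t)x)\big],\qquad t\in I_0,$$ we have for all $t\in I_0$ $$\|u(t)\|_{L^4}^2+\frac1{1+\mu(t)}\le C\,\delta(t),\qquad C^{-1}\delta(t)\le\|g(t)\|_{\dot H^1}\le C\,\delta(t),\qquad \Big|\frac{\mu'(t)}{\mu(t)}\Big|\le C\,\mu(t)^2\,\delta(t),$$ where $\|g\|_{\dot H^1}=\|\nabla g\|_{L^2}$. -/

import Mathlib

open MeasureTheory Set Filter Topology
open scoped ENNReal ContDiff InnerProductSpace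

noncomputable section

/-- Three-dimensional Euclidean space. -/
abbrev Space3 : Type := EuclideanSpace ℝ (Fin 3)

/-- `G` is the weak gradient of the complex-valued function `f` on `ℝ³`:
`∫ (∂ⱼφ) f = - ∫ φ Gⱼ` for every real test function `φ` and every `j`. -/
structure HasWeakGradient (f : Space3 → ℂ) (G : Space3 → EuclideanSpace ℂ (Fin 3)) : Prop where
  locallyIntegrable : LocallyIntegrable f volume
  locallyIntegrable_grad : LocallyIntegrable G volume
  integral_eq : ∀ (φ : Space3 → ℝ), ContDiff ℝ ∞ φ → HasCompactSupport φ → ∀ j : Fin 3,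
    ∫ x, ((fderiv ℝ φ x (EuclideanSpace.single j 1) : ℝ) : ℂ) * f x
      = -∫ x, ((φ x : ℝ) : ℂ) * G x j

/-- `‖∇f‖_{L^p}` for the weak gradient of `f`, with the value `∞` if `f` has no weak gradient.
The weak gradient is unique up to null sets, so the infimum runs over a single value. -/
def gradNorm (p : ℝ≥0∞) (f : Space3 → ℂ) : ℝ≥0∞ :=
  ⨅ (G : Space3 → EuclideanSpace ℂ (Fin 3)) (_ : HasWeakGradient f G), eLpNorm G p volume

/-- The norm `‖f‖_{L^p} + ‖∇f‖_{L^p}` of the Sobolev space `H^{1,p}(ℝ³)`,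
with the value `∞` exactly when `f` is not in this space. -/
def sobolevNorm (p : ℝ≥0∞) (f : Space3 → ℂ) : ℝ≥0∞ :=
  eLpNorm f p volume + gradNorm p f

/-- The seminorm `‖f‖_{Ḣ¹} = ‖∇f‖_{L²}`. -/
def hDotNorm (f : Space3 → ℂ) : ℝ≥0∞ := gradNorm 2 f

/-- The ground state `W(x) = (1 + |x|²/3)^{-1/2}`. -/
def groundState (x : Space3) : ℂ := (((Real.sqrt (1 + ‖x‖ ^ 2 / 3))⁻¹ : ℝ) : ℂ)

/-- The quintic energy `E^c(f) = ∫ ½|∇f|² - ⅙|f|⁶`. -/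
def criticalEnergy (f : Space3 → ℂ) : ℝ :=
  (1 / 2) * (hDotNorm f).toReal ^ 2 - (1 / 6) * ∫ x, ‖f x‖ ^ 6

/-- The cubic-quintic energy `E(f) = ∫ ½|∇f|² - ⅙|f|⁶ + ¼|f|⁴`. -/
def energy (f : Space3 → ℂ) : ℝ :=
  (1 / 2) * (hDotNorm f).toReal ^ 2 - (1 / 6) * (∫ x, ‖f x‖ ^ 6) + (1 / 4) * ∫ x, ‖f x‖ ^ 4

/-- `δ(f) = | ‖∇W‖² - ‖∇f‖² |`. -/
def gradGap (f : Space3 → ℂ) : ℝ :=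
  |(hDotNorm groundState).toReal ^ 2 - (hDotNorm f).toReal ^ 2|

/-- Radial functions, as almost-everywhere classes: invariant under all linear isometries. -/
def IsRadial (f : Space3 → ℂ) : Prop :=
  ∀ A : Space3 ≃ₗᵢ[ℝ] Space3, (fun x => f (A x)) =ᵐ[volume] f

/-- Schrödinger-admissible pairs in three dimensions. -/
def IsAdmissible (q r : ℝ≥0∞) : Prop :=
  2 ≤ q ∧ 2 ≤ r ∧ 2 / q + 3 / r = 3 / 2

/-- The nonlinearity `|z|² z - |z|⁴ z`. -/
def nonlinearity (z : ℂ) : ℂ := ((‖z‖ ^ 2 : ℝ) : ℂ) * z - ((‖z‖ ^ 4 : ℝ) : ℂ) * z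

/-- `u` is an `H¹` solution of `i ∂ₜu + Δu = |u|²u - |u|⁴u` on the open time interval `I ∋ 0`,
in the class in which the equation is well posed: `u ∈ C(I, H¹) ∩ L^q_loc(I, H^{1,r})` for all
admissible `(q, r)`, and for every `t ∈ I` the equation holds for `∂ₜu(t)` in the sense of
distributions on `ℝ³`. -/
structure IsNLSSolution (I : Set ℝ) (u : ℝ → Space3 → ℂ) : Prop where
  isOpen : IsOpen I
  ordConnected : I.OrdConnected
  zero_mem : (0 : ℝ) ∈ I
  mem_sobolev : ∀ t ∈ I, sobolevNorm 2 (u t) < ⊤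
  continuous_sobolev : ∀ t ∈ I,
    Tendsto (fun s => sobolevNorm 2 (fun x => u s x - u t x)) (𝓝 t) (𝓝 0)
  strichartz : ∀ a b : ℝ, Icc a b ⊆ I → ∀ q r : ℝ≥0∞, IsAdmissible q r →
    eLpNorm (fun t => sobolevNorm r (u t)) q (volume.restrict (Icc a b)) < ⊤
  equation : ∀ (φ : Space3 → ℝ), ContDiff ℝ ∞ φ → HasCompactSupport φ → ∀ t ∈ I,
    HasDerivAt (fun s => ∫ x, u s x * ((φ x : ℝ) : ℂ))
      (Complex.I * ((∫ x, u t x * ((Laplacian.laplacian φ x : ℝ) : ℂ))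
        - ∫ x, nonlinearity (u t x) * ((φ x : ℝ) : ℂ))) t

end

/-!
The proof is elementary: it needs neither the classification of optimisers of the Sobolev
inequality nor the spectral theory of the linearisation at the ground state.

*Stability of the Sobolev inequality.* In logarithmic coordinates `w s = e^{s/2} f(e^s)`, a radial
`f` has `‖∇f‖² = κ ∫ (|w'|² + |w|²/4)` and `‖f‖₆⁶ = κ ∫ |w|⁶`, and the bubbles become, up to a
constant factor, the translates of `sech^{1/2}`. The increasing map transporting `sech³` to `|w|⁶`
turns the deficit of the sharp inequality into an explicit sum of nonnegative terms. These terms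
also control `∫ |w' + ½ tanh(· - τ) w|²` for a suitable `τ`, and a function for which this last
integral is small is close to a multiple of `sech^{1/2}(· - τ)`. Hence the square of the distance
in `Ḣ¹` from a radial `f` to the multiples of bubbles is bounded by the Sobolev deficit
(`exists_soliton_near`, `exists_bubble_near`).

*The static estimates.* If `E(f) = E^c(W)` and `δ = δ(f)` is small, expanding the energy identity
around `‖∇f‖² = ‖∇W‖²` gives `deficit + ‖f‖₄⁴ ≲ δ²`: the first-order terms cancel, because `‖∇W‖²`
is a critical point of `G ↦ G/2 - G³/(6 ‖∇W‖⁴)`. So `f` is within `O(δ)` of a unimodular multiple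
of a bubble `W_μ = μ^{1/2} W(μ ·)`. Pairing `f` with a bump at scale `1/μ` shows that
`μ^{-1/4} ≲ ‖f‖₄ ≲ δ^{1/2}`, so that `1/μ ≲ δ² ≲ δ` (`exists_near_bubble_of_energy`).

*Conservation of energy.* The hypothesis on the energy is made at time `0` only. To carry it to
the other times the solution is mollified: `d/dt E(ρ_ε * u)` involves only the commutator of the
nonlinearity with convolution by `ρ_ε`. It is bounded by Strichartz-type norms of `u`, uniformly
in `ε`, and tends to `0` for almost every time (`IsNLSSolution.energy_eq`).

*Modulation.* For a fixed bump `χ` supported in the shell `1 ≤ |x| ≤ 3`, let `T f a = ∫ f χ_a`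
with `χ_a = a^{5/2} χ(a ·)`. On a bubble `T(e^{iθ} W_μ)(a) = e^{iθ} P(a/μ)`, where `P > 0` tends
to `0` at both ends of the range of scales. Let `Ψ` be a smooth cutoff of the modulus away from
`0`. Up to a constant factor, `∫ Ψ(T f a) da` recovers the frequency `μ`, and the argument of
`∫ Ψ(T f a) T f a da` recovers the phase, with relative errors `O(δ)` (`exists_modulation_le`).
These averages are `C¹` in time directly from the weak form of the equation, with no implicit
function theorem. As `Δ W_μ + W_μ⁵ = 0`, the time derivative of `T u(t) a` is `O(μ² δ)` at the
scales that matter, and this gives the bound on `μ'/μ` (`exists_abs_deriv_scale_le`).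
-/

/-! ### The hyperbolic secant -/

/-- The hyperbolic secant; `sech ^ (1/2)` is the ground state in Emden–Fowler coordinates. -/
noncomputable def sech (y : ℝ) : ℝ := (Real.cosh y)⁻¹

lemma sech_pos (y : ℝ) : 0 < sech y := inv_pos.2 (Real.cosh_pos y)

lemma sech_le_one (y : ℝ) : sech y ≤ 1 := inv_le_one_of_one_le₀ (Real.one_le_cosh y)

lemma sech_neg (y : ℝ) : sech (-y) = sech y := by simp [sech]

lemma hasDerivAt_sech (y : ℝ) : HasDerivAt sech (-(Real.tanh y * sech y)) y := by
  have h := (Real.hasDerivAt_cosh y).inv (Real.cosh_pos y).ne'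
  refine h.congr_deriv ?_
  rw [Real.tanh_eq_sinh_div_cosh, sech]
  field_simp

lemma sech_sq (y : ℝ) : sech y ^ 2 = 1 - Real.tanh y ^ 2 := by
  have h := Real.cosh_sq y
  have := (Real.cosh_pos y).ne'
  rw [Real.tanh_eq_sinh_div_cosh, sech]
  field_simp
  linarith

lemma hasDerivAt_tanh (y : ℝ) : HasDerivAt Real.tanh (1 - Real.tanh y ^ 2) y := by
  have h := (Real.hasDerivAt_sinh y).div (Real.hasDerivAt_cosh y) (Real.cosh_pos y).ne'
  have h2 : (fun y => Real.sinh y / Real.cosh y) = Real.tanh := by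
    ext z; rw [Real.tanh_eq_sinh_div_cosh]
  have h3 : HasDerivAt (fun y => Real.sinh y / Real.cosh y) (1 - Real.tanh y ^ 2) y := by
    refine h.congr_deriv ?_
    have := (Real.cosh_pos y).ne'
    rw [Real.tanh_eq_sinh_div_cosh]
    field_simp
  rwa [h2] at h3

lemma continuous_sech : Continuous sech :=
  continuous_iff_continuousAt.2 fun y => (hasDerivAt_sech y).continuousAt

lemma continuous_tanh : Continuous Real.tanh :=
  continuous_iff_continuousAt.2 fun y => (hasDerivAt_tanh y).continuousAt

lemma abs_tanh_le_one (y : ℝ) : |Real.tanh y| ≤ 1 := (Real.abs_tanh_lt_one y).le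

lemma tanh_sq_le_one (y : ℝ) : Real.tanh y ^ 2 ≤ 1 := (Real.tanh_sq_lt_one y).le

lemma strictMono_tanh : StrictMono Real.tanh := by
  refine strictMono_of_deriv_pos fun y => ?_
  rw [(hasDerivAt_tanh y).deriv, ← sech_sq]
  exact pow_pos (sech_pos y) 2

lemma tanh_nonneg {y : ℝ} (hy : 0 ≤ y) : 0 ≤ Real.tanh y := by
  simpa using strictMono_tanh.monotone hy

lemma sech_le_two_exp (y : ℝ) : sech y ≤ 2 * Real.exp y := by
  have h1 : Real.cosh y = (Real.exp y + Real.exp (-y)) / 2 := Real.cosh_eq y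
  rw [sech, inv_le_iff_one_le_mul₀ (Real.cosh_pos y), h1]
  have : Real.exp y * Real.exp (-y) = 1 := by rw [← Real.exp_add]; simp
  nlinarith [Real.exp_pos y]

lemma sech_le_two_exp_neg (y : ℝ) : sech y ≤ 2 * Real.exp (-y) := by
  simpa [sech_neg] using sech_le_two_exp (-y)

lemma exp_le_sech {y : ℝ} (hy : y ≤ 0) : Real.exp y ≤ sech y := by
  have h1 : Real.cosh y = (Real.exp y + Real.exp (-y)) / 2 := Real.cosh_eq y
  rw [sech, le_inv_comm₀ (Real.exp_pos y) (Real.cosh_pos y), h1, ← Real.exp_neg]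
  have : Real.exp y ≤ Real.exp (-y) := Real.exp_le_exp.2 (by linarith)
  linarith

lemma exp_neg_le_sech {y : ℝ} (hy : 0 ≤ y) : Real.exp (-y) ≤ sech y := by
  simpa [sech_neg] using exp_le_sech (y := -y) (by linarith)

lemma integrable_sech : Integrable sech := by
  refine (integrable_inv_one_add_sq.const_mul 4).mono' continuous_sech.aestronglyMeasurable ?_
  refine Eventually.of_forall fun y => ?_
  rw [Real.norm_eq_abs, abs_of_pos (sech_pos y), sech, ← div_eq_mul_inv,
    inv_eq_one_div, div_le_div_iff₀ (Real.cosh_pos y) (by positivity)]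
  have h : 1 + |y| ^ 2 / 4 ≤ Real.cosh |y| := by
    have h1 := Real.cosh_eq |y|
    have h2 := Real.quadratic_le_exp_of_nonneg (abs_nonneg y)
    have h3 := Real.add_one_le_exp (-|y|)
    linarith
  rw [Real.cosh_abs, sq_abs] at h
  nlinarith

lemma integrable_mul_sech {f : ℝ → ℝ} (hf : Continuous f) {B : ℝ} (hB : ∀ y, |f y| ≤ B * sech y) :
    Integrable f :=
  (integrable_sech.const_mul B).mono' hf.aestronglyMeasurable (Eventually.of_forall hB)

lemma tendsto_sech_atTop : Tendsto sech atTop (𝓝 0) := by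
  refine squeeze_zero (fun y => (sech_pos y).le) sech_le_two_exp_neg ?_
  simpa using (Real.tendsto_exp_neg_atTop_nhds_zero).const_mul 2

lemma tendsto_sech_atBot : Tendsto sech atBot (𝓝 0) := by
  refine squeeze_zero (fun y => (sech_pos y).le) sech_le_two_exp ?_
  simpa using (Real.tendsto_exp_atBot).const_mul 2

lemma integrable_sech_pow (n : ℕ) (hn : n ≠ 0) : Integrable fun y => sech y ^ n := by
  refine integrable_mul_sech (continuous_sech.pow n) (B := 1) fun y => ?_
  rw [abs_of_pos (pow_pos (sech_pos y) n), one_mul]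
  exact pow_le_of_le_one (sech_pos y).le (sech_le_one y) hn

/-- A function whose modulus is at most a multiple of `sech` tends to zero at both ends. -/
lemma tendsto_zero_of_le_sech {E : Type*} [NormedAddCommGroup E] {f : ℝ → E} {B : ℝ}
    (hB : ∀ y, ‖f y‖ ≤ B * sech y) :
    Tendsto f atBot (𝓝 0) ∧ Tendsto f atTop (𝓝 0) :=
  ⟨squeeze_zero_norm hB (by simpa using tendsto_sech_atBot.const_mul B),
    squeeze_zero_norm hB (by simpa using tendsto_sech_atTop.const_mul B)⟩

/-- The integral of a derivative vanishes for functions bounded by a multiple of `sech`. -/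
lemma integral_deriv_eq_zero_of_le_sech {f f' : ℝ → ℝ} (hf : ∀ y, HasDerivAt f (f' y) y)
    (hi : Integrable f') {B : ℝ} (hB : ∀ y, |f y| ≤ B * sech y) : ∫ y, f' y = 0 := by
  have h := tendsto_zero_of_le_sech (f := f) hB
  simpa using integral_of_hasDerivAt_of_tendsto hf hi h.1 h.2

lemma integral_sech_pow_three : ∫ y, sech y ^ 3 = (∫ y, sech y) / 2 := by
  have h1 : ∀ y, HasDerivAt (fun y => Real.tanh y * sech y) (2 * sech y ^ 3 - sech y) y := by
    intro y
    refine ((hasDerivAt_tanh y).mul (hasDerivAt_sech y)).congr_deriv ?_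
    have := sech_sq y
    have h3 : sech y ^ 3 = sech y ^ 2 * sech y := by ring
    rw [h3, this]; ring
  have hi : Integrable fun y => 2 * sech y ^ 3 - sech y :=
    ((integrable_sech_pow 3 (by norm_num)).const_mul 2).sub integrable_sech
  have h2 := integral_deriv_eq_zero_of_le_sech h1 hi (B := 1) fun y => by
    rw [abs_mul, abs_of_pos (sech_pos y)]
    exact mul_le_mul_of_nonneg_right (abs_tanh_le_one y) (sech_pos y).le
  rw [integral_sub ((integrable_sech_pow 3 (by norm_num)).const_mul 2) integrable_sech,
    integral_const_mul] at h2
  linarith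

lemma integral_sech_pos : 0 < ∫ y, sech y := by
  rw [integral_pos_iff_support_of_nonneg (fun y => (sech_pos y).le) integrable_sech]
  have : Function.support sech = univ := by
    ext y; simp [(sech_pos y).ne']
  simp [this]

/-! ### Monotone transport on the line -/

lemma hasDerivAt_integral_Iic {f : ℝ → ℝ} (hf : Continuous f) (hi : Integrable f) (s : ℝ) :
    HasDerivAt (fun s => ∫ x in Iic s, f x) (f s) s := by
  have h : ∀ s, ∫ x in Iic s, f x = (∫ x in Iic 0, f x) + ∫ x in (0:ℝ)..s, f x := by
    intro s
    have := intervalIntegral.integral_Iic_sub_Iic (hi.integrableOn (s := Iic 0))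
      (hi.integrableOn (s := Iic s))
    linarith
  have h2 : (fun s => ∫ x in Iic s, f x)
      = fun s => (∫ x in Iic 0, f x) + ∫ x in (0:ℝ)..s, f x := funext h
  rw [h2]
  exact (hf.integral_hasStrictDerivAt 0 s).hasDerivAt.const_add _

lemma strictMono_integral_Iic {f : ℝ → ℝ} (hf : Continuous f) (hi : Integrable f)
    (hpos : ∀ x, 0 < f x) : StrictMono (fun s => ∫ x in Iic s, f x) := by
  refine strictMono_of_deriv_pos fun s => ?_
  rw [(hasDerivAt_integral_Iic hf hi s).deriv]
  exact hpos s

lemma tendsto_integral_Iic_atBot {f : ℝ → ℝ} :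
    Tendsto (fun s => ∫ x in Iic s, f x) atBot (𝓝 0) := tendsto_integral_Iic_zero tendsto_id

lemma integral_Iic_add_Ioi {f : ℝ → ℝ} (hi : Integrable f) (s : ℝ) :
    (∫ x in Iic s, f x) + ∫ x in Ioi s, f x = ∫ x, f x := by
  rw [← integral_add_compl (measurableSet_Iic (a := s)) hi, compl_Iic]

lemma tendsto_integral_Iic_atTop {f : ℝ → ℝ} (hi : Integrable f) :
    Tendsto (fun s => ∫ x in Iic s, f x) atTop (𝓝 (∫ x, f x)) :=
  (aecover_Iic tendsto_id).integral_tendsto_of_countably_generated hi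

lemma exists_integral_Iic_eq {f g : ℝ → ℝ} (hf : Continuous f) (hfi : Integrable f)
    (hg : Continuous g) (hgi : Integrable g) (hgpos : ∀ x, 0 < g x)
    (h : ∫ x, f x = ∫ x, g x) (y : ℝ) : ∃ s, ∫ x in Iic s, f x = ∫ x in Iic y, g x := by
  have hmono := strictMono_integral_Iic hg hgi hgpos
  have hcont : Continuous (fun s => ∫ x in Iic s, f x) :=
    continuous_iff_continuousAt.2 fun s => (hasDerivAt_integral_Iic hf hfi s).continuousAt
  have hlow : 0 < ∫ x in Iic y, g x := by
    have h1 : 0 ≤ ∫ x in Iic (y - 1), g x := integral_nonneg fun x => (hgpos x).le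
    exact h1.trans_lt (hmono (by linarith))
  have hup : ∫ x in Iic y, g x < ∫ x, f x := by
    rw [h]
    exact (hmono (by linarith : y < y + 1)).trans_le
      (hmono.monotone.ge_of_tendsto (tendsto_integral_Iic_atTop hgi) (y + 1))
  obtain ⟨a, ha⟩ := (tendsto_integral_Iic_atBot (f := f)).eventually_lt_const hlow |>.exists
  obtain ⟨b, hb⟩ := (tendsto_integral_Iic_atTop hfi).eventually_const_lt hup |>.exists
  exact mem_range_of_exists_le_of_exists_ge hcont ⟨a, ha.le⟩ ⟨b, hb.le⟩

/-- Two positive continuous densities on the line with equal mass are related by an increasing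
transport map. -/
lemma exists_transport {f g : ℝ → ℝ} (hf : Continuous f) (hfi : Integrable f)
    (hfpos : ∀ x, 0 < f x) (hg : Continuous g) (hgi : Integrable g) (hgpos : ∀ x, 0 < g x)
    (h : ∫ x, f x = ∫ x, g x) :
    ∃ σ : ℝ → ℝ, StrictMono σ ∧ Function.Surjective σ ∧
      (∀ y, ∫ x in Iic (σ y), f x = ∫ x in Iic y, g x) ∧
      ∀ y, HasDerivAt σ (g y / f (σ y)) y := by
  choose σ hσ using exists_integral_Iic_eq hf hfi hg hgi hgpos h
  have hF := strictMono_integral_Iic hf hfi hfpos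
  have hG := strictMono_integral_Iic hg hgi hgpos
  have hmono : StrictMono σ := by
    intro a b hab
    have := hG hab
    simp only [← hσ] at this
    exact hF.lt_iff_lt.1 this
  have hsurj : Function.Surjective σ := by
    intro s
    obtain ⟨y, hy⟩ := exists_integral_Iic_eq hg hgi hf hfi hfpos h.symm s
    exact ⟨y, hF.injective (by simpa [hσ] using hy)⟩
  have hcont : Continuous σ := hmono.monotone.continuous_of_surjective hsurj
  refine ⟨σ, hmono, hsurj, hσ, fun y => ?_⟩
  -- `σ = F⁻¹ ∘ G` for the distribution functions `F`, `G`.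
  let e : ℝ ≃ ℝ := Equiv.ofBijective σ ⟨hmono.injective, hsurj⟩
  have hinv : HasDerivAt (fun s => e.symm s) (f (σ y) / g y) (σ y) := by
    have h1 : ∀ s, ∫ x in Iic (e.symm s), g x = ∫ x in Iic s, f x := by
      intro s
      rw [← hσ]
      congr 2
      exact congrArg _ (e.apply_symm_apply s)
    have hc : ContinuousAt (fun s => e.symm s) (σ y) := by
      have hm : StrictMono e.symm := by
        intro a b hab
        by_contra! hle
        have := hmono.monotone hle
        have ha : σ (e.symm a) = a := e.apply_symm_apply a
        have hb : σ (e.symm b) = b := e.apply_symm_apply b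
        rw [ha, hb] at this
        linarith
      exact (hm.monotone.continuous_of_surjective e.symm.surjective).continuousAt
    have he : e.symm (σ y) = y := e.symm_apply_apply y
    have hd := hasDerivAt_integral_Iic hg hgi y
    have hfd := hasDerivAt_integral_Iic hf hfi (σ y)
    -- the inverse `s ↦ e.symm s` satisfies `G (e.symm s) = F s`
    have hslope : HasDerivAt (fun s => ∫ x in Iic (e.symm s), g x) (f (σ y)) (σ y) := by
      simpa only [h1] using hfd
    rw [hasDerivAt_iff_tendsto_slope] at hslope hd ⊢
    have hne : Tendsto (fun s => e.symm s) (𝓝[≠] (σ y)) (𝓝[≠] y) := by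
      refine tendsto_nhdsWithin_iff.2 ⟨?_, ?_⟩
      · have := hc.tendsto
        rw [he] at this
        exact this.mono_left nhdsWithin_le_nhds
      · filter_upwards [self_mem_nhdsWithin] with s hs h2
        apply hs
        have : s = σ (e.symm s) := (e.apply_symm_apply s).symm
        rw [h2] at this
        exact this
    have hd' := hd.comp hne
    have := hslope.div hd' (hgpos y).ne'
    refine this.congr' ?_
    filter_upwards [hne self_mem_nhdsWithin, self_mem_nhdsWithin] with s hs hs2
    have hs' : e.symm s ≠ y := hs
    have hs3 : s ≠ σ y := hs2
    have hne2 : (∫ x in Iic (e.symm s), g x) - ∫ x in Iic y, g x ≠ 0 := fun h0 =>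
      hs' (hG.injective (by simpa using sub_eq_zero.1 h0))
    simp only [Function.comp, slope_def_field, he, Pi.div_apply]
    have h4 := sub_ne_zero.2 hs'
    have h5 := sub_ne_zero.2 hs3
    field_simp
  have h3 := HasDerivAt.of_local_left_inverse (g := σ) (f := fun s => e.symm s) (a := y)
    (f' := f (σ y) / g y) hcont.continuousAt hinv (div_pos (hfpos _) (hgpos _)).ne'
    (Eventually.of_forall fun x => e.symm_apply_apply x)
  simpa using h3

/-- A Hardy type inequality on the half-line with weight `sech`: a bounded function `e` vanishing at
the origin is controlled by `f` as soon as `e e' ≤ 12 |e| |f|` wherever `f` is small. The pointwise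
bound confines the remaining points to a tail of small weight. -/
lemma integral_Ioi_sech_mul_sq_le {e e' f : ℝ → ℝ} {D : ℝ} (hD : 0 < D)
    (he : ∀ y, HasDerivAt e (e' y) y) (hec : Continuous e') (h0 : e 0 = 0)
    (hb : ∀ y, |e y| ≤ 2) (hf : Continuous f) (hfi : Integrable fun y => sech y * f y ^ 2)
    (hint : ∫ y, sech y * f y ^ 2 ≤ 8 * D) (hpt : ∀ y, sech y * f y ^ 2 ≤ 32 * D)
    (hode : ∀ y, 0 ≤ y → |f y| < 3 / 4 → e y * e' y ≤ 12 * |e y| * |f y|) :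
    ∫ y in Ioi 0, sech y * e y ^ 2 ≤ 10000 * D := by
  have hecont : Continuous e := continuous_iff_continuousAt.2 fun y => (he y).continuousAt
  have hsq : ∀ y, e y ^ 2 ≤ 4 := fun y => by
    have := sq_le_sq' (by linarith [abs_le.1 (hb y)]) (abs_le.1 (hb y)).2
    linarith
  set Y : ℝ := max 0 (-Real.log (57 * D)) with hY
  have hY0 : 0 ≤ Y := le_max_left _ _
  have hexpY : Real.exp (-Y) ≤ 57 * D := by
    have h1 : -Y ≤ Real.log (57 * D) := by
      have := le_max_right 0 (-Real.log (57 * D)); linarith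
    calc Real.exp (-Y) ≤ Real.exp (Real.log (57 * D)) := Real.exp_le_exp.2 h1
      _ = 57 * D := Real.exp_log (by positivity)
  have hsmall : ∀ y, 0 ≤ y → y < Y → |f y| < 3 / 4 := by
    intro y hy hyY
    have h1 : y < -Real.log (57 * D) := by
      rcases max_choice 0 (-Real.log (57 * D)) with h | h
      · rw [hY, h] at hyY; linarith
      · rw [hY, h] at hyY; exact hyY
    have h2 : 57 * D < sech y := by
      calc 57 * D = Real.exp (Real.log (57 * D)) := (Real.exp_log (by positivity)).symm
        _ < Real.exp (-y) := Real.exp_lt_exp.2 (by linarith)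
        _ ≤ sech y := exp_neg_le_sech hy
    have h3 := hpt y
    by_contra! hcon
    have h4 : 9 / 16 ≤ f y ^ 2 := by
      rw [← sq_abs]; nlinarith
    nlinarith
  have hint_sq : Integrable fun y => sech y * e y ^ 2 := by
    refine integrable_mul_sech (continuous_sech.mul (hecont.pow 2)) (B := 4) fun y => ?_
    rw [abs_of_nonneg (mul_nonneg (sech_pos y).le (sq_nonneg _)), mul_comm]
    exact mul_le_mul_of_nonneg_right (hsq y) (sech_pos y).le
  have hc1 : Continuous fun y => Real.exp (-y) * e y ^ 2 := by fun_prop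
  have hc2 : Continuous fun y => Real.exp (-y) * f y ^ 2 := by fun_prop
  have hder : ∀ y, HasDerivAt (fun y => Real.exp (-y) * e y ^ 2)
      (-(Real.exp (-y) * e y ^ 2) + 2 * (Real.exp (-y) * (e y * e' y))) y := by
    intro y
    have h1 : HasDerivAt (fun y => Real.exp (-y)) (-Real.exp (-y)) y := by
      simpa using (hasDerivAt_neg y).exp
    refine (h1.mul ((he y).pow 2)).congr_deriv ?_
    simp; ring
  have hFTC := intervalIntegral.integral_eq_sub_of_hasDerivAt (a := 0) (b := Y)
    (fun y _ => hder y) (by apply Continuous.intervalIntegrable; fun_prop)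
  have hkey : (0:ℝ) ≤ ∫ y in (0:ℝ)..Y,
      (-(1 / 2) * (Real.exp (-y) * e y ^ 2) + 288 * (Real.exp (-y) * f y ^ 2)) := by
    have h1 : (0:ℝ) ≤ ∫ y in (0:ℝ)..Y,
        (-(Real.exp (-y) * e y ^ 2) + 2 * (Real.exp (-y) * (e y * e' y))) := by
      rw [hFTC, h0]
      have := mul_nonneg (Real.exp_pos (-Y)).le (sq_nonneg (e Y))
      simpa using this
    refine h1.trans (intervalIntegral.integral_mono_on_of_le_Ioo hY0
      (by apply Continuous.intervalIntegrable; fun_prop)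
      (by apply Continuous.intervalIntegrable; fun_prop) fun y hy => ?_)
    have h2 := hode y hy.1.le (hsmall y hy.1.le hy.2)
    have h3 := Real.exp_pos (-y)
    have h4 : 24 * (|e y| * |f y|) ≤ 1 / 2 * e y ^ 2 + 288 * f y ^ 2 := by
      have := sq_nonneg (|e y| - 24 * |f y|)
      have h5 := sq_abs (e y)
      have h6 := sq_abs (f y)
      nlinarith
    nlinarith
  rw [intervalIntegral.integral_add (by apply Continuous.intervalIntegrable; fun_prop)
    (by apply Continuous.intervalIntegrable; fun_prop), intervalIntegral.integral_const_mul,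
    intervalIntegral.integral_const_mul] at hkey
  have hA : ∫ y in (0:ℝ)..Y, Real.exp (-y) * f y ^ 2 ≤ 8 * D := by
    have h1 : ∫ y in (0:ℝ)..Y, Real.exp (-y) * f y ^ 2 ≤ ∫ y in (0:ℝ)..Y, sech y * f y ^ 2 := by
      refine intervalIntegral.integral_mono_on hY0 (hc2.intervalIntegrable _ _)
        (by apply Continuous.intervalIntegrable; exact continuous_sech.mul (hf.pow 2))
        fun y hy => mul_le_mul_of_nonneg_right (exp_neg_le_sech hy.1) (sq_nonneg _)
    refine h1.trans (le_trans ?_ hint)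
    rw [intervalIntegral.integral_of_le hY0]
    exact setIntegral_le_integral hfi
      (Eventually.of_forall fun y => mul_nonneg (sech_pos y).le (sq_nonneg _))
  have hB : ∫ y in (0:ℝ)..Y, sech y * e y ^ 2 ≤ 2 * ∫ y in (0:ℝ)..Y, Real.exp (-y) * e y ^ 2 := by
    rw [← intervalIntegral.integral_const_mul]
    refine intervalIntegral.integral_mono_on hY0
      (by apply Continuous.intervalIntegrable; exact continuous_sech.mul (hecont.pow 2))
      (by apply Continuous.intervalIntegrable; fun_prop) fun y _ => ?_
    have := mul_le_mul_of_nonneg_right (sech_le_two_exp_neg y) (sq_nonneg (e y))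
    linarith
  have hC : ∫ y in Ioi Y, sech y * e y ^ 2 ≤ 8 * Real.exp (-Y) := by
    rw [← integral_exp_neg_Ioi, ← integral_const_mul]
    refine setIntegral_mono_on hint_sq.integrableOn
      ((integrableOn_exp_neg_Ioi Y).const_mul 8) measurableSet_Ioi fun y _ => ?_
    nlinarith [sech_le_two_exp_neg y, hsq y, Real.exp_pos (-y), sech_pos y, sq_nonneg (e y)]
  have hsplit := intervalIntegral.integral_interval_add_Ioi
    (hint_sq.integrableOn (s := Ioi 0)) (hint_sq.integrableOn (s := Ioi Y))
  linarith

lemma integral_comp_strictMono {σ σ' : ℝ → ℝ} (hσ : StrictMono σ) (hs : Function.Surjective σ)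
    (hd : ∀ y, HasDerivAt σ (σ' y) y) (hpos : ∀ y, 0 ≤ σ' y) (g : ℝ → ℝ) :
    (Integrable g ↔ Integrable fun y => σ' y * g (σ y)) ∧ ∫ s, g s = ∫ y, σ' y * g (σ y) := by
  have h1 := integrableOn_image_iff_integrableOn_abs_deriv_smul MeasurableSet.univ
    (fun y _ => (hd y).hasDerivWithinAt (s := univ)) hσ.injective.injOn g
  have h2 := integral_image_eq_integral_abs_deriv_smul MeasurableSet.univ
    (fun y _ => (hd y).hasDerivWithinAt (s := univ)) hσ.injective.injOn g
  simpa [hs.range_eq, abs_of_nonneg (hpos _)] using And.intro h1 h2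

lemma integral_Iic_exp_three (y : ℝ) : ∫ x in Iic y, Real.exp (3 * x) = Real.exp (3 * y) / 3 := by
  have h := integral_exp_mul_Iic (a := 3) (by norm_num) y
  simpa using h

lemma integral_Iic_sech_pow_le (y : ℝ) :
    ∫ x in Iic y, sech x ^ 3 ≤ 8 / 3 * Real.exp (3 * y) := by
  have h : ∫ x in Iic y, sech x ^ 3 ≤ ∫ x in Iic y, 8 * Real.exp (3 * x) := by
    refine integral_mono (integrable_sech_pow 3 (by norm_num)).integrableOn
      ((integrableOn_exp_mul_Iic (by norm_num) y).const_mul 8) fun x => ?_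
    have h1 := pow_le_pow_left₀ (sech_pos x).le (sech_le_two_exp x) 3
    refine h1.trans_eq ?_
    rw [mul_pow, ← Real.exp_nat_mul]; norm_num
  rw [integral_const_mul, integral_Iic_exp_three] at h
  linarith

lemma le_integral_Iic_sech_pow (y : ℝ) :
    1 / 3 * (2 * Real.cosh y)⁻¹ ^ 3 ≤ ∫ x in Iic y, sech x ^ 3 := by
  have hi := integrable_sech_pow 3 (by norm_num)
  have h1 : ∫ x in Iic (-|y|), sech x ^ 3 ≤ ∫ x in Iic y, sech x ^ 3 :=
    setIntegral_mono_set hi.integrableOn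
      (Eventually.of_forall fun x => (pow_pos (sech_pos x) 3).le)
      (Iic_subset_Iic.2 (neg_abs_le y)).eventuallyLE
  have h2 : ∫ x in Iic (-|y|), Real.exp (3 * x) ≤ ∫ x in Iic (-|y|), sech x ^ 3 := by
    refine setIntegral_mono_on (integrableOn_exp_mul_Iic (by norm_num) _) hi.integrableOn
      measurableSet_Iic fun x hx => ?_
    have hx0 : x ≤ 0 := (mem_Iic.1 hx).trans (by simp)
    have h3 := pow_le_pow_left₀ (Real.exp_pos x).le (exp_le_sech hx0) 3
    rwa [← Real.exp_nat_mul] at h3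
  rw [integral_Iic_exp_three] at h2
  have h4 : (2 * Real.cosh y)⁻¹ ^ 3 ≤ Real.exp (3 * -|y|) := by
    have : Real.exp (3 * -|y|) = Real.exp (-|y|) ^ 3 := by rw [← Real.exp_nat_mul]; norm_num
    rw [this]
    refine pow_le_pow_left₀ (by positivity) ?_ 3
    rw [Real.exp_neg]
    refine inv_anti₀ (Real.exp_pos _) ?_
    rw [← Real.cosh_abs, Real.cosh_eq]
    have := Real.exp_pos (-|y|)
    linarith
  linarith

/-- Transport maps between two densities comparable to `sech ^ 3` do not move mass far: this is the
one-sided estimate at the left end. -/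
lemma exp_neg_le_of_integral_Iic {f : ℝ → ℝ} {c : ℝ} (hc : 0 < c) (hi : Integrable f)
    (hcf : ∀ s, (c * sech s) ^ 3 ≤ f s) {s y : ℝ}
    (h : ∫ x in Iic s, f x = ∫ x in Iic y, sech x ^ 3) :
    c * Real.exp (-y) ≤ 4 * Real.cosh s := by
  have h1 : c ^ 3 * ∫ x in Iic s, sech x ^ 3 ≤ ∫ x in Iic s, f x := by
    rw [← integral_const_mul]
    refine integral_mono ((integrable_sech_pow 3 (by norm_num)).integrableOn.const_mul _)
      hi.integrableOn fun x => ?_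
    have := hcf x
    rwa [mul_pow] at this
  have h2 := le_integral_Iic_sech_pow s
  have h3 := integral_Iic_sech_pow_le y
  have h4 : c ^ 3 * (1 / 3 * (2 * Real.cosh s)⁻¹ ^ 3) ≤ 8 / 3 * Real.exp (3 * y) := by
    refine le_trans (mul_le_mul_of_nonneg_left h2 (by positivity)) ?_
    rw [h] at h1
    exact h1.trans h3
  have hcs := Real.cosh_pos s
  have h5 : Real.exp (3 * y) = Real.exp y ^ 3 := by rw [← Real.exp_nat_mul]; norm_num
  rw [h5] at h4
  have h6 : c ^ 3 ≤ (4 * Real.cosh s * Real.exp y) ^ 3 := by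
    have h7 : c ^ 3 * (1 / 3 * (2 * Real.cosh s)⁻¹ ^ 3) * (24 * Real.cosh s ^ 3)
        ≤ 8 / 3 * Real.exp y ^ 3 * (24 * Real.cosh s ^ 3) :=
      mul_le_mul_of_nonneg_right h4 (by positivity)
    have h8 : c ^ 3 * (1 / 3 * (2 * Real.cosh s)⁻¹ ^ 3) * (24 * Real.cosh s ^ 3) = c ^ 3 := by
      field_simp; norm_num
    rw [h8] at h7
    calc c ^ 3 ≤ _ := h7
      _ = _ := by ring
  have h9 := le_of_pow_le_pow_left₀ (by norm_num) (by positivity) h6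
  have h10 : Real.exp y * Real.exp (-y) = 1 := by rw [← Real.exp_add]; simp
  calc c * Real.exp (-y) ≤ 4 * Real.cosh s * Real.exp y * Real.exp (-y) :=
        mul_le_mul_of_nonneg_right h9 (Real.exp_pos _).le
    _ = 4 * Real.cosh s := by rw [mul_assoc, h10, mul_one]

lemma integral_Iic_comp_neg (f : ℝ → ℝ) (s : ℝ) :
    ∫ x in Iic (-s), f (-x) = ∫ x in Ioi s, f x := by
  simp

lemma cosh_le_of_integral_Iic {f : ℝ → ℝ} {c : ℝ} (hc : 0 < c) (hi : Integrable f)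
    (hcf : ∀ s, (c * sech s) ^ 3 ≤ f s) (htot : ∫ x, f x = ∫ x, sech x ^ 3) {s y : ℝ}
    (h : ∫ x in Iic s, f x = ∫ x in Iic y, sech x ^ 3) :
    c * Real.cosh y ≤ 4 * Real.cosh s := by
  have h1 := exp_neg_le_of_integral_Iic hc hi hcf h
  have h2 : ∫ x in Iic (-s), f (-x) = ∫ x in Iic (-y), sech x ^ 3 := by
    have e1 := integral_Iic_comp_neg f s
    have e2 := integral_Iic_comp_neg (fun x => sech x ^ 3) y
    simp only [sech_neg] at e2
    rw [e1, e2]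
    have a1 := integral_Iic_add_Ioi hi s
    have a2 := integral_Iic_add_Ioi (integrable_sech_pow 3 (by norm_num)) y
    linarith
  have h3 := exp_neg_le_of_integral_Iic hc hi.comp_neg
    (fun s => by simpa [sech_neg] using hcf (-s)) h2
  rw [Real.cosh_neg, neg_neg] at h3
  rw [Real.cosh_eq y]
  linarith

/-- The data obtained from transporting `ρ ^ 6` to `sech ^ 3`: the map `σ` and the square root `κ`
of `(σ')^(-2/3)`, with its derivative `κ'`. -/
structure TransportData (ρ ρ' σ κ κ' : ℝ → ℝ) (K : ℝ) : Prop where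
  strictMono : StrictMono σ
  surjective : Function.Surjective σ
  hasDerivAt_map : ∀ y, HasDerivAt σ ((κ y ^ 3)⁻¹) y
  hasDerivAt : ∀ y, HasDerivAt κ (κ' y) y
  continuous_deriv : Continuous κ'
  pos : ∀ y, 0 < κ y
  le : ∀ y, κ y ≤ K
  sq_eq : ∀ y, ρ (σ y) ^ 2 = κ y * sech y
  mul_eq : ∀ y, 2 * (ρ (σ y) * ρ' (σ y)) = (κ' y - Real.tanh y * κ y) * sech y * κ y ^ 3

lemma exists_transportData {ρ ρ' : ℝ → ℝ} {c₁ c₂ : ℝ} (hρ : ∀ s, HasDerivAt ρ (ρ' s) s)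
    (hρ' : Continuous ρ') (hpos : ∀ s, 0 < ρ s) (hc₁ : 0 < c₁)
    (h₁ : ∀ s, c₁ * sech s ≤ ρ s ^ 2) (h₂ : ∀ s, ρ s ^ 2 ≤ c₂ * sech s)
    (hN : ∫ s, ρ s ^ 6 = ∫ s, sech s ^ 3) :
    ∃ σ κ κ' K, TransportData ρ ρ' σ κ κ' K := by
  have hρc : Continuous ρ := continuous_iff_continuousAt.2 fun y => (hρ y).continuousAt
  have hlow : ∀ s, (c₁ * sech s) ^ 3 ≤ ρ s ^ 6 := fun s => by
    have := pow_le_pow_left₀ (mul_nonneg hc₁.le (sech_pos s).le) (h₁ s) 3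
    rwa [← pow_mul] at this
  have hup : ∀ s, ρ s ^ 6 ≤ (c₂ * sech s) ^ 3 := fun s => by
    have := pow_le_pow_left₀ (sq_nonneg _) (h₂ s) 3
    rwa [← pow_mul] at this
  have hc₂ : 0 < c₂ := by
    have := (mul_pos hc₁ (sech_pos 0)).trans_le ((h₁ 0).trans (h₂ 0))
    exact pos_of_mul_pos_left this (sech_pos 0).le
  have hfi : Integrable fun s => ρ s ^ 6 := by
    refine ((integrable_sech_pow 3 (by norm_num)).const_mul (c₂ ^ 3)).mono'
      (hρc.pow 6).aestronglyMeasurable (Eventually.of_forall fun s => ?_)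
    rw [Real.norm_eq_abs, abs_of_pos (pow_pos (hpos s) 6), ← mul_pow]
    exact hup s
  obtain ⟨σ, hmono, hsurj, hσ, hd⟩ := exists_transport
    (f := fun s => ρ s ^ 6) (g := fun s => sech s ^ 3) (hρc.pow 6) hfi
    (fun s => pow_pos (hpos s) 6) (continuous_sech.pow 3) (integrable_sech_pow 3 (by norm_num))
    (fun s => pow_pos (sech_pos s) 3) hN
  have hσc : Continuous σ := continuous_iff_continuousAt.2 fun y => (hd y).continuousAt
  have hcosh : ∀ y, sech y = (Real.cosh y)⁻¹ := fun y => rfl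
  have hd' : ∀ y, HasDerivAt σ (((ρ (σ y) ^ 2 * Real.cosh y) ^ 3)⁻¹) y := fun y => by
    refine (hd y).congr_deriv ?_
    have := (Real.cosh_pos y).ne'
    have := (hpos (σ y)).ne'
    rw [hcosh]; field_simp
  refine ⟨σ, fun y => ρ (σ y) ^ 2 * Real.cosh y,
    fun y => 2 * (ρ (σ y) * ρ' (σ y)) * ((ρ (σ y) ^ 2 * Real.cosh y) ^ 3)⁻¹ * Real.cosh y
      + ρ (σ y) ^ 2 * Real.sinh y, 4 * c₂ / c₁, hmono, hsurj, hd', fun y => ?_, ?_, ?_, ?_, ?_, ?_⟩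
  · have h1 : HasDerivAt (fun y => ρ (σ y)) (ρ' (σ y) * ((ρ (σ y) ^ 2 * Real.cosh y) ^ 3)⁻¹) y :=
      (hρ (σ y)).comp y (hd' y)
    refine ((h1.pow 2).mul (Real.hasDerivAt_cosh y)).congr_deriv ?_
    simp only [Pi.pow_apply, Nat.add_one_sub_one, Nat.cast_ofNat, pow_one]; ring
  · have : ∀ y, (ρ (σ y) ^ 2 * Real.cosh y) ^ 3 ≠ 0 := fun y =>
      (pow_pos (mul_pos (pow_pos (hpos _) 2) (Real.cosh_pos y)) 3).ne'
    have hcc := Real.continuous_cosh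
    have hss := Real.continuous_sinh
    exact (((continuous_const.mul ((hρc.comp hσc).mul (hρ'.comp hσc))).mul
      (((((hρc.comp hσc).pow 2).mul hcc).pow 3).inv₀ this)).mul hcc).add
      (((hρc.comp hσc).pow 2).mul hss)
  · exact fun y => mul_pos (pow_pos (hpos _) 2) (Real.cosh_pos y)
  · intro y
    have h1 := cosh_le_of_integral_Iic hc₁ hfi hlow hN (hσ y)
    have h3 : ρ (σ y) ^ 2 * Real.cosh (σ y) ≤ c₂ := by
      have := h₂ (σ y)
      rw [hcosh, ← div_eq_mul_inv, le_div_iff₀ (Real.cosh_pos _)] at this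
      exact this
    rw [le_div_iff₀ hc₁]
    have h4 := pow_pos (hpos (σ y)) 2
    nlinarith
  · intro y
    have := (Real.cosh_pos y).ne'
    rw [hcosh]; field_simp
  · intro y
    have := (Real.cosh_pos y).ne'
    have := (hpos (σ y)).ne'
    rw [hcosh, Real.tanh_eq_sinh_div_cosh]; field_simp; ring

namespace TransportData
variable {ρ ρ' σ κ κ' : ℝ → ℝ} {K : ℝ} (T : TransportData ρ ρ' σ κ κ' K)
include T

lemma continuous : Continuous κ :=
  continuous_iff_continuousAt.2 fun y => (T.hasDerivAt y).continuousAt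

lemma continuous_map : Continuous σ :=
  continuous_iff_continuousAt.2 fun y => (T.hasDerivAt_map y).continuousAt

lemma sq_le (y : ℝ) : κ y ^ 2 ≤ K ^ 2 := pow_le_pow_left₀ (T.pos y).le (T.le y) 2

lemma pow_four_le (y : ℝ) : κ y ^ 4 ≤ K ^ 4 := pow_le_pow_left₀ (T.pos y).le (T.le y) 4

lemma integral_comp (g : ℝ → ℝ) : (Integrable g ↔ Integrable fun y => (κ y ^ 3)⁻¹ * g (σ y)) ∧
    ∫ s, g s = ∫ y, (κ y ^ 3)⁻¹ * g (σ y) :=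
  integral_comp_strictMono T.strictMono T.surjective T.hasDerivAt_map
    (fun y => (inv_pos.2 (pow_pos (T.pos y) 3)).le) g

lemma deriv_sq_eq (y : ℝ) :
    ρ' (σ y) ^ 2 = (κ' y - Real.tanh y * κ y) ^ 2 * sech y * κ y ^ 5 / 4 := by
  have h1 := T.mul_eq y
  have h2 := T.sq_eq y
  have h3 : κ y * sech y * ρ' (σ y) ^ 2
      = κ y * sech y * ((κ' y - Real.tanh y * κ y) ^ 2 * sech y * κ y ^ 5 / 4) := by
    rw [← h2]
    have : ρ (σ y) ^ 2 * ρ' (σ y) ^ 2 = (2 * (ρ (σ y) * ρ' (σ y))) ^ 2 / 4 := by ring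
    rw [this, h1, h2]; ring
  exact mul_left_cancel₀ (mul_pos (T.pos y) (sech_pos y)).ne' h3

/-- The energy density after transport, up to an exact derivative. -/
lemma energy_comp (y : ℝ) : (κ y ^ 3)⁻¹ * (ρ' (σ y) ^ 2 + ρ (σ y) ^ 2 / 4)
    = sech y * (κ y ^ 2 * (κ' y - Real.tanh y * κ y) ^ 2 + (κ y ^ 2)⁻¹) / 4 := by
  have := (T.pos y).ne'
  rw [T.deriv_sq_eq, T.sq_eq]; field_simp

lemma excess_comp (b y : ℝ) : (κ y ^ 3)⁻¹ * (ρ' (σ y) + 1 / 2 * b * ρ (σ y)) ^ 2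
    = sech y * (κ y * κ' y - Real.tanh y * κ y ^ 2 + b * (κ y)⁻¹) ^ 2 / 4 := by
  have h0 := (T.pos y).ne'
  have : (ρ' (σ y) + 1 / 2 * b * ρ (σ y)) ^ 2 = ρ' (σ y) ^ 2
      + b / 2 * (2 * (ρ (σ y) * ρ' (σ y))) + b ^ 2 / 4 * ρ (σ y) ^ 2 := by ring
  rw [this, T.deriv_sq_eq, T.sq_eq, T.mul_eq]; field_simp; ring

/-- The density of the deficit after transport. -/
lemma integral_deficit (hi : Integrable fun s => ρ' s ^ 2 + ρ s ^ 2 / 4) :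
    Integrable (fun y => sech y * (κ y ^ 2 * κ' y ^ 2 / 4
      + (κ y ^ 2 - 1) ^ 2 * (κ y ^ 2 + 2) / (8 * κ y ^ 2))) ∧
    ∫ y, sech y * (κ y ^ 2 * κ' y ^ 2 / 4 + (κ y ^ 2 - 1) ^ 2 * (κ y ^ 2 + 2) / (8 * κ y ^ 2))
      = (∫ s, (ρ' s ^ 2 + ρ s ^ 2 / 4)) - 3 / 8 * ∫ y, sech y := by
  have hκ := T.continuous
  have hκ' := T.continuous_deriv
  have hs := continuous_sech
  have ht := continuous_tanh
  obtain ⟨h1, h2⟩ := T.integral_comp fun s => ρ' s ^ 2 + ρ s ^ 2 / 4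
  have hG := h1.1 hi
  simp only [T.energy_comp] at hG h2
  have hne : ∀ y, κ y ^ 2 ≠ 0 := fun y => (pow_pos (T.pos y) 2).ne'
  have hinvc : Continuous fun y => (κ y ^ 2)⁻¹ := (hκ.pow 2).inv₀ hne
  -- the individual terms are integrable
  have i4 : Integrable fun y => sech y * κ y ^ 4 := by
    refine integrable_mul_sech (by fun_prop) (B := K ^ 4) fun y => ?_
    rw [abs_of_pos (mul_pos (sech_pos y) (pow_pos (T.pos y) 4)), mul_comm]
    exact mul_le_mul_of_nonneg_right (T.pow_four_le y) (sech_pos y).le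
  have iinv : Integrable fun y => sech y * (κ y ^ 2)⁻¹ := by
    refine (hG.const_mul 4).mono' (by fun_prop) (Eventually.of_forall fun y => ?_)
    have := inv_pos.2 (pow_pos (T.pos y) 2)
    rw [Real.norm_eq_abs, abs_of_pos (mul_pos (sech_pos y) this)]
    have := mul_nonneg (sech_pos y).le
      (mul_nonneg (pow_pos (T.pos y) 2).le (sq_nonneg (κ' y - Real.tanh y * κ y)))
    nlinarith
  have isq : Integrable fun y => sech y * (κ y ^ 2 * κ' y ^ 2) := by
    refine ((hG.const_mul 8).add (i4.const_mul 2)).mono' (by fun_prop)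
      (Eventually.of_forall fun y => ?_)
    have hs0 := sech_pos y
    have hk := pow_pos (T.pos y) 2
    rw [Real.norm_eq_abs, abs_of_nonneg (mul_nonneg hs0.le (mul_nonneg hk.le (sq_nonneg _)))]
    simp only [Pi.add_apply]
    have hinv := inv_pos.2 hk
    have h5 : κ' y ^ 2 ≤ 2 * (κ' y - Real.tanh y * κ y) ^ 2 + 2 * κ y ^ 2 := by
      have := mul_le_mul_of_nonneg_right (tanh_sq_le_one y) hk.le
      nlinarith [sq_nonneg (κ' y - 2 * (Real.tanh y * κ y))]
    have h6 : κ y ^ 2 * κ' y ^ 2 ≤ 2 * (κ y ^ 2 * (κ' y - Real.tanh y * κ y) ^ 2 + (κ y ^ 2)⁻¹)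
        + 2 * κ y ^ 4 := by
      have := mul_le_mul_of_nonneg_left h5 hk.le
      nlinarith
    have := mul_le_mul_of_nonneg_left h6 hs0.le
    linarith
  -- the cross term is an exact derivative up to `κ ^ 4`
  have hder : ∀ y, HasDerivAt (fun y => Real.tanh y * sech y * κ y ^ 4)
      (sech y * (1 - 2 * Real.tanh y ^ 2) * κ y ^ 4
        + 4 * (sech y * (Real.tanh y * κ y ^ 3 * κ' y))) y := by
    intro y
    refine (((hasDerivAt_tanh y).mul (hasDerivAt_sech y)).mul
      ((T.hasDerivAt y).pow 4)).congr_deriv ?_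
    simp; ring
  have icross : Integrable fun y => sech y * (Real.tanh y * κ y ^ 3 * κ' y) := by
    refine (isq.add i4).mono' (by fun_prop) (Eventually.of_forall fun y => ?_)
    have hs0 := sech_pos y
    rw [Real.norm_eq_abs, abs_mul, abs_of_pos hs0]
    simp only [Pi.add_apply]
    rw [← mul_add]
    refine mul_le_mul_of_nonneg_left ?_ hs0.le
    have e1 : |Real.tanh y * κ y ^ 3 * κ' y| = |Real.tanh y| * (κ y ^ 2 * |κ y * κ' y|) := by
      have hk := T.pos y
      rw [abs_mul, abs_mul, abs_mul, abs_of_pos hk, abs_of_pos (pow_pos hk 3)]; ring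
    rw [e1]
    have e2 := mul_le_mul_of_nonneg_right (abs_tanh_le_one y)
      (mul_nonneg (sq_nonneg (κ y)) (abs_nonneg (κ y * κ' y)))
    have e3 := sq_abs (κ y * κ' y)
    nlinarith [sq_nonneg (κ y ^ 2 - |κ y * κ' y|)]
  have i4t : Integrable fun y => sech y * (1 - 2 * Real.tanh y ^ 2) * κ y ^ 4 := by
    refine (i4.const_mul 3).mono' (by fun_prop) (Eventually.of_forall fun y => ?_)
    have hs0 := sech_pos y
    have hk4 := pow_pos (T.pos y) 4
    have e1 := tanh_sq_le_one y
    have e2 := sq_nonneg (Real.tanh y)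
    rw [Real.norm_eq_abs, abs_mul, abs_mul, abs_of_pos hs0, abs_of_pos hk4]
    have e3 : |1 - 2 * Real.tanh y ^ 2| ≤ 3 := abs_le.2 ⟨by linarith, by linarith⟩
    have := mul_le_mul_of_nonneg_right e3 (mul_pos hs0 hk4).le
    calc _ = |1 - 2 * Real.tanh y ^ 2| * (sech y * κ y ^ 4) := by ring
      _ ≤ _ := this
  have hzero := integral_deriv_eq_zero_of_le_sech hder (i4t.add (icross.const_mul 4)) (B := K ^ 4)
    fun y => by
      have hk4 := pow_pos (T.pos y) 4
      rw [abs_mul, abs_mul, abs_of_pos (sech_pos y), abs_of_pos hk4]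
      have e1 := mul_le_mul_of_nonneg_right (abs_tanh_le_one y) (mul_pos (sech_pos y) hk4).le
      have e2 := mul_le_mul_of_nonneg_right (T.pow_four_le y) (sech_pos y).le
      linarith
  have hkey : ∀ y, sech y * (κ y ^ 2 * κ' y ^ 2 / 4
      + (κ y ^ 2 - 1) ^ 2 * (κ y ^ 2 + 2) / (8 * κ y ^ 2))
      = (sech y * (κ y ^ 2 * (κ' y - Real.tanh y * κ y) ^ 2 + (κ y ^ 2)⁻¹) / 4
        + 1 / 8 * (sech y * (1 - 2 * Real.tanh y ^ 2) * κ y ^ 4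
        + 4 * (sech y * (Real.tanh y * κ y ^ 3 * κ' y)))) - 3 / 8 * sech y := by
    intro y
    have := (T.pos y).ne'
    field_simp
    ring
  simp only [hkey]
  have iA := (i4t.add (icross.const_mul 4)).const_mul (1 / 8)
  simp only [Pi.add_apply] at iA hzero
  have hGA : Integrable fun y =>
      sech y * (κ y ^ 2 * (κ' y - Real.tanh y * κ y) ^ 2 + (κ y ^ 2)⁻¹) / 4
        + 1 / 8 * (sech y * (1 - 2 * Real.tanh y ^ 2) * κ y ^ 4
        + 4 * (sech y * (Real.tanh y * κ y ^ 3 * κ' y))) := hG.add iA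
  refine ⟨hGA.sub (integrable_sech.const_mul (3 / 8)), ?_⟩
  rw [integral_sub hGA (integrable_sech.const_mul (3 / 8)), integral_add hG iA,
    integral_const_mul, hzero, h2, integral_const_mul]
  ring
end TransportData

/-- The density of the deficit, written in the transported variable. -/
noncomputable def deficitDensity (κ κ' : ℝ → ℝ) (y : ℝ) : ℝ :=
  sech y * (κ y ^ 2 * κ' y ^ 2 / 4 + (κ y ^ 2 - 1) ^ 2 * (κ y ^ 2 + 2) / (8 * κ y ^ 2))

namespace TransportData
variable {ρ ρ' σ κ κ' : ℝ → ℝ} {K : ℝ} (T : TransportData ρ ρ' σ κ κ' K)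
include T

lemma potential_nonneg (y : ℝ) : 0 ≤ (κ y ^ 2 - 1) ^ 2 * (κ y ^ 2 + 2) / (8 * κ y ^ 2) := by
  have := T.pos y; positivity

lemma deficitDensity_nonneg (y : ℝ) : 0 ≤ deficitDensity κ κ' y :=
  mul_nonneg (sech_pos y).le (add_nonneg (by positivity) (T.potential_nonneg y))

lemma sech_mul_deriv_sq_le (y : ℝ) :
    sech y * (κ y ^ 2 * κ' y ^ 2) ≤ 4 * deficitDensity κ κ' y := by
  have := mul_nonneg (sech_pos y).le (T.potential_nonneg y)
  rw [deficitDensity]; linarith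

lemma sech_mul_sub_one_sq_le (y : ℝ) :
    sech y * (κ y ^ 2 - 1) ^ 2 ≤ 8 * deficitDensity κ κ' y := by
  have hk := T.pos y
  have h1 : (κ y ^ 2 - 1) ^ 2 / 8 ≤ (κ y ^ 2 - 1) ^ 2 * (κ y ^ 2 + 2) / (8 * κ y ^ 2) := by
    rw [div_le_div_iff₀ (by norm_num) (by positivity)]
    nlinarith [mul_nonneg (sq_nonneg (κ y ^ 2 - 1)) (sq_nonneg (κ y)), sq_nonneg (κ y ^ 2 - 1)]
  have h2 : 0 ≤ κ y ^ 2 * κ' y ^ 2 / 4 := by positivity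
  have := mul_le_mul_of_nonneg_left (h1.trans (le_add_of_nonneg_left h2)) (sech_pos y).le
  rw [deficitDensity]; linarith

lemma sech_mul_inv_sub_sq_le (y : ℝ) :
    sech y * ((κ y)⁻¹ - κ y ^ 2) ^ 2 ≤ 16 * deficitDensity κ κ' y := by
  have hk := T.pos y
  have h1 : ((κ y)⁻¹ - κ y ^ 2) ^ 2
      ≤ 16 * ((κ y ^ 2 - 1) ^ 2 * (κ y ^ 2 + 2) / (8 * κ y ^ 2)) := by
    have e1 : ((κ y)⁻¹ - κ y ^ 2) ^ 2 = (1 - κ y ^ 3) ^ 2 / κ y ^ 2 := by field_simp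
    rw [e1, mul_div_assoc', div_le_div_iff₀ (by positivity) (by positivity)]
    have e2 : (1 + κ y + κ y ^ 2) ^ 2 ≤ 2 * ((1 + κ y) ^ 2 * (κ y ^ 2 + 2)) := by
      nlinarith [sq_nonneg (κ y - 1), mul_pos hk hk, pow_pos hk 3, pow_pos hk 4]
    have e3 := mul_le_mul_of_nonneg_left e2
      (mul_nonneg (sq_nonneg (1 - κ y)) (sq_nonneg (κ y)))
    nlinarith
  have h2 : 0 ≤ κ y ^ 2 * κ' y ^ 2 / 4 := by positivity
  have h3 := mul_le_mul_of_nonneg_left h1 (sech_pos y).le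
  have h4 := mul_nonneg (sech_pos y).le h2
  rw [deficitDensity]; linarith

lemma sech_mul_sub_one_sq_le_integral (hi : Integrable (deficitDensity κ κ')) (y : ℝ) :
    sech y * (κ y ^ 2 - 1) ^ 2 ≤ 32 * ∫ y, deficitDensity κ κ' y := by
  have hκ := T.continuous
  have hκ' := T.continuous_deriv
  have hs := continuous_sech
  have ht := continuous_tanh
  have hder : ∀ y, HasDerivAt (fun y => sech y * (κ y ^ 2 - 1) ^ 2)
      (-(Real.tanh y * sech y) * (κ y ^ 2 - 1) ^ 2
        + sech y * (2 * (κ y ^ 2 - 1) * (2 * (κ y * κ' y)))) y := fun y => by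
    refine ((hasDerivAt_sech y).mul ((((T.hasDerivAt y).pow 2).sub_const 1).pow 2)).congr_deriv ?_
    simp only [Pi.pow_apply, Nat.add_one_sub_one, Nat.cast_ofNat, pow_one]; ring
  have hbd : ∀ y, |-(Real.tanh y * sech y) * (κ y ^ 2 - 1) ^ 2
        + sech y * (2 * (κ y ^ 2 - 1) * (2 * (κ y * κ' y)))| ≤ 32 * deficitDensity κ κ' y := by
    intro y
    have h1 := T.sech_mul_deriv_sq_le y
    have h2 := T.sech_mul_sub_one_sq_le y
    have hs0 := sech_pos y
    have e1 : |-(Real.tanh y * sech y) * (κ y ^ 2 - 1) ^ 2| ≤ sech y * (κ y ^ 2 - 1) ^ 2 := by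
      rw [abs_mul, abs_neg, abs_mul, abs_of_pos hs0,
        (abs_of_nonneg (sq_nonneg _) : |(κ y ^ 2 - 1) ^ 2| = (κ y ^ 2 - 1) ^ 2)]
      have := mul_le_mul_of_nonneg_right (abs_tanh_le_one y)
        (mul_nonneg hs0.le (sq_nonneg (κ y ^ 2 - 1)))
      linarith
    have e2 : |sech y * (2 * (κ y ^ 2 - 1) * (2 * (κ y * κ' y)))|
        ≤ sech y * ((κ y ^ 2 - 1) ^ 2 + 4 * (κ y ^ 2 * κ' y ^ 2)) := by
      rw [abs_mul, abs_of_pos hs0]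
      refine mul_le_mul_of_nonneg_left (abs_le.2 ⟨?_, ?_⟩) hs0.le
      · nlinarith [sq_nonneg ((κ y ^ 2 - 1) + 2 * (κ y * κ' y))]
      · nlinarith [sq_nonneg ((κ y ^ 2 - 1) - 2 * (κ y * κ' y))]
    refine (abs_add_le _ _).trans ?_
    linarith
  have hgi : Integrable fun y => -(Real.tanh y * sech y) * (κ y ^ 2 - 1) ^ 2
        + sech y * (2 * (κ y ^ 2 - 1) * (2 * (κ y * κ' y))) :=
    (hi.const_mul 32).mono' (by fun_prop) (Eventually.of_forall hbd)
  have hlim := (tendsto_zero_of_le_sech (f := fun y => sech y * (κ y ^ 2 - 1) ^ 2)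
    (B := (K ^ 2 + 1) ^ 2) fun y => by
      rw [Real.norm_eq_abs, abs_of_nonneg (mul_nonneg (sech_pos y).le (sq_nonneg _)), mul_comm]
      refine mul_le_mul_of_nonneg_right ?_ (sech_pos y).le
      have h1 := T.sq_le y
      have h2 := sq_nonneg (κ y)
      exact sq_le_sq' (by linarith) (by linarith)).2
  have h1 := integral_Ioi_of_hasDerivAt_of_tendsto' (a := y) (fun y _ => hder y)
    hgi.integrableOn hlim
  have h2 : |∫ y in Ioi y, (-(Real.tanh y * sech y) * (κ y ^ 2 - 1) ^ 2
        + sech y * (2 * (κ y ^ 2 - 1) * (2 * (κ y * κ' y))))|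
      ≤ 32 * ∫ y, deficitDensity κ κ' y := by
    rw [← Real.norm_eq_abs]
    refine (norm_integral_le_integral_norm _).trans ?_
    rw [← integral_const_mul]
    refine (setIntegral_le_integral hgi.norm (Eventually.of_forall fun y => norm_nonneg _)).trans ?_
    exact integral_mono hgi.norm (hi.const_mul 32) hbd
  rw [h1] at h2
  have := neg_le_abs (0 - sech y * (κ y ^ 2 - 1) ^ 2)
  linarith

omit T in
lemma abs_inv_cube_sub_one_le {k : ℝ} (hk : 0 < k) (h : |k ^ 2 - 1| < 3 / 4) :
    |(k ^ 3)⁻¹ - 1| ≤ 12 * |k ^ 2 - 1| := by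
  have hk2 : 1 / 2 < k := by
    have := (abs_lt.1 h).1
    nlinarith
  have e1 : (k ^ 3)⁻¹ - 1 = (1 - k) * ((1 + k + k ^ 2) / k ^ 3) := by
    field_simp; ring
  have e2 : k ^ 2 - 1 = -((1 - k) * (1 + k)) := by ring
  have h3 : (1 + k + k ^ 2) / k ^ 3 ≤ 12 * (1 + k) := by
    rw [div_le_iff₀ (by positivity)]
    nlinarith [mul_pos hk hk, pow_pos hk 3, mul_pos (mul_pos hk hk) (sub_pos.2 hk2),
      mul_pos hk (sub_pos.2 hk2), mul_pos (pow_pos hk 3) (sub_pos.2 hk2)]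
  rw [e1, e2, abs_neg, abs_mul, abs_mul, abs_of_pos (by positivity : 0 < 1 + k),
    abs_of_pos (by positivity : 0 < (1 + k + k ^ 2) / k ^ 3)]
  have := mul_le_mul_of_nonneg_left h3 (abs_nonneg (1 - k))
  linarith

omit T in
/-- The differential inequality satisfied by `b - t`, where `b` and `t` have the sign of `ε`. -/
lemma drift_le {k b t ε : ℝ} (hk : 0 < k) (h : |k ^ 2 - 1| < 3 / 4) (hb : b ^ 2 ≤ 1)
    (hε : 0 ≤ ε * (b + t)) (hε1 : |ε| = 1) :
    ε * ((b - t) * ((1 - b ^ 2) * (k ^ 3)⁻¹ - (1 - t ^ 2))) ≤ 12 * |b - t| * |k ^ 2 - 1| := by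
  have e1 : ε * ((b - t) * ((1 - b ^ 2) * (k ^ 3)⁻¹ - (1 - t ^ 2)))
      = ε * (b - t) * ((1 - b ^ 2) * ((k ^ 3)⁻¹ - 1)) - ε * (b + t) * (b - t) ^ 2 := by ring
  rw [e1]
  have h1 : ε * (b - t) * ((1 - b ^ 2) * ((k ^ 3)⁻¹ - 1)) ≤ |b - t| * |(k ^ 3)⁻¹ - 1| := by
    refine (le_abs_self _).trans ?_
    rw [abs_mul, abs_mul, abs_mul, hε1, one_mul]
    refine mul_le_mul_of_nonneg_left ?_ (abs_nonneg _)
    have : |1 - b ^ 2| ≤ 1 := abs_le.2 ⟨by linarith, by linarith [sq_nonneg b]⟩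
    nlinarith [abs_nonneg ((k ^ 3)⁻¹ - 1)]
  have h2 := mul_le_mul_of_nonneg_left (abs_inv_cube_sub_one_le hk h) (abs_nonneg (b - t))
  have h3 := mul_nonneg hε (sq_nonneg (b - t))
  linarith

/-- Control of the displacement of the transport map, by the Hardy type inequality on each half-line
for `e = tanh (σ - σ 0) - tanh` and `f = κ² - 1`. -/
lemma integral_sech_mul_tanh_sub_sq_le (hi : Integrable (deficitDensity κ κ')) {D : ℝ}
    (hD0 : 0 < D) (hD : ∫ y, deficitDensity κ κ' y ≤ D) :
    ∫ y, sech y * (Real.tanh (σ y - σ 0) - Real.tanh y) ^ 2 ≤ 20000 * D := by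
  have hκ := T.continuous
  have hκ' := T.continuous_deriv
  have hσc := T.continuous_map
  have hs := continuous_sech
  have ht := continuous_tanh
  have hne : ∀ y, κ y ^ 3 ≠ 0 := fun y => (pow_pos (T.pos y) 3).ne'
  have hinvc : Continuous fun y => (κ y ^ 3)⁻¹ := (hκ.pow 3).inv₀ hne
  set e : ℝ → ℝ := fun y => Real.tanh (σ y - σ 0) - Real.tanh y with he
  set e' : ℝ → ℝ := fun y => (1 - Real.tanh (σ y - σ 0) ^ 2) * (κ y ^ 3)⁻¹ - (1 - Real.tanh y ^ 2)
    with he'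
  have hder : ∀ y, HasDerivAt e (e' y) y := fun y => by
    have h1 : HasDerivAt (fun y => σ y - σ 0) ((κ y ^ 3)⁻¹) y := (T.hasDerivAt_map y).sub_const _
    exact ((hasDerivAt_tanh (σ y - σ 0)).comp y h1).sub (hasDerivAt_tanh y)
  have hec : Continuous e := by fun_prop
  have he'c : Continuous e' := by fun_prop
  have he2 : ∀ y, |e y| ≤ 2 := fun y => by
    have := abs_sub (Real.tanh (σ y - σ 0)) (Real.tanh y)
    linarith [abs_tanh_le_one (σ y - σ 0), abs_tanh_le_one y]
  have he0 : e 0 = 0 := by simp [he]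
  have hfi : Integrable fun y => sech y * (κ y ^ 2 - 1) ^ 2 :=
    (hi.const_mul 8).mono' (by fun_prop) (Eventually.of_forall fun y => by
      rw [Real.norm_eq_abs, abs_of_nonneg (mul_nonneg (sech_pos y).le (sq_nonneg _))]
      exact T.sech_mul_sub_one_sq_le y)
  have hint : ∫ y, sech y * (κ y ^ 2 - 1) ^ 2 ≤ 8 * D := by
    refine (integral_mono hfi (hi.const_mul 8) T.sech_mul_sub_one_sq_le).trans ?_
    rw [integral_const_mul]; linarith
  have hpt : ∀ y, sech y * (κ y ^ 2 - 1) ^ 2 ≤ 32 * D := fun y =>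
    (T.sech_mul_sub_one_sq_le_integral hi y).trans (by linarith)
  have hright : ∫ y in Ioi 0, sech y * e y ^ 2 ≤ 10000 * D := by
    refine integral_Ioi_sech_mul_sq_le hD0 hder he'c he0 he2 (f := fun y => κ y ^ 2 - 1)
      (by fun_prop) hfi hint hpt fun y hy hf => ?_
    have hb : 0 ≤ Real.tanh (σ y - σ 0) :=
      tanh_nonneg (sub_nonneg.2 (T.strictMono.monotone hy))
    have := drift_le (ε := 1) (t := Real.tanh y) (T.pos y) hf
      (tanh_sq_le_one (σ y - σ 0)) (by linarith [tanh_nonneg hy]) (by simp)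
    simpa using this
  have hleft : ∫ y in Ioi 0, sech y * e (-y) ^ 2 ≤ 10000 * D := by
    refine integral_Ioi_sech_mul_sq_le hD0 (e := fun y => e (-y)) (e' := fun y => -e' (-y))
      (fun y => ?_) (by fun_prop) (by simpa using he0) (fun y => he2 (-y))
      (f := fun y => κ (-y) ^ 2 - 1) (by fun_prop) ?_ ?_ (fun y => ?_) fun y hy hf => ?_
    · exact ((hder (-y)).comp y (hasDerivAt_neg y)).congr_deriv (by simp)
    · simpa [sech_neg] using hfi.comp_neg
    · have := integral_neg_eq_self (fun y => sech y * (κ y ^ 2 - 1) ^ 2) volume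
      simp only [sech_neg] at this
      rw [this]; exact hint
    · simpa [sech_neg] using hpt (-y)
    · have hb : Real.tanh (σ (-y) - σ 0) ≤ 0 := by
        have := tanh_nonneg (sub_nonneg.2 (T.strictMono.monotone (neg_nonpos.2 hy)))
        have h2 : Real.tanh (σ (-y) - σ 0) = -Real.tanh (σ 0 - σ (-y)) := by
          rw [← Real.tanh_neg]; ring_nf
        linarith
      have ht : Real.tanh (-y) ≤ 0 := by
        rw [Real.tanh_neg]; linarith [tanh_nonneg hy]
      have := drift_le (ε := -1) (t := Real.tanh (-y)) (T.pos (-y)) hf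
        (tanh_sq_le_one (σ (-y) - σ 0)) (by linarith) (by simp)
      simp only [he, he']
      linarith
  have hint_sq : Integrable fun y => sech y * e y ^ 2 := by
    refine integrable_mul_sech (hs.mul (hec.pow 2)) (B := 4) fun y => ?_
    rw [abs_of_nonneg (mul_nonneg (sech_pos y).le (sq_nonneg _)), mul_comm]
    refine mul_le_mul_of_nonneg_right ?_ (sech_pos y).le
    have := sq_le_sq' (by linarith [abs_le.1 (he2 y)]) (abs_le.1 (he2 y)).2
    linarith
  have hsplit := integral_Iic_add_Ioi hint_sq 0
  have hneg : ∫ y in Iic 0, sech y * e y ^ 2 = ∫ y in Ioi 0, sech y * e (-y) ^ 2 := by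
    have := integral_comp_neg_Ioi 0 (fun y => sech y * e y ^ 2)
    simpa [sech_neg] using this.symm
  linarith

/-- Stability in the sharp inequality for positive functions with the mass of the ground state. -/
lemma excess_le (hi : Integrable fun s => ρ' s ^ 2 + ρ s ^ 2 / 4) :
    ∫ s, (ρ' s + 1 / 2 * Real.tanh (s - σ 0) * ρ s) ^ 2
      ≤ 31000 * ((∫ s, (ρ' s ^ 2 + ρ s ^ 2 / 4)) - 3 / 8 * ∫ y, sech y) := by
  obtain ⟨hA, hAint⟩ := T.integral_deficit hi
  change Integrable (deficitDensity κ κ') at hA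
  change ∫ y, deficitDensity κ κ' y = _ at hAint
  rw [← hAint]
  have hκ := T.continuous
  have hκ' := T.continuous_deriv
  have hσc := T.continuous_map
  have hs := continuous_sech
  have ht := continuous_tanh
  have hA0 : 0 ≤ ∫ y, deficitDensity κ κ' y := integral_nonneg T.deficitDensity_nonneg
  refine le_of_forall_pos_le_add fun ε hε => ?_
  have hdisp := T.integral_sech_mul_tanh_sub_sq_le hA
    (D := (∫ y, deficitDensity κ κ' y) + ε / 31000) (by positivity)
    (by have : 0 < ε / 31000 := by positivity
        linarith)
  have hcomp := (T.integral_comp fun s => (ρ' s + 1 / 2 * Real.tanh (s - σ 0) * ρ s) ^ 2).2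
  rw [hcomp]
  simp only [T.excess_comp]
  have hesq : Integrable fun y => sech y * (Real.tanh (σ y - σ 0) - Real.tanh y) ^ 2 := by
    refine integrable_mul_sech (by fun_prop) (B := 4) fun y => ?_
    rw [abs_of_nonneg (mul_nonneg (sech_pos y).le (sq_nonneg _)), mul_comm]
    refine mul_le_mul_of_nonneg_right ?_ (sech_pos y).le
    have h1 := abs_le.1 (abs_tanh_le_one (σ y - σ 0))
    have h2 := abs_le.1 (abs_tanh_le_one y)
    nlinarith
  have hpt : ∀ y, sech y * (κ y * κ' y - Real.tanh y * κ y ^ 2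
      + Real.tanh (σ y - σ 0) * (κ y)⁻¹) ^ 2 / 4
      ≤ 63 * deficitDensity κ κ' y
        + 3 / 2 * (sech y * (Real.tanh (σ y - σ 0) - Real.tanh y) ^ 2) := by
    intro y
    set b := Real.tanh (σ y - σ 0)
    set t := Real.tanh y
    have hs0 := sech_pos y
    have h1 := T.sech_mul_deriv_sq_le y
    have h2 := T.sech_mul_sub_one_sq_le y
    have h3 := T.sech_mul_inv_sub_sq_le y
    have hb : b ^ 2 ≤ 1 := tanh_sq_le_one _
    have ht2 : t ^ 2 ≤ 1 := tanh_sq_le_one _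
    have e1 : κ y * κ' y - t * κ y ^ 2 + b * (κ y)⁻¹
        = κ y * κ' y + b * ((κ y)⁻¹ - κ y ^ 2) + κ y ^ 2 * (b - t) := by ring
    have e2 : ∀ x y z : ℝ, (x + y + z) ^ 2 ≤ 3 * (x ^ 2 + y ^ 2 + z ^ 2) := fun x y z => by
      nlinarith [sq_nonneg (x - y), sq_nonneg (y - z), sq_nonneg (x - z)]
    have e3 : (b * ((κ y)⁻¹ - κ y ^ 2)) ^ 2 ≤ ((κ y)⁻¹ - κ y ^ 2) ^ 2 := by
      rw [mul_pow]; nlinarith [sq_nonneg ((κ y)⁻¹ - κ y ^ 2)]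
    have e4 : (κ y ^ 2 * (b - t)) ^ 2 ≤ 8 * (κ y ^ 2 - 1) ^ 2 + 2 * (b - t) ^ 2 := by
      have h5 : (κ y ^ 2) ^ 2 ≤ 2 * (κ y ^ 2 - 1) ^ 2 + 2 := by
        nlinarith [sq_nonneg (κ y ^ 2 - 2)]
      have h6 : (b - t) ^ 2 ≤ 4 := by nlinarith [sq_nonneg (b + t)]
      rw [mul_pow]
      nlinarith [mul_le_mul_of_nonneg_right h5 (sq_nonneg (b - t)),
        mul_le_mul_of_nonneg_left h6 (sq_nonneg (κ y ^ 2 - 1))]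
    rw [e1]
    have e5 := (e2 (κ y * κ' y) (b * ((κ y)⁻¹ - κ y ^ 2)) (κ y ^ 2 * (b - t)))
    have e6 : (κ y * κ' y + b * ((κ y)⁻¹ - κ y ^ 2) + κ y ^ 2 * (b - t)) ^ 2
        ≤ 3 * (κ y ^ 2 * κ' y ^ 2 + ((κ y)⁻¹ - κ y ^ 2) ^ 2
          + (8 * (κ y ^ 2 - 1) ^ 2 + 2 * (b - t) ^ 2)) := by
      rw [mul_pow] at e5
      linarith
    have := mul_le_mul_of_nonneg_left e6 hs0.le
    linarith
  have h1 : ∫ y, sech y * (κ y * κ' y - Real.tanh y * κ y ^ 2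
      + Real.tanh (σ y - σ 0) * (κ y)⁻¹) ^ 2 / 4
      ≤ ∫ y, (63 * deficitDensity κ κ' y
        + 3 / 2 * (sech y * (Real.tanh (σ y - σ 0) - Real.tanh y) ^ 2)) :=
    integral_mono_of_nonneg
      (Eventually.of_forall fun y => by have := sech_pos y; positivity)
      ((hA.const_mul 63).add (hesq.const_mul (3 / 2))) (Eventually.of_forall hpt)
  rw [integral_add (hA.const_mul 63) (hesq.const_mul (3 / 2)), integral_const_mul,
    integral_const_mul] at h1
  linarith

end TransportData

/-- The constant of the sharp one-dimensional inequality
`sharpConst * (∫ |w| ^ 6) ^ (1/3) ≤ ∫ |w'| ^ 2 + |w| ^ 2 / 4`. -/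
noncomputable def sharpConst : ℝ := 3 / 4 * (∫ y, sech y ^ 3) ^ (2 / 3 : ℝ)

lemma integral_sech_cube_pos : 0 < ∫ y, sech y ^ 3 := by
  rw [integral_sech_pow_three]; exact half_pos integral_sech_pos

lemma sharpConst_pos : 0 < sharpConst :=
  mul_pos (by norm_num) (Real.rpow_pos_of_pos integral_sech_cube_pos _)

lemma exists_excess_le_of_pos {ρ ρ' : ℝ → ℝ} {c₁ c₂ : ℝ} (hρ : ∀ s, HasDerivAt ρ (ρ' s) s)
    (hρ' : Continuous ρ') (hpos : ∀ s, 0 < ρ s) (hc₁ : 0 < c₁)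
    (h₁ : ∀ s, c₁ * sech s ≤ ρ s ^ 2) (h₂ : ∀ s, ρ s ^ 2 ≤ c₂ * sech s)
    (hi : Integrable fun s => ρ' s ^ 2 + ρ s ^ 2 / 4) (hN : 0 < ∫ s, ρ s ^ 6) :
    ∃ τ, ∫ s, (ρ' s + 1 / 2 * Real.tanh (s - τ) * ρ s) ^ 2
      ≤ 31000 * ((∫ s, (ρ' s ^ 2 + ρ s ^ 2 / 4))
        - sharpConst * (∫ s, ρ s ^ 6) ^ (1 / 3 : ℝ)) := by
  set J := ∫ y, sech y ^ 3 with hJ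
  have hJ0 : 0 < J := integral_sech_cube_pos
  set N := ∫ s, ρ s ^ 6 with hNdef
  -- Multiplication by `l` gives `ρ` the mass of the ground state, as the transport requires.
  set l : ℝ := (J / N) ^ (1 / 6 : ℝ) with hl
  have hl0 : 0 < l := Real.rpow_pos_of_pos (div_pos hJ0 hN) _
  have hl6 : l ^ 6 = J / N := by
    rw [hl, ← Real.rpow_natCast, ← Real.rpow_mul (div_pos hJ0 hN).le]; norm_num
  have hl2 : l ^ 2 * (sharpConst * N ^ (1 / 3 : ℝ)) = 3 / 4 * J := by
    have e1 : l ^ 2 = J ^ (1 / 3 : ℝ) / N ^ (1 / 3 : ℝ) := by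
      rw [hl, ← Real.rpow_natCast, ← Real.rpow_mul (div_pos hJ0 hN).le,
        ← Real.div_rpow hJ0.le hN.le]; norm_num
    have e2 : J ^ (1 / 3 : ℝ) * J ^ (2 / 3 : ℝ) = J := by
      rw [← Real.rpow_add hJ0]; norm_num
    have e3 := (Real.rpow_pos_of_pos hN (1 / 3 : ℝ)).ne'
    rw [e1, sharpConst, ← hJ]
    field_simp
    rw [e2]
  obtain ⟨σ, κ, κ', K, T⟩ := exists_transportData (ρ := fun s => l * ρ s) (ρ' := fun s => l * ρ' s)
    (c₁ := l ^ 2 * c₁) (c₂ := l ^ 2 * c₂) (fun s => (hρ s).const_mul l) (by fun_prop)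
    (fun s => mul_pos hl0 (hpos s)) (by positivity)
    (fun s => by rw [mul_pow, mul_assoc]; exact mul_le_mul_of_nonneg_left (h₁ s) (sq_nonneg l))
    (fun s => by rw [mul_pow, mul_assoc]; exact mul_le_mul_of_nonneg_left (h₂ s) (sq_nonneg l))
    (by simp only [mul_pow]
        rw [integral_const_mul, hl6, ← hNdef]; field_simp; exact hJ)
  have e1 : ∀ s, (l * ρ' s) ^ 2 + (l * ρ s) ^ 2 / 4 = l ^ 2 * (ρ' s ^ 2 + ρ s ^ 2 / 4) :=
    fun s => by ring
  have e2 : ∀ s, (l * ρ' s + 1 / 2 * Real.tanh (s - σ 0) * (l * ρ s)) ^ 2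
      = l ^ 2 * (ρ' s + 1 / 2 * Real.tanh (s - σ 0) * ρ s) ^ 2 := fun s => by ring
  have h := T.excess_le (by simp only [e1]; exact hi.const_mul _)
  simp only [e1, e2] at h
  rw [integral_const_mul, integral_const_mul] at h
  refine ⟨σ 0, ?_⟩
  have h38 : 3 / 8 * ∫ y, sech y = l ^ 2 * (sharpConst * N ^ (1 / 3 : ℝ)) := by
    rw [hl2, hJ, integral_sech_pow_three]; ring
  rw [h38, ← mul_sub] at h
  have hl20 : 0 < l ^ 2 := by positivity
  refine le_of_mul_le_mul_left ?_ hl20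
  linarith

/-- The Bogomolny type identity for the excess. -/
lemma integral_excess_eq {E : Type*} [NormedAddCommGroup E] [InnerProductSpace ℝ E]
    {w w' : ℝ → E} (hw : ∀ s, HasDerivAt w (w' s) s) (hw' : Continuous w') {B : ℝ}
    (hB : ∀ s, ‖w s‖ ^ 2 ≤ B * sech s) (hB' : ∀ s, ‖w' s‖ ^ 2 ≤ B * sech s) (τ : ℝ) :
    ∫ s, ‖w' s + (1 / 2 * Real.tanh (s - τ)) • w s‖ ^ 2
      = (∫ s, (‖w' s‖ ^ 2 + ‖w s‖ ^ 2 / 4)) - 3 / 4 * ∫ s, sech (s - τ) ^ 2 * ‖w s‖ ^ 2 := by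
  have hwc : Continuous w := continuous_iff_continuousAt.2 fun y => (hw y).continuousAt
  have hs := continuous_sech
  have ht := continuous_tanh
  have i1 : Integrable fun s => ‖w s‖ ^ 2 := integrable_mul_sech (by fun_prop) (B := B) fun s => by
    rw [abs_of_nonneg (sq_nonneg _)]; exact hB s
  have i2 : Integrable fun s => ‖w' s‖ ^ 2 := integrable_mul_sech (by fun_prop) (B := B) fun s => by
    rw [abs_of_nonneg (sq_nonneg _)]; exact hB' s
  have i12 : Integrable fun s => ‖w' s‖ ^ 2 + ‖w s‖ ^ 2 / 4 := i2.add (i1.div_const 4)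
  have i3 : Integrable fun s => sech (s - τ) ^ 2 * ‖w s‖ ^ 2 := by
    refine i1.mono' (by fun_prop) (Eventually.of_forall fun s => ?_)
    have h1 := pow_le_one₀ (n := 2) (sech_pos (s - τ)).le (sech_le_one (s - τ))
    rw [Real.norm_eq_abs, abs_of_nonneg (by positivity)]
    nlinarith [sq_nonneg ‖w s‖]
  have hder : ∀ s, HasDerivAt (fun s => Real.tanh (s - τ) * ‖w s‖ ^ 2)
      (sech (s - τ) ^ 2 * ‖w s‖ ^ 2 + 2 * (Real.tanh (s - τ) * ⟪w s, w' s⟫_ℝ)) s := fun s => by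
    have h1 : HasDerivAt (fun s => Real.tanh (s - τ)) (1 - Real.tanh (s - τ) ^ 2) s := by
      exact HasDerivAt.comp_sub_const s τ (hasDerivAt_tanh (s - τ))
    refine (h1.mul (hw s).norm_sq).congr_deriv ?_
    rw [sech_sq]; ring
  have i4 : Integrable fun s => Real.tanh (s - τ) * ⟪w s, w' s⟫_ℝ := by
    refine (i1.add i2).mono' (by fun_prop) (Eventually.of_forall fun s => ?_)
    rw [Real.norm_eq_abs, abs_mul]
    have h1 := mul_le_mul_of_nonneg_right (abs_tanh_le_one (s - τ)) (abs_nonneg ⟪w s, w' s⟫_ℝ)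
    have h2 := abs_real_inner_le_norm (w s) (w' s)
    simp only [Pi.add_apply]
    nlinarith [sq_nonneg (‖w s‖ - ‖w' s‖), norm_nonneg (w s), norm_nonneg (w' s)]
  have hzero := integral_deriv_eq_zero_of_le_sech (B := B) hder
      (i3.add (i4.const_mul 2)) fun s => by
    rw [abs_mul, abs_of_nonneg (sq_nonneg ‖w s‖)]
    have h1 := mul_le_mul_of_nonneg_right (abs_tanh_le_one (s - τ)) (sq_nonneg ‖w s‖)
    linarith [hB s]
  have hpt : ∀ s, ‖w' s + (1 / 2 * Real.tanh (s - τ)) • w s‖ ^ 2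
      = ((‖w' s‖ ^ 2 + ‖w s‖ ^ 2 / 4) - 3 / 4 * (sech (s - τ) ^ 2 * ‖w s‖ ^ 2))
        + 1 / 2 * (sech (s - τ) ^ 2 * ‖w s‖ ^ 2
        + 2 * (Real.tanh (s - τ) * ⟪w s, w' s⟫_ℝ)) := fun s => by
    rw [norm_add_sq_real, real_inner_smul_right, norm_smul, mul_pow, Real.norm_eq_abs, sq_abs,
      real_inner_comm, sech_sq]
    ring
  have i5 : Integrable fun s => sech (s - τ) ^ 2 * ‖w s‖ ^ 2
        + 2 * (Real.tanh (s - τ) * ⟪w s, w' s⟫_ℝ) := i3.add (i4.const_mul 2)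
  have i6 : Integrable fun s => (‖w' s‖ ^ 2 + ‖w s‖ ^ 2 / 4)
      - 3 / 4 * (sech (s - τ) ^ 2 * ‖w s‖ ^ 2) := i12.sub (i3.const_mul _)
  simp only [hpt]
  rw [integral_add i6 (i5.const_mul _), integral_sub i12 (i3.const_mul _), integral_const_mul,
    integral_const_mul, hzero]
  ring

lemma sq_sub_le_of_abs_le {a b c d x : ℝ} (hx : |x| ≤ a * b) :
    (x - c * d) ^ 2 ≤ (a ^ 2 + c ^ 2) * (b ^ 2 + d ^ 2) := by
  have h1 : x ^ 2 ≤ (a * b) ^ 2 := sq_le_sq' (abs_le.1 hx).1 (abs_le.1 hx).2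
  have h2 : -(x * (c * d)) ≤ (a * b) * |c * d| := by
    calc -(x * (c * d)) ≤ |x * (c * d)| := neg_le_abs _
      _ = |x| * |c * d| := abs_mul _ _
      _ ≤ _ := mul_le_mul_of_nonneg_right hx (abs_nonneg _)
  have h3 : 2 * ((a * b) * |c * d|) ≤ a ^ 2 * d ^ 2 + b ^ 2 * c ^ 2 := by
    rw [abs_mul]
    have := sq_nonneg (a * |d| - b * |c|)
    have e1 := sq_abs c
    have e2 := sq_abs d
    nlinarith
  nlinarith

/-- Stability of the sharp one-dimensional inequality in terms of the excess. The modulus of `w` is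
regularised to `√(|w|² + η² sech)`, which is positive and does not increase the energy by more than
a multiple of `η²`. -/
lemma exists_excess_le {w w' : ℝ → ℂ} (hw : ∀ s, HasDerivAt w (w' s) s) (hw' : Continuous w')
    {B : ℝ} (hB : ∀ s, ‖w s‖ ^ 2 ≤ B * sech s) (hB' : ∀ s, ‖w' s‖ ^ 2 ≤ B * sech s) {ε : ℝ}
    (hε : 0 < ε) :
    ∃ τ, ∫ s, ‖w' s + (1 / 2 * Real.tanh (s - τ)) • w s‖ ^ 2
      ≤ 31000 * ((∫ s, (‖w' s‖ ^ 2 + ‖w s‖ ^ 2 / 4))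
        - sharpConst * (∫ s, ‖w s‖ ^ 6) ^ (1 / 3 : ℝ)) + ε := by
  have hwc : Continuous w := continuous_iff_continuousAt.2 fun y => (hw y).continuousAt
  have hsc := continuous_sech
  have htc := continuous_tanh
  have hJ := integral_sech_pos
  set J := ∫ y, sech y
  set η : ℝ := √(ε / (31000 * J)) with hη
  have hη2 : η ^ 2 = ε / (31000 * J) := Real.sq_sqrt (by positivity)
  have hη0 : 0 < η ^ 2 := by rw [hη2]; positivity
  have hB0 : 0 ≤ B := by
    have := (sq_nonneg ‖w 0‖).trans (hB 0)
    exact nonneg_of_mul_nonneg_left this (sech_pos 0)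
  have hpos2 : ∀ s, 0 < ‖w s‖ ^ 2 + η ^ 2 * sech s := fun s => by
    have := mul_pos hη0 (sech_pos s); positivity
  set ρ : ℝ → ℝ := fun s => √(‖w s‖ ^ 2 + η ^ 2 * sech s) with hρdef
  set ρ' : ℝ → ℝ := fun s => (⟪w s, w' s⟫_ℝ - η ^ 2 * (Real.tanh s * sech s) / 2) / ρ s with hρ'def
  have hρpos : ∀ s, 0 < ρ s := fun s => Real.sqrt_pos.2 (hpos2 s)
  have hρsq : ∀ s, ρ s ^ 2 = ‖w s‖ ^ 2 + η ^ 2 * sech s := fun s => Real.sq_sqrt (hpos2 s).le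
  have hρ : ∀ s, HasDerivAt ρ (ρ' s) s := fun s => by
    have h1 := (((hw s).norm_sq).add ((hasDerivAt_sech s).const_mul (η ^ 2))).sqrt (hpos2 s).ne'
    refine h1.congr_deriv ?_
    have := (hρpos s).ne'
    simp only [hρ'def]
    change _ / (2 * ρ s) = _
    field_simp
    ring
  have hρc : Continuous ρ := by fun_prop
  have hρ'c : Continuous ρ' := by
    refine Continuous.div (by fun_prop) hρc fun s => (hρpos s).ne'
  have hρ'sq : ∀ s, ρ' s ^ 2 ≤ ‖w' s‖ ^ 2 + η ^ 2 * sech s / 4 := fun s => by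
    have hss : √(sech s) ^ 2 = sech s := Real.sq_sqrt (sech_pos s).le
    have h1 := sq_sub_le_of_abs_le (c := η * √(sech s)) (d := η * √(sech s) * Real.tanh s / 2)
      (abs_real_inner_le_norm (w s) (w' s))
    have e1 : η * √(sech s) * (η * √(sech s) * Real.tanh s / 2)
        = η ^ 2 * (Real.tanh s * sech s) / 2 := by
      calc _ = η ^ 2 * (Real.tanh s * √(sech s) ^ 2) / 2 := by ring
        _ = _ := by rw [hss]
    have e2 : (η * √(sech s) * Real.tanh s / 2) ^ 2 = η ^ 2 * sech s * Real.tanh s ^ 2 / 4 := by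
      calc _ = η ^ 2 * √(sech s) ^ 2 * Real.tanh s ^ 2 / 4 := by ring
        _ = _ := by rw [hss]
    have e3 : (η * √(sech s)) ^ 2 = η ^ 2 * sech s := by rw [mul_pow, hss]
    rw [e1, e2, e3, ← hρsq] at h1
    simp only [hρ'def]
    rw [div_pow, div_le_iff₀ (pow_pos (hρpos s) 2)]
    refine h1.trans ?_
    rw [mul_comm]
    refine mul_le_mul_of_nonneg_right ?_ (sq_nonneg _)
    have := mul_le_mul_of_nonneg_left (tanh_sq_le_one s) (mul_pos hη0 (sech_pos s)).le
    linarith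
  have hbρ : ∀ s, ‖ρ s‖ ^ 2 ≤ (B + η ^ 2) * sech s := fun s => by
    rw [Real.norm_eq_abs, sq_abs, hρsq]; linarith [hB s]
  have hbρ' : ∀ s, ‖ρ' s‖ ^ 2 ≤ (B + η ^ 2) * sech s := fun s => by
    rw [Real.norm_eq_abs, sq_abs]
    have := mul_pos hη0 (sech_pos s)
    linarith [hB' s, hρ'sq s]
  have iρ : Integrable fun s => ρ s ^ 2 :=
    integrable_mul_sech (by fun_prop) (B := B + η ^ 2) fun s => by
      rw [abs_of_nonneg (sq_nonneg _), ← sq_abs, ← Real.norm_eq_abs]; exact hbρ s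
  have iρ' : Integrable fun s => ρ' s ^ 2 :=
    integrable_mul_sech (by fun_prop) (B := B + η ^ 2) fun s => by
      rw [abs_of_nonneg (sq_nonneg _), ← sq_abs, ← Real.norm_eq_abs]; exact hbρ' s
  have iw : Integrable fun s => ‖w s‖ ^ 2 := integrable_mul_sech (by fun_prop) (B := B) fun s => by
    rw [abs_of_nonneg (sq_nonneg _)]; exact hB s
  have iw' : Integrable fun s => ‖w' s‖ ^ 2 :=
      integrable_mul_sech (by fun_prop) (B := B) fun s => by
    rw [abs_of_nonneg (sq_nonneg _)]; exact hB' s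
  have iG : Integrable fun s => ρ' s ^ 2 + ρ s ^ 2 / 4 := iρ'.add (iρ.div_const 4)
  have iGw : Integrable fun s => ‖w' s‖ ^ 2 + ‖w s‖ ^ 2 / 4 := iw'.add (iw.div_const 4)
  have i6 : Integrable fun s => ρ s ^ 6 := by
    refine (iρ.const_mul ((B + η ^ 2) ^ 2)).mono' (by fun_prop) (Eventually.of_forall fun s => ?_)
    rw [Real.norm_eq_abs, abs_of_pos (pow_pos (hρpos s) 6)]
    have h1 : ρ s ^ 2 ≤ B + η ^ 2 := by
      have := hbρ s
      rw [Real.norm_eq_abs, sq_abs] at this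
      nlinarith [sech_le_one s]
    have h2 := pow_le_pow_left₀ (sq_nonneg _) h1 2
    calc ρ s ^ 6 = (ρ s ^ 2) ^ 2 * ρ s ^ 2 := by ring
      _ ≤ _ := mul_le_mul_of_nonneg_right h2 (sq_nonneg _)
  have hle : ∀ s, ‖w s‖ ^ 6 ≤ ρ s ^ 6 := fun s => by
    refine pow_le_pow_left₀ (norm_nonneg _) ?_ 6
    refine Real.le_sqrt_of_sq_le ?_
    linarith [mul_pos hη0 (sech_pos s)]
  have hN0 : 0 < ∫ s, ρ s ^ 6 := by
    rw [integral_pos_iff_support_of_nonneg (fun s => (pow_pos (hρpos s) 6).le) i6]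
    have : Function.support (fun s => ρ s ^ 6) = univ := by
      ext s; simp [(hρpos s).ne']
    simp [this]
  have hNle : ∫ s, ‖w s‖ ^ 6 ≤ ∫ s, ρ s ^ 6 :=
    integral_mono_of_nonneg (Eventually.of_forall fun s => by positivity) i6
      (Eventually.of_forall hle)
  obtain ⟨τ, hτ⟩ := exists_excess_le_of_pos hρ hρ'c hρpos hη0
    (fun s => by rw [hρsq]; linarith [sq_nonneg ‖w s‖])
    (c₂ := B + η ^ 2) (fun s => by rw [hρsq]; linarith [hB s]) iG hN0
  refine ⟨τ, ?_⟩
  have id1 := integral_excess_eq hw hw' hB hB' τ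
  have id2 := integral_excess_eq hρ hρ'c hbρ hbρ' τ
  simp only [smul_eq_mul, Real.norm_eq_abs, sq_abs] at id2
  have hcmp : ∫ s, sech (s - τ) ^ 2 * ρ s ^ 2
      ≤ (∫ s, sech (s - τ) ^ 2 * ‖w s‖ ^ 2) + η ^ 2 * J := by
    have i3 : Integrable fun s => sech (s - τ) ^ 2 * ‖w s‖ ^ 2 := by
      refine iw.mono' (by fun_prop) (Eventually.of_forall fun s => ?_)
      have h1 := pow_le_one₀ (n := 2) (sech_pos (s - τ)).le (sech_le_one (s - τ))
      rw [Real.norm_eq_abs, abs_of_nonneg (by positivity)]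
      nlinarith [sq_nonneg ‖w s‖]
    rw [← integral_const_mul, ← integral_add i3 (integrable_sech.const_mul _)]
    refine integral_mono_of_nonneg (Eventually.of_forall fun s => by positivity)
      (i3.add (integrable_sech.const_mul _)) (Eventually.of_forall fun s => ?_)
    have h1 := pow_le_one₀ (n := 2) (sech_pos (s - τ)).le (sech_le_one (s - τ))
    simp only [hρsq]
    nlinarith [mul_pos hη0 (sech_pos s)]
  have hGle : ∫ s, (ρ' s ^ 2 + ρ s ^ 2 / 4)
      ≤ (∫ s, (‖w' s‖ ^ 2 + ‖w s‖ ^ 2 / 4)) + η ^ 2 / 2 * J := by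
    rw [← integral_const_mul, ← integral_add iGw (integrable_sech.const_mul _)]
    refine integral_mono iG (iGw.add (integrable_sech.const_mul _)) fun s => ?_
    have := hρ'sq s
    simp only [hρsq]
    linarith
  have hKle : sharpConst * (∫ s, ‖w s‖ ^ 6) ^ (1 / 3 : ℝ)
      ≤ sharpConst * (∫ s, ρ s ^ 6) ^ (1 / 3 : ℝ) :=
    mul_le_mul_of_nonneg_left (Real.rpow_le_rpow (integral_nonneg fun s => by positivity) hNle
      (by norm_num)) sharpConst_pos.le
  have hηJ : 31000 * (η ^ 2 * J) = ε := by
    rw [hη2]; field_simp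
  have hJη : 0 ≤ η ^ 2 * J := by positivity
  rw [id1]
  rw [id2] at hτ
  linarith

lemma sq_integral_mul_le {α : Type*} [MeasurableSpace α] {μ : Measure α} {f g : α → ℝ}
    (hf : Integrable (fun x => f x ^ 2) μ) (hg : Integrable (fun x => g x ^ 2) μ)
    (hfg : Integrable (fun x => f x * g x) μ) :
    (∫ x, f x * g x ∂μ) ^ 2 ≤ (∫ x, f x ^ 2 ∂μ) * ∫ x, g x ^ 2 ∂μ := by
  have h : ∀ l : ℝ, 0 ≤ (∫ x, f x ^ 2 ∂μ) * (l * l) + (2 * ∫ x, f x * g x ∂μ) * l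
      + ∫ x, g x ^ 2 ∂μ := fun l => by
    have e : ∀ x, (l * f x + g x) ^ 2 = (l * l) * f x ^ 2 + (2 * l) * (f x * g x) + g x ^ 2 :=
      fun x => by ring
    have h0 : 0 ≤ ∫ x, (l * f x + g x) ^ 2 ∂μ := integral_nonneg fun x => sq_nonneg _
    have i1 : Integrable (fun x => (l * l) * f x ^ 2 + (2 * l) * (f x * g x)) μ :=
      (hf.const_mul _).add (hfg.const_mul _)
    simp only [e] at h0
    rw [integral_add i1 hg, integral_add (hf.const_mul _) (hfg.const_mul _), integral_const_mul,
      integral_const_mul] at h0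
    linarith
  have := discrim_le_zero h
  rw [discrim] at this
  linarith

/-- The ground state `√(sech (s - τ))` in Emden–Fowler coordinates. -/
noncomputable def soliton (τ s : ℝ) : ℝ := √(sech (s - τ))

lemma soliton_pos (τ s : ℝ) : 0 < soliton τ s := Real.sqrt_pos.2 (sech_pos _)

lemma soliton_sq (τ s : ℝ) : soliton τ s ^ 2 = sech (s - τ) := Real.sq_sqrt (sech_pos _).le

lemma hasDerivAt_soliton (τ s : ℝ) :
    HasDerivAt (soliton τ) (-(1 / 2) * Real.tanh (s - τ) * soliton τ s) s := by
  have h1 : HasDerivAt (fun s => sech (s - τ)) (-(Real.tanh (s - τ) * sech (s - τ))) s :=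
    HasDerivAt.comp_sub_const s τ (hasDerivAt_sech (s - τ))
  refine (h1.sqrt (sech_pos _).ne').congr_deriv ?_
  have h2 := (soliton_pos τ s).ne'
  change _ / (2 * soliton τ s) = _
  rw [← soliton_sq]
  field_simp

lemma continuous_soliton (τ : ℝ) : Continuous (soliton τ) := by
  have := continuous_sech
  unfold soliton; fun_prop

lemma sech_sub_le (τ s : ℝ) : sech (s - τ) ≤ 2 * Real.cosh τ * sech s := by
  have h1 : Real.cosh s ≤ 2 * Real.cosh τ * Real.cosh (s - τ) := by
    have e : Real.cosh s = Real.cosh (s - τ) * Real.cosh τ + Real.sinh (s - τ) * Real.sinh τ := by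
      rw [← Real.cosh_add]; ring_nf
    have h2 : |Real.sinh (s - τ)| ≤ Real.cosh (s - τ) :=
      abs_le_of_sq_le_sq (by have := Real.cosh_sq (s - τ); linarith) (Real.cosh_pos _).le
    have h3 : |Real.sinh τ| ≤ Real.cosh τ :=
      abs_le_of_sq_le_sq (by have := Real.cosh_sq τ; linarith) (Real.cosh_pos _).le
    have h4 : Real.sinh (s - τ) * Real.sinh τ ≤ Real.cosh (s - τ) * Real.cosh τ := by
      refine (le_abs_self _).trans ?_
      rw [abs_mul]
      exact mul_le_mul h2 h3 (abs_nonneg _) (Real.cosh_pos _).le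
    linarith
  have := Real.cosh_pos s
  have := Real.cosh_pos (s - τ)
  rw [sech, sech, ← div_eq_mul_inv, inv_eq_one_div, div_le_div_iff₀ (by positivity) (by positivity)]
  linarith

lemma abs_sinh_mul_sech_le (y : ℝ) : |Real.sinh y| * sech y ≤ 1 := by
  have h := abs_tanh_le_one y
  rw [Real.tanh_eq_sinh_div_cosh, abs_div, abs_of_pos (Real.cosh_pos y)] at h
  exact h

/-- Pointwise control of the distance to a multiple of the ground state by the excess, from the
fundamental theorem of calculus for `w / √sech`. -/
lemma norm_sub_soliton_sq_le {w w' : ℝ → ℂ} (hw : ∀ s, HasDerivAt w (w' s) s)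
    (hw' : Continuous w') {τ : ℝ}
    (hi : Integrable fun s => ‖w' s + (1 / 2 * Real.tanh (s - τ)) • w s‖ ^ 2) (s : ℝ) :
    ‖w s - soliton τ s • w τ‖ ^ 2 ≤ |Real.sinh (s - τ)| * sech (s - τ)
      * ∫ s, ‖w' s + (1 / 2 * Real.tanh (s - τ)) • w s‖ ^ 2 := by
  have hwc : Continuous w := continuous_iff_continuousAt.2 fun y => (hw y).continuousAt
  have hsc := continuous_soliton τ
  have htc := continuous_tanh
  set g : ℝ → ℂ := fun s => w' s + (1 / 2 * Real.tanh (s - τ)) • w s with hg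
  set E := ∫ s, ‖g s‖ ^ 2
  have hgc : Continuous g := by fun_prop
  have hinv : Continuous fun s => (soliton τ s)⁻¹ := hsc.inv₀ fun s => (soliton_pos τ s).ne'
  have hder : ∀ s, HasDerivAt (fun s => (soliton τ s)⁻¹ • w s) ((soliton τ s)⁻¹ • g s) s := by
    intro s
    have h1 := ((hasDerivAt_soliton τ s).inv (soliton_pos τ s).ne').smul (hw s)
    refine h1.congr_deriv ?_
    have h2 : ((soliton τ s : ℝ) : ℂ) ≠ 0 := by exact_mod_cast (soliton_pos τ s).ne'
    simp only [hg, Complex.real_smul, Pi.inv_apply]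
    push_cast
    field_simp
  have hone : soliton τ τ = 1 := by simp [soliton, sech]
  have hFTC := intervalIntegral.integral_eq_sub_of_hasDerivAt (a := τ) (b := s)
    (fun y _ => hder y) (by apply Continuous.intervalIntegrable; fun_prop)
  rw [hone, inv_one, one_smul] at hFTC
  have e1 : w s - soliton τ s • w τ
      = soliton τ s • ((soliton τ s)⁻¹ • w s - w τ) := by
    rw [smul_sub, smul_smul, mul_inv_cancel₀ (soliton_pos τ s).ne', one_smul]
  have hnorm : ‖∫ y in τ..s, (soliton τ y)⁻¹ • g y‖ ^ 2 ≤ |Real.sinh (s - τ)| * E := by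
    have h1 : ‖∫ y in τ..s, (soliton τ y)⁻¹ • g y‖
        ≤ ∫ y in uIoc τ s, (soliton τ y)⁻¹ * ‖g y‖ := by
      refine (intervalIntegral.norm_integral_le_integral_norm_uIoc).trans (le_of_eq ?_)
      refine integral_congr_ae (Eventually.of_forall fun y => ?_)
      simp only [norm_smul, Real.norm_eq_abs]
      rw [abs_of_pos (inv_pos.2 (soliton_pos τ y))]
    have hsub : ∀ f : ℝ → ℝ, Continuous f → IntegrableOn f (uIoc τ s) := fun f hf =>
      (hf.integrableOn_Icc (a := min τ s) (b := max τ s)).mono_set Ioc_subset_Icc_self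
    have h2 := sq_integral_mul_le (μ := volume.restrict (uIoc τ s))
      (f := fun y => (soliton τ y)⁻¹) (g := fun y => ‖g y‖)
      (hsub _ (by fun_prop)) (hsub _ (by fun_prop)) (hsub _ (by fun_prop))
    have h3 : ∫ y in uIoc τ s, ‖g y‖ ^ 2 ≤ E :=
      setIntegral_le_integral hi (Eventually.of_forall fun y => sq_nonneg _)
    have h4 : ∫ y in uIoc τ s, (soliton τ y)⁻¹ ^ 2 = |Real.sinh (s - τ)| := by
      have e2 : ∀ y, (soliton τ y)⁻¹ ^ 2 = Real.cosh (y - τ) := fun y => by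
        rw [inv_pow, soliton_sq, sech, inv_inv]
      simp only [e2]
      have h5 := intervalIntegral.integral_eq_sub_of_hasDerivAt (a := τ) (b := s)
        (f := fun y => Real.sinh (y - τ)) (f' := fun y => Real.cosh (y - τ))
        (fun y _ => HasDerivAt.comp_sub_const y τ (Real.hasDerivAt_sinh (y - τ)))
        (by apply Continuous.intervalIntegrable
            have := Real.continuous_cosh
            fun_prop)
      have h6 : |∫ y in τ..s, Real.cosh (y - τ)| = |∫ y in uIoc τ s, Real.cosh (y - τ)| :=
        intervalIntegral.abs_integral_eq_abs_integral_uIoc _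
      rw [h5, abs_of_nonneg (integral_nonneg fun y => (Real.cosh_pos _).le)] at h6
      simpa using h6.symm
    have h0 : 0 ≤ ∫ y in uIoc τ s, (soliton τ y)⁻¹ * ‖g y‖ :=
      integral_nonneg fun y => mul_nonneg (inv_pos.2 (soliton_pos τ y)).le (norm_nonneg _)
    calc _ ≤ (∫ y in uIoc τ s, (soliton τ y)⁻¹ * ‖g y‖) ^ 2 :=
          pow_le_pow_left₀ (norm_nonneg _) h1 2
      _ ≤ _ := h2
      _ ≤ _ := by rw [h4]; exact mul_le_mul_of_nonneg_left h3 (abs_nonneg _)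
  rw [e1, ← hFTC, norm_smul, mul_pow, Real.norm_eq_abs, sq_abs, soliton_sq]
  have := mul_le_mul_of_nonneg_left hnorm (sech_pos (s - τ)).le
  linarith

/-- Stability of the sharp one-dimensional inequality: the squared distance to the family of
multiples of translated ground states is bounded by the deficit, both in the energy norm and in
`L⁶`. -/
theorem exists_soliton_near : ∃ C : ℝ, 0 < C ∧ ∀ (w w' : ℝ → ℂ) (B : ℝ),
    (∀ s, HasDerivAt w (w' s) s) → Continuous w' → (∀ s, ‖w s‖ ^ 2 ≤ B * sech s) →
    (∀ s, ‖w' s‖ ^ 2 ≤ B * sech s) → ∀ ε > 0, ∃ (τ : ℝ) (c : ℂ) (X : ℝ), 0 ≤ X ∧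
      X ≤ C * ((∫ s, (‖w' s‖ ^ 2 + ‖w s‖ ^ 2 / 4))
        - sharpConst * (∫ s, ‖w s‖ ^ 6) ^ (1 / 3 : ℝ)) + ε ∧
      ∫ s, (‖w' s - (-(1 / 2) * Real.tanh (s - τ) * soliton τ s) • c‖ ^ 2
        + ‖w s - soliton τ s • c‖ ^ 2 / 4) ≤ X ∧
      ∫ s, ‖w s - soliton τ s • c‖ ^ 6 ≤ X ^ 3 := by
  have hJ := integral_sech_pos
  set J := ∫ y, sech y with hJdef
  refine ⟨31000 * (4 * (1 + J)), by positivity, ?_⟩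
  intro w w' B hw hw' hB hB' ε hε
  obtain ⟨τ, hτ⟩ := exists_excess_le hw hw' hB hB' (ε := ε / (4 * (1 + J))) (by positivity)
  have hwc : Continuous w := continuous_iff_continuousAt.2 fun y => (hw y).continuousAt
  have hsc := continuous_soliton τ
  have hse := continuous_sech
  have htc := continuous_tanh
  set E := ∫ s, ‖w' s + (1 / 2 * Real.tanh (s - τ)) • w s‖ ^ 2 with hE
  have hE0 : 0 ≤ E := integral_nonneg fun s => sq_nonneg _
  have i2 : Integrable fun s => ‖w s‖ ^ 2 := integrable_mul_sech (by fun_prop) (B := B) fun s => by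
    rw [abs_of_nonneg (sq_nonneg _)]; exact hB s
  have i2' : Integrable fun s => ‖w' s‖ ^ 2 :=
      integrable_mul_sech (by fun_prop) (B := B) fun s => by
    rw [abs_of_nonneg (sq_nonneg _)]; exact hB' s
  have hi : Integrable fun s => ‖w' s + (1 / 2 * Real.tanh (s - τ)) • w s‖ ^ 2 := by
    refine ((i2'.add i2).const_mul 2).mono' (by fun_prop) (Eventually.of_forall fun s => ?_)
    rw [Real.norm_eq_abs, abs_of_nonneg (sq_nonneg _)]
    have h1 := norm_add_le (w' s) ((1 / 2 * Real.tanh (s - τ)) • w s)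
    have h2 : ‖(1 / 2 * Real.tanh (s - τ)) • w s‖ ≤ ‖w s‖ := by
      rw [norm_smul, Real.norm_eq_abs, abs_mul, abs_of_pos (by norm_num : (0:ℝ) < 1 / 2)]
      nlinarith [abs_tanh_le_one (s - τ), norm_nonneg (w s), abs_nonneg (Real.tanh (s - τ))]
    simp only [Pi.add_apply]
    nlinarith [sq_nonneg (‖w' s‖ - ‖w s‖), norm_nonneg (w' s), norm_nonneg (w s),
      norm_nonneg (w' s + (1 / 2 * Real.tanh (s - τ)) • w s)]
  set c := w τ with hc
  set v : ℝ → ℂ := fun s => w s - soliton τ s • c with hv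
  set v' : ℝ → ℂ := fun s => w' s - (-(1 / 2) * Real.tanh (s - τ) * soliton τ s) • c with hv'
  have hvd : ∀ s, HasDerivAt v (v' s) s := fun s =>
    (hw s).sub ((hasDerivAt_soliton τ s).smul_const c)
  have hvc : Continuous v := by fun_prop
  have hv'c : Continuous v' := by fun_prop
  set B' := 2 * B + 2 * (2 * Real.cosh τ * ‖c‖ ^ 2)
  have hsm : ∀ s, (soliton τ s * ‖c‖) ^ 2 ≤ (2 * Real.cosh τ * ‖c‖ ^ 2) * sech s := fun s => by
    rw [mul_pow, soliton_sq]
    have := mul_le_mul_of_nonneg_right (sech_sub_le τ s) (sq_nonneg ‖c‖)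
    linarith
  have hvB : ∀ s, ‖v s‖ ^ 2 ≤ B' * sech s := fun s => by
    have h1 := norm_sub_le (w s) (soliton τ s • c)
    have h2 : ‖soliton τ s • c‖ = soliton τ s * ‖c‖ := by
      rw [norm_smul, Real.norm_eq_abs, abs_of_pos (soliton_pos τ s)]
    have h3 := hB s
    have h4 := hsm s
    rw [h2] at h1
    simp only [hv, B']
    nlinarith [sq_nonneg (‖w s‖ - soliton τ s * ‖c‖), norm_nonneg (w s - soliton τ s • c)]
  have hvB' : ∀ s, ‖v' s‖ ^ 2 ≤ B' * sech s := fun s => by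
    have h1 := norm_sub_le (w' s) ((-(1 / 2) * Real.tanh (s - τ) * soliton τ s) • c)
    have h2 : ‖(-(1 / 2) * Real.tanh (s - τ) * soliton τ s) • c‖ ≤ soliton τ s * ‖c‖ := by
      rw [norm_smul, Real.norm_eq_abs, abs_mul, abs_mul, abs_of_pos (soliton_pos τ s), abs_neg,
        abs_of_pos (by norm_num : (0:ℝ) < 1 / 2)]
      refine mul_le_mul_of_nonneg_right ?_ (norm_nonneg c)
      nlinarith [abs_tanh_le_one (s - τ), soliton_pos τ s, abs_nonneg (Real.tanh (s - τ))]
    have h3 := hB' s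
    have h4 := hsm s
    have h5 : ‖v' s‖ ≤ ‖w' s‖ + soliton τ s * ‖c‖ := h1.trans (by linarith)
    have h6 := pow_le_pow_left₀ (norm_nonneg (v' s)) h5 2
    nlinarith [sq_nonneg (‖w' s‖ - soliton τ s * ‖c‖)]
  have hpt : ∀ s, ‖v s‖ ^ 2 ≤ E := fun s => by
    have h1 := norm_sub_soliton_sq_le hw hw' hi s
    have h2 := mul_le_mul_of_nonneg_right (abs_sinh_mul_sech_le (s - τ)) hE0
    linarith
  have hid := integral_excess_eq hvd hv'c hvB hvB' τ
  have hex : ∀ s, v' s + (1 / 2 * Real.tanh (s - τ)) • v s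
      = w' s + (1 / 2 * Real.tanh (s - τ)) • w s := fun s => by
    simp only [hv, hv', Complex.real_smul]
    push_cast
    ring
  simp only [hex] at hid
  rw [← hE] at hid
  have hsq : ∫ s, sech (s - τ) ^ 2 * ‖v s‖ ^ 2 ≤ J * E := by
    rw [hJdef, ← integral_sub_right_eq_self sech τ, ← integral_mul_const]
    refine integral_mono_of_nonneg (Eventually.of_forall fun s => by positivity)
      ((integrable_sech.comp_sub_right τ).mul_const E) (Eventually.of_forall fun s => ?_)
    have h1 : sech (s - τ) ^ 2 ≤ sech (s - τ) := by
      have := sech_le_one (s - τ); have := sech_pos (s - τ); nlinarith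
    exact mul_le_mul h1 (hpt s) (sq_nonneg _) (sech_pos _).le
  have iv : Integrable fun s => ‖v s‖ ^ 2 := integrable_mul_sech (by fun_prop) (B := B') fun s => by
    rw [abs_of_nonneg (sq_nonneg _)]; exact hvB s
  have iv' : Integrable fun s => ‖v' s‖ ^ 2 :=
      integrable_mul_sech (by fun_prop) (B := B') fun s => by
    rw [abs_of_nonneg (sq_nonneg _)]; exact hvB' s
  have hH : ∫ s, (‖v' s‖ ^ 2 + ‖v s‖ ^ 2 / 4) ≤ (1 + J) * E := by nlinarith
  have hL2 : ∫ s, ‖v s‖ ^ 2 ≤ 4 * ((1 + J) * E) := by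
    have h1 : ∫ s, ‖v s‖ ^ 2 / 4 ≤ ∫ s, (‖v' s‖ ^ 2 + ‖v s‖ ^ 2 / 4) :=
      integral_mono (iv.div_const 4) (iv'.add (iv.div_const 4)) fun s => by
        have := sq_nonneg ‖v' s‖
        simp only
        linarith
    rw [integral_div] at h1
    linarith
  refine ⟨τ, c, 4 * (1 + J) * E, by positivity, ?_, ?_, ?_⟩
  · have h1 := mul_le_mul_of_nonneg_left hτ (by positivity : 0 ≤ 4 * (1 + J))
    refine h1.trans (le_of_eq ?_)
    field_simp
  · refine hH.trans ?_
    nlinarith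
  · have h1 : ∫ s, ‖v s‖ ^ 6 ≤ ∫ s, E ^ 2 * ‖v s‖ ^ 2 := by
      refine integral_mono_of_nonneg (Eventually.of_forall fun s => by positivity)
        (iv.const_mul _) (Eventually.of_forall fun s => ?_)
      have := pow_le_pow_left₀ (sq_nonneg _) (hpt s) 2
      calc ‖v s‖ ^ 6 = (‖v s‖ ^ 2) ^ 2 * ‖v s‖ ^ 2 := by ring
        _ ≤ _ := mul_le_mul_of_nonneg_right this (sq_nonneg _)
    rw [integral_const_mul] at h1
    have h2 := mul_le_mul_of_nonneg_left hL2 (sq_nonneg E)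
    have h3 : E ^ 2 * (4 * ((1 + J) * E)) = (4 * (1 + J)) * E ^ 3 := by ring
    have h4 : (4 * (1 + J)) * E ^ 3 ≤ (4 * (1 + J)) ^ 3 * E ^ 3 := by
      refine mul_le_mul_of_nonneg_right ?_ (by positivity)
      exact le_self_pow₀ (by linarith) (by norm_num)
    rw [mul_pow]
    linarith

/-! ### Mollification -/

section Minkowski
variable {α β F : Type*} [MeasurableSpace α] [MeasurableSpace β] [NormedAddCommGroup F]
  {μ : Measure α} {ν : Measure β} [SFinite μ] [SFinite ν]

omit [SFinite ν] in
lemma rpow_lintegral_mul_le {a b : β → ℝ≥0∞} (ha : Measurable a) (hb : Measurable b) {p : ℝ}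
    (hp : 1 ≤ p) :
    (∫⁻ y, a y * b y ∂ν) ^ p ≤ (∫⁻ y, a y ∂ν) ^ (p - 1) * ∫⁻ y, a y * b y ^ p ∂ν := by
  rcases hp.eq_or_lt with rfl | hp1
  · simp
  have hp0 : 0 < p := by linarith
  have hpq : p.HolderConjugate (p / (p - 1)) := Real.HolderConjugate.conjExponent hp1
  have h1 : ∫⁻ y, a y * b y ∂ν = ∫⁻ y, ((a y ^ (1 / p) * b y) * a y ^ ((p - 1) / p)) ∂ν := by
    refine lintegral_congr fun y => ?_
    have : a y ^ (1 / p) * a y ^ ((p - 1) / p) = a y := by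
      rw [← ENNReal.rpow_add_of_nonneg _ _ (by positivity)
        (div_nonneg (by linarith) hp0.le), ← add_div]
      have : (1 + (p - 1)) / p = 1 := by field_simp; ring
      rw [this, ENNReal.rpow_one]
    calc a y * b y = (a y ^ (1 / p) * a y ^ ((p - 1) / p)) * b y := by rw [this]
      _ = _ := by ring
  have h2 := ENNReal.lintegral_mul_le_Lp_mul_Lq ν hpq
    (f := fun y => a y ^ (1 / p) * b y) (g := fun y => a y ^ ((p - 1) / p))
    (((ha.pow_const _).mul hb).aemeasurable) (ha.pow_const _).aemeasurable
  have e1 : ∀ y, (a y ^ (1 / p) * b y) ^ p = a y * b y ^ p := fun y => by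
    rw [ENNReal.mul_rpow_of_nonneg _ _ hp0.le, ← ENNReal.rpow_mul]
    simp [hp0.ne']
  have e2 : ∀ y, (a y ^ ((p - 1) / p)) ^ (p / (p - 1)) = a y := fun y => by
    rw [← ENNReal.rpow_mul]
    have : (p - 1) / p * (p / (p - 1)) = 1 := by
      have : p - 1 ≠ 0 := by linarith
      field_simp
    rw [this, ENNReal.rpow_one]
  simp only [e1, e2, Pi.mul_apply] at h2
  rw [h1]
  calc _ ≤ _ := ENNReal.rpow_le_rpow h2 hp0.le
    _ = _ := by
      rw [ENNReal.mul_rpow_of_nonneg _ _ hp0.le, ← ENNReal.rpow_mul, ← ENNReal.rpow_mul, mul_comm]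
      have e3 : 1 / p * p = 1 := by field_simp
      have e4 : 1 / (p / (p - 1)) * p = p - 1 := by field_simp
      rw [e3, e4, ENNReal.rpow_one]

/-- A form of Minkowski's integral inequality. -/
lemma eLpNorm_le_of_enorm_le_lintegral {H : α → F} {a : β → ℝ≥0∞} {b : α → β → ℝ≥0∞}
    (ha : Measurable a) (hb : Measurable (Function.uncurry b)) {p : ℝ≥0∞} (hp : 1 ≤ p)
    (hp' : p ≠ ⊤) (hH : ∀ᵐ x ∂μ, ‖H x‖ₑ ≤ ∫⁻ y, a y * b x y ∂ν) {M : ℝ≥0∞}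
    (hM : ∀ y, a y ≠ 0 → ∫⁻ x, b x y ^ p.toReal ∂μ ≤ M ^ p.toReal) :
    eLpNorm H p μ ≤ (∫⁻ y, a y ∂ν) * M := by
  have hp1 : 1 ≤ p.toReal := by
    rw [← ENNReal.toReal_one]; exact ENNReal.toReal_mono hp' hp
  have hp0 : 0 < p.toReal := by linarith
  have hpne : p ≠ 0 := (zero_lt_one.trans_le hp).ne'
  rw [eLpNorm_eq_lintegral_rpow_enorm_toReal hpne hp', ← ENNReal.rpow_le_rpow_iff hp0,
    ← ENNReal.rpow_mul, one_div_mul_cancel hp0.ne', ENNReal.rpow_one]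
  calc ∫⁻ x, ‖H x‖ₑ ^ p.toReal ∂μ
      ≤ ∫⁻ x, (∫⁻ y, a y ∂ν) ^ (p.toReal - 1) * ∫⁻ y, a y * b x y ^ p.toReal ∂ν ∂μ := by
        refine lintegral_mono_ae (hH.mono fun x hx => ?_)
        exact (ENNReal.rpow_le_rpow hx hp0.le).trans
          (rpow_lintegral_mul_le ha (hb.comp measurable_prodMk_left) hp1)
    _ = (∫⁻ y, a y ∂ν) ^ (p.toReal - 1) * ∫⁻ x, ∫⁻ y, a y * b x y ^ p.toReal ∂ν ∂μ := by
        refine lintegral_const_mul _ ?_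
        exact Measurable.lintegral_prod_right' (f := fun z : α × β => a z.2 * b z.1 z.2 ^ p.toReal)
          ((ha.comp measurable_snd).mul (hb.pow_const _))
    _ = (∫⁻ y, a y ∂ν) ^ (p.toReal - 1) * ∫⁻ y, a y * ∫⁻ x, b x y ^ p.toReal ∂μ ∂ν := by
        rw [lintegral_lintegral_swap
          ((ha.comp measurable_snd).mul (hb.pow_const _)).aemeasurable]
        congr 1
        refine lintegral_congr fun y => ?_
        exact lintegral_const_mul (a y) (f := fun x => b x y ^ p.toReal)
          ((hb.comp measurable_prodMk_right).pow_const _)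
    _ ≤ (∫⁻ y, a y ∂ν) ^ (p.toReal - 1) * ∫⁻ y, a y * M ^ p.toReal ∂ν := by
        refine mul_le_mul' le_rfl (lintegral_mono fun y => ?_)
        by_cases hy : a y = 0
        · simp [hy]
        · exact mul_le_mul' le_rfl (hM y hy)
    _ = ((∫⁻ y, a y ∂ν) * M) ^ p.toReal := by
        rw [lintegral_mul_const _ ha, ← mul_assoc, ENNReal.mul_rpow_of_nonneg _ _ hp0.le]
        congr 1
        conv_lhs => enter [2]; rw [← ENNReal.rpow_one (∫⁻ y, a y ∂ν)]
        rw [← ENNReal.rpow_add_of_nonneg _ _ (by linarith) zero_le_one]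
        congr 1; ring
end Minkowski

/-- The partial derivative in the `j`-th coordinate direction. -/
noncomputable def pd {F : Type*} [NormedAddCommGroup F] [NormedSpace ℝ F] (j : Fin 3)
    (f : Space3 → F) (x : Space3) : F := fderiv ℝ f x (EuclideanSpace.single j 1)

/-- Test functions. -/
structure IsTest (φ : Space3 → ℝ) : Prop where
  contDiff : ContDiff ℝ ∞ φ
  hasCompactSupport : HasCompactSupport φ

namespace IsTest
variable {φ ψ : Space3 → ℝ}

lemma continuous (h : IsTest φ) : Continuous φ := h.contDiff.continuous

lemma differentiable (h : IsTest φ) : Differentiable ℝ φ := h.contDiff.differentiable (by simp)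

lemma pd (h : IsTest φ) (j : Fin 3) : IsTest (pd j φ) :=
  ⟨(h.contDiff.fderiv_right (m := ∞) (by simp)).clm_apply contDiff_const,
    h.hasCompactSupport.fderiv_apply ℝ _⟩

lemma comp_sub (h : IsTest φ) (x : Space3) : IsTest fun y => φ (x - y) :=
  ⟨h.contDiff.comp (contDiff_const.sub contDiff_id),
    h.hasCompactSupport.comp_homeomorph (Homeomorph.subLeft x)⟩

lemma comp_smul (h : IsTest φ) {a : ℝ} (ha : a ≠ 0) : IsTest fun y => φ (a • y) :=
  ⟨h.contDiff.comp (contDiff_id.const_smul a), h.hasCompactSupport.comp_smul ha⟩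

lemma const_mul (h : IsTest φ) (c : ℝ) : IsTest fun y => c * φ y :=
  ⟨contDiff_const.mul h.contDiff, h.hasCompactSupport.mul_left⟩

lemma add (h : IsTest φ) (h' : IsTest ψ) : IsTest fun y => φ y + ψ y :=
  ⟨h.contDiff.add h'.contDiff, h.hasCompactSupport.add h'.hasCompactSupport⟩

lemma integrable (h : IsTest φ) : Integrable φ :=
  h.continuous.integrable_of_hasCompactSupport h.hasCompactSupport

lemma memLp (h : IsTest φ) (p : ℝ≥0∞) : MemLp φ p volume :=
  h.continuous.memLp_of_hasCompactSupport h.hasCompactSupport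

lemma integrable_smul {F : Type*} [NormedAddCommGroup F] [NormedSpace ℝ F] (h : IsTest φ)
    {f : Space3 → F} (hf : LocallyIntegrable f volume) : Integrable fun x => φ x • f x :=
  hf.integrable_smul_left_of_hasCompactSupport h.continuous h.hasCompactSupport

end IsTest

lemma pd_comp_sub {φ : Space3 → ℝ} (hφ : Differentiable ℝ φ) (j : Fin 3) (x y : Space3) :
    pd j (fun y => φ (x - y)) y = -pd j φ (x - y) := by
  have h : HasFDerivAt (fun y => φ (x - y)) ((fderiv ℝ φ (x - y)).comp
      (-ContinuousLinearMap.id ℝ Space3)) y :=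
    (hφ (x - y)).hasFDerivAt.comp y ((hasFDerivAt_id y).const_sub x)
  rw [pd, h.fderiv]
  simp [pd]

lemma pd_comp_smul {F : Type*} [NormedAddCommGroup F] [NormedSpace ℝ F] (f : Space3 → F)
    (j : Fin 3) (a : ℝ) (x : Space3) :
    pd j (fun y => f (a • y)) x = a • pd j f (a • x) := by
  rw [pd, fderiv_comp_smul]
  simp [pd]

section Moll
variable {F : Type*} [NormedAddCommGroup F] [NormedSpace ℝ F]

/-- The convolution of `f` with the real kernel `ψ`. -/
noncomputable def moll (ψ : Space3 → ℝ) (f : Space3 → F) (x : Space3) : F :=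
  ∫ y, ψ (x - y) • f y

lemma moll_eq_convolution (ψ : Space3 → ℝ) (f : Space3 → F) :
    moll ψ f = convolution ψ f (ContinuousLinearMap.lsmul ℝ ℝ) volume := by
  ext x
  rw [convolution_eq_swap]; rfl

lemma moll_apply' (ψ : Space3 → ℝ) (f : Space3 → F) (x : Space3) :
    moll ψ f x = ∫ y, ψ y • f (x - y) := by
  rw [moll_eq_convolution]; rfl

lemma moll_congr (ψ : Space3 → ℝ) {f g : Space3 → F} (h : f =ᵐ[volume] g) :
    moll ψ f = moll ψ g := by
  ext x
  exact integral_congr_ae (h.mono fun y hy => by simp only [hy])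

lemma contDiff_moll [CompleteSpace F] {ψ : Space3 → ℝ} (hψ : IsTest ψ) {f : Space3 → F}
    (hf : LocallyIntegrable f volume) : ContDiff ℝ ∞ (moll ψ f) := by
  rw [moll_eq_convolution]
  exact hψ.hasCompactSupport.contDiff_convolution_left _ hψ.contDiff hf

lemma continuous_moll [CompleteSpace F] {ψ : Space3 → ℝ} (hψ : IsTest ψ) {f : Space3 → F}
    (hf : LocallyIntegrable f volume) : Continuous (moll ψ f) := (contDiff_moll hψ hf).continuous

lemma pd_moll [CompleteSpace F] {ψ : Space3 → ℝ} (hψ : IsTest ψ) {f : Space3 → F}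
    (hf : LocallyIntegrable f volume) (j : Fin 3) (x : Space3) :
    pd j (moll ψ f) x = moll (pd j ψ) f x := by
  have h := hψ.hasCompactSupport.hasFDerivAt_convolution_left (ContinuousLinearMap.lsmul ℝ ℝ)
    (hψ.contDiff.of_le (by exact_mod_cast le_top)) hf x
  have hex := (hψ.hasCompactSupport.fderiv (𝕜 := ℝ)).convolutionExists_left
    ((ContinuousLinearMap.lsmul ℝ ℝ : ℝ →L[ℝ] F →L[ℝ] F).precompL Space3)
    (hψ.contDiff.continuous_fderiv (by simp)) hf x
  rw [pd, moll_eq_convolution, h.fderiv, convolution, ContinuousLinearMap.integral_apply hex,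
    moll_apply']
  rfl

lemma measurePreserving_sub_right' (y : Space3) :
    MeasurePreserving (fun x : Space3 => x - y) volume volume := measurePreserving_sub_right _ y

omit [NormedSpace ℝ F] in
lemma lintegral_enorm_sub_rpow {f : Space3 → F} (y : Space3) (p : ℝ) :
    ∫⁻ x, ‖f (x - y)‖ₑ ^ p = ∫⁻ x, ‖f x‖ₑ ^ p :=
  lintegral_sub_right_eq_self (fun x => ‖f x‖ₑ ^ p) y

lemma eLpNorm_rpow_toReal {α G : Type*} [MeasurableSpace α] [NormedAddCommGroup G] {μ : Measure α}
    {f : α → G} {p : ℝ≥0∞} (hp : 1 ≤ p) (hp' : p ≠ ⊤) :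
    ∫⁻ x, ‖f x‖ₑ ^ p.toReal ∂μ = eLpNorm f p μ ^ p.toReal := by
  have hpne : p ≠ 0 := (zero_lt_one.trans_le hp).ne'
  have hp0 : 0 < p.toReal := ENNReal.toReal_pos hpne hp'
  rw [eLpNorm_eq_lintegral_rpow_enorm_toReal hpne hp', ← ENNReal.rpow_mul,
    one_div_mul_cancel hp0.ne', ENNReal.rpow_one]

/-- Young's inequality for convolution with an integrable kernel. -/
lemma eLpNorm_moll_le {ψ : Space3 → ℝ} (hψ : Continuous ψ) {f : Space3 → F}
    (hf : AEStronglyMeasurable f volume) {p : ℝ≥0∞} (hp : 1 ≤ p) (hp' : p ≠ ⊤) :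
    eLpNorm (moll ψ f) p volume ≤ (∫⁻ y, ‖ψ y‖ₑ) * eLpNorm f p volume := by
  rw [moll_congr ψ hf.ae_eq_mk, eLpNorm_congr_ae hf.ae_eq_mk]
  set g := hf.mk f
  have hg : StronglyMeasurable g := hf.stronglyMeasurable_mk
  refine eLpNorm_le_of_enorm_le_lintegral (a := fun y => ‖ψ y‖ₑ) (b := fun x y => ‖g (x - y)‖ₑ)
    hψ.measurable.enorm ?_ hp hp' (Eventually.of_forall fun x => ?_) fun y _ => ?_
  · exact (hg.comp_measurable (measurable_fst.sub measurable_snd)).enorm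
  · rw [moll_apply']
    refine (enorm_integral_le_lintegral_enorm _).trans (le_of_eq ?_)
    simp only [enorm_smul]
  · rw [lintegral_enorm_sub_rpow, eLpNorm_rpow_toReal hp hp']

omit [NormedSpace ℝ F] in
lemma tendsto_eLpNorm_translate {f : Space3 → F} {p : ℝ≥0∞} (hp : 1 ≤ p) (hp' : p ≠ ⊤)
    (hf : MemLp f p volume) :
    Tendsto (fun y => eLpNorm (fun x => f (x - y) - f x) p volume) (𝓝 0) (𝓝 0) := by
  have : Fact (1 ≤ p) := ⟨hp⟩
  let g : Space3 → C(Space3, Space3) := fun y => ⟨fun x => x - y, by fun_prop⟩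
  have hg : Continuous g :=
    (ContinuousMap.curry (⟨fun z : Space3 × Space3 => z.2 - z.1, by fun_prop⟩)).continuous
  have hgm : ∀ y, MeasurePreserving (g y) (volume : Measure Space3) volume :=
    measurePreserving_sub_right'
  have h1 := (continuous_const (y := hf.toLp f)).compMeasurePreservingLp hg hgm hp'
  have h2 := (tendsto_iff_edist_tendsto_0.1 (h1.tendsto 0))
  refine h2.congr fun y => ?_
  rw [Lp.edist_def]
  refine eLpNorm_congr_ae ?_
  have a1 := Lp.coeFn_compMeasurePreserving (hf.toLp f) (hgm y)
  have a2 := Lp.coeFn_compMeasurePreserving (hf.toLp f) (hgm 0)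
  have a3 := hf.coeFn_toLp
  have a4 := (hgm y).quasiMeasurePreserving.tendsto_ae.eventually a3
  have a5 := (hgm 0).quasiMeasurePreserving.tendsto_ae.eventually a3
  filter_upwards [a1, a2, a4, a5] with x h1 h2 h4 h5
  rw [Pi.sub_apply, h1, h2, Function.comp_apply, Function.comp_apply, h4, h5]
  simp [g]

/-- Convolution with `ψ` differs from multiplication by `∫ ψ` no more than the translations in the
support of `ψ` differ from the identity. -/
lemma eLpNorm_moll_sub_le [CompleteSpace F] {ψ : Space3 → ℝ} (hψ : IsTest ψ)
    {f : Space3 → F} {p : ℝ≥0∞} (hp : 1 ≤ p) (hp' : p ≠ ⊤)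
    (hf : MemLp f p volume) {M : ℝ≥0∞}
    (hM : ∀ y, ψ y ≠ 0 → eLpNorm (fun x => f (x - y) - f x) p volume ≤ M) :
    eLpNorm (fun x => moll ψ f x - (∫ y, ψ y) • f x) p volume ≤ (∫⁻ y, ‖ψ y‖ₑ) * M := by
  have hloc : LocallyIntegrable f volume := hf.locallyIntegrable hp
  have hfm := hf.1
  set g := hfm.mk f
  have hg : StronglyMeasurable g := hfm.stronglyMeasurable_mk
  have hfg : f =ᵐ[volume] g := hfm.ae_eq_mk
  have hloc' : LocallyIntegrable g volume := hloc.congr hfg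
  have e1 : (fun x => moll ψ f x - (∫ y, ψ y) • f x) =ᵐ[volume]
      fun x => moll ψ g x - (∫ y, ψ y) • g x := by
    rw [moll_congr ψ hfg]
    filter_upwards [hfg] with x hx
    rw [hx]
  rw [eLpNorm_congr_ae e1]
  refine eLpNorm_le_of_enorm_le_lintegral (a := fun y => ‖ψ y‖ₑ)
    (b := fun x y => ‖g (x - y) - g x‖ₑ) hψ.continuous.measurable.enorm ?_ hp hp'
    (Eventually.of_forall fun x => ?_) fun y hy => ?_
  · exact ((hg.comp_measurable (measurable_fst.sub measurable_snd)).sub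
      (hg.comp_measurable measurable_fst)).enorm
  · have e2 : moll ψ g x - (∫ y, ψ y) • g x = ∫ y, ψ y • (g (x - y) - g x) := by
      have i1 : Integrable fun y => ψ y • g (x - y) := by
        have := (hψ.comp_sub x).integrable_smul hloc'
        have h2 := this.comp_sub_left x
        simpa using h2
      simp only [smul_sub]
      rw [integral_sub i1 (hψ.integrable.smul_const _), integral_smul_const, moll_apply']
    rw [e2]
    refine (enorm_integral_le_lintegral_enorm _).trans (le_of_eq ?_)
    simp only [enorm_smul]
  · rw [eLpNorm_rpow_toReal hp hp']
    refine ENNReal.rpow_le_rpow ?_ ENNReal.toReal_nonneg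
    refine le_trans (le_of_eq (eLpNorm_congr_ae ?_)) (hM y (by simpa using hy))
    have h2 := (measurePreserving_sub_right' y).quasiMeasurePreserving.tendsto_ae.eventually hfg
    filter_upwards [hfg, h2] with x hx hx2
    rw [hx, hx2]
end Moll

/-- A smooth radial cutoff, equal to one on the unit ball and supported in the ball of radius
two. -/
noncomputable def cutoff (x : Space3) : ℝ := Real.smoothTransition (2 - ‖x‖ ^ 2)

lemma cutoff_nonneg (x : Space3) : 0 ≤ cutoff x := Real.smoothTransition.nonneg _

lemma cutoff_le_one (x : Space3) : cutoff x ≤ 1 := Real.smoothTransition.le_one _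

lemma cutoff_eq_one {x : Space3} (hx : ‖x‖ ≤ 1) : cutoff x = 1 :=
  Real.smoothTransition.one_of_one_le (by nlinarith [norm_nonneg x])

lemma cutoff_eq_zero {x : Space3} (hx : 2 ≤ ‖x‖) : cutoff x = 0 :=
  Real.smoothTransition.zero_of_nonpos (by nlinarith [norm_nonneg x])

lemma isTest_cutoff : IsTest cutoff := by
  refine ⟨Real.smoothTransition.contDiff.comp (contDiff_const.sub (contDiff_norm_sq ℝ)), ?_⟩
  refine HasCompactSupport.of_support_subset_isCompact (isCompact_closedBall (0 : Space3) 2)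
    fun x hx => ?_
  rw [mem_closedBall_zero_iff]
  by_contra h
  exact hx (cutoff_eq_zero (not_le.1 h).le)

lemma integral_cutoff_pos : 0 < ∫ x, cutoff x := by
  refine isTest_cutoff.continuous.integral_pos_of_hasCompactSupport_nonneg_nonzero
    isTest_cutoff.hasCompactSupport cutoff_nonneg (x := 0) ?_
  rw [cutoff_eq_one (by simp)]; exact one_ne_zero

/-- The mollifier at frequency `a`: a radial probability density supported in `‖x‖ ≤ 2 / a`. -/
noncomputable def mollifier (a : ℝ) (x : Space3) : ℝ := a ^ 3 * (∫ y, cutoff y)⁻¹ * cutoff (a • x)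

lemma isTest_mollifier {a : ℝ} (ha : 0 < a) : IsTest (mollifier a) :=
  (isTest_cutoff.comp_smul ha.ne').const_mul _

lemma mollifier_nonneg {a : ℝ} (ha : 0 < a) (x : Space3) : 0 ≤ mollifier a x :=
  mul_nonneg (mul_nonneg (by positivity) (inv_nonneg.2 integral_cutoff_pos.le)) (cutoff_nonneg _)

lemma integral_comp_smul_space3 {F : Type*} [NormedAddCommGroup F] [NormedSpace ℝ F]
    (f : Space3 → F) {a : ℝ} (ha : 0 < a) : ∫ x, f (a • x) = (a ^ 3)⁻¹ • ∫ x, f x := by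
  rw [Measure.integral_comp_smul]
  simp [abs_of_pos (inv_pos.2 (pow_pos ha 3))]

lemma integral_mollifier {a : ℝ} (ha : 0 < a) : ∫ x, mollifier a x = 1 := by
  simp only [mollifier]
  rw [integral_const_mul, integral_comp_smul_space3 _ ha, smul_eq_mul]
  have := integral_cutoff_pos
  field_simp

lemma norm_le_of_mollifier_ne_zero {a : ℝ} (ha : 0 < a) {x : Space3} (hx : mollifier a x ≠ 0) :
    ‖x‖ ≤ 2 / a := by
  by_contra h
  refine hx ?_
  rw [mollifier, cutoff_eq_zero, mul_zero]
  rw [norm_smul, Real.norm_of_nonneg ha.le]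
  rw [not_le, div_lt_iff₀ ha] at h
  linarith

lemma norm_le_of_pd_mollifier_ne_zero {a : ℝ} (ha : 0 < a) {j : Fin 3} {x : Space3}
    (hx : pd j (mollifier a) x ≠ 0) : ‖x‖ ≤ 2 / a := by
  have h1 : x ∈ tsupport (mollifier a) := by
    by_contra h
    refine hx ?_
    have := image_eq_zero_of_notMem_tsupport (f := fderiv ℝ (mollifier a)) (x := x)
      (fun h' => h (tsupport_fderiv_subset ℝ h'))
    rw [pd, this]; rfl
  have h2 : tsupport (mollifier a) ⊆ Metric.closedBall 0 (2 / a) :=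
    closure_minimal (fun y hy => mem_closedBall_zero_iff.2 (norm_le_of_mollifier_ne_zero ha hy))
      Metric.isClosed_closedBall
  exact mem_closedBall_zero_iff.1 (h2 h1)

lemma mollifier_comp_isometry (a : ℝ) (A : Space3 ≃ₗᵢ[ℝ] Space3) (x : Space3) :
    mollifier a (A x) = mollifier a x := by
  simp [mollifier, cutoff, norm_smul]

lemma lintegral_enorm_mollifier {a : ℝ} (ha : 0 < a) : ∫⁻ x, ‖mollifier a x‖ₑ = 1 := by
  have h := ofReal_integral_eq_lintegral_ofReal (isTest_mollifier ha).integrable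
    (Eventually.of_forall (mollifier_nonneg ha))
  rw [integral_mollifier ha, ENNReal.ofReal_one] at h
  rw [h]
  exact lintegral_congr fun y => Real.enorm_of_nonneg (mollifier_nonneg ha y)

lemma pd_const_mul {f : Space3 → ℝ} (hf : Differentiable ℝ f) (c : ℝ) (j : Fin 3) (x : Space3) :
    pd j (fun y => c * f y) x = c * pd j f x := by
  rw [pd, fderiv_const_mul (hf x)]; rfl

lemma exists_lintegral_pd_mollifier_le : ∃ K : ℝ, 0 < K ∧ ∀ a : ℝ, 0 < a → ∀ j,
    ∫⁻ x, ‖pd j (mollifier a) x‖ₑ ≤ ENNReal.ofReal (K * a) := by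
  have hI := integral_cutoff_pos
  refine ⟨(∫ y, cutoff y)⁻¹ * (1 + ∑ j, ∫ x, ‖pd j cutoff x‖), ?_, fun a ha j => ?_⟩
  · exact mul_pos (inv_pos.2 hI) (by positivity)
  have h1 : ∀ x, pd j (mollifier a) x
      = (a ^ 4 * (∫ y, cutoff y)⁻¹) * pd j cutoff (a • x) := fun x => by
    have : mollifier a = fun x => (a ^ 3 * (∫ y, cutoff y)⁻¹) * cutoff (a • x) := rfl
    rw [this, pd_const_mul (isTest_cutoff.comp_smul ha.ne').differentiable, pd_comp_smul]
    simp only [smul_eq_mul]; ring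
  have h2 := ((isTest_mollifier ha).pd j).integrable
  rw [← ofReal_integral_norm_eq_lintegral_enorm h2]
  refine ENNReal.ofReal_le_ofReal ?_
  simp only [h1, norm_mul]
  rw [integral_const_mul, integral_comp_smul_space3 (fun x => ‖pd j cutoff x‖) ha, smul_eq_mul,
    Real.norm_of_nonneg (by positivity : 0 ≤ a ^ 4), Real.norm_of_nonneg (inv_pos.2 hI).le]
  have h3 : ∫ x, ‖pd j cutoff x‖ ≤ 1 + ∑ j, ∫ x, ‖pd j cutoff x‖ := by
    have := Finset.single_le_sum (f := fun j => ∫ x, ‖pd j cutoff x‖)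
      (fun j _ => integral_nonneg fun x => norm_nonneg _) (Finset.mem_univ j)
    linarith
  calc _ = (∫ y, cutoff y)⁻¹ * (∫ x, ‖pd j cutoff x‖) * a := by field_simp
    _ ≤ _ := by gcongr

lemma integral_pd_eq_zero {φ : Space3 → ℝ} (h : IsTest φ) (j : Fin 3) : ∫ x, pd j φ x = 0 := by
  have h1 : Integrable fun x => fderiv ℝ φ x (EuclideanSpace.single j 1) := (h.pd j).integrable
  have := integral_mul_fderiv_eq_neg_fderiv_mul_of_integrable (μ := (volume : Measure Space3))
    (f := fun _ => (1 : ℝ)) (g := φ) (v := EuclideanSpace.single j 1) (by simp)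
    (by simpa using h1) (by simpa using h.integrable) (fun x _ => by fun_prop)
    (fun x _ => h.differentiable x)
  simpa [pd] using this

section Modulus
variable {F : Type*} [NormedAddCommGroup F]

/-- The modulus of continuity of `f` in `L^p`. -/
noncomputable def translationModulus (p : ℝ≥0∞) (f : Space3 → F) (r : ℝ) : ℝ≥0∞ :=
  ⨆ y ∈ Metric.closedBall (0 : Space3) r, eLpNorm (fun x => f (x - y) - f x) p volume

lemma le_translationModulus {p : ℝ≥0∞} (f : Space3 → F) {r : ℝ} {y : Space3} (hy : ‖y‖ ≤ r) :
    eLpNorm (fun x => f (x - y) - f x) p volume ≤ translationModulus p f r :=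
  le_iSup₂ (f := fun y (_ : y ∈ Metric.closedBall (0 : Space3) r) =>
    eLpNorm (fun x => f (x - y) - f x) p volume) y (mem_closedBall_zero_iff.2 hy)

lemma eLpNorm_comp_sub {f : Space3 → F} {p : ℝ≥0∞} (hf : AEStronglyMeasurable f volume)
    (y : Space3) : eLpNorm (fun x => f (x - y)) p volume = eLpNorm f p volume :=
  eLpNorm_comp_measurePreserving hf (measurePreserving_sub_right' y)

lemma translationModulus_le {p : ℝ≥0∞} (hp : 1 ≤ p) {f : Space3 → F}
    (hf : AEStronglyMeasurable f volume) (r : ℝ) :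
    translationModulus p f r ≤ 2 * eLpNorm f p volume := by
  refine iSup₂_le fun y _ => ?_
  have := eLpNorm_sub_le (p := p) (hf.comp_measurePreserving (measurePreserving_sub_right' y)) hf hp
  refine this.trans (le_of_eq ?_)
  rw [two_mul]
  congr 1
  exact eLpNorm_comp_sub hf y

lemma tendsto_translationModulus {p : ℝ≥0∞} (hp : 1 ≤ p) (hp' : p ≠ ⊤) {f : Space3 → F}
    (hf : MemLp f p volume) : Tendsto (translationModulus p f) (𝓝 0) (𝓝 0) := by
  rw [ENNReal.tendsto_nhds_zero]
  intro ε hε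
  obtain ⟨d, hd, h⟩ := Metric.eventually_nhds_iff.1
    (ENNReal.tendsto_nhds_zero.1 (tendsto_eLpNorm_translate hp hp' hf) ε hε)
  refine Metric.eventually_nhds_iff.2 ⟨d, hd, fun r hr => iSup₂_le fun y hy => h ?_⟩
  rw [dist_zero_right] at hr ⊢
  exact (mem_closedBall_zero_iff.1 hy).trans_lt ((le_abs_self r).trans_lt hr)

lemma tendsto_translationModulus_two_div {p : ℝ≥0∞} (hp : 1 ≤ p) (hp' : p ≠ ⊤) {f : Space3 → F}
    (hf : MemLp f p volume) :
    Tendsto (fun a : ℝ => translationModulus p f (2 / a)) atTop (𝓝 0) :=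
  (tendsto_translationModulus hp hp' hf).comp (tendsto_const_nhds.div_atTop tendsto_id)

variable [NormedSpace ℝ F] [CompleteSpace F]

lemma eLpNorm_mollifier_sub_le {p : ℝ≥0∞} (hp : 1 ≤ p) (hp' : p ≠ ⊤) {f : Space3 → F}
    (hf : MemLp f p volume) {a : ℝ} (ha : 0 < a) :
    eLpNorm (fun x => moll (mollifier a) f x - f x) p volume ≤ translationModulus p f (2 / a) := by
  have := eLpNorm_moll_sub_le (isTest_mollifier ha) hp hp' hf fun y hy =>
    le_translationModulus (p := p) f (norm_le_of_mollifier_ne_zero ha hy)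
  simpa only [integral_mollifier ha, lintegral_enorm_mollifier ha, one_smul, one_mul] using this

lemma tendsto_eLpNorm_mollifier_sub {p : ℝ≥0∞} (hp : 1 ≤ p) (hp' : p ≠ ⊤) {f : Space3 → F}
    (hf : MemLp f p volume) :
    Tendsto (fun a => eLpNorm (fun x => moll (mollifier a) f x - f x) p volume) atTop (𝓝 0) :=
  tendsto_of_tendsto_of_tendsto_of_le_of_le' tendsto_const_nhds
    (tendsto_translationModulus_two_div hp hp' hf) (Eventually.of_forall fun _ => zero_le)
    ((eventually_gt_atTop 0).mono fun _ ha => eLpNorm_mollifier_sub_le hp hp' hf ha)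

lemma eLpNorm_pd_mollifier_le {p : ℝ≥0∞} (hp : 1 ≤ p) (hp' : p ≠ ⊤) {f : Space3 → F}
    (hf : MemLp f p volume) {a : ℝ} (ha : 0 < a) (j : Fin 3) :
    eLpNorm (moll (pd j (mollifier a)) f) p volume
      ≤ (∫⁻ x, ‖pd j (mollifier a) x‖ₑ) * translationModulus p f (2 / a) := by
  have := eLpNorm_moll_sub_le ((isTest_mollifier ha).pd j) hp hp' hf fun y hy =>
    le_translationModulus (p := p) f (norm_le_of_pd_mollifier_ne_zero ha hy)
  simpa only [integral_pd_eq_zero (isTest_mollifier ha), zero_smul, sub_zero] using this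

omit [CompleteSpace F] in
lemma eLpNorm_mollifier_le {p : ℝ≥0∞} (hp : 1 ≤ p) (hp' : p ≠ ⊤) {f : Space3 → F}
    (hf : AEStronglyMeasurable f volume) {a : ℝ} (ha : 0 < a) :
    eLpNorm (moll (mollifier a) f) p volume ≤ eLpNorm f p volume := by
  have := eLpNorm_moll_le (isTest_mollifier ha).continuous hf hp hp'
  rwa [lintegral_enorm_mollifier ha, one_mul] at this

lemma memLp_mollifier {p : ℝ≥0∞} (hp : 1 ≤ p) (hp' : p ≠ ⊤) {f : Space3 → F}
    (hf : MemLp f p volume) {a : ℝ} (ha : 0 < a) : MemLp (moll (mollifier a) f) p volume :=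
  ⟨(continuous_moll (isTest_mollifier ha) (hf.locallyIntegrable hp)).aestronglyMeasurable,
    (eLpNorm_mollifier_le hp hp' hf.1 ha).trans_lt hf.2⟩

end Modulus

/-! ### Weak gradients -/

/-- The classical gradient of a complex-valued function. -/
noncomputable def cgrad (f : Space3 → ℂ) (x : Space3) : EuclideanSpace ℂ (Fin 3) :=
  WithLp.toLp 2 fun j => pd j f x

@[simp] lemma cgrad_apply (f : Space3 → ℂ) (x : Space3) (j : Fin 3) : cgrad f x j = pd j f x := rfl

lemma norm_sq_cgrad (f : Space3 → ℂ) (x : Space3) :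
    ‖cgrad f x‖ ^ 2 = ∑ j, ‖pd j f x‖ ^ 2 := EuclideanSpace.norm_sq_eq _

lemma norm_apply_le (v : EuclideanSpace ℂ (Fin 3)) (j : Fin 3) : ‖v j‖ ≤ ‖v‖ :=
  PiLp.norm_apply_le v j

lemma space3_eq_sum (v : Space3) : v = ∑ j, v j • EuclideanSpace.single j (1 : ℝ) := by
  ext i
  simp [Finset.sum_apply, Pi.single_apply]

lemma fderiv_apply_eq_sum {F : Type*} [NormedAddCommGroup F] [NormedSpace ℝ F] (f : Space3 → F)
    (x v : Space3) : fderiv ℝ f x v = ∑ j, v j • pd j f x := by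
  conv_lhs => rw [space3_eq_sum v]
  simp [pd]

lemma norm_fderiv_le_cgrad (f : Space3 → ℂ) (x : Space3) : ‖fderiv ℝ f x‖ ≤ ‖cgrad f x‖ := by
  refine ContinuousLinearMap.opNorm_le_bound _ (norm_nonneg _) fun v => ?_
  rw [fderiv_apply_eq_sum]
  refine (norm_sum_le _ _).trans ?_
  have h := Finset.sum_mul_sq_le_sq_mul_sq Finset.univ (fun j => ‖pd j f x‖) (fun j => ‖v j‖)
  have h1 := norm_sq_cgrad f x
  have h2 : ‖v‖ ^ 2 = ∑ j, ‖v j‖ ^ 2 := EuclideanSpace.norm_sq_eq _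
  rw [← h1, ← h2, ← mul_pow] at h
  have h3 : ∑ j, ‖v j • pd j f x‖ = ∑ j, ‖pd j f x‖ * ‖v j‖ :=
    Finset.sum_congr rfl fun j _ => by rw [norm_smul, mul_comm]
  rw [h3]
  exact (le_abs_self _).trans (abs_le_of_sq_le_sq h (by positivity))

lemma continuous_pd {F : Type*} [NormedAddCommGroup F] [NormedSpace ℝ F] {f : Space3 → F}
    (hf : ContDiff ℝ 1 f) (j : Fin 3) : Continuous (pd j f) :=
  (hf.continuous_fderiv (by simp)).clm_apply continuous_const

lemma continuous_cgrad {f : Space3 → ℂ} (hf : ContDiff ℝ 1 f) : Continuous (cgrad f) :=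
  (PiLp.continuous_toLp 2 _).comp (continuous_pi fun j => continuous_pd hf j)

lemma integral_pd_smul_eq {F : Type*} [NormedAddCommGroup F] [NormedSpace ℝ F]
    {φ : Space3 → ℝ} (hφ : IsTest φ) {f : Space3 → F} (hf : ContDiff ℝ 1 f) (j : Fin 3) :
    ∫ x, pd j φ x • f x = -∫ x, φ x • pd j f x := by
  have h := integral_smul_fderiv_eq_neg_fderiv_smul_of_integrable
    (μ := (volume : Measure Space3)) (f := φ) (g := f) (v := EuclideanSpace.single j 1)
    ((hφ.pd j).integrable_smul hf.continuous.locallyIntegrable)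
    (hφ.integrable_smul (continuous_pd hf j).locallyIntegrable)
    (hφ.integrable_smul hf.continuous.locallyIntegrable)
    (fun x _ => hφ.differentiable x) (fun x _ => hf.differentiable (by simp) x)
  have h' : ∫ x, φ x • pd j f x = -∫ x, pd j φ x • f x := h
  rw [h', neg_neg]

lemma hasWeakGradient_cgrad {f : Space3 → ℂ} (hf : ContDiff ℝ 1 f) :
    HasWeakGradient f (cgrad f) := by
  refine ⟨hf.continuous.locallyIntegrable, (continuous_cgrad hf).locallyIntegrable,
    fun φ h1 h2 j => ?_⟩
  have h := integral_pd_smul_eq ⟨h1, h2⟩ hf j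
  simp only [Complex.real_smul] at h
  exact h

lemma locallyIntegrable_apply {G : Space3 → EuclideanSpace ℂ (Fin 3)}
    (hG : LocallyIntegrable G volume) (j : Fin 3) : LocallyIntegrable (fun x => G x j) volume := by
  intro x
  obtain ⟨s, hs, h⟩ := hG x
  exact ⟨s, hs, (EuclideanSpace.proj (𝕜 := ℂ) j).integrable_comp h⟩

lemma real_smul_mul (r : ℝ) (c z : ℂ) : r • (c * z) = c * r • z := by
  simp only [Complex.real_smul]; ring

namespace HasWeakGradient
variable {f f' : Space3 → ℂ} {G G' : Space3 → EuclideanSpace ℂ (Fin 3)}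

lemma integral_pd (h : HasWeakGradient f G) {φ : Space3 → ℝ} (hφ : IsTest φ) (j : Fin 3) :
    ∫ x, pd j φ x • f x = -∫ x, φ x • G x j := by
  have := h.integral_eq φ hφ.1 hφ.2 j
  simp only [Complex.real_smul]
  exact this

lemma mk' (h1 : LocallyIntegrable f volume) (h2 : LocallyIntegrable G volume)
    (h : ∀ φ, IsTest φ → ∀ j, ∫ x, pd j φ x • f x = -∫ x, φ x • G x j) : HasWeakGradient f G := by
  refine ⟨h1, h2, fun φ a b j => ?_⟩
  have := h φ ⟨a, b⟩ j
  simp only [Complex.real_smul] at this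
  exact this

lemma ae_unique (h : HasWeakGradient f G) (h' : HasWeakGradient f G') : G =ᵐ[volume] G' := by
  have : ∀ j, (fun x => G x j) =ᵐ[volume] fun x => G' x j := fun j =>
    ae_eq_of_integral_contDiff_smul_eq (locallyIntegrable_apply h.locallyIntegrable_grad j)
      (locallyIntegrable_apply h'.locallyIntegrable_grad j) fun φ a b => by
        have e1 := h.integral_pd ⟨a, b⟩ j
        have e2 := h'.integral_pd ⟨a, b⟩ j
        exact neg_injective (e1.symm.trans e2)
  filter_upwards [ae_all_iff.2 this] with x hx
  ext j
  exact hx j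

lemma gradNorm_eq (h : HasWeakGradient f G) (p : ℝ≥0∞) : gradNorm p f = eLpNorm G p volume := by
  refine le_antisymm (iInf₂_le G h) (le_iInf₂ fun G' h' => ?_)
  rw [eLpNorm_congr_ae (h.ae_unique h')]

lemma add (h : HasWeakGradient f G) (h' : HasWeakGradient f' G') :
    HasWeakGradient (fun x => f x + f' x) (fun x => G x + G' x) := by
  refine mk' (h.locallyIntegrable.add h'.locallyIntegrable)
    (h.locallyIntegrable_grad.add h'.locallyIntegrable_grad) fun φ hφ j => ?_
  simp only [smul_add, PiLp.add_apply]
  rw [integral_add ((hφ.pd j).integrable_smul h.locallyIntegrable)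
    ((hφ.pd j).integrable_smul h'.locallyIntegrable),
    integral_add (hφ.integrable_smul (locallyIntegrable_apply h.locallyIntegrable_grad j))
    (hφ.integrable_smul (locallyIntegrable_apply h'.locallyIntegrable_grad j)),
    h.integral_pd hφ, h'.integral_pd hφ, neg_add]

lemma const_mul (h : HasWeakGradient f G) (c : ℂ) :
    HasWeakGradient (fun x => c * f x) (fun x => c • G x) := by
  refine mk' (h.locallyIntegrable.smul c) (h.locallyIntegrable_grad.smul c) fun φ hφ j => ?_
  simp only [PiLp.smul_apply, smul_eq_mul, real_smul_mul, integral_const_mul]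
  rw [h.integral_pd hφ, mul_neg]

lemma sub (h : HasWeakGradient f G) (h' : HasWeakGradient f' G') :
    HasWeakGradient (fun x => f x - f' x) (fun x => G x - G' x) := by
  have := h.add (h'.const_mul (-1))
  simpa only [neg_mul, one_mul, neg_smul, one_smul, ← sub_eq_add_neg] using this

end HasWeakGradient

lemma moll_apply_apply {ψ : Space3 → ℝ} (hψ : IsTest ψ) {G : Space3 → EuclideanSpace ℂ (Fin 3)}
    (hG : LocallyIntegrable G volume) (x : Space3) (j : Fin 3) :
    moll ψ G x j = moll ψ (fun y => G y j) x := by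
  have := (EuclideanSpace.proj (𝕜 := ℂ) j : EuclideanSpace ℂ (Fin 3) →L[ℂ] ℂ).integral_comp_comm
    ((hψ.comp_sub x).integrable_smul hG)
  rw [moll, moll]
  simpa using this.symm

lemma HasWeakGradient.moll_pd {f : Space3 → ℂ} {G : Space3 → EuclideanSpace ℂ (Fin 3)}
    (h : HasWeakGradient f G) {ψ : Space3 → ℝ} (hψ : IsTest ψ) (j : Fin 3) (x : Space3) :
    moll (pd j ψ) f x = moll ψ (fun y => G y j) x := by
  have h1 := h.integral_pd (hψ.comp_sub x) j
  simp only [pd_comp_sub hψ.differentiable, neg_smul, integral_neg] at h1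
  exact neg_injective h1

lemma HasWeakGradient.cgrad_moll {f : Space3 → ℂ} {G : Space3 → EuclideanSpace ℂ (Fin 3)}
    (h : HasWeakGradient f G) {ψ : Space3 → ℝ} (hψ : IsTest ψ) : cgrad (moll ψ f) = moll ψ G := by
  ext x j
  rw [cgrad_apply, pd_moll hψ h.locallyIntegrable, h.moll_pd hψ,
    moll_apply_apply hψ h.locallyIntegrable_grad]

/-- `f` lies in the Sobolev space `H^{1,p}`, with weak gradient `G`. -/
structure IsSobolev (p : ℝ≥0∞) (f : Space3 → ℂ) (G : Space3 → EuclideanSpace ℂ (Fin 3)) :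
    Prop where
  weak : HasWeakGradient f G
  memLp : MemLp f p volume
  memLp_grad : MemLp G p volume

namespace IsSobolev
variable {p : ℝ≥0∞} {f f' : Space3 → ℂ} {G G' : Space3 → EuclideanSpace ℂ (Fin 3)}

lemma sobolevNorm_eq (h : IsSobolev p f G) :
    sobolevNorm p f = eLpNorm f p volume + eLpNorm G p volume := by
  rw [sobolevNorm, h.weak.gradNorm_eq]

lemma sub (h : IsSobolev p f G) (h' : IsSobolev p f' G') :
    IsSobolev p (fun x => f x - f' x) (fun x => G x - G' x) :=
  ⟨h.weak.sub h'.weak, h.memLp.sub h'.memLp, h.memLp_grad.sub h'.memLp_grad⟩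

end IsSobolev

lemma exists_isSobolev {p : ℝ≥0∞} {f : Space3 → ℂ} (h : sobolevNorm p f < ⊤) :
    ∃ G, IsSobolev p f G := by
  have h1 : eLpNorm f p volume < ⊤ := lt_of_le_of_lt le_self_add h
  have h2 : gradNorm p f < ⊤ := lt_of_le_of_lt le_add_self h
  obtain ⟨G, hG⟩ := iInf_lt_iff.1 h2
  obtain ⟨hw, hG⟩ := iInf_lt_iff.1 hG
  exact ⟨G, hw, ⟨hw.locallyIntegrable.aestronglyMeasurable, h1⟩,
    ⟨hw.locallyIntegrable_grad.aestronglyMeasurable, hG⟩⟩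

/-! ### Translations, approximation by test functions and the Sobolev inequality -/

lemma eLpNorm_translate_sub_le_of_contDiff {v : Space3 → ℂ} (hv : ContDiff ℝ 1 v) {p : ℝ≥0∞}
    (hp : 1 ≤ p) (hp' : p ≠ ⊤) (y : Space3) :
    eLpNorm (fun x => v (x - y) - v x) p volume ≤ ‖y‖ₑ * eLpNorm (cgrad v) p volume := by
  have hc := continuous_cgrad hv
  have h := eLpNorm_le_of_enorm_le_lintegral (μ := (volume : Measure Space3))
    (ν := (volume : Measure ℝ).restrict (Ioc 0 1)) (H := fun x => v (x - y) - v x)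
    (a := fun _ => ‖y‖ₑ) (b := fun x t => ‖cgrad v (x - t • y)‖ₑ) (M := eLpNorm (cgrad v) p volume)
    measurable_const ?_ hp hp' (Eventually.of_forall fun x => ?_) fun t _ => ?_
  · refine h.trans (le_of_eq ?_)
    simp
  · exact (hc.comp (continuous_fst.sub (continuous_snd.smul continuous_const))).measurable.enorm
  · have hd : ∀ t : ℝ, HasDerivAt (fun t : ℝ => v (x - t • y))
        (fderiv ℝ v (x - t • y) (-y)) t := fun t => by
      have h1 : HasDerivAt (fun t : ℝ => x - t • y) (-y) t := by
        simpa using ((hasDerivAt_id t).smul_const y).const_sub x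
      exact (hv.differentiable (by simp) _).hasFDerivAt.comp_hasDerivAt t h1
    have hcont : Continuous fun t : ℝ => fderiv ℝ v (x - t • y) (-y) :=
      ((hv.continuous_fderiv (by simp)).comp
        (continuous_const.sub (continuous_id.smul continuous_const))).clm_apply continuous_const
    have hftc := intervalIntegral.integral_eq_sub_of_hasDerivAt (a := 0) (b := 1)
      (fun t _ => hd t) (hcont.intervalIntegrable 0 1)
    simp only [one_smul, zero_smul, sub_zero] at hftc
    beta_reduce
    rw [← hftc, intervalIntegral.integral_of_le zero_le_one]
    refine (enorm_integral_le_lintegral_enorm _).trans (lintegral_mono fun t => ?_)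
    rw [← ofReal_norm, ← ofReal_norm, ← ofReal_norm,
      ← ENNReal.ofReal_mul (norm_nonneg _)]
    refine ENNReal.ofReal_le_ofReal ((ContinuousLinearMap.le_opNorm _ _).trans ?_)
    rw [norm_neg, mul_comm]
    exact mul_le_mul_of_nonneg_left (norm_fderiv_le_cgrad _ _) (norm_nonneg _)
  · rw [← eLpNorm_rpow_toReal hp hp']
    exact (lintegral_enorm_sub_rpow (t • y) p.toReal).le

lemma IsSobolev.contDiff_moll {p : ℝ≥0∞} {f : Space3 → ℂ} {G : Space3 → EuclideanSpace ℂ (Fin 3)}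
    (h : IsSobolev p f G) {a : ℝ} (ha : 0 < a) : ContDiff ℝ ∞ (moll (mollifier a) f) :=
  _root_.contDiff_moll (isTest_mollifier ha) h.weak.locallyIntegrable

lemma IsSobolev.moll {p : ℝ≥0∞} (hp : 1 ≤ p) (hp' : p ≠ ⊤) {f : Space3 → ℂ}
    {G : Space3 → EuclideanSpace ℂ (Fin 3)} (h : IsSobolev p f G) {a : ℝ} (ha : 0 < a) :
    IsSobolev p (moll (mollifier a) f) (cgrad (_root_.moll (mollifier a) f)) := by
  refine ⟨hasWeakGradient_cgrad ((h.contDiff_moll ha).of_le (by exact_mod_cast le_top)),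
    memLp_mollifier hp hp' h.memLp ha, ?_⟩
  rw [h.weak.cgrad_moll (isTest_mollifier ha)]
  exact memLp_mollifier hp hp' h.memLp_grad ha

lemma IsSobolev.eLpNorm_translate_sub_le {p : ℝ≥0∞} (hp : 1 ≤ p) (hp' : p ≠ ⊤) {f : Space3 → ℂ}
    {G : Space3 → EuclideanSpace ℂ (Fin 3)} (h : IsSobolev p f G) (y : Space3) :
    eLpNorm (fun x => f (x - y) - f x) p volume ≤ ‖y‖ₑ * eLpNorm G p volume := by
  have ht := tendsto_eLpNorm_mollifier_sub hp hp' h.memLp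
  have ht2 : Tendsto (fun a => ‖y‖ₑ * eLpNorm G p volume
      + (eLpNorm (fun x => _root_.moll (mollifier a) f x - f x) p volume
        + eLpNorm (fun x => _root_.moll (mollifier a) f x - f x) p volume)) atTop
      (𝓝 (‖y‖ₑ * eLpNorm G p volume + (0 + 0))) := tendsto_const_nhds.add (ht.add ht)
  rw [add_zero, add_zero] at ht2
  refine ge_of_tendsto ht2 ((eventually_gt_atTop 0).mono fun a ha => ?_)
  set v := _root_.moll (mollifier a) f
  have hvL : MemLp v p volume := memLp_mollifier hp hp' h.memLp ha
  have hd : MemLp (fun x => v x - f x) p volume := hvL.sub h.memLp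
  have e : (fun x => f (x - y) - f x)
      = fun x => ((v (x - y) - v x) - (v (x - y) - f (x - y))) + (v x - f x) := by
    ext x; ring
  have hmp := measurePreserving_sub_right' y
  have m1 := hvL.1.comp_measurePreserving hmp
  have m2 := hd.1.comp_measurePreserving hmp
  rw [e]
  refine (eLpNorm_add_le ((m1.sub hvL.1).sub m2) hd.1 hp).trans ?_
  rw [← add_assoc]
  refine add_le_add ((eLpNorm_sub_le (m1.sub hvL.1) m2 hp).trans (add_le_add ?_ ?_)) le_rfl
  · refine (eLpNorm_translate_sub_le_of_contDiff
      ((h.contDiff_moll ha).of_le (by exact_mod_cast le_top)) hp hp' y).trans ?_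
    rw [h.weak.cgrad_moll (isTest_mollifier ha)]
    exact mul_le_mul' le_rfl (eLpNorm_mollifier_le hp hp' h.memLp_grad.1 ha)
  · exact (eLpNorm_comp_sub hd.1 y).le

lemma IsSobolev.translationModulus_le {p : ℝ≥0∞} (hp : 1 ≤ p) (hp' : p ≠ ⊤) {f : Space3 → ℂ}
    {G : Space3 → EuclideanSpace ℂ (Fin 3)} (h : IsSobolev p f G) (r : ℝ) :
    translationModulus p f r ≤ ENNReal.ofReal r * eLpNorm G p volume := by
  refine iSup₂_le fun y hy => (h.eLpNorm_translate_sub_le hp hp' y).trans ?_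
  gcongr
  rw [← ofReal_norm]
  exact ENNReal.ofReal_le_ofReal (mem_closedBall_zero_iff.1 hy)

section Cutoff
variable {F : Type*} [NormedAddCommGroup F] [NormedSpace ℝ F]

/-- The cutoff at radius `n + 1`. -/
noncomputable def cutoffAt (n : ℕ) (x : Space3) : ℝ := cutoff ((n + 1 : ℝ)⁻¹ • x)

lemma isTest_cutoffAt (n : ℕ) : IsTest (cutoffAt n) :=
  isTest_cutoff.comp_smul (by positivity)

lemma tendsto_cutoffAt (x : Space3) : ∀ᶠ n in atTop, cutoffAt n x = 1 := by
  filter_upwards [eventually_ge_atTop ⌈‖x‖⌉₊] with n hn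
  refine cutoff_eq_one ?_
  rw [norm_smul, Real.norm_of_nonneg (by positivity), inv_mul_le_iff₀ (by positivity), mul_one]
  have := Nat.ceil_le.1 hn
  linarith

lemma tendsto_eLpNorm_cutoffAt_smul {p : ℝ≥0∞} (hp : 1 ≤ p) (hp' : p ≠ ⊤) {f : Space3 → F}
    (hf : MemLp f p volume) {g : ℕ → Space3 → F} (hg : ∀ n, AEStronglyMeasurable (g n) volume)
    (h : Tendsto (fun n => eLpNorm (fun x => g n x - f x) p volume) atTop (𝓝 0)) :
    Tendsto (fun n => eLpNorm (fun x => cutoffAt n x • g n x - f x) p volume) atTop (𝓝 0) := by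
  have hpne : p ≠ 0 := (zero_lt_one.trans_le hp).ne'
  have hp0 : 0 < p.toReal := ENNReal.toReal_pos hpne hp'
  have hcm : ∀ n, AEStronglyMeasurable (cutoffAt n) volume := fun n =>
    (isTest_cutoffAt n).continuous.aestronglyMeasurable
  have hb : ∀ n x, ‖cutoffAt n x - 1‖ₑ ≤ 1 := fun n x => by
    rw [← ofReal_norm]
    refine ENNReal.ofReal_le_one.2 ?_
    rw [Real.norm_eq_abs, abs_le]
    constructor <;> linarith [cutoff_nonneg ((n + 1 : ℝ)⁻¹ • x), cutoff_le_one ((n + 1 : ℝ)⁻¹ • x),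
      show cutoffAt n x = cutoff ((n + 1 : ℝ)⁻¹ • x) from rfl]
  have hm : ∀ n, AEStronglyMeasurable (fun x => (cutoffAt n x - 1) • f x) volume := fun n =>
    ((hcm n).sub aestronglyMeasurable_const).smul hf.1
  have htail : Tendsto (fun n => eLpNorm (fun x => (cutoffAt n x - 1) • f x) p volume) atTop
      (𝓝 0) := by
    have h1 : Tendsto (fun n => ∫⁻ x, ‖(cutoffAt n x - 1) • f x‖ₑ ^ p.toReal) atTop
        (𝓝 (∫⁻ _ : Space3, (0 : ℝ≥0∞))) := by
      refine tendsto_lintegral_of_dominated_convergence' (fun x => ‖f x‖ₑ ^ p.toReal)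
        (fun n => (hm n).enorm.pow_const _) (fun n => Eventually.of_forall fun x => ?_) ?_
        (Eventually.of_forall fun x => ?_)
      · refine ENNReal.rpow_le_rpow ?_ hp0.le
        rw [enorm_smul]
        exact mul_le_of_le_one_left' (hb n x)
      · rw [eLpNorm_rpow_toReal hp hp']
        exact ENNReal.rpow_ne_top_of_nonneg hp0.le hf.2.ne
      · refine tendsto_const_nhds.congr' ((tendsto_cutoffAt x).mono fun n hn => ?_)
        beta_reduce
        rw [hn, sub_self, zero_smul, enorm_zero, ENNReal.zero_rpow_of_pos hp0]
    rw [lintegral_zero] at h1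
    have h2 := (ENNReal.continuous_rpow_const (y := 1 / p.toReal)).tendsto 0 |>.comp h1
    rw [ENNReal.zero_rpow_of_pos (by positivity)] at h2
    refine h2.congr fun n => ?_
    rw [eLpNorm_eq_lintegral_rpow_enorm_toReal hpne hp']; rfl
  have hsum := h.add htail
  rw [add_zero] at hsum
  refine tendsto_of_tendsto_of_tendsto_of_le_of_le tendsto_const_nhds hsum
    (fun _ => zero_le) fun n => ?_
  have e : (fun x => cutoffAt n x • g n x - f x)
      = fun x => cutoffAt n x • (g n x - f x) + (cutoffAt n x - 1) • f x := by
    ext x; rw [smul_sub, sub_smul, one_smul]; abel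
  beta_reduce
  rw [e]
  refine (eLpNorm_add_le ((hcm n).smul ((hg n).sub hf.1)) (hm n) hp).trans
    (add_le_add (eLpNorm_mono_enorm fun x => ?_) le_rfl)
  rw [Pi.smul_apply', Pi.sub_apply, enorm_smul]
  refine mul_le_of_le_one_left' ?_
  rw [← ofReal_norm, Real.norm_of_nonneg (show 0 ≤ cutoffAt n x from cutoff_nonneg _)]
  exact ENNReal.ofReal_le_one.2 (cutoff_le_one _)
end Cutoff

lemma cgrad_smul {η : Space3 → ℝ} {v : Space3 → ℂ} (hη : Differentiable ℝ η)
    (hv : Differentiable ℝ v) (x : Space3) :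
    cgrad (fun y => η y • v y) x = η x • cgrad v x + v x • cgrad (fun y => (η y : ℂ)) x := by
  ext j
  have h1 : HasFDerivAt (fun y => (η y : ℂ)) (Complex.ofRealCLM.comp (fderiv ℝ η x)) x :=
    Complex.ofRealCLM.hasFDerivAt.comp x (hη x).hasFDerivAt
  have h2 : HasFDerivAt (fun y => η y • v y)
      (η x • fderiv ℝ v x + (fderiv ℝ η x).smulRight (v x)) x :=
    (hη x).hasFDerivAt.smul (hv x).hasFDerivAt
  have h3 : pd j (fun y => η y • v y) x = η x • pd j v x + pd j η x • v x := by
    rw [pd, h2.fderiv]; rfl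
  have h4 : pd j (fun y => (η y : ℂ)) x = pd j η x := by
    rw [pd, h1.fderiv]; rfl
  rw [cgrad_apply, h3, PiLp.add_apply, PiLp.smul_apply, PiLp.smul_apply, cgrad_apply, cgrad_apply,
    h4]
  simp only [Complex.real_smul, smul_eq_mul]
  ring

/-- Approximation of `f` by smooth compactly supported functions. -/
noncomputable def testApprox (f : Space3 → ℂ) (n : ℕ) (x : Space3) : ℂ :=
  cutoffAt n x • moll (mollifier (n + 1)) f x

section Approx
variable {p : ℝ≥0∞} {f : Space3 → ℂ} {G : Space3 → EuclideanSpace ℂ (Fin 3)}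

lemma contDiff_testApprox (h : LocallyIntegrable f volume) (n : ℕ) :
    ContDiff ℝ ∞ (testApprox f n) :=
  (isTest_cutoffAt n).contDiff.smul (contDiff_moll (isTest_mollifier (by positivity)) h)

lemma hasCompactSupport_testApprox (f : Space3 → ℂ) (n : ℕ) :
    HasCompactSupport (testApprox f n) :=
  (isTest_cutoffAt n).hasCompactSupport.smul_right

lemma tendsto_natCast_add_one : Tendsto (fun n : ℕ => (n + 1 : ℝ)) atTop atTop :=
  tendsto_atTop_add_const_right _ _ tendsto_natCast_atTop_atTop

lemma tendsto_testApprox (hp : 1 ≤ p) (hp' : p ≠ ⊤) (h : MemLp f p volume) :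
    Tendsto (fun n => eLpNorm (fun x => testApprox f n x - f x) p volume) atTop (𝓝 0) :=
  tendsto_eLpNorm_cutoffAt_smul hp hp' h
    (fun n => (memLp_mollifier hp hp' h (by positivity)).1)
    ((tendsto_eLpNorm_mollifier_sub hp hp' h).comp tendsto_natCast_add_one)

lemma exists_norm_cgrad_cutoffAt_le : ∃ K : ℝ, 0 < K ∧ ∀ n x,
    ‖cgrad (fun y => (cutoffAt n y : ℂ)) x‖ ≤ K * (n + 1 : ℝ)⁻¹ := by
  have hc : ContDiff ℝ 1 fun y => (cutoff y : ℂ) :=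
    Complex.ofRealCLM.contDiff.comp (isTest_cutoff.contDiff.of_le (by exact_mod_cast le_top))
  have hs : HasCompactSupport (cgrad fun y => (cutoff y : ℂ)) := by
    have h0 : HasCompactSupport fun y => (cutoff y : ℂ) :=
      isTest_cutoff.hasCompactSupport.comp_left (g := fun r : ℝ => (r : ℂ)) (by simp)
    refine (h0.fderiv (𝕜 := ℝ)).mono' (fun x hx => subset_tsupport _ fun h => hx ?_)
    ext j
    simp only [cgrad_apply, pd, h]; rfl
  obtain ⟨K, hK⟩ := (continuous_cgrad hc).bounded_above_of_compact_support hs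
  refine ⟨max K 1, by positivity, fun n x => ?_⟩
  have e : cgrad (fun y => (cutoffAt n y : ℂ)) x
      = (n + 1 : ℝ)⁻¹ • cgrad (fun y => (cutoff y : ℂ)) ((n + 1 : ℝ)⁻¹ • x) := by
    ext j
    exact pd_comp_smul (fun y => (cutoff y : ℂ)) j _ x
  rw [e, norm_smul, Real.norm_of_nonneg (by positivity), mul_comm]
  exact mul_le_mul_of_nonneg_right ((hK _).trans (le_max_left _ _)) (by positivity)

lemma IsSobolev.tendsto_cgrad_testApprox (hp : 1 ≤ p) (hp' : p ≠ ⊤) (h : IsSobolev p f G) :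
    Tendsto (fun n => eLpNorm (fun x => cgrad (testApprox f n) x - G x) p volume) atTop (𝓝 0) := by
  obtain ⟨K, hK, hKb⟩ := exists_norm_cgrad_cutoffAt_le
  have hpos : ∀ n : ℕ, (0 : ℝ) < n + 1 := fun n => by positivity
  have hmL : ∀ n : ℕ, MemLp (_root_.moll (mollifier (n + 1)) G) p volume := fun n =>
    memLp_mollifier hp hp' h.memLp_grad (hpos n)
  have hvL : ∀ n : ℕ, MemLp (_root_.moll (mollifier (n + 1)) f) p volume := fun n =>
    memLp_mollifier hp hp' h.memLp (hpos n)
  have h1 := tendsto_eLpNorm_cutoffAt_smul hp hp' h.memLp_grad (fun n => (hmL n).1)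
    ((tendsto_eLpNorm_mollifier_sub hp hp' h.memLp_grad).comp tendsto_natCast_add_one)
  have h2 : Tendsto (fun n : ℕ => ENNReal.ofReal (K * (n + 1 : ℝ)⁻¹) * eLpNorm f p volume) atTop
      (𝓝 0) := by
    have h3 : Tendsto (fun n : ℕ => K * (n + 1 : ℝ)⁻¹) atTop (𝓝 (K * 0)) :=
      tendsto_const_nhds.mul (tendsto_inv_atTop_zero.comp tendsto_natCast_add_one)
    have h4 := (ENNReal.continuous_ofReal.tendsto _).comp h3
    rw [mul_zero, ENNReal.ofReal_zero] at h4
    have h5 := ENNReal.Tendsto.mul_const (b := eLpNorm f p volume) h4 (Or.inr h.memLp.2.ne)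
    rwa [zero_mul] at h5
  have hsum := h1.add h2
  rw [add_zero] at hsum
  refine tendsto_of_tendsto_of_tendsto_of_le_of_le tendsto_const_nhds hsum
    (fun _ => zero_le) fun n => ?_
  have e : (fun x => cgrad (testApprox f n) x - G x)
      = fun x => (cutoffAt n x • _root_.moll (mollifier (n + 1)) G x - G x)
        + _root_.moll (mollifier (n + 1)) f x • cgrad (fun y => (cutoffAt n y : ℂ)) x := by
    ext1 x
    have := cgrad_smul (isTest_cutoffAt n).differentiable
      ((h.contDiff_moll (hpos n)).differentiable (by simp)) x
    have e2 : testApprox f n = fun y => cutoffAt n y • _root_.moll (mollifier (n + 1)) f y := rfl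
    rw [e2, this, h.weak.cgrad_moll (isTest_mollifier (hpos n))]
    abel
  have hcc : Continuous (cgrad fun y => (cutoffAt n y : ℂ)) := continuous_cgrad
    (Complex.ofRealCLM.contDiff.comp ((isTest_cutoffAt n).contDiff.of_le
      (by exact_mod_cast le_top)))
  beta_reduce
  rw [e]
  refine (eLpNorm_add_le (((isTest_cutoffAt n).continuous.aestronglyMeasurable.smul
    (hmL n).1).sub h.memLp_grad.1) ((hvL n).1.smul hcc.aestronglyMeasurable) hp).trans
    (add_le_add le_rfl ?_)
  refine (eLpNorm_le_mul_eLpNorm_of_ae_le_mul (g := _root_.moll (mollifier (n + 1)) f)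
    (c := K * (n + 1 : ℝ)⁻¹) (Eventually.of_forall fun x => ?_) p).trans
    (mul_le_mul' le_rfl (eLpNorm_mollifier_le hp hp' h.memLp.1 (hpos n)))
  rw [Pi.smul_apply', norm_smul, mul_comm]
  exact mul_le_mul_of_nonneg_right (hKb n x) (norm_nonneg _)

end Approx

/-- The Sobolev inequality for `H^{1,p}`. -/
lemma exists_sobolev_le {p p' : NNReal} (hp : 1 ≤ p) (h : (p' : ℝ)⁻¹ = (p : ℝ)⁻¹ - 3⁻¹) :
    ∃ C : ℝ, 0 < C ∧ ∀ f G, IsSobolev p f G →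
      eLpNorm f p' volume ≤ ENNReal.ofReal C * eLpNorm G p volume := by
  refine ⟨max 1 (SNormLESNormFDerivOfEqConst ℂ (volume : Measure Space3) p), by positivity,
    fun f G hf => ?_⟩
  set C : ℝ := max 1 (SNormLESNormFDerivOfEqConst ℂ (volume : Measure Space3) p)
  have hp1 : (1 : ℝ≥0∞) ≤ p := by exact_mod_cast hp
  have ht := tendsto_testApprox hp1 ENNReal.coe_ne_top hf.memLp
  have htg := hf.tendsto_cgrad_testApprox hp1 ENNReal.coe_ne_top
  have hcd : ∀ n, ContDiff ℝ 1 (testApprox f n) := fun n =>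
    (contDiff_testApprox hf.weak.locallyIntegrable n).of_le (by exact_mod_cast le_top)
  have hgns : ∀ n, eLpNorm (testApprox f n) p' volume
      ≤ ENNReal.ofReal C * eLpNorm (cgrad (testApprox f n)) p volume := fun n => by
    have h1 := eLpNorm_le_eLpNorm_fderiv_of_eq (volume : Measure Space3) (hcd n)
      (hasCompactSupport_testApprox f n) (p := p) (p' := p') hp (by simp) (by simpa using h)
    refine h1.trans (mul_le_mul' ?_ (eLpNorm_mono fun x => norm_fderiv_le_cgrad _ x))
    rw [← ENNReal.ofReal_coe_nnreal]
    exact ENNReal.ofReal_le_ofReal (le_max_right _ _)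
  have hmeas := tendstoInMeasure_of_tendsto_eLpNorm (μ := volume) (p := p)
    (zero_lt_one.trans_le hp1).ne' (fun n => (hcd n).continuous.aestronglyMeasurable) hf.memLp.1 ht
  obtain ⟨ns, hns, hae⟩ := hmeas.exists_seq_tendsto_ae
  refine ENNReal.le_of_forall_pos_le_add fun ε hε hfin => ?_
  have hC0 : ENNReal.ofReal C ≠ 0 := by
    simp only [ne_eq, ENNReal.ofReal_eq_zero, not_le]; positivity
  have hlim : Tendsto (fun n => ENNReal.ofReal C *
      (eLpNorm (fun x => cgrad (testApprox f (ns n)) x - G x) p volume)) atTop (𝓝 0) := by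
    have := ENNReal.Tendsto.const_mul (a := ENNReal.ofReal C)
      (htg.comp hns.tendsto_atTop) (Or.inr ENNReal.ofReal_ne_top)
    rwa [mul_zero] at this
  refine Lp.eLpNorm_le_of_ae_tendsto (u := atTop) (f := fun n => testApprox f (ns n)) ?_
    (fun n => (hcd _).continuous.aestronglyMeasurable) hae
  filter_upwards [ENNReal.tendsto_nhds_zero.1 hlim ε (by exact_mod_cast hε)] with n hn
  refine (hgns _).trans ?_
  have e : cgrad (testApprox f (ns n)) = fun x => G x + (cgrad (testApprox f (ns n)) x - G x) := by
    ext1 x; abel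
  have hle : eLpNorm (cgrad (testApprox f (ns n))) p volume ≤ eLpNorm G p volume
      + eLpNorm (fun x => cgrad (testApprox f (ns n)) x - G x) p volume := by
    conv_lhs => rw [e]
    exact eLpNorm_add_le hf.memLp_grad.1
      ((continuous_cgrad (hcd _)).aestronglyMeasurable.sub hf.memLp_grad.1) hp1
  calc _ ≤ ENNReal.ofReal C * (eLpNorm G p volume
      + eLpNorm (fun x => cgrad (testApprox f (ns n)) x - G x) p volume) := mul_le_mul' le_rfl hle
    _ ≤ _ := by rw [mul_add]; exact add_le_add le_rfl hn

/-! ### Radial functions in logarithmic coordinates -/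

/-- Three times the volume of the unit ball, the area of the unit sphere. -/
noncomputable def sphereArea : ℝ := 3 * (volume : Measure Space3).real (Metric.ball 0 1)

lemma sphereArea_pos : 0 < sphereArea :=
  mul_pos (by norm_num) (ENNReal.toReal_pos (Metric.measure_ball_pos _ _ one_pos).ne'
    measure_ball_lt_top.ne)

lemma integral_norm_eq (g : ℝ → ℝ) :
    ∫ x : Space3, g ‖x‖ = sphereArea * ∫ s, Real.exp (3 * s) * g (Real.exp s) := by
  have h1 := integral_fun_norm_addHaar (volume : Measure Space3) g
  have h2 := integral_image_eq_integral_abs_deriv_smul (s := univ) (f := Real.exp)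
    (f' := Real.exp) MeasurableSet.univ
    (fun x _ => (Real.hasDerivAt_exp x).hasDerivWithinAt) Real.exp_injective.injOn
    (fun y => y ^ 2 * g y)
  rw [image_univ, Real.range_exp] at h2
  simp only [finrank_euclideanSpace, Fintype.card_fin, Nat.add_one_sub_one, smul_eq_mul,
    nsmul_eq_mul, Nat.cast_ofNat] at h1
  rw [h1, h2, sphereArea, ← mul_assoc]
  simp only [Measure.restrict_univ, smul_eq_mul]
  congr 1
  refine integral_congr_ae (Eventually.of_forall fun s => ?_)
  have : Real.exp (3 * s) = Real.exp s * Real.exp s ^ 2 := by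
    rw [← Real.exp_nat_mul, ← Real.exp_add]; congr 1; push_cast; ring
  simp only [abs_of_pos (Real.exp_pos s)]
  rw [this]; ring

/-- `f` is radial with profile `w` in logarithmic coordinates, `f(x) = |x|^{-1/2} w(log |x|)`. -/
def HasProfile (f : Space3 → ℂ) (w : ℝ → ℂ) : Prop :=
  ∀ x, x ≠ 0 → f x = Real.exp (-(Real.log ‖x‖ / 2)) • w (Real.log ‖x‖)

lemma HasProfile.sub_const_mul {f g : Space3 → ℂ} {w v : ℝ → ℂ} (hf : HasProfile f w)
    (hg : HasProfile g v) (c : ℂ) :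
    HasProfile (fun x => f x - c * g x) fun s => w s - c * v s := fun x hx => by
  beta_reduce
  rw [hf x hx, hg x hx]
  simp only [Complex.real_smul]; ring

lemma ae_ne_zero : ∀ᵐ x : Space3, x ≠ 0 := by
  rw [ae_iff]; simp

lemma HasProfile.integral_norm_pow_six {f : Space3 → ℂ} {w : ℝ → ℂ} (hf : HasProfile f w) :
    ∫ x, ‖f x‖ ^ 6 = sphereArea * ∫ s, ‖w s‖ ^ 6 := by
  have h := integral_norm_eq fun r => ‖Real.exp (-(Real.log r / 2)) • w (Real.log r)‖ ^ 6
  have e : ∫ x, ‖f x‖ ^ 6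
      = ∫ x : Space3, ‖Real.exp (-(Real.log ‖x‖ / 2)) • w (Real.log ‖x‖)‖ ^ 6 :=
    integral_congr_ae (ae_ne_zero.mono fun x hx => by simp only [hf x hx])
  rw [e, h]
  congr 1
  refine integral_congr_ae (Eventually.of_forall fun s => ?_)
  simp only [Real.log_exp, norm_smul, Real.norm_of_nonneg (Real.exp_pos _).le, mul_pow,
    ← Real.exp_nat_mul, ← mul_assoc, ← Real.exp_add]
  have : 3 * s + ((6 : ℕ) : ℝ) * -(s / 2) = 0 := by push_cast; ring
  rw [this, Real.exp_zero, one_mul]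

lemma HasProfile.norm_sq_cgrad {f : Space3 → ℂ} {w w' : ℝ → ℂ} (hf : HasProfile f w)
    (hw : ∀ s, HasDerivAt w (w' s) s) {x : Space3} (hx : x ≠ 0) :
    ‖cgrad f x‖ ^ 2 = Real.exp (-(3 * Real.log ‖x‖)) *
      ‖w' (Real.log ‖x‖) - (1 / 2 : ℝ) • w (Real.log ‖x‖)‖ ^ 2 := by
  set s := Real.log ‖x‖ with hs
  have hn : 0 < ‖x‖ := norm_pos_iff.2 hx
  have hlog : ∀ y : Space3, Real.log ‖y‖ = Real.log (‖y‖ ^ 2) / 2 := fun y => by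
    rw [Real.log_pow]; push_cast; ring
  have h1 : HasFDerivAt (fun y : Space3 => Real.log ‖y‖) ((‖x‖ ^ 2)⁻¹ • innerSL ℝ x) x := by
    have := (((hasStrictFDerivAt_norm_sq x).hasFDerivAt).log (by positivity)).mul_const (2⁻¹ : ℝ)
    simp only [hlog, div_eq_mul_inv]
    refine this.congr_fderiv ?_
    ext v
    simp
    ring
  have hK : HasDerivAt (fun s => Real.exp (-(s / 2)) • w s)
      (Real.exp (-(s / 2)) • (w' s - (1 / 2 : ℝ) • w s)) s := by
    have he : HasDerivAt (fun s : ℝ => Real.exp (-(s / 2))) (Real.exp (-(s / 2)) * -(1 / 2)) s := by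
      have h0 : HasDerivAt (fun s : ℝ => -(s / 2)) (-(1 / 2)) s :=
        ((hasDerivAt_id s).div_const 2).neg
      exact h0.exp
    refine (he.smul (hw s)).congr_deriv ?_
    simp only [Complex.real_smul]; push_cast; ring
  have h2 := hK.hasFDerivAt.comp x h1
  have h3 : HasFDerivAt f _ x := h2.congr_of_eventuallyEq
    ((eventually_ne_nhds hx).mono fun y hy => hf y hy)
  set v := Real.exp (-(s / 2)) • (w' s - (1 / 2 : ℝ) • w s) with hv
  have h4 : ∀ j, pd j f x = ((‖x‖ ^ 2)⁻¹ * x j) • v := fun j => by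
    rw [pd, h3.fderiv]
    simp [EuclideanSpace.inner_single_right]
    ring
  rw [_root_.norm_sq_cgrad]
  simp only [h4, norm_smul, mul_pow, ← Finset.sum_mul]
  have h5 : ∑ j, ‖(‖x‖ ^ 2)⁻¹ * x j‖ ^ 2 = (‖x‖ ^ 2)⁻¹ := by
    simp only [norm_mul, mul_pow, ← Finset.mul_sum]
    rw [← EuclideanSpace.norm_sq_eq x, norm_inv, norm_pow, norm_norm]
    field_simp
  have h6 : (‖x‖ ^ 2)⁻¹ = Real.exp (-(2 * s)) := by
    rw [Real.exp_neg]; congr 1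
    rw [hs, two_mul, Real.exp_add, Real.exp_log hn, sq]
  rw [h5, h6, hv, norm_smul, mul_pow, Real.norm_of_nonneg (Real.exp_pos _).le, ← mul_assoc,
    ← Real.exp_nat_mul, ← Real.exp_add]
  congr 2; push_cast; ring

/-- The energy of a profile is the Dirichlet energy. -/
lemma HasProfile.integral_norm_cgrad_sq {f : Space3 → ℂ} {w w' : ℝ → ℂ} (hf : HasProfile f w)
    (hw : ∀ s, HasDerivAt w (w' s) s) (hw' : Continuous w') {B : ℝ}
    (hB : ∀ s, ‖w s‖ ^ 2 ≤ B * sech s) (hB' : ∀ s, ‖w' s‖ ^ 2 ≤ B * sech s) :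
    ∫ x, ‖cgrad f x‖ ^ 2 = sphereArea * ∫ s, (‖w' s‖ ^ 2 + ‖w s‖ ^ 2 / 4) := by
  have h := integral_norm_eq fun r =>
    Real.exp (-(3 * Real.log r)) * ‖w' (Real.log r) - (1 / 2 : ℝ) • w (Real.log r)‖ ^ 2
  have e : ∫ x, ‖cgrad f x‖ ^ 2 = ∫ x : Space3, Real.exp (-(3 * Real.log ‖x‖)) *
      ‖w' (Real.log ‖x‖) - (1 / 2 : ℝ) • w (Real.log ‖x‖)‖ ^ 2 :=
    integral_congr_ae (ae_ne_zero.mono fun x hx => hf.norm_sq_cgrad hw hx)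
  rw [e, h]
  congr 1
  have hc : Continuous w := continuous_iff_continuousAt.2 fun s => (hw s).continuousAt
  have hd : ∀ s, HasDerivAt (fun s => ‖w s‖ ^ 2) (2 * ⟪w s, w' s⟫_ℝ) s := fun s =>
    (hw s).norm_sq
  have hsq : ∀ g : ℝ → ℂ, Continuous g → (∀ s, ‖g s‖ ^ 2 ≤ B * sech s) →
      Integrable fun s => ‖g s‖ ^ 2 := fun g hg hgB =>
    integrable_mul_sech (hg.norm.pow 2) (B := B) fun s => by
      rw [abs_of_nonneg (by positivity)]; exact hgB s
  have hi : Integrable fun s => 2 * ⟪w s, w' s⟫_ℝ := by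
    refine integrable_mul_sech (by fun_prop) (B := 2 * B) fun s => ?_
    have h1 := abs_real_inner_le_norm (w s) (w' s)
    rw [abs_mul, abs_two]
    nlinarith [hB s, hB' s, sq_nonneg (‖w s‖ - ‖w' s‖)]
  have h0 := integral_deriv_eq_zero_of_le_sech hd hi (B := B) fun s => by
    rw [abs_of_nonneg (by positivity)]; exact hB s
  have hA : Integrable fun s => ‖w' s‖ ^ 2 + ‖w s‖ ^ 2 / 4 :=
    (hsq _ hw' hB').add ((hsq _ hc hB).div_const 4)
  have e2 : ∀ s, Real.exp (3 * s) * (Real.exp (-(3 * Real.log (Real.exp s))) *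
      ‖w' (Real.log (Real.exp s)) - (1 / 2 : ℝ) • w (Real.log (Real.exp s))‖ ^ 2)
      = (‖w' s‖ ^ 2 + ‖w s‖ ^ 2 / 4) - 1 / 2 * (2 * ⟪w s, w' s⟫_ℝ) := fun s => by
    rw [Real.log_exp, ← mul_assoc, ← Real.exp_add, add_neg_cancel, Real.exp_zero, one_mul,
      norm_sub_sq_real, norm_smul, inner_smul_right, real_inner_comm, mul_pow]
    norm_num
    ring
  simp only [e2]
  rw [integral_sub hA (hi.const_mul _), integral_const_mul, h0, mul_zero, sub_zero]

/-- The rescaled ground state `μ^{1/2} W(μ x)`. -/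
noncomputable def bubble (μ : ℝ) (x : Space3) : ℂ := ((√μ : ℝ) : ℂ) * groundState (μ • x)

/-- The normalisation `(√3 / 2)^{1/2}` relating the ground state to the soliton. -/
noncomputable def bubbleConst : ℝ := √(√3 / 2)

lemma bubbleConst_pos : 0 < bubbleConst := Real.sqrt_pos.2 (by positivity)

lemma bubbleConst_pow_four : bubbleConst ^ 4 = 3 / 4 := by
  have h1 : bubbleConst ^ 2 = √3 / 2 := Real.sq_sqrt (by positivity)
  have h2 : √3 ^ 2 = (3 : ℝ) := Real.sq_sqrt (by norm_num)
  calc bubbleConst ^ 4 = (bubbleConst ^ 2) ^ 2 := by ring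
    _ = _ := by rw [h1, div_pow, h2]; norm_num

lemma hasProfile_bubble {μ : ℝ} (hμ : 0 < μ) :
    HasProfile (bubble μ) fun s => ((bubbleConst * soliton (Real.log (√3 / μ)) s : ℝ) : ℂ) := by
  intro x hx
  have hn : 0 < ‖x‖ := norm_pos_iff.2 hx
  set s := Real.log ‖x‖ with hs
  have hns : ‖x‖ = Real.exp s := (Real.exp_log hn).symm
  set τ := Real.log (√3 / μ) with hτ
  have h3 : (0 : ℝ) < √3 := by positivity
  have h32 : √3 ^ 2 = (3 : ℝ) := Real.sq_sqrt (by norm_num)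
  have hτe : Real.exp τ = √3 / μ := Real.exp_log (by positivity)
  rw [bubble, groundState, Complex.real_smul, ← Complex.ofReal_mul, ← Complex.ofReal_mul]
  congr 1
  rw [bubbleConst, soliton, ← Real.sqrt_inv, ← Real.sqrt_mul hμ.le, ← Real.sqrt_mul (by positivity)]
  have hE : Real.exp (-(s / 2)) = √(Real.exp (-s)) := by
    rw [eq_comm, Real.sqrt_eq_iff_mul_self_eq (Real.exp_pos _).le (Real.exp_pos _).le,
      ← Real.exp_add]
    congr 1; ring
  rw [hE, ← Real.sqrt_mul (Real.exp_pos _).le]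
  congr 1
  rw [norm_smul, Real.norm_of_nonneg hμ.le, hns, sech, Real.cosh_eq, neg_sub, Real.exp_sub,
    Real.exp_sub, hτe, Real.exp_neg]
  have he := Real.exp_pos s
  have : 1 + (μ * Real.exp s) ^ 2 / 3 ≠ 0 := by positivity
  have : Real.exp s / (√3 / μ) + √3 / μ / Real.exp s ≠ 0 := by positivity
  field_simp
  rw [h32]
  ring

lemma exists_isometry_apply (x : Space3) : ∃ A : Space3 ≃ₗᵢ[ℝ] Space3,
    A x = ‖x‖ • EuclideanSpace.single 0 1 := by
  refine ⟨(ℝ ∙ (x - ‖x‖ • EuclideanSpace.single 0 1))ᗮ.reflection, Submodule.reflection_sub ?_⟩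
  simp [norm_smul]

/-- A compactly supported `C¹` radial function has a profile, of exponential decay. -/
lemma exists_profile {F : Space3 → ℂ} (hF : ContDiff ℝ 1 F) (hs : HasCompactSupport F)
    (hr : ∀ (A : Space3 ≃ₗᵢ[ℝ] Space3) x, F (A x) = F x) :
    ∃ (w w' : ℝ → ℂ) (B : ℝ), HasProfile F w ∧ (∀ s, HasDerivAt w (w' s) s) ∧ Continuous w' ∧
      (∀ s, ‖w s‖ ^ 2 ≤ B * sech s) ∧ ∀ s, ‖w' s‖ ^ 2 ≤ B * sech s := by
  set e : Space3 := EuclideanSpace.single 0 1 with he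
  have hen : ‖e‖ = 1 := by simp [he]
  set w : ℝ → ℂ := fun s => Real.exp (s / 2) • F (Real.exp s • e) with hwdef
  set w' : ℝ → ℂ := fun s => (1 / 2 : ℝ) • w s
    + Real.exp (s / 2) • fderiv ℝ F (Real.exp s • e) (Real.exp s • e) with hw'def
  have hcw : Continuous w := by
    have := hF.continuous; fun_prop
  have hd : ∀ s, HasDerivAt w (w' s) s := fun s => by
    have h1 : HasDerivAt (fun s => Real.exp s • e) (Real.exp s • e) s :=
      (Real.hasDerivAt_exp s).smul_const e
    have h2 := (hF.differentiable (by simp) (Real.exp s • e)).hasFDerivAt.comp_hasDerivAt s h1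
    have h3 : HasDerivAt (fun s : ℝ => Real.exp (s / 2)) (Real.exp (s / 2) * (1 / 2)) s :=
      ((hasDerivAt_id s).div_const 2).exp
    refine (h3.smul h2).congr_deriv ?_
    simp only [hw'def, hwdef, Complex.real_smul, Function.comp]; push_cast; ring
  have hcw' : Continuous w' := by
    have h1 : Continuous fun s => fderiv ℝ F (Real.exp s • e) (Real.exp s • e) :=
      ((hF.continuous_fderiv (by simp)).comp (by fun_prop)).clm_apply (by fun_prop)
    fun_prop
  obtain ⟨R, hR⟩ := hs.isCompact.isBounded.subset_closedBall (0 : Space3)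
  obtain ⟨M0, hM0⟩ := hF.continuous.bounded_above_of_compact_support hs
  obtain ⟨M1, hM1⟩ := (hF.continuous_fderiv (by simp)).bounded_above_of_compact_support
    (hs.fderiv (𝕜 := ℝ))
  set L := max R 1
  have hL1 : 1 ≤ L := le_max_right _ _
  have hout : ∀ s, L < Real.exp s → F (Real.exp s • e) = 0
      ∧ fderiv ℝ F (Real.exp s • e) = 0 := fun s hsL => by
    have hn : Real.exp s • e ∉ tsupport F := fun h => by
      have := mem_closedBall_zero_iff.1 (hR h)
      rw [norm_smul, hen, mul_one, Real.norm_of_nonneg (Real.exp_pos _).le] at this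
      exact absurd (this.trans (le_max_left R 1)) (not_le.2 hsL)
    exact ⟨image_eq_zero_of_notMem_tsupport hn,
      image_eq_zero_of_notMem_tsupport fun h => hn (tsupport_fderiv_subset ℝ h)⟩
  have hM0' : 0 ≤ M0 := (norm_nonneg _).trans (hM0 0)
  have hM1' : 0 ≤ M1 := (norm_nonneg _).trans (hM1 0)
  have hbd : ∀ K : ℝ, 0 ≤ K → ∀ g : ℝ → ℂ, (∀ s, L < Real.exp s → g s = 0) →
      (∀ s, Real.exp s ≤ L → ‖g s‖ ≤ K * Real.exp (s / 2)) →
      ∀ s, ‖g s‖ ^ 2 ≤ (K ^ 2 * L ^ 2) * sech s := by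
    intro K hK g h1 h2 s
    rcases lt_or_ge L (Real.exp s) with h | h
    · rw [h1 s h, norm_zero]
      simpa using mul_nonneg (by positivity : 0 ≤ K ^ 2 * L ^ 2) (sech_pos s).le
    · have h3 : ‖g s‖ ^ 2 ≤ K ^ 2 * Real.exp s := by
        have h4 : Real.exp (s / 2) ^ 2 = Real.exp s := by
          rw [← Real.exp_nat_mul]; congr 1; push_cast; ring
        calc ‖g s‖ ^ 2 ≤ (K * Real.exp (s / 2)) ^ 2 := by gcongr; exact h2 s h
          _ = _ := by rw [mul_pow, h4]
      refine h3.trans ?_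
      rw [mul_assoc]
      refine mul_le_mul_of_nonneg_left ?_ (by positivity)
      rw [sech, ← div_eq_mul_inv, le_div_iff₀ (Real.cosh_pos s), Real.cosh_eq]
      have h5 : Real.exp s * Real.exp (-s) = 1 := by rw [← Real.exp_add]; simp
      have he0 := Real.exp_pos s
      nlinarith
  have hK : (0 : ℝ) ≤ M0 + M1 * L := by positivity
  refine ⟨w, w', (M0 + M1 * L) ^ 2 * L ^ 2, fun x hx => ?_, hd, hcw', hbd _ hK _ ?_ ?_,
    hbd _ hK _ ?_ ?_⟩
  · have hn : 0 < ‖x‖ := norm_pos_iff.2 hx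
    obtain ⟨A, hA⟩ := exists_isometry_apply x
    rw [hwdef]
    beta_reduce
    rw [smul_smul, ← Real.exp_add, neg_add_cancel, Real.exp_zero, one_smul, Real.exp_log hn,
      ← hr A x, hA]
  · intro s h
    simp [hwdef, (hout s h).1]
  · intro s h
    simp only [hwdef, norm_smul, Real.norm_of_nonneg (Real.exp_pos _).le]
    rw [mul_comm]
    refine mul_le_mul_of_nonneg_right ((hM0 _).trans ?_) (Real.exp_pos _).le
    have : 0 ≤ M1 * L := by positivity
    linarith
  · intro s h
    simp [hw'def, hwdef, (hout s h).1, (hout s h).2]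
  · intro s h
    have h1 : ‖fderiv ℝ F (Real.exp s • e) (Real.exp s • e)‖ ≤ M1 * L := by
      refine (ContinuousLinearMap.le_opNorm _ _).trans ?_
      rw [norm_smul, hen, mul_one, Real.norm_of_nonneg (Real.exp_pos _).le]
      gcongr
      exact hM1 _
    simp only [hw'def, hwdef]
    refine (norm_add_le _ _).trans ?_
    simp only [norm_smul, Real.norm_of_nonneg (Real.exp_pos _).le]
    have h2 := hM0 (Real.exp s • e)
    have h3 := Real.exp_pos (s / 2)
    have h4 : ‖(1 / 2 : ℝ)‖ = 1 / 2 := by norm_num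
    rw [h4]
    nlinarith [mul_le_mul_of_nonneg_left h2 h3.le, mul_le_mul_of_nonneg_left h1 h3.le,
      mul_nonneg h3.le hM0']

/-! ### The ground state -/

/-- The ground state as a real-valued function. -/
noncomputable def realGroundState (x : Space3) : ℝ := (√(1 + ‖x‖ ^ 2 / 3))⁻¹

lemma groundState_eq (x : Space3) : groundState x = (realGroundState x : ℂ) := rfl

lemma realGroundState_pos (x : Space3) : 0 < realGroundState x := by
  rw [realGroundState]; positivity

lemma norm_groundState (x : Space3) : ‖groundState x‖ = realGroundState x := by
  rw [groundState_eq, Complex.norm_real, Real.norm_of_nonneg (realGroundState_pos x).le]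

lemma realGroundState_sq (x : Space3) : realGroundState x ^ 2 * (1 + ‖x‖ ^ 2 / 3) = 1 := by
  rw [realGroundState, inv_pow, Real.sq_sqrt (by positivity)]
  exact inv_mul_cancel₀ (by positivity)

lemma contDiff_realGroundState : ContDiff ℝ ∞ realGroundState := by
  have h : ∀ x : Space3, 1 + ‖x‖ ^ 2 / 3 ≠ 0 := fun x => by positivity
  exact ((contDiff_const.add ((contDiff_norm_sq ℝ).div_const 3)).sqrt h).inv
    fun x => Real.sqrt_ne_zero'.2 (by positivity)

lemma contDiff_groundState : ContDiff ℝ ∞ groundState :=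
  Complex.ofRealCLM.contDiff.comp contDiff_realGroundState

lemma hasFDerivAt_realGroundState (x : Space3) :
    HasFDerivAt realGroundState (-(realGroundState x ^ 3 / 3) • innerSL ℝ x) x := by
  have hp : 0 < 1 + ‖x‖ ^ 2 / 3 := by positivity
  have h1 : HasFDerivAt (fun x : Space3 => 1 + ‖x‖ ^ 2 / 3) ((2 / 3 : ℝ) • innerSL ℝ x) x := by
    have := ((hasStrictFDerivAt_norm_sq x).hasFDerivAt.mul_const (3⁻¹ : ℝ)).const_add 1
    simp only [div_eq_mul_inv]
    refine this.congr_fderiv ?_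
    ext v
    simp
    ring
  have h2 := ((Real.hasDerivAt_sqrt hp.ne').inv (Real.sqrt_ne_zero'.2 hp)).comp_hasFDerivAt x h1
  refine (show HasFDerivAt realGroundState _ x from h2).congr_fderiv ?_
  rw [smul_smul]
  congr 1
  rw [realGroundState]
  have := Real.sqrt_pos.2 hp
  field_simp

lemma pd_ofReal {f : Space3 → ℝ} {x : Space3} (hf : DifferentiableAt ℝ f x) (j : Fin 3) :
    pd j (fun y => (f y : ℂ)) x = pd j f x := by
  have h1 : HasFDerivAt (fun y => (f y : ℂ)) (Complex.ofRealCLM.comp (fderiv ℝ f x)) x :=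
    Complex.ofRealCLM.hasFDerivAt.comp x hf.hasFDerivAt
  rw [pd, h1.fderiv]; rfl

lemma pd_realGroundState (j : Fin 3) (x : Space3) :
    pd j realGroundState x = -(x j * realGroundState x ^ 3 / 3) := by
  rw [pd, (hasFDerivAt_realGroundState x).fderiv]
  simp [EuclideanSpace.inner_single_right]
  ring

lemma pd_groundState (j : Fin 3) (x : Space3) :
    pd j groundState x = ((-(x j * realGroundState x ^ 3 / 3) : ℝ) : ℂ) := by
  rw [← pd_realGroundState]
  exact pd_ofReal (contDiff_realGroundState.differentiable (by simp) x) j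

lemma realGroundState_le (x : Space3) : realGroundState x ≤ 2 * (1 + ‖x‖)⁻¹ := by
  rw [realGroundState, ← div_eq_mul_inv, inv_eq_one_div, div_le_div_iff₀ (by positivity)
    (by positivity), one_mul]
  refine (abs_le_of_sq_le_sq' ?_ (by positivity)).2
  rw [mul_pow, Real.sq_sqrt (by positivity)]
  nlinarith [sq_nonneg (‖x‖ - 3)]

lemma norm_cgrad_groundState (x : Space3) :
    ‖cgrad groundState x‖ = ‖x‖ * realGroundState x ^ 3 / 3 := by
  have hW := realGroundState_pos x
  have : ‖cgrad groundState x‖ ^ 2 = (‖x‖ * realGroundState x ^ 3 / 3) ^ 2 := by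
    rw [norm_sq_cgrad]
    simp only [pd_groundState, Complex.norm_real, norm_neg, norm_div, norm_mul, div_pow, mul_pow]
    rw [← Finset.sum_div, ← Finset.sum_mul, ← EuclideanSpace.norm_sq_eq x,
      Real.norm_of_nonneg (by positivity : 0 ≤ realGroundState x ^ 3)]
    norm_num
  exact (pow_left_inj₀ (norm_nonneg _) (by positivity) two_ne_zero).1 this

lemma norm_cgrad_groundState_le (x : Space3) : ‖cgrad groundState x‖ ≤ 3 * ((1 + ‖x‖)⁻¹) ^ 2 := by
  rw [norm_cgrad_groundState]
  have h1 := realGroundState_le x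
  have h2 := realGroundState_pos x
  have h3 : ‖x‖ * (1 + ‖x‖)⁻¹ ≤ 1 := by
    rw [← div_eq_mul_inv, div_le_one (by positivity)]; linarith
  calc ‖x‖ * realGroundState x ^ 3 / 3 ≤ ‖x‖ * (2 * (1 + ‖x‖)⁻¹) ^ 3 / 3 := by gcongr
    _ = 8 / 3 * (‖x‖ * (1 + ‖x‖)⁻¹) * (1 + ‖x‖)⁻¹ ^ 2 := by ring
    _ ≤ 8 / 3 * 1 * (1 + ‖x‖)⁻¹ ^ 2 := by gcongr
    _ ≤ _ := by gcongr; norm_num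

lemma integrable_inv_one_add_norm_pow {n : ℕ} (hn : 4 ≤ n) :
    Integrable fun x : Space3 => ((1 + ‖x‖)⁻¹) ^ n := by
  have h := integrable_one_add_norm (μ := (volume : Measure Space3)) (r := n) (by
    simp only [finrank_euclideanSpace, Fintype.card_fin]; exact_mod_cast (by omega : 3 < n))
  refine h.congr (Eventually.of_forall fun x => ?_)
  simp only
  rw [Real.rpow_neg (by positivity), Real.rpow_natCast, inv_pow]

lemma memLp_of_norm_pow_integrable {F : Type*} [NormedAddCommGroup F] {f : Space3 → F}
    (hf : AEStronglyMeasurable f volume) {n : ℕ} (hn : n ≠ 0)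
    (h : Integrable fun x => ‖f x‖ ^ n) : MemLp f n volume := by
  rw [← integrable_norm_rpow_iff hf (by exact_mod_cast hn) (by simp)]
  simpa using h

lemma memLp_groundState : MemLp groundState 6 volume := by
  refine memLp_of_norm_pow_integrable (n := 6)
    contDiff_groundState.continuous.aestronglyMeasurable (by norm_num) ?_
  refine ((integrable_inv_one_add_norm_pow (n := 6) (by norm_num)).const_mul (2 ^ 6)).mono'
    (contDiff_groundState.continuous.norm.pow 6).aestronglyMeasurable
    (Eventually.of_forall fun x => ?_)
  rw [Real.norm_of_nonneg (by positivity), norm_groundState, ← mul_pow]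
  exact pow_le_pow_left₀ (realGroundState_pos x).le (realGroundState_le x) 6

lemma contDiff_bubble (μ : ℝ) : ContDiff ℝ ∞ (bubble μ) :=
  contDiff_const.mul (contDiff_groundState.comp (contDiff_const_smul μ))

lemma bubble_one : bubble 1 = groundState := by
  ext x; simp [bubble]

lemma contDiff_one_of_infty {F : Type*} [NormedAddCommGroup F] [NormedSpace ℝ F] {f : Space3 → F}
    (hf : ContDiff ℝ ∞ f) : ContDiff ℝ 1 f := hf.of_le (by exact_mod_cast le_top)

lemma cgrad_const_mul {f : Space3 → ℂ} (hf : Differentiable ℝ f) (c : ℂ) (x : Space3) :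
    cgrad (fun y => c * f y) x = c • cgrad f x := by
  ext j
  simp only [cgrad_apply, PiLp.smul_apply, pd, smul_eq_mul]
  rw [fderiv_const_mul (hf x)]; rfl

lemma cgrad_sub {f g : Space3 → ℂ} (hf : Differentiable ℝ f) (hg : Differentiable ℝ g)
    (x : Space3) : cgrad (fun y => f y - g y) x = cgrad f x - cgrad g x := by
  ext j
  simp only [cgrad_apply, PiLp.sub_apply, pd]
  rw [fderiv_fun_sub (hf x) (hg x)]; rfl

lemma cgrad_comp_smul (f : Space3 → ℂ) (a : ℝ) (x : Space3) :
    cgrad (fun y => f (a • y)) x = a • cgrad f (a • x) := by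
  ext j
  simp only [cgrad_apply, PiLp.smul_apply, pd_comp_smul]

lemma cgrad_bubble (μ : ℝ) (x : Space3) :
    cgrad (bubble μ) x = ((√μ : ℝ) : ℂ) • μ • cgrad groundState (μ • x) := by
  have := cgrad_const_mul (f := fun y => groundState (μ • y))
    ((contDiff_groundState.comp (contDiff_const_smul μ)).differentiable (by simp))
    ((√μ : ℝ) : ℂ) x
  rw [← cgrad_comp_smul]; exact this

lemma integrable_comp_smul_space3 {F : Type*} [NormedAddCommGroup F] {f : Space3 → F}
    (hf : Integrable f) {a : ℝ} (ha : a ≠ 0) : Integrable fun x => f (a • x) :=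
  (integrable_comp_smul_iff volume f ha).2 hf

lemma memLp_bubble {μ : ℝ} (hμ : μ ≠ 0) : MemLp (bubble μ) 6 volume := by
  have hc := (contDiff_bubble μ).continuous
  refine memLp_of_norm_pow_integrable (n := 6) hc.aestronglyMeasurable (by norm_num) ?_
  have h := integrable_comp_smul_space3 (memLp_groundState.integrable_norm_pow (by norm_num)) hμ
  simp only [bubble, norm_mul, mul_pow]
  exact h.const_mul _

lemma memLp_cgrad_groundState : MemLp (cgrad groundState) 2 volume := by
  have hc := continuous_cgrad (contDiff_one_of_infty contDiff_groundState)
  refine memLp_of_norm_pow_integrable (n := 2) hc.aestronglyMeasurable (by norm_num) ?_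
  refine ((integrable_inv_one_add_norm_pow (n := 4) (by norm_num)).const_mul 9).mono'
    (hc.norm.pow 2).aestronglyMeasurable (Eventually.of_forall fun x => ?_)
  rw [Real.norm_of_nonneg (by positivity)]
  calc ‖cgrad groundState x‖ ^ 2 ≤ (3 * ((1 + ‖x‖)⁻¹) ^ 2) ^ 2 :=
        pow_le_pow_left₀ (norm_nonneg _) (norm_cgrad_groundState_le x) 2
    _ = _ := by ring

lemma memLp_cgrad_bubble {μ : ℝ} (hμ : μ ≠ 0) : MemLp (cgrad (bubble μ)) 2 volume := by
  have hc := continuous_cgrad (contDiff_one_of_infty (contDiff_bubble μ))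
  refine memLp_of_norm_pow_integrable (n := 2) hc.aestronglyMeasurable (by norm_num) ?_
  have h := integrable_comp_smul_space3
    (memLp_cgrad_groundState.integrable_norm_pow (by norm_num)) hμ
  simp only [cgrad_bubble, norm_smul, mul_pow]
  exact (h.const_mul _).const_mul _

lemma hasWeakGradient_bubble (μ : ℝ) : HasWeakGradient (bubble μ) (cgrad (bubble μ)) :=
  hasWeakGradient_cgrad (contDiff_one_of_infty (contDiff_bubble μ))

/-- The common value of `‖∇W‖²` and `‖W‖⁶`. -/
noncomputable def bubbleMass : ℝ := sphereArea * bubbleConst ^ 6 * ∫ y, sech y ^ 3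

lemma bubbleMass_pos : 0 < bubbleMass :=
  mul_pos (mul_pos sphereArea_pos (pow_pos bubbleConst_pos 6)) integral_sech_cube_pos

lemma integral_norm_bubble_pow_six {μ : ℝ} (hμ : 0 < μ) :
    ∫ x, ‖bubble μ x‖ ^ 6 = bubbleMass := by
  rw [(hasProfile_bubble hμ).integral_norm_pow_six, bubbleMass, mul_assoc]
  congr 1
  rw [← integral_sub_right_eq_self (fun y => sech y ^ 3) (Real.log (√3 / μ)), ← integral_const_mul]
  refine integral_congr_ae (Eventually.of_forall fun s => ?_)
  simp only [Complex.norm_real, norm_mul, mul_pow, Real.norm_of_nonneg bubbleConst_pos.le,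
    Real.norm_of_nonneg (soliton_pos _ _).le]
  rw [← soliton_sq]; ring

lemma norm_sq_soliton_le (τ s : ℝ) (m : ℝ) :
    ‖((m * soliton τ s : ℝ) : ℂ)‖ ^ 2 ≤ (m ^ 2 * (2 * Real.cosh τ)) * sech s := by
  rw [Complex.norm_real, Real.norm_eq_abs, sq_abs, mul_pow, soliton_sq, mul_assoc]
  exact mul_le_mul_of_nonneg_left (sech_sub_le τ s) (sq_nonneg m)

lemma norm_sq_soliton_deriv_le (τ s : ℝ) (m : ℝ) :
    ‖((m * (-(1 / 2) * Real.tanh (s - τ) * soliton τ s) : ℝ) : ℂ)‖ ^ 2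
      ≤ (m ^ 2 * (2 * Real.cosh τ)) * sech s := by
  refine le_trans ?_ (norm_sq_soliton_le τ s m)
  rw [Complex.norm_real, Complex.norm_real, Real.norm_eq_abs, Real.norm_eq_abs, sq_abs, sq_abs]
  have h := tanh_sq_le_one (s - τ)
  calc (m * (-(1 / 2) * Real.tanh (s - τ) * soliton τ s)) ^ 2
      = (m * soliton τ s) ^ 2 * (Real.tanh (s - τ) ^ 2 / 4) := by ring
    _ ≤ (m * soliton τ s) ^ 2 * 1 := by gcongr; linarith
    _ = _ := mul_one _

lemma continuous_soliton_deriv (τ m : ℝ) :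
    Continuous fun s => ((m * (-(1 / 2) * Real.tanh (s - τ) * soliton τ s) : ℝ) : ℂ) := by
  have h1 := continuous_soliton τ
  have h2 : Continuous fun s => Real.tanh (s - τ) :=
    continuous_tanh.comp (continuous_id.sub continuous_const)
  exact Complex.continuous_ofReal.comp (continuous_const.mul ((continuous_const.mul h2).mul h1))

lemma integral_norm_cgrad_bubble_sq {μ : ℝ} (hμ : 0 < μ) :
    ∫ x, ‖cgrad (bubble μ) x‖ ^ 2 = bubbleMass := by
  set τ := Real.log (√3 / μ)
  have h := (hasProfile_bubble hμ).integral_norm_cgrad_sq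
    (fun s => ((hasDerivAt_soliton τ s).const_mul bubbleConst).ofReal_comp)
    (continuous_soliton_deriv τ bubbleConst) (norm_sq_soliton_le τ · bubbleConst)
    (norm_sq_soliton_deriv_le τ · bubbleConst)
  rw [h, bubbleMass, mul_assoc]
  congr 1
  have e : ∀ s, ‖((bubbleConst * (-(1 / 2) * Real.tanh (s - τ) * soliton τ s) : ℝ) : ℂ)‖ ^ 2
      + ‖((bubbleConst * soliton τ s : ℝ) : ℂ)‖ ^ 2 / 4
      = bubbleConst ^ 2 / 4 * (2 * sech (s - τ) - sech (s - τ) ^ 3) := fun s => by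
    rw [Complex.norm_real, Complex.norm_real, Real.norm_eq_abs, Real.norm_eq_abs, sq_abs, sq_abs]
    have h1 := soliton_sq τ s
    have h2 := sech_sq (s - τ)
    calc _ = bubbleConst ^ 2 / 4 * (Real.tanh (s - τ) ^ 2 + 1) * soliton τ s ^ 2 := by ring
      _ = _ := by
        rw [h1]
        have : Real.tanh (s - τ) ^ 2 = 1 - sech (s - τ) ^ 2 := by linarith
        rw [this]; ring
  refine (integral_congr_ae (Eventually.of_forall e)).trans ?_
  rw [integral_const_mul, integral_sub_right_eq_self (fun y => 2 * sech y - sech y ^ 3) τ,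
    integral_sub (integrable_sech.const_mul 2) (integrable_sech_pow 3 (by norm_num)),
    integral_const_mul]
  have h3 := integral_sech_pow_three
  have h4 := bubbleConst_pow_four
  have : bubbleConst ^ 6 = bubbleConst ^ 2 * (3 / 4) := by rw [← h4]; ring
  rw [this]
  have h5 : ∫ y, sech y = 2 * ∫ y, sech y ^ 3 := by rw [h3]; ring
  rw [h5]; ring

/-! ### Stability of the Sobolev inequality for radial functions -/

lemma lpNorm_pow_eq {F : Type*} [NormedAddCommGroup F] {f : Space3 → F} {n : ℕ} (hn : n ≠ 0)
    (hf : AEStronglyMeasurable f volume) : lpNorm f n volume ^ n = ∫ x, ‖f x‖ ^ n := by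
  have h := lpNorm_nnreal_eq_integral_norm_rpow (p := (n : NNReal)) (by exact_mod_cast hn) hf
  have hc : (((n : NNReal) : ℝ≥0∞)) = (n : ℝ≥0∞) := by simp
  rw [hc] at h
  rw [h]
  simp only [NNReal.coe_natCast, Real.rpow_natCast]
  rw [← Real.rpow_natCast, ← Real.rpow_mul (integral_nonneg fun x => by positivity),
    inv_mul_cancel₀ (by exact_mod_cast hn), Real.rpow_one]

lemma lpNorm_two_sq {F : Type*} [NormedAddCommGroup F] {f : Space3 → F}
    (hf : AEStronglyMeasurable f volume) : lpNorm f 2 volume ^ 2 = ∫ x, ‖f x‖ ^ 2 := by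
  exact_mod_cast lpNorm_pow_eq (n := 2) (by norm_num) hf

lemma lpNorm_four_pow {F : Type*} [NormedAddCommGroup F] {f : Space3 → F}
    (hf : AEStronglyMeasurable f volume) : lpNorm f 4 volume ^ 4 = ∫ x, ‖f x‖ ^ 4 := by
  exact_mod_cast lpNorm_pow_eq (n := 4) (by norm_num) hf

lemma lpNorm_six_pow {F : Type*} [NormedAddCommGroup F] {f : Space3 → F}
    (hf : AEStronglyMeasurable f volume) : lpNorm f 6 volume ^ 6 = ∫ x, ‖f x‖ ^ 6 := by
  exact_mod_cast lpNorm_pow_eq (n := 6) (by norm_num) hf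

lemma bubbleMass_rpow : bubbleMass ^ (2 / 3 : ℝ) = sphereArea ^ (2 / 3 : ℝ) * sharpConst := by
  have hκ := sphereArea_pos
  have hm := bubbleConst_pos
  have hJ := integral_sech_cube_pos
  rw [bubbleMass, sharpConst, Real.mul_rpow (by positivity) hJ.le,
    Real.mul_rpow hκ.le (by positivity), ← bubbleConst_pow_four]
  have : (bubbleConst ^ 6) ^ (2 / 3 : ℝ) = bubbleConst ^ 4 := by
    rw [← Real.rpow_natCast, ← Real.rpow_mul hm.le, ← Real.rpow_natCast]; norm_num
  rw [this]; ring

lemma exists_bubble_near_test : ∃ C : ℝ, 0 < C ∧ ∀ F : Space3 → ℂ, ContDiff ℝ 1 F →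
    HasCompactSupport F → (∀ (A : Space3 ≃ₗᵢ[ℝ] Space3) x, F (A x) = F x) → ∀ ε > 0,
    ∃ (μ : ℝ) (c : ℂ) (X : ℝ), 0 < μ ∧ 0 ≤ X ∧
      X ≤ C * ((∫ x, ‖cgrad F x‖ ^ 2)
        - bubbleMass ^ (2 / 3 : ℝ) * (∫ x, ‖F x‖ ^ 6) ^ (1 / 3 : ℝ)) + ε ∧
      ∫ x, ‖cgrad F x - c • cgrad (bubble μ) x‖ ^ 2 ≤ X ∧
      ∫ x, ‖F x - c * bubble μ x‖ ^ 6 ≤ X ^ 3 := by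
  obtain ⟨C, hC, h1⟩ := exists_soliton_near
  have hκ := sphereArea_pos
  have hm := bubbleConst_pos
  set κ := sphereArea
  refine ⟨(κ + 1) * C / κ, by positivity, fun F hF hs hr ε hε => ?_⟩
  obtain ⟨w, w', B, hp, hd, hc', hB, hB'⟩ := exists_profile hF hs hr
  obtain ⟨τ, c, X, hX0, hX, hX2, hX6⟩ := h1 w w' B hd hc' hB hB' (ε / (κ + 1)) (by positivity)
  set μ := √3 * Real.exp (-τ) with hμdef
  have hμ : 0 < μ := by positivity
  have hτ : Real.log (√3 / μ) = τ := by
    rw [hμdef, ← div_div, div_self (by positivity), Real.exp_neg, one_div, inv_inv, Real.log_exp]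
  have hpb := hasProfile_bubble hμ
  rw [hτ] at hpb
  set c' : ℂ := c / bubbleConst with hc'def
  have hmC : (bubbleConst : ℂ) ≠ 0 := by exact_mod_cast hm.ne'
  have hpd := hp.sub_const_mul hpb c'
  have e1 : ∀ s, w s - c' * ((bubbleConst * soliton τ s : ℝ) : ℂ) = w s - soliton τ s • c :=
    fun s => by
      rw [Complex.real_smul, hc'def]; push_cast; field_simp
  have e2 : ∀ s, w' s - c' * ((bubbleConst * (-(1 / 2) * Real.tanh (s - τ) * soliton τ s) : ℝ) : ℂ)
      = w' s - (-(1 / 2) * Real.tanh (s - τ) * soliton τ s) • c := fun s => by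
    rw [Complex.real_smul, hc'def]; push_cast; field_simp
  have hdd : ∀ s, HasDerivAt (fun s => w s - c' * ((bubbleConst * soliton τ s : ℝ) : ℂ))
      (w' s - c' * ((bubbleConst * (-(1 / 2) * Real.tanh (s - τ) * soliton τ s) : ℝ) : ℂ)) s :=
    fun s => (hd s).sub
      ((((hasDerivAt_soliton τ s).const_mul bubbleConst).ofReal_comp).const_mul c')
  have hsub : ∀ a b : ℂ, ‖a - c' * b‖ ^ 2 ≤ 2 * ‖a‖ ^ 2 + 2 * ‖c'‖ ^ 2 * ‖b‖ ^ 2 := fun a b => by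
    have := norm_sub_le a (c' * b)
    rw [norm_mul] at this
    nlinarith [norm_nonneg (a - c' * b), sq_nonneg (‖a‖ - ‖c'‖ * ‖b‖)]
  set B' := 2 * B + 2 * ‖c'‖ ^ 2 * (bubbleConst ^ 2 * (2 * Real.cosh τ)) with hB'def
  have hb1 : ∀ s, ‖w s - c' * ((bubbleConst * soliton τ s : ℝ) : ℂ)‖ ^ 2 ≤ B' * sech s :=
      fun s => by
    refine (hsub _ _).trans ?_
    rw [hB'def]
    have h2 := mul_le_mul_of_nonneg_left (norm_sq_soliton_le τ s bubbleConst)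
      (by positivity : 0 ≤ 2 * ‖c'‖ ^ 2)
    linarith [hB s]
  have hb2 : ∀ s, ‖w' s - c' *
      ((bubbleConst * (-(1 / 2) * Real.tanh (s - τ) * soliton τ s) : ℝ) : ℂ)‖ ^ 2
      ≤ B' * sech s := fun s => by
    refine (hsub _ _).trans ?_
    rw [hB'def]
    have h2 := mul_le_mul_of_nonneg_left (norm_sq_soliton_deriv_le τ s bubbleConst)
      (by positivity : 0 ≤ 2 * ‖c'‖ ^ 2)
    linarith [hB' s]
  have hE := hpd.integral_norm_cgrad_sq hdd
    (hc'.sub (continuous_const.mul (continuous_soliton_deriv τ bubbleConst))) hb1 hb2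
  have hN := hpd.integral_norm_pow_six
  have hEF := hp.integral_norm_cgrad_sq hd hc' hB hB'
  have hNF := hp.integral_norm_pow_six
  simp only [e1, e2] at hE hN
  have hbd : Differentiable ℝ (bubble μ) := (contDiff_bubble μ).differentiable (by simp)
  have hgr : ∀ x, cgrad (fun x => F x - c' * bubble μ x) x
      = cgrad F x - c' • cgrad (bubble μ) x := fun x => by
    rw [cgrad_sub (hF.differentiable (by simp)) (hbd.const_mul c'), cgrad_const_mul hbd]
  simp only [hgr] at hE
  refine ⟨μ, c', (κ + 1) * X, hμ, by positivity, ?_, ?_, ?_⟩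
  · rw [hEF, hNF, bubbleMass_rpow, Real.mul_rpow hκ.le (integral_nonneg fun s => by positivity)]
    have h3 : κ ^ (2 / 3 : ℝ) * κ ^ (1 / 3 : ℝ) = κ := by
      rw [← Real.rpow_add hκ]; norm_num
    set D := (∫ s, (‖w' s‖ ^ 2 + ‖w s‖ ^ 2 / 4)) with hDdef
    set N := (∫ s, ‖w s‖ ^ 6) ^ (1 / 3 : ℝ)
    have h4 : κ * D - κ ^ (2 / 3 : ℝ) * sharpConst * (κ ^ (1 / 3 : ℝ) * N)
        = κ * (D - sharpConst * N) := by
      calc _ = κ * D - (κ ^ (2 / 3 : ℝ) * κ ^ (1 / 3 : ℝ)) * sharpConst * N := by ring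
        _ = _ := by rw [h3]; ring
    rw [h4]
    calc (κ + 1) * X ≤ (κ + 1) * (C * (D - sharpConst * N) + ε / (κ + 1)) := by gcongr
      _ = _ := by field_simp
  · rw [hE]
    calc _ ≤ κ * X := by gcongr
      _ ≤ _ := by gcongr; linarith
  · rw [hN]
    have hk1 : κ ≤ (κ + 1) ^ 3 := by nlinarith [sq_nonneg κ, mul_pos hκ (mul_pos hκ hκ)]
    calc _ ≤ κ * X ^ 3 := by gcongr
      _ ≤ (κ + 1) ^ 3 * X ^ 3 := by gcongr
      _ = _ := by ring

lemma IsRadial.testApprox {f : Space3 → ℂ} (hr : IsRadial f) (n : ℕ)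
    (A : Space3 ≃ₗᵢ[ℝ] Space3) (x : Space3) : testApprox f n (A x) = testApprox f n x := by
  have h1 : cutoffAt n (A x) = cutoffAt n x := by
    simp [cutoffAt, cutoff, norm_smul]
  have h2 : moll (mollifier (n + 1)) f (A x) = moll (mollifier (n + 1)) f x := by
    have h3 := A.measurePreserving.integral_comp A.toHomeomorph.measurableEmbedding
      (fun y => mollifier (n + 1) (A x - y) • f y)
    rw [moll, moll, ← h3]
    refine integral_congr_ae ((hr A).mono fun y hy => ?_)
    simp only at hy ⊢
    rw [hy, ← map_sub, mollifier_comp_isometry]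
  rw [_root_.testApprox, _root_.testApprox, h1, h2]

lemma exists_lpNorm_six_le : ∃ C : ℝ, 0 < C ∧ ∀ f G, IsSobolev 2 f G →
    MemLp f 6 volume ∧ lpNorm f 6 volume ≤ C * lpNorm G 2 volume := by
  obtain ⟨C, hC, h⟩ := exists_sobolev_le (p := 2) (p' := 6) (by norm_num) (by norm_num)
  refine ⟨C, hC, fun f G hf => ?_⟩
  have h1 : eLpNorm f 6 volume ≤ ENNReal.ofReal C * eLpNorm G 2 volume := by
    exact_mod_cast h f G (by exact_mod_cast hf)
  have h2 : MemLp f 6 volume :=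
    ⟨hf.memLp.1, h1.trans_lt (ENNReal.mul_lt_top ENNReal.ofReal_lt_top hf.memLp_grad.2)⟩
  refine ⟨h2, ?_⟩
  rw [← ofReal_lpNorm h2, ← ofReal_lpNorm hf.memLp_grad, ← ENNReal.ofReal_mul hC.le] at h1
  exact (ENNReal.ofReal_le_ofReal_iff (mul_nonneg hC.le lpNorm_nonneg)).1 h1

lemma tendsto_lpNorm_of_eLpNorm {F ι : Type*} [NormedAddCommGroup F] {l : Filter ι} {p : ℝ≥0∞}
    {g : ι → Space3 → F} (hg : ∀ i, MemLp (g i) p volume)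
    (h : Tendsto (fun i => eLpNorm (g i) p volume) l (𝓝 0)) :
    Tendsto (fun i => lpNorm (g i) p volume) l (𝓝 0) := by
  have := (ENNReal.tendsto_toReal ENNReal.zero_ne_top).comp h
  rw [ENNReal.toReal_zero] at this
  exact this.congr fun i => toReal_eLpNorm (hg i).1

lemma abs_lpNorm_sub_le {F : Type*} [NormedAddCommGroup F] {p : ℝ≥0∞} {f g : Space3 → F}
    (hp : 1 ≤ p) (hf : MemLp f p volume) (hg : MemLp g p volume) :
    |lpNorm f p volume - lpNorm g p volume| ≤ lpNorm (fun x => f x - g x) p volume := by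
  have h1 := lpNorm_le_lpNorm_add_lpNorm_sub' (f := f) hg hp
  have h2 := lpNorm_le_lpNorm_add_lpNorm_sub' (f := g) hf hp
  rw [lpNorm_sub_comm] at h2
  have e : lpNorm (f - g) p volume = lpNorm (fun x => f x - g x) p volume := rfl
  rw [abs_le]
  constructor <;> linarith

lemma tendsto_lpNorm {F ι : Type*} [NormedAddCommGroup F] {l : Filter ι} {p : ℝ≥0∞} (hp : 1 ≤ p)
    {g : ι → Space3 → F} {f : Space3 → F} (hg : ∀ i, MemLp (g i) p volume) (hf : MemLp f p volume)
    (h : Tendsto (fun i => lpNorm (fun x => g i x - f x) p volume) l (𝓝 0)) :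
    Tendsto (fun i => lpNorm (g i) p volume) l (𝓝 (lpNorm f p volume)) := by
  rw [tendsto_iff_dist_tendsto_zero]
  exact squeeze_zero (fun _ => dist_nonneg) (fun i => abs_lpNorm_sub_le hp (hg i) hf) h

/-- Quantitative stability of the sharp Sobolev inequality on radial functions: the distance to
the set of multiples of bubbles is controlled by the square root of the Sobolev deficit. -/
theorem exists_bubble_near : ∃ C : ℝ, 0 < C ∧ ∀ f G, IsSobolev 2 f G → IsRadial f → ∀ ε > 0,
    ∃ (μ : ℝ) (c : ℂ) (Y : ℝ), 0 < μ ∧ 0 ≤ Y ∧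
      Y ^ 2 ≤ C * (lpNorm G 2 volume ^ 2
        - bubbleMass ^ (2 / 3 : ℝ) * lpNorm f 6 volume ^ 2) + ε ∧
      lpNorm (fun x => G x - c • cgrad (bubble μ) x) 2 volume ≤ Y ∧
      lpNorm (fun x => f x - c * bubble μ x) 6 volume ≤ Y := by
  obtain ⟨C, hC, h1⟩ := exists_bubble_near_test
  obtain ⟨K, hK, hsob⟩ := exists_lpNorm_six_le
  refine ⟨2 * C, by positivity, fun f G hf hr ε hε => ?_⟩
  have hone : (1 : ℝ≥0∞) ≤ 2 := one_le_two
  have hcd : ∀ n, ContDiff ℝ 1 (testApprox f n) := fun n =>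
    contDiff_one_of_infty (contDiff_testApprox hf.weak.locallyIntegrable n)
  have hcs := hasCompactSupport_testApprox f
  have hcgs : ∀ n, HasCompactSupport (cgrad (testApprox f n)) := fun n => by
    refine ((hcs n).fderiv (𝕜 := ℝ)).mono' (fun x hx => subset_tsupport _ fun h => hx ?_)
    ext j
    simp only [cgrad_apply, pd, h]; rfl
  have hS : ∀ n, IsSobolev 2 (testApprox f n) (cgrad (testApprox f n)) := fun n =>
    ⟨hasWeakGradient_cgrad (hcd n), (hcd n).continuous.memLp_of_hasCompactSupport (hcs n),
      (continuous_cgrad (hcd n)).memLp_of_hasCompactSupport (hcgs n)⟩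
  have hD : ∀ n, IsSobolev 2 (fun x => testApprox f n x - f x)
      (fun x => cgrad (testApprox f n) x - G x) := fun n => (hS n).sub hf
  have t1 := tendsto_lpNorm_of_eLpNorm (fun n => (hD n).memLp_grad)
    (hf.tendsto_cgrad_testApprox hone ENNReal.ofNat_ne_top)
  have t2 : Tendsto (fun n => lpNorm (fun x => testApprox f n x - f x) 6 volume) atTop (𝓝 0) := by
    refine squeeze_zero (fun _ => lpNorm_nonneg) (fun n => (hsob _ _ (hD n)).2) ?_
    simpa using t1.const_mul K
  have h6 : ∀ n, MemLp (testApprox f n) 6 volume := fun n => (hsob _ _ (hS n)).1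
  have hf6 := (hsob _ _ hf).1
  have t3 := tendsto_lpNorm hone (fun n => (hS n).memLp_grad) hf.memLp_grad t1
  have t4 := tendsto_lpNorm (by norm_num : (1 : ℝ≥0∞) ≤ 6) h6 hf6 t2
  have t5 := ((t3.pow 2).sub ((t4.pow 2).const_mul (bubbleMass ^ (2 / 3 : ℝ)))).const_mul C
  set η := √(ε / 4)
  have hη : 0 < η := Real.sqrt_pos.2 (by positivity)
  have hη2 : η ^ 2 = ε / 4 := Real.sq_sqrt (by positivity)
  obtain ⟨n, hn1, hn2, hn3⟩ := ((t1.eventually_le_const hη).and ((t2.eventually_le_const hη).and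
    (t5.eventually_le_const (lt_add_of_pos_right _ (by positivity : 0 < ε / 8))))).exists
  obtain ⟨μ, c, X, hμ, hX0, hX, hX2, hX6⟩ := h1 _ (hcd n) (hcs n) (hr.testApprox n) (ε / 8)
    (by positivity)
  have hN : (∫ x, ‖testApprox f n x‖ ^ 6) ^ (1 / 3 : ℝ) = lpNorm (testApprox f n) 6 volume ^ 2 := by
    rw [← lpNorm_six_pow (hcd n).continuous.aestronglyMeasurable, ← Real.rpow_natCast,
      ← Real.rpow_mul lpNorm_nonneg, ← Real.rpow_natCast]
    norm_num
  rw [hN, ← lpNorm_two_sq (hS n).memLp_grad.1] at hX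
  have hb := (contDiff_bubble μ).continuous
  have hm2 : MemLp (fun x => cgrad (testApprox f n) x - c • cgrad (bubble μ) x) 2 volume :=
    (hS n).memLp_grad.sub ((memLp_cgrad_bubble hμ.ne').const_smul c)
  have hm6 : MemLp (fun x => testApprox f n x - c * bubble μ x) 6 volume :=
    (h6 n).sub ((memLp_bubble hμ.ne').const_smul c)
  have hX2' :
      lpNorm (fun x => cgrad (testApprox f n) x - c • cgrad (bubble μ) x) 2 volume ≤ √X := by
    refine Real.le_sqrt_of_sq_le ?_
    rw [lpNorm_two_sq hm2.1]; exact hX2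
  have hX6' : lpNorm (fun x => testApprox f n x - c * bubble μ x) 6 volume ≤ √X := by
    refine le_of_pow_le_pow_left₀ (n := 6) (by norm_num) (Real.sqrt_nonneg _) ?_
    rw [lpNorm_six_pow hm6.1]
    refine hX6.trans (le_of_eq ?_)
    calc X ^ 3 = (√X ^ 2) ^ 3 := by rw [Real.sq_sqrt hX0]
      _ = _ := by ring
  refine ⟨μ, c, √X + η, hμ, by positivity, ?_, ?_, ?_⟩
  · have := Real.sq_sqrt hX0
    nlinarith [sq_nonneg (√X - η)]
  · have h3 := lpNorm_sub_le (g := fun x => cgrad (testApprox f n) x - G x) hm2 hone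
    have e : ((fun x => cgrad (testApprox f n) x - c • cgrad (bubble μ) x)
        - fun x => cgrad (testApprox f n) x - G x) = fun x => G x - c • cgrad (bubble μ) x := by
      ext1 x; simp only [Pi.sub_apply]; abel
    rw [e] at h3
    linarith
  · have h3 := lpNorm_sub_le (g := fun x => testApprox f n x - f x) hm6 (by norm_num)
    have e : ((fun x => testApprox f n x - c * bubble μ x)
        - fun x => testApprox f n x - f x) = fun x => f x - c * bubble μ x := by
      ext1 x; simp only [Pi.sub_apply]; abel
    rw [e] at h3
    linarith

/-! ### Pairings with rescaled test functions -/

lemma norm_integral_mul_le {p q : ℝ≥0∞} [ENNReal.HolderTriple p q 1] {f g : Space3 → ℂ}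
    (hf : MemLp f p volume) (hg : MemLp g q volume) :
    ‖∫ x, f x * g x‖ ≤ lpNorm f p volume * lpNorm g q volume := by
  have h1 : MemLp (fun x => f x * g x) 1 volume := hg.mul hf
  have h2 := eLpNorm_le_eLpNorm_mul_eLpNorm'_of_norm (p := p) (q := q) (r := 1) hf.1 hg.1
    (fun a b => a * b) 1 (Eventually.of_forall fun x => by simp)
  rw [ENNReal.coe_one, one_mul, ← ofReal_lpNorm hf, ← ofReal_lpNorm hg, ← ofReal_lpNorm h1,
    ← ENNReal.ofReal_mul lpNorm_nonneg] at h2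
  have h3 := (ENNReal.ofReal_le_ofReal_iff (mul_nonneg lpNorm_nonneg lpNorm_nonneg)).1 h2
  refine (norm_integral_le_integral_norm _).trans ?_
  rwa [lpNorm_one_eq_integral_norm h1.1] at h3

instance holderTriple_six : ENNReal.HolderTriple 6 (6 / 5) 1 :=
  ⟨by
    rw [ENNReal.inv_div (by simp) (by simp), inv_one, ← one_div, ENNReal.div_add_div_same]
    norm_num
    exact ENNReal.div_self (by simp) (by simp)⟩

instance holderTriple_four : ENNReal.HolderTriple 4 (4 / 3) 1 :=
  ⟨by
    rw [ENNReal.inv_div (by simp) (by simp), inv_one, ← one_div, ENNReal.div_add_div_same]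
    norm_num
    exact ENNReal.div_self (by simp) (by simp)⟩

lemma lpNorm_comp_smul {F : Type*} [NormedAddCommGroup F] {f : Space3 → F} (hf : Continuous f)
    {p : ℝ≥0∞} (hp : p ≠ 0) (hp' : p ≠ ⊤) {a : ℝ} (ha : 0 < a) :
    lpNorm (fun x => f (a • x)) p volume = a ^ (-(3 / p.toReal)) * lpNorm f p volume := by
  rw [lpNorm_eq_integral_norm_rpow_toReal hp hp' (by fun_prop : Continuous fun x =>
      f (a • x)).aestronglyMeasurable,
    lpNorm_eq_integral_norm_rpow_toReal hp hp' hf.aestronglyMeasurable,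
    integral_comp_smul_space3 (fun x => ‖f x‖ ^ p.toReal) ha, smul_eq_mul,
    Real.mul_rpow (by positivity) (integral_nonneg fun x => by positivity)]
  congr 1
  rw [← Real.rpow_natCast, ← Real.rpow_neg ha.le, ← Real.rpow_mul ha.le]
  congr 1
  push_cast; ring

/-- The dilation `a^{5/2} φ(a x)`, dual to the scaling of `Ḣ¹`. -/
noncomputable def dilate (a : ℝ) (φ : Space3 → ℝ) (x : Space3) : ℝ := √a * a ^ 2 * φ (a • x)

lemma IsTest.dilate {φ : Space3 → ℝ} (h : IsTest φ) {a : ℝ} (ha : 0 < a) : IsTest (dilate a φ) :=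
  (h.comp_smul ha.ne').const_mul _

lemma IsTest.memLp_ofReal {φ : Space3 → ℝ} (h : IsTest φ) (p : ℝ≥0∞) :
    MemLp (fun x => (φ x : ℂ)) p volume := (h.memLp p).ofReal

lemma lpNorm_dilate {φ : Space3 → ℝ} (h : IsTest φ) {p : ℝ≥0∞} (hp : p ≠ 0) (hp' : p ≠ ⊤)
    {a : ℝ} (ha : 0 < a) : lpNorm (fun x => (dilate a φ x : ℂ)) p volume
      = a ^ (5 / 2 - 3 / p.toReal) * lpNorm (fun x => (φ x : ℂ)) p volume := by
  have hc : Continuous fun x => (φ x : ℂ) := Complex.continuous_ofReal.comp h.continuous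
  have e : (fun x => (dilate a φ x : ℂ))
      = ((√a * a ^ 2 : ℝ) : ℂ) • fun x : Space3 => (φ (a • x) : ℂ) := by
    ext x; simp [dilate]
  rw [e, lpNorm_const_smul, lpNorm_comp_smul hc hp hp' ha, ← mul_assoc]
  congr 1
  rw [coe_nnnorm, Complex.norm_real, Real.norm_of_nonneg (by positivity), Real.sqrt_eq_rpow,
    ← Real.rpow_natCast, ← Real.rpow_add ha, ← Real.rpow_add ha]
  congr 1; push_cast; ring

lemma lpNorm_dilate_six_fifths {φ : Space3 → ℝ} (h : IsTest φ) {a : ℝ} (ha : 0 < a) :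
    lpNorm (fun x => (dilate a φ x : ℂ)) (6 / 5) volume
      = lpNorm (fun x => (φ x : ℂ)) (6 / 5) volume := by
  rw [lpNorm_dilate h (by simp) (ENNReal.div_ne_top (by simp) (by simp)) ha]
  norm_num

lemma lpNorm_dilate_six {φ : Space3 → ℝ} (h : IsTest φ) {a : ℝ} (ha : 0 < a) :
    lpNorm (fun x => (dilate a φ x : ℂ)) 6 volume
      = a ^ 2 * lpNorm (fun x => (φ x : ℂ)) 6 volume := by
  rw [lpNorm_dilate h (by simp) (by simp) ha, ← Real.rpow_natCast]
  norm_num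

lemma lpNorm_dilate_four {φ : Space3 → ℝ} (h : IsTest φ) {a : ℝ} (ha : 0 < a) :
    lpNorm (fun x => (dilate a φ x : ℂ)) 4 volume
      = a ^ (7 / 4 : ℝ) * lpNorm (fun x => (φ x : ℂ)) 4 volume := by
  rw [lpNorm_dilate h (by simp) (by simp) ha]
  norm_num

lemma lpNorm_dilate_four_thirds {φ : Space3 → ℝ} (h : IsTest φ) {a : ℝ} (ha : 0 < a) :
    lpNorm (fun x => (dilate a φ x : ℂ)) (4 / 3) volume
      = a ^ (1 / 4 : ℝ) * lpNorm (fun x => (φ x : ℂ)) (4 / 3) volume := by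
  rw [lpNorm_dilate h (by simp) (ENNReal.div_ne_top (by simp) (by simp)) ha]
  norm_num

lemma integral_bubble_mul_dilate (φ : Space3 → ℝ) {a μ : ℝ} (ha : 0 < a) (hμ : 0 < μ) :
    ∫ x, bubble μ x * (dilate a φ x : ℂ) = ∫ x, groundState x * (dilate (a / μ) φ x : ℂ) := by
  have h := integral_comp_smul_space3
    (fun y => groundState y * ((dilate (a / μ) φ y : ℝ) : ℂ)) hμ
  have e : ∀ x, bubble μ x * (dilate a φ x : ℂ)
      = ((μ ^ 3 : ℝ) : ℂ) * (groundState (μ • x) * ((dilate (a / μ) φ (μ • x) : ℝ) : ℂ)) := by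
    intro x
    have h1 : (a / μ) • μ • x = a • x := by rw [smul_smul, div_mul_cancel₀ _ hμ.ne']
    have h2 : √μ * (√a * a ^ 2) = μ ^ 3 * (√(a / μ) * (a / μ) ^ 2) := by
      rw [Real.sqrt_div ha.le]
      have h3 := Real.sq_sqrt hμ.le
      have h4 := Real.sqrt_pos.2 hμ
      field_simp
      exact h3
    rw [bubble, dilate, dilate, h1]
    calc _ = ((√μ * (√a * a ^ 2) : ℝ) : ℂ) * (groundState (μ • x) * φ (a • x)) := by
          push_cast; ring
      _ = _ := by rw [h2]; push_cast; ring
  simp only [e]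
  rw [integral_const_mul, h, Complex.real_smul, ← mul_assoc, ← Complex.ofReal_mul,
    mul_inv_cancel₀ (by positivity), Complex.ofReal_one, one_mul]

/-- A bump function supported in the shell `1 ≤ |x| ≤ 3`. -/
noncomputable def bump : Space3 → ℝ :=
  ((⟨1 / 2, 1, by norm_num, by norm_num⟩ : ContDiffBump ((2 : ℝ) • (EuclideanSpace.single 0 1 :
    Space3))) : Space3 → ℝ)

lemma isTest_bump : IsTest bump := ⟨ContDiffBump.contDiff _, ContDiffBump.hasCompactSupport _⟩

lemma bump_nonneg (x : Space3) : 0 ≤ bump x := ContDiffBump.nonneg _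

lemma bump_center : bump ((2 : ℝ) • EuclideanSpace.single 0 1) = 1 :=
  ContDiffBump.one_of_mem_closedBall _ (by simp)

lemma norm_mem_of_bump_ne_zero {x : Space3} (hx : bump x ≠ 0) : 1 ≤ ‖x‖ ∧ ‖x‖ ≤ 3 := by
  have h : x ∈ Function.support bump := hx
  rw [bump, ContDiffBump.support_eq, mem_ball_iff_norm] at h
  have h2 : ‖(2 : ℝ) • (EuclideanSpace.single 0 1 : Space3)‖ = 2 := by simp [norm_smul]
  have h3 := norm_sub_norm_le ((2 : ℝ) • (EuclideanSpace.single 0 1 : Space3)) x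
  have h4 := norm_sub_norm_le x ((2 : ℝ) • (EuclideanSpace.single 0 1 : Space3))
  rw [norm_sub_rev] at h3
  simp only at h
  constructor <;> linarith

/-- The pairing of the ground state with the dilated bump. -/
noncomputable def bumpPairing (b : ℝ) : ℝ := ∫ x, realGroundState x * dilate b bump x

lemma integral_groundState_mul_dilate (b : ℝ) :
    ∫ x, groundState x * (dilate b bump x : ℂ) = (bumpPairing b : ℂ) := by
  rw [bumpPairing]
  refine (integral_congr_ae (Eventually.of_forall fun x => ?_)).trans integral_ofReal
  simp [groundState_eq]

lemma bumpPairing_pos {b : ℝ} (hb : 0 < b) : 0 < bumpPairing b := by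
  have ht := isTest_bump.dilate hb
  refine (contDiff_realGroundState.continuous.mul
    ht.continuous).integral_pos_of_hasCompactSupport_nonneg_nonzero
    ht.hasCompactSupport.mul_left (fun x => mul_nonneg (realGroundState_pos x).le ?_)
    (x := b⁻¹ • (2 : ℝ) • EuclideanSpace.single 0 1) ?_
  · exact mul_nonneg (by positivity) (bump_nonneg _)
  · refine mul_ne_zero (realGroundState_pos _).ne' ?_
    rw [dilate, smul_inv_smul₀ hb.ne', bump_center]
    positivity

/-! ### Functions with the energy of the ground state -/

lemma IsSobolev.hDotNorm_eq {f : Space3 → ℂ} {G : Space3 → EuclideanSpace ℂ (Fin 3)}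
    (h : IsSobolev 2 f G) : (hDotNorm f).toReal = lpNorm G 2 volume := by
  rw [hDotNorm, h.weak.gradNorm_eq, toReal_eLpNorm h.memLp_grad.1]

lemma lpNorm_cgrad_bubble_sq {μ : ℝ} (hμ : 0 < μ) :
    lpNorm (cgrad (bubble μ)) 2 volume ^ 2 = bubbleMass := by
  rw [lpNorm_two_sq (memLp_cgrad_bubble hμ.ne').1, integral_norm_cgrad_bubble_sq hμ]

lemma lpNorm_bubble_six {μ : ℝ} (hμ : 0 < μ) :
    lpNorm (bubble μ) 6 volume ^ 6 = bubbleMass := by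
  rw [lpNorm_six_pow (memLp_bubble hμ.ne').1, integral_norm_bubble_pow_six hμ]

lemma hDotNorm_groundState_sq : (hDotNorm groundState).toReal ^ 2 = bubbleMass := by
  have h := (hasWeakGradient_bubble 1).gradNorm_eq 2
  rw [bubble_one] at h
  have h1 := lpNorm_cgrad_bubble_sq one_pos
  rw [bubble_one] at h1
  rw [hDotNorm, h, toReal_eLpNorm memLp_cgrad_groundState.1, h1]

lemma criticalEnergy_groundState : criticalEnergy groundState = bubbleMass / 3 := by
  have h1 := integral_norm_bubble_pow_six one_pos
  rw [bubble_one] at h1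
  rw [criticalEnergy, hDotNorm_groundState_sq, h1]; ring

lemma memLp_four {f : Space3 → ℂ} (h2 : MemLp f 2 volume) (h6 : MemLp f 6 volume) :
    MemLp f 4 volume := by
  refine memLp_of_norm_pow_integrable (n := 4) h2.1 (by norm_num) ?_
  have i2 : Integrable fun x => ‖f x‖ ^ 2 := h2.integrable_norm_pow (by norm_num)
  have i6 : Integrable fun x => ‖f x‖ ^ 6 := h6.integrable_norm_pow (by norm_num)
  refine (i2.add i6).mono' (h2.1.norm.pow 4) (Eventually.of_forall fun x => ?_)
  rw [Real.norm_of_nonneg (by positivity), Pi.add_apply]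
  nlinarith [sq_nonneg (‖f x‖ * (‖f x‖ ^ 2 - 1)), sq_nonneg ‖f x‖]

/-- The deficit and the quartic term of a function at the threshold energy are quadratic in the
gap `d`. Here `s ^ 3` stands for `‖∇W‖²`, `a` for `‖∇f‖²`, `n` for `‖f‖₆` and `q` for `‖f‖₄⁴`. -/
lemma deficit_le_of_energy {s d a n q : ℝ} (hs : 0 < s) (ha : a = s ^ 3 + d)
    (hd : |d| ≤ s ^ 3 / 2) (hq : 0 ≤ q)
    (hE : 1 / 2 * a - 1 / 6 * n ^ 6 + 1 / 4 * q = s ^ 3 / 3) (hD : 0 ≤ a - s ^ 2 * n ^ 2) :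
    s ^ 3 * q ≤ 7 / 3 * d ^ 2 ∧ s ^ 3 * (a - s ^ 2 * n ^ 2) ≤ 14 * d ^ 2 := by
  set M := s ^ 3 with hM
  have hM0 : 0 < M := by positivity
  obtain ⟨hd1, hd2⟩ := abs_le.1 hd
  have ha0 : M / 2 ≤ a := by linarith
  set b := s ^ 2 * n ^ 2 with hb
  have hb0 : 0 ≤ b := by positivity
  have hb3 : b ^ 3 = M ^ 2 * n ^ 6 := by rw [hb, hM]; ring
  have hn6 : n ^ 6 = M + 3 * d + 3 / 2 * q := by rw [ha] at hE; linarith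
  have hab : b ^ 3 ≤ a ^ 3 := pow_le_pow_left₀ hb0 (by linarith) 3
  -- The energy identity determines `n ^ 6`; the terms of first order in `d` in `a³ - b³` cancel.
  rw [hn6] at hb3
  have hexp : a ^ 3 = M ^ 3 + 3 * M ^ 2 * d + 3 * M * d ^ 2 + d ^ 3 := by rw [ha]; ring
  have hd3 : d ^ 3 ≤ M / 2 * d ^ 2 := by nlinarith [sq_nonneg d]
  have h1 : a ^ 3 - b ^ 3 ≤ 7 / 2 * M * d ^ 2 - 3 / 2 * M ^ 2 * q := by
    rw [hexp, hb3]; nlinarith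
  constructor
  · refine le_of_mul_le_mul_left ?_ hM0
    nlinarith
  · have h2 : (a - b) * a ^ 2 ≤ a ^ 3 - b ^ 3 := by
      have : 0 ≤ b * ((a - b) * (a + b)) := by
        have : 0 ≤ a + b := by linarith
        positivity
      nlinarith
    have h3 : (a - b) * (M / 2) ^ 2 ≤ (a - b) * a ^ 2 := by gcongr
    refine le_of_mul_le_mul_left ?_ hM0
    nlinarith [mul_nonneg (sq_nonneg M) hq]

lemma norm_sub_exp_arg (c : ℂ) : ‖c - Complex.exp (Complex.I * Complex.arg c)‖ = |‖c‖ - 1| := by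
  have h : c - Complex.exp (Complex.I * Complex.arg c)
      = ((‖c‖ - 1 : ℝ) : ℂ) * Complex.exp (Complex.I * Complex.arg c) := by
    have := Complex.norm_mul_exp_arg_mul_I c
    rw [mul_comm Complex.I]
    push_cast
    rw [sub_mul, this, one_mul]
  rw [h, norm_mul, mul_comm Complex.I, Complex.norm_exp_ofReal_mul_I, mul_one, Complex.norm_real,
    Real.norm_eq_abs]

lemma lpNorm_sub_smul_le {F : Type*} [NormedAddCommGroup F] [NormedSpace ℂ F] {p : ℝ≥0∞}
    (hp : 1 ≤ p) {f b : Space3 → F} (hf : MemLp f p volume) (hb : MemLp b p volume) (c e : ℂ) :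
    lpNorm (fun x => f x - e • b x) p volume
      ≤ lpNorm (fun x => f x - c • b x) p volume + ‖c - e‖ * lpNorm b p volume := by
  have h1 := lpNorm_add_le (f := fun x => f x - c • b x) (g := (c - e) • b)
    (hf.sub (hb.const_smul c)) hp
  have h2 : ((fun x => f x - c • b x) + (c - e) • b) = fun x => f x - e • b x := by
    ext1 x
    rw [Pi.add_apply, Pi.smul_apply, sub_smul]; abel
  rwa [h2, lpNorm_const_smul, coe_nnnorm] at h1

/-- Closeness to a bubble in `L⁶` bounds its frequency from below in terms of the `L⁴` norm, by
testing with a bump at the scale of the bubble. -/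
lemma le_of_near_bubble {f : Space3 → ℂ} (hf4 : MemLp f 4 volume) (hf6 : MemLp f 6 volume) {μ : ℝ}
    (hμ : 0 < μ) {e : ℂ} (he : ‖e‖ = 1)
    (h : lpNorm (fun x => f x - e * bubble μ x) 6 volume
      * lpNorm (fun x => (bump x : ℂ)) (6 / 5) volume ≤ bumpPairing 1 / 2) :
    (bumpPairing 1 / 2) ^ 4 ≤ lpNorm f 4 volume ^ 4 * μ
      * lpNorm (fun x => (bump x : ℂ)) (4 / 3) volume ^ 4 := by
  have hm6 := memLp_bubble hμ.ne'
  have hp₀0 := bumpPairing_pos one_pos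
  set p₀ := bumpPairing 1
  have ht := isTest_bump.dilate hμ
  have h1 := norm_integral_mul_le (hf6.sub (hm6.const_smul e)) (ht.memLp_ofReal (6 / 5))
  rw [lpNorm_dilate_six_fifths isTest_bump hμ] at h1
  have h2 := norm_integral_mul_le hf4 (ht.memLp_ofReal (4 / 3))
  rw [lpNorm_dilate_four_thirds isTest_bump hμ] at h2
  have i1 : Integrable fun x => f x * (dilate μ bump x : ℂ) :=
    memLp_one_iff_integrable.1 ((ht.memLp_ofReal (6 / 5)).mul hf6)
  have i2 : Integrable fun x => bubble μ x * (dilate μ bump x : ℂ) :=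
    memLp_one_iff_integrable.1 ((ht.memLp_ofReal (6 / 5)).mul hm6)
  have h3 : ∫ x, (f - e • bubble μ) x * (dilate μ bump x : ℂ)
      = (∫ x, f x * (dilate μ bump x : ℂ)) - e * p₀ := by
    have : ∀ x, (f - e • bubble μ) x * (dilate μ bump x : ℂ)
        = f x * (dilate μ bump x : ℂ) - e * (bubble μ x * (dilate μ bump x : ℂ)) := fun x => by
      simp only [Pi.sub_apply, Pi.smul_apply, smul_eq_mul]; ring
    simp only [this]
    rw [integral_sub i1 (i2.const_mul e), integral_const_mul, integral_bubble_mul_dilate _ hμ hμ,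
      div_self hμ.ne', integral_groundState_mul_dilate]
  rw [h3] at h1
  have h4 : ‖e * p₀‖ = p₀ := by
    rw [norm_mul, he, one_mul, Complex.norm_real, Real.norm_of_nonneg hp₀0.le]
  have h6 : p₀ / 2 ≤ lpNorm f 4 volume * (μ ^ (1 / 4 : ℝ)
      * lpNorm (fun x => (bump x : ℂ)) (4 / 3) volume) := by
    have h7 := norm_sub_norm_le (e * p₀) (∫ x, f x * (dilate μ bump x : ℂ))
    rw [h4, norm_sub_rev] at h7
    have h8 := h1.trans h
    linarith
  have h7 := pow_le_pow_left₀ (by positivity) h6 4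
  have h8 : (μ ^ (1 / 4 : ℝ)) ^ 4 = μ := by
    rw [← Real.rpow_natCast, ← Real.rpow_mul hμ.le]; norm_num
  refine h7.trans (le_of_eq ?_)
  rw [mul_pow, mul_pow, h8]; ring

/-- Radial functions with the energy of the ground state and almost its kinetic energy are close to
a modulated, highly concentrated ground state, and have a small `L⁴` norm. -/
theorem exists_near_bubble_of_energy : ∃ δ₁ C : ℝ, 0 < δ₁ ∧ 0 < C ∧ ∀ f G, IsSobolev 2 f G →
    IsRadial f → energy f = criticalEnergy groundState → gradGap f < δ₁ →
    0 < gradGap f ∧ lpNorm f 4 volume ^ 2 ≤ C * gradGap f ∧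
    ∃ θ μ : ℝ, 0 < μ ∧ 1 / μ ≤ C * gradGap f ∧
      lpNorm (fun x => G x - Complex.exp (Complex.I * θ) • cgrad (bubble μ) x) 2 volume
        ≤ C * gradGap f ∧
      lpNorm (fun x => f x - Complex.exp (Complex.I * θ) * bubble μ x) 6 volume
        ≤ C * gradGap f := by
  obtain ⟨C, hC, hnear⟩ := exists_bubble_near
  obtain ⟨K, hK, hsob⟩ := exists_lpNorm_six_le
  have hM := bubbleMass_pos
  set M := bubbleMass with hMdef
  set s := M ^ (1 / 3 : ℝ) with hs
  have hs0 : 0 < s := Real.rpow_pos_of_pos hM _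
  have hs3 : s ^ 3 = M := by
    rw [hs, ← Real.rpow_natCast, ← Real.rpow_mul hM.le]; norm_num
  have hs2 : M ^ (2 / 3 : ℝ) = s ^ 2 := by
    rw [hs, ← Real.rpow_natCast, ← Real.rpow_mul hM.le]; norm_num
  set k := √M with hk
  have hk0 : 0 < k := Real.sqrt_pos.2 hM
  have hk2 : k ^ 2 = M := Real.sq_sqrt hM.le
  set n₀ := M ^ (1 / 6 : ℝ) with hn₀
  have hn₀0 : 0 < n₀ := Real.rpow_pos_of_pos hM _
  have hn₀6 : n₀ ^ 6 = M := by
    rw [hn₀, ← Real.rpow_natCast, ← Real.rpow_mul hM.le]; norm_num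
  set C₁ := √(C * (14 / M) + 1) with hC₁
  have hC₁0 : 0 < C₁ := Real.sqrt_pos.2 (by positivity)
  have hC₁2 : C₁ ^ 2 = C * (14 / M) + 1 := Real.sq_sqrt (by positivity)
  set C₂ := (C₁ + 1 / k) / k with hC₂
  have hC₂0 : 0 < C₂ := by positivity
  set C₃ := C₁ + C₂ * (k + n₀) with hC₃
  have hC₃0 : 0 < C₃ := by positivity
  have hC₃k : C₁ + C₂ * k ≤ C₃ := by
    rw [hC₃]; linarith [mul_add C₂ k n₀, mul_pos hC₂0 hn₀0]
  have hC₃n : C₁ + C₂ * n₀ ≤ C₃ := by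
    rw [hC₃]; linarith [mul_add C₂ k n₀, mul_pos hC₂0 hk0]
  set p₀ := bumpPairing 1 with hp₀
  have hp₀0 : 0 < p₀ := bumpPairing_pos one_pos
  set c₁ := lpNorm (fun x => (bump x : ℂ)) (6 / 5) volume
  set c₂ := lpNorm (fun x => (bump x : ℂ)) (4 / 3) volume
  have hc₁ : 0 ≤ c₁ := lpNorm_nonneg
  have hc₂ : 0 ≤ c₂ := lpNorm_nonneg
  set C₄ := 16 * c₂ ^ 4 / p₀ ^ 4 * (7 / 3 / M) * (M / 2) with hC₄
  have hC₄0 : 0 ≤ C₄ := by positivity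
  set C₅ := √(7 / 3 / M) with hC₅
  have hC₅0 : 0 < C₅ := Real.sqrt_pos.2 (by positivity)
  have hC₅2 : C₅ ^ 2 = 7 / 3 / M := Real.sq_sqrt (by positivity)
  clear_value s k n₀ C₁ C₂ C₃ C₄ C₅
  refine ⟨min (M / 2) (p₀ / (2 * (C₃ * c₁ + 1))), C₃ + C₄ + C₅, by positivity, by positivity, ?_⟩
  intro f G hf hr hE hgap
  obtain ⟨hgap1, hgap2⟩ := lt_min_iff.1 hgap
  obtain ⟨hf6, -⟩ := hsob f G hf
  have hf4 := memLp_four hf.memLp hf6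
  rw [criticalEnergy_groundState, energy, hf.hDotNorm_eq, ← lpNorm_six_pow hf6.1,
    ← lpNorm_four_pow hf4.1] at hE
  have hgap_eq : gradGap f = |M - lpNorm G 2 volume ^ 2| := by
    rw [gradGap, hDotNorm_groundState_sq, hf.hDotNorm_eq]
  set gap := gradGap f with hgapdef
  set g := lpNorm G 2 volume with hg
  set n := lpNorm f 6 volume with hn
  set q := lpNorm f 4 volume with hq
  have hg0 : 0 ≤ g := lpNorm_nonneg
  have hq0 : 0 ≤ q := lpNorm_nonneg
  set d := g ^ 2 - M with hd
  have hgd : gap = |d| := by rw [hgap_eq, abs_sub_comm]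
  have hgap0 : 0 ≤ gap := by rw [hgd]; exact abs_nonneg d
  have hdd : d ^ 2 = gap ^ 2 := by rw [hgd, sq_abs]
  have hD : 0 ≤ g ^ 2 - s ^ 2 * n ^ 2 := by
    have h1 : ∀ ε > 0, 0 ≤ C * (g ^ 2 - s ^ 2 * n ^ 2) + ε := fun ε hε => by
      obtain ⟨μ, c, Y, -, -, hY, -⟩ := hnear f G hf hr ε hε
      rw [hs2] at hY
      exact (sq_nonneg Y).trans hY
    have h2 := le_of_forall_pos_le_add h1
    exact nonneg_of_mul_nonneg_right h2 hC
  obtain ⟨hq4, hDd⟩ := deficit_le_of_energy (q := q ^ 4) hs0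
    (by rw [hs3, hd]; ring : g ^ 2 = s ^ 3 + d)
    (by rw [hs3, ← hgd]; exact hgap1.le) (by positivity) (by rw [hs3]; exact hE) hD
  rw [hs3, hdd] at hq4 hDd
  have hq4' : q ^ 4 ≤ 7 / 3 / M * gap ^ 2 := by
    rw [div_mul_eq_mul_div, le_div_iff₀ hM]; linarith
  have hgap_pos : 0 < gap := by
    refine lt_of_le_of_ne hgap0 fun h0 => ?_
    rw [← h0] at hq4'
    have hq1 : q = 0 := by
      have : q ^ 4 ≤ 0 := by simpa using hq4'
      exact pow_eq_zero_iff (by norm_num : 4 ≠ 0) |>.1 (le_antisymm this (by positivity))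
    have hfz : f =ᵐ[volume] 0 := (lpNorm_eq_zero hf4 (by norm_num)).1 hq1
    have hn1 : n = 0 := (lpNorm_eq_zero hf6 (by norm_num)).2 hfz
    have hd0 : d = 0 := by rwa [hgd, eq_comm, abs_eq_zero] at h0
    rw [hn1, hq1] at hE
    norm_num at hE
    linarith
  obtain ⟨μ, c, Y, hμ, hY0, hY, hY2, hY6⟩ := hnear f G hf hr (gap ^ 2) (by positivity)
  rw [hs2] at hY
  have hYg : Y ≤ C₁ * gap := by
    refine le_of_pow_le_pow_left₀ two_ne_zero (by positivity) ?_
    have h1 : g ^ 2 - s ^ 2 * n ^ 2 ≤ 14 / M * gap ^ 2 := by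
      rw [div_mul_eq_mul_div, le_div_iff₀ hM]; linarith
    calc Y ^ 2 ≤ C * (14 / M * gap ^ 2) + gap ^ 2 := hY.trans (by gcongr)
      _ = _ := by rw [mul_pow, hC₁2]; ring
  have hbk : lpNorm (cgrad (bubble μ)) 2 volume = k := by
    refine (pow_left_inj₀ lpNorm_nonneg hk0.le two_ne_zero).1 ?_
    rw [lpNorm_cgrad_bubble_sq hμ, hk2]
  have hb6 : lpNorm (bubble μ) 6 volume = n₀ := by
    refine (pow_left_inj₀ lpNorm_nonneg hn₀0.le (by norm_num : 6 ≠ 0)).1 ?_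
    rw [lpNorm_bubble_six hμ, hn₀6]
  have hm2 := memLp_cgrad_bubble hμ.ne'
  have hm6 := memLp_bubble hμ.ne'
  have hcd : |‖c‖ - 1| ≤ C₂ * gap := by
    have h1 := abs_lpNorm_sub_le (by norm_num : (1 : ℝ≥0∞) ≤ 2) hf.memLp_grad (hm2.const_smul c)
    rw [lpNorm_const_smul, hbk, coe_nnnorm] at h1
    have h2 : |g - ‖c‖ * k| ≤ C₁ * gap := h1.trans (hY2.trans hYg)
    have h3 : |g - k| ≤ gap / k := by
      rw [le_div_iff₀ hk0, hgd, hd, ← hk2]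
      have : g ^ 2 - k ^ 2 = (g - k) * (g + k) := by ring
      rw [this, abs_mul, abs_of_pos (by positivity : 0 < g + k)]
      gcongr
      linarith
    rw [hC₂, div_mul_eq_mul_div, le_div_iff₀ hk0]
    have h4 : |‖c‖ - 1| * k = |(g - k) - (g - ‖c‖ * k)| := by
      rw [← abs_of_pos hk0, ← abs_mul, abs_of_pos hk0]; congr 1; ring
    rw [h4]
    calc _ ≤ |g - k| + |g - ‖c‖ * k| := abs_sub _ _
      _ ≤ gap / k + C₁ * gap := add_le_add h3 h2
      _ = _ := by ring
  have hce := norm_sub_exp_arg c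
  set e := Complex.exp (Complex.I * Complex.arg c) with he
  have hfin2 : lpNorm (fun x => G x - e • cgrad (bubble μ) x) 2 volume ≤ C₃ * gap := by
    have h1 := lpNorm_sub_smul_le one_le_two hf.memLp_grad hm2 c e
    rw [hbk, hce] at h1
    calc _ ≤ C₁ * gap + C₂ * gap * k := h1.trans (by gcongr; exact hY2.trans hYg)
      _ = (C₁ + C₂ * k) * gap := by ring
      _ ≤ _ := mul_le_mul_of_nonneg_right hC₃k hgap0
  have hfin6 : lpNorm (fun x => f x - e * bubble μ x) 6 volume ≤ C₃ * gap := by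
    have h1 := lpNorm_sub_smul_le (by norm_num) hf6 hm6 c e
    rw [hb6, hce] at h1
    simp only [smul_eq_mul] at h1
    calc _ ≤ C₁ * gap + C₂ * gap * n₀ := h1.trans (by gcongr; exact hY6.trans hYg)
      _ = (C₁ + C₂ * n₀) * gap := by ring
      _ ≤ _ := mul_le_mul_of_nonneg_right hC₃n hgap0
  have hμq : 1 / μ ≤ C₄ * gap := by
    have h5 : C₃ * gap * c₁ ≤ p₀ / 2 := by
      have h6 : gap * (2 * (C₃ * c₁ + 1)) ≤ p₀ := by
        rw [lt_div_iff₀ (by positivity)] at hgap2; exact hgap2.le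
      linarith [mul_add gap (2 * (C₃ * c₁)) (2 * 1), mul_add gap (2 * (C₃ * c₁)) 2]
    have h7 := le_of_near_bubble hf4 hf6 hμ (by
      rw [he, mul_comm Complex.I, Complex.norm_exp_ofReal_mul_I])
      ((mul_le_mul_of_nonneg_right hfin6 hc₁).trans h5)
    have h10 : gap ^ 2 ≤ M / 2 * gap := by
      rw [sq]; exact mul_le_mul_of_nonneg_right hgap1.le hgap0
    rw [div_le_iff₀ hμ]
    calc (1 : ℝ) = 16 / p₀ ^ 4 * (p₀ / 2) ^ 4 := by field_simp; norm_num
      _ ≤ 16 / p₀ ^ 4 * (q ^ 4 * μ * c₂ ^ 4) := by gcongr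
      _ ≤ 16 / p₀ ^ 4 * ((7 / 3 / M * (M / 2 * gap)) * μ * c₂ ^ 4) := by
          gcongr; exact hq4'.trans (by gcongr)
      _ = C₄ * gap * μ := by rw [hC₄]; ring
  have hq2 : q ^ 2 ≤ C₅ * gap := by
    refine le_of_pow_le_pow_left₀ two_ne_zero (by positivity) ?_
    calc (q ^ 2) ^ 2 = q ^ 4 := by ring
      _ ≤ _ := by rw [mul_pow, hC₅2]; exact hq4'
  have hle : ∀ D, 0 ≤ C₃ + C₄ + C₅ - D → D * gap ≤ (C₃ + C₄ + C₅) * gap := fun D hD =>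
    mul_le_mul_of_nonneg_right (by linarith) hgap0
  exact ⟨hgap_pos, hq2.trans (hle _ (by linarith)), Complex.arg c, μ, hμ,
    hμq.trans (hle _ (by linarith)), hfin2.trans (hle _ (by linarith)),
    hfin6.trans (hle _ (by linarith))⟩

/-! ### The nonlinearity and its commutator with mollification -/

lemma norm_cubic_sub_le (a b : ℂ) :
    ‖((‖a‖ ^ 2 : ℝ) : ℂ) * a - ((‖b‖ ^ 2 : ℝ) : ℂ) * b‖ ≤ ‖a - b‖ * (‖a‖ + ‖b‖) ^ 2 := by
  have e : ((‖a‖ ^ 2 : ℝ) : ℂ) * a - ((‖b‖ ^ 2 : ℝ) : ℂ) * b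
      = ((‖a‖ ^ 2 : ℝ) : ℂ) * (a - b) + (((‖a‖ - ‖b‖) * (‖a‖ + ‖b‖) : ℝ) : ℂ) * b := by
    push_cast; ring
  have ha := norm_nonneg a
  have hb := norm_nonneg b
  have hd := norm_nonneg (a - b)
  have h1 := abs_norm_sub_norm_le a b
  rw [e]
  refine (norm_add_le _ _).trans ?_
  rw [norm_mul, norm_mul, Complex.norm_real, Complex.norm_real, norm_mul, Real.norm_eq_abs (_ - _),
    Real.norm_of_nonneg (by positivity : 0 ≤ ‖a‖ ^ 2),
    Real.norm_of_nonneg (by positivity : 0 ≤ ‖a‖ + ‖b‖)]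
  calc ‖a‖ ^ 2 * ‖a - b‖ + |‖a‖ - ‖b‖| * (‖a‖ + ‖b‖) * ‖b‖
      ≤ ‖a‖ ^ 2 * ‖a - b‖ + ‖a - b‖ * (‖a‖ + ‖b‖) * ‖b‖ := by gcongr
    _ = ‖a - b‖ * (‖a‖ ^ 2 + ‖a‖ * ‖b‖ + ‖b‖ ^ 2) := by ring
    _ ≤ _ := by gcongr; nlinarith [mul_nonneg ha hb]

lemma norm_quintic_sub_le (a b : ℂ) :
    ‖((‖a‖ ^ 4 : ℝ) : ℂ) * a - ((‖b‖ ^ 4 : ℝ) : ℂ) * b‖ ≤ ‖a - b‖ * (‖a‖ + ‖b‖) ^ 4 := by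
  have e : ((‖a‖ ^ 4 : ℝ) : ℂ) * a - ((‖b‖ ^ 4 : ℝ) : ℂ) * b
      = ((‖a‖ ^ 4 : ℝ) : ℂ) * (a - b)
        + (((‖a‖ - ‖b‖) * ((‖a‖ + ‖b‖) * (‖a‖ ^ 2 + ‖b‖ ^ 2)) : ℝ) : ℂ) * b := by
    push_cast; ring
  have ha := norm_nonneg a
  have hb := norm_nonneg b
  have hd := norm_nonneg (a - b)
  have h1 := abs_norm_sub_norm_le a b
  rw [e]
  refine (norm_add_le _ _).trans ?_
  rw [norm_mul, norm_mul, Complex.norm_real, Complex.norm_real, norm_mul, Real.norm_eq_abs (_ - _),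
    Real.norm_of_nonneg (by positivity : 0 ≤ ‖a‖ ^ 4),
    Real.norm_of_nonneg (by positivity : 0 ≤ (‖a‖ + ‖b‖) * (‖a‖ ^ 2 + ‖b‖ ^ 2))]
  calc ‖a‖ ^ 4 * ‖a - b‖ + |‖a‖ - ‖b‖| * ((‖a‖ + ‖b‖) * (‖a‖ ^ 2 + ‖b‖ ^ 2)) * ‖b‖
      ≤ ‖a‖ ^ 4 * ‖a - b‖ + ‖a - b‖ * ((‖a‖ + ‖b‖) * (‖a‖ ^ 2 + ‖b‖ ^ 2)) * ‖b‖ := by gcongr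
    _ = ‖a - b‖ * (‖a‖ ^ 4 + (‖a‖ + ‖b‖) * (‖a‖ ^ 2 + ‖b‖ ^ 2) * ‖b‖) := by ring
    _ ≤ _ := by
      gcongr
      have : 0 ≤ 3 * ‖a‖ ^ 3 * ‖b‖ + 5 * ‖a‖ ^ 2 * ‖b‖ ^ 2 + 3 * ‖a‖ * ‖b‖ ^ 3 := by positivity
      nlinarith

lemma norm_nonlinearity_sub_le (a b : ℂ) : ‖nonlinearity a - nonlinearity b‖
    ≤ ‖a - b‖ * (‖a‖ + ‖b‖) ^ 2 + ‖a - b‖ * (‖a‖ + ‖b‖) ^ 4 := by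
  have e : nonlinearity a - nonlinearity b
      = (((‖a‖ ^ 2 : ℝ) : ℂ) * a - ((‖b‖ ^ 2 : ℝ) : ℂ) * b)
        - (((‖a‖ ^ 4 : ℝ) : ℂ) * a - ((‖b‖ ^ 4 : ℝ) : ℂ) * b) := by
    rw [nonlinearity, nonlinearity]; ring
  rw [e]
  exact (norm_sub_le _ _).trans (add_le_add (norm_cubic_sub_le a b) (norm_quintic_sub_le a b))

lemma nonlinearity_zero : nonlinearity 0 = 0 := by simp [nonlinearity]

lemma norm_nonlinearity_le (a : ℂ) : ‖nonlinearity a‖ ≤ ‖a‖ ^ 3 + ‖a‖ ^ 5 := by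
  have h := norm_nonlinearity_sub_le a 0
  rw [nonlinearity_zero, sub_zero, sub_zero, norm_zero, add_zero] at h
  calc _ ≤ _ := h
    _ = _ := by ring

lemma continuous_nonlinearity : Continuous nonlinearity := by
  unfold nonlinearity
  exact ((Complex.continuous_ofReal.comp (continuous_norm.pow 2)).mul continuous_id).sub
    ((Complex.continuous_ofReal.comp (continuous_norm.pow 4)).mul continuous_id)

lemma integrable_nonlinearity {f : Space3 → ℂ} (h2 : MemLp f 2 volume) (h6 : MemLp f 6 volume) :
    Integrable fun x => nonlinearity (f x) := by
  have i2 : Integrable fun x => ‖f x‖ ^ 2 := h2.integrable_norm_pow (by norm_num)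
  have i6 : Integrable fun x => ‖f x‖ ^ 6 := h6.integrable_norm_pow (by norm_num)
  refine ((i2.add i6).const_mul 2).mono'
    (continuous_nonlinearity.comp_aestronglyMeasurable h2.1) (Eventually.of_forall fun x => ?_)
  refine (norm_nonlinearity_le _).trans ?_
  rw [Pi.add_apply]
  have h0 := norm_nonneg (f x)
  rcases le_total (‖f x‖) 1 with h | h
  · have a1 : ‖f x‖ ^ 3 ≤ ‖f x‖ ^ 2 := pow_le_pow_of_le_one h0 h (by norm_num)
    have a2 : ‖f x‖ ^ 5 ≤ ‖f x‖ ^ 2 := pow_le_pow_of_le_one h0 h (by norm_num)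
    have : 0 ≤ ‖f x‖ ^ 6 := by positivity
    linarith
  · have a1 : ‖f x‖ ^ 3 ≤ ‖f x‖ ^ 6 := pow_le_pow_right₀ h (by norm_num)
    have a2 : ‖f x‖ ^ 5 ≤ ‖f x‖ ^ 6 := pow_le_pow_right₀ h (by norm_num)
    have : 0 ≤ ‖f x‖ ^ 2 := by positivity
    linarith

lemma eLpNorm_pow_eq (X : Space3 → ℝ) {k : ℕ} (hk : k ≠ 0) (p : ℝ≥0∞) :
    eLpNorm (fun x => X x ^ k) p volume = eLpNorm X (p * k) volume ^ k := by
  have h := eLpNorm_norm_rpow (μ := (volume : Measure Space3)) (p := p) X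
    (q := k) (by exact_mod_cast Nat.pos_of_ne_zero hk)
  rw [ENNReal.ofReal_natCast, ENNReal.rpow_natCast] at h
  rw [← h, ← eLpNorm_norm]
  simp only [Real.rpow_natCast, norm_pow]

lemma eLpNorm_norm_mul_le {p q r : ℝ≥0∞} [ENNReal.HolderTriple p q r] {d : Space3 → ℂ}
    {Y : Space3 → ℝ} (hd : AEStronglyMeasurable d volume) (hY : AEStronglyMeasurable Y volume) :
    eLpNorm (fun x => ‖d x‖ * Y x) r volume ≤ eLpNorm d p volume * eLpNorm Y q volume := by
  have := eLpNorm_le_eLpNorm_mul_eLpNorm'_of_norm (p := p) (q := q) (r := r) hd.norm hY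
    (fun a b => a * b) 1 (Eventually.of_forall fun x => by simp)
  rwa [ENNReal.coe_one, one_mul, eLpNorm_norm] at this

lemma ennreal_eq_of_toReal {a b : ℝ≥0∞} (ha : a ≠ ⊤) (hb : b ≠ ⊤) (h : a.toReal = b.toReal) :
    a = b := (ENNReal.toReal_eq_toReal_iff' ha hb).1 h

instance holderTriple_two_three : ENNReal.HolderTriple 2 3 (6 / 5) :=
  ⟨ennreal_eq_of_toReal (by simp) (by simp) (by
    rw [ENNReal.toReal_add (by simp) (by simp)]; norm_num [ENNReal.toReal_inv])⟩

instance holderTriple_six_three_halves : ENNReal.HolderTriple 6 (3 / 2) (6 / 5) :=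
  ⟨ennreal_eq_of_toReal (by simp) (by simp) (by
    rw [ENNReal.toReal_add (by simp) (by simp)]; norm_num [ENNReal.toReal_inv])⟩

section Difference
variable {a b : Space3 → ℂ} (ha : AEStronglyMeasurable a volume)
  (hb : AEStronglyMeasurable b volume)
include ha hb

lemma eLpNorm_nonlinearity_sub_le :
    eLpNorm (fun x => nonlinearity (a x) - nonlinearity (b x)) (6 / 5) volume
      ≤ eLpNorm (fun x => a x - b x) 2 volume * eLpNorm (fun x => ‖a x‖ + ‖b x‖) 6 volume ^ 2
      + eLpNorm (fun x => a x - b x) 6 volume * eLpNorm (fun x => ‖a x‖ + ‖b x‖) 6 volume ^ 4 := by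
  have hd : AEStronglyMeasurable (fun x => a x - b x) volume := ha.sub hb
  have hX : AEStronglyMeasurable (fun x => ‖a x‖ + ‖b x‖) volume := ha.norm.add hb.norm
  have e1 : (3 : ℝ≥0∞) * (2 : ℕ) = 6 := by norm_num
  have e2 : (3 / 2 : ℝ≥0∞) * (4 : ℕ) = 6 := ennreal_eq_of_toReal
    (ENNReal.mul_ne_top (ENNReal.div_ne_top (by simp) (by simp)) (by simp)) (by simp) (by norm_num)
  have h1 := eLpNorm_norm_mul_le (p := 2) (q := 3) (r := 6 / 5) hd (hX.pow 2)
  have h2 := eLpNorm_norm_mul_le (p := 6) (q := 3 / 2) (r := 6 / 5) hd (hX.pow 4)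
  simp only [Pi.pow_apply] at h1 h2
  have h3 : eLpNorm ((fun x => ‖a x‖ + ‖b x‖) ^ 2) 3 volume
      = eLpNorm (fun x => ‖a x‖ + ‖b x‖) 6 volume ^ 2 := by
    rw [← e1]; exact eLpNorm_pow_eq _ two_ne_zero 3
  have h4 : eLpNorm ((fun x => ‖a x‖ + ‖b x‖) ^ 4) (3 / 2) volume
      = eLpNorm (fun x => ‖a x‖ + ‖b x‖) 6 volume ^ 4 := by
    rw [← e2]; exact eLpNorm_pow_eq _ four_ne_zero _
  rw [h3] at h1
  rw [h4] at h2
  have hp : (1 : ℝ≥0∞) ≤ 6 / 5 := by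
    rw [ENNReal.le_div_iff_mul_le (by simp) (by simp)]; norm_num
  refine (eLpNorm_mono_real fun x => norm_nonlinearity_sub_le (a x) (b x)).trans ?_
  exact (eLpNorm_add_le (hd.norm.mul (hX.pow 2)) (hd.norm.mul (hX.pow 4)) hp).trans
    (add_le_add h1 h2)

lemma eLpNorm_nonlinearity_mul_sub_le :
    eLpNorm (fun x => ‖nonlinearity (a x)‖ • (nonlinearity (a x) - nonlinearity (b x))) 1 volume
      ≤ 2 * eLpNorm (fun x => a x - b x) 6 volume
        * (eLpNorm (fun x => ‖a x‖ + ‖b x‖) 6 volume ^ 5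
          + eLpNorm (fun x => ‖a x‖ + ‖b x‖) (54 / 5) volume ^ 9) := by
  have hd : AEStronglyMeasurable (fun x => a x - b x) volume := ha.sub hb
  have hX : AEStronglyMeasurable (fun x => ‖a x‖ + ‖b x‖) volume := ha.norm.add hb.norm
  have e1 : (6 / 5 : ℝ≥0∞) * (5 : ℕ) = 6 := ennreal_eq_of_toReal
    (ENNReal.mul_ne_top (ENNReal.div_ne_top (by simp) (by simp)) (by simp)) (by simp) (by norm_num)
  have e2 : (6 / 5 : ℝ≥0∞) * (9 : ℕ) = 54 / 5 := ennreal_eq_of_toReal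
    (ENNReal.mul_ne_top (ENNReal.div_ne_top (by simp) (by simp)) (by simp))
    (ENNReal.div_ne_top (by simp) (by simp)) (by norm_num)
  have h1 := eLpNorm_norm_mul_le (p := 6) (q := 6 / 5) (r := 1) hd (hX.pow 5)
  have h2 := eLpNorm_norm_mul_le (p := 6) (q := 6 / 5) (r := 1) hd (hX.pow 9)
  simp only [Pi.pow_apply] at h1 h2
  have h3 : eLpNorm ((fun x => ‖a x‖ + ‖b x‖) ^ 5) (6 / 5) volume
      = eLpNorm (fun x => ‖a x‖ + ‖b x‖) 6 volume ^ 5 := by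
    exact (eLpNorm_pow_eq _ (k := 5) (by norm_num) _).trans (by rw [e1])
  have h4 : eLpNorm ((fun x => ‖a x‖ + ‖b x‖) ^ 9) (6 / 5) volume
      = eLpNorm (fun x => ‖a x‖ + ‖b x‖) (54 / 5) volume ^ 9 := by
    rw [← e2]; exact eLpNorm_pow_eq _ (k := 9) (by norm_num) _
  rw [h3] at h1
  rw [h4] at h2
  have hpt : ∀ x, ‖‖nonlinearity (a x)‖ • (nonlinearity (a x) - nonlinearity (b x))‖
      ≤ (2 : ℝ) • (‖a x - b x‖ * (‖a x‖ + ‖b x‖) ^ 5 + ‖a x - b x‖ * (‖a x‖ + ‖b x‖) ^ 9) :=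
    fun x => by
      rw [norm_smul, norm_norm, smul_eq_mul]
      set X := ‖a x‖ + ‖b x‖
      have hX0 : 0 ≤ X := by positivity
      have hd0 := norm_nonneg (a x - b x)
      have f1 : ‖nonlinearity (a x)‖ ≤ X ^ 3 + X ^ 5 := by
        have : ‖a x‖ ≤ X := le_add_of_nonneg_right (norm_nonneg _)
        exact (norm_nonlinearity_le _).trans (by gcongr)
      have f2 : (X ^ 3 + X ^ 5) * (X ^ 2 + X ^ 4) ≤ 2 * (X ^ 5 + X ^ 9) := by
        have : 0 ≤ X ^ 5 * (X ^ 2 - 1) ^ 2 := by positivity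
        nlinarith
      calc _ ≤ (X ^ 3 + X ^ 5) * (‖a x - b x‖ * X ^ 2 + ‖a x - b x‖ * X ^ 4) :=
            mul_le_mul f1 (norm_nonlinearity_sub_le _ _) (norm_nonneg _) (by positivity)
        _ = ‖a x - b x‖ * ((X ^ 3 + X ^ 5) * (X ^ 2 + X ^ 4)) := by ring
        _ ≤ ‖a x - b x‖ * (2 * (X ^ 5 + X ^ 9)) := by gcongr
        _ = _ := by ring
  refine (eLpNorm_mono_real hpt).trans ?_
  have h5 := eLpNorm_add_le (hd.norm.mul (hX.pow 5)) (hd.norm.mul (hX.pow 9)) (le_refl 1)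
  have h6 := eLpNorm_const_smul (2 : ℝ)
    (fun x => ‖a x - b x‖ * (‖a x‖ + ‖b x‖) ^ 5 + ‖a x - b x‖ * (‖a x‖ + ‖b x‖) ^ 9) 1
    (volume : Measure Space3)
  have e3 : ‖(2 : ℝ)‖ₑ = 2 := by
    rw [Real.enorm_of_nonneg (by norm_num)]; simp
  rw [e3] at h6
  refine h6.le.trans ?_
  rw [mul_assoc, mul_add]
  exact mul_le_mul' le_rfl (h5.trans (add_le_add h1 h2))
end Difference

/-- The `L^p` norm of `wt (V - ρ * Φ)` is controlled by that of `wt (V - Φ(· - y))`, for `y` in the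
support of the mollifier `ρ`. -/
lemma eLpNorm_weight_sub_moll_le {wt : Space3 → ℝ} (hwt : Measurable wt) {V Φ : Space3 → ℂ}
    (hV : Measurable V) (hΦ : LocallyIntegrable Φ volume) {p : ℝ≥0∞} (hp : 1 ≤ p) (hp' : p ≠ ⊤)
    {a : ℝ} (ha : 0 < a) {M : ℝ≥0∞}
    (hM : ∀ y, ‖y‖ ≤ 2 / a → eLpNorm (fun x => wt x • (V x - Φ (x - y))) p volume ≤ M) :
    eLpNorm (fun x => wt x • (V x - moll (mollifier a) Φ x)) p volume ≤ M := by
  have hψ := isTest_mollifier ha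
  have hΦm := hΦ.aestronglyMeasurable
  set g := hΦm.mk Φ
  have hg : StronglyMeasurable g := hΦm.stronglyMeasurable_mk
  have hfg : Φ =ᵐ[volume] g := hΦm.ae_eq_mk
  have hloc' : LocallyIntegrable g volume := hΦ.congr hfg
  rw [moll_congr _ hfg, ← one_mul M, ← lintegral_enorm_mollifier ha]
  refine eLpNorm_le_of_enorm_le_lintegral (a := fun y => ‖mollifier a y‖ₑ)
    (b := fun x y => ‖wt x • (V x - g (x - y))‖ₑ) hψ.continuous.measurable.enorm ?_ hp hp'
    (Eventually.of_forall fun x => ?_) fun y hy => ?_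
  · exact ((hwt.comp measurable_fst).smul ((hV.comp measurable_fst).sub
      (hg.measurable.comp (measurable_fst.sub measurable_snd)))).enorm
  · have e2 : wt x • (V x - moll (mollifier a) g x)
        = ∫ y, mollifier a y • (wt x • (V x - g (x - y))) := by
      have i1 : Integrable fun y => mollifier a y • g (x - y) := by
        have := ((hψ.comp_sub x).integrable_smul hloc').comp_sub_left x
        simpa using this
      have e3 : ∀ y, mollifier a y • (wt x • (V x - g (x - y)))
          = wt x • (mollifier a y • V x - mollifier a y • g (x - y)) := fun y => by
        rw [smul_comm, smul_sub]
      simp only [e3]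
      rw [integral_smul, integral_sub (hψ.integrable.smul_const _) i1, integral_smul_const,
        integral_mollifier ha, one_smul, moll_apply']
    rw [e2]
    refine (enorm_integral_le_lintegral_enorm _).trans (le_of_eq ?_)
    simp only [enorm_smul]
  · rw [eLpNorm_rpow_toReal hp hp']
    refine ENNReal.rpow_le_rpow ?_ ENNReal.toReal_nonneg
    refine le_trans (le_of_eq (eLpNorm_congr_ae ?_))
      (hM y (norm_le_of_mollifier_ne_zero ha (by simpa using hy)))
    have h2 := (measurePreserving_sub_right' y).quasiMeasurePreserving.tendsto_ae.eventually hfg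
    filter_upwards [h2] with x hx2
    rw [hx2]

/-- The Laplacian as a sum of second partial derivatives. -/
noncomputable def lap (φ : Space3 → ℝ) (x : Space3) : ℝ := ∑ j, pd j (pd j φ) x

lemma IsTest.lap {φ : Space3 → ℝ} (h : IsTest φ) : IsTest (lap φ) := by
  have : _root_.lap φ = fun x => (_root_.pd 0 (_root_.pd 0 φ) x + _root_.pd 1 (_root_.pd 1 φ) x)
      + _root_.pd 2 (_root_.pd 2 φ) x := by
    ext x; rw [_root_.lap, Fin.sum_univ_three]
  rw [this]
  exact (((h.pd 0).pd 0).add ((h.pd 1).pd 1)).add ((h.pd 2).pd 2)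

lemma moll_lap {φ : Space3 → ℝ} (h : IsTest φ) {f : Space3 → ℂ} (hf : LocallyIntegrable f volume)
    (x : Space3) : moll (lap φ) f x = ∑ j, moll (pd j (pd j φ)) f x := by
  simp only [moll, lap, Finset.sum_smul]
  exact integral_finsetSum _ fun j _ => ((((h.pd j).pd j)).comp_sub x).integrable_smul hf

section Commutator
variable {f : Space3 → ℂ} {G : Space3 → EuclideanSpace ℂ (Fin 3)} {a : ℝ}

lemma eLpNorm_moll_sub_translate_le {p : ℝ≥0∞} (hp : 1 ≤ p) (hp' : p ≠ ⊤) (hf : MemLp f p volume)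
    (ha : 0 < a) {y : Space3} (hy : ‖y‖ ≤ 2 / a) :
    eLpNorm (fun x => moll (mollifier a) f x - f (x - y)) p volume
      ≤ 2 * translationModulus p f (2 / a) := by
  have e : (fun x => moll (mollifier a) f x - f (x - y))
      = fun x => (moll (mollifier a) f x - f x) - (f (x - y) - f x) := by ext x; ring
  have hy' := hf.1.comp_measurePreserving (measurePreserving_sub_right' y)
  rw [e, two_mul]
  exact (eLpNorm_sub_le ((memLp_mollifier hp hp' hf ha).1.sub hf.1) (hy'.sub hf.1) hp).trans
    (add_le_add (eLpNorm_mollifier_sub_le hp hp' hf ha) (le_translationModulus f hy))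

lemma eLpNorm_norm_add_norm_le {p : ℝ≥0∞} (hp : 1 ≤ p) (hp' : p ≠ ⊤)
    (hf : AEStronglyMeasurable f volume) (hl : LocallyIntegrable f volume) (ha : 0 < a)
    (y : Space3) :
    eLpNorm (fun x => ‖moll (mollifier a) f x‖ + ‖f (x - y)‖) p volume
      ≤ 2 * eLpNorm f p volume := by
  have hy' := hf.comp_measurePreserving (measurePreserving_sub_right' y)
  have hv := (continuous_moll (isTest_mollifier ha) hl).aestronglyMeasurable (μ := volume)
  rw [two_mul]
  refine (eLpNorm_add_le hv.norm hy'.norm hp).trans (add_le_add ?_ ?_)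
  · rw [eLpNorm_norm]; exact eLpNorm_mollifier_le hp hp' hf ha
  · exact ((eLpNorm_norm (fun x => f (x - y))).trans (eLpNorm_comp_sub hf y)).le

lemma one_le_six_fifths : (1 : ℝ≥0∞) ≤ 6 / 5 := by
  rw [ENNReal.le_div_iff_mul_le (by simp) (by simp)]; norm_num

lemma eLpNorm_moll_lap_le : ∃ K : ℝ, 0 < K ∧ ∀ f G, IsSobolev 6 f G → ∀ a : ℝ, 0 < a →
    eLpNorm (moll (lap (mollifier a)) f) 6 volume
      ≤ ENNReal.ofReal (K * a) * translationModulus 6 G (2 / a) := by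
  obtain ⟨K, hK, h⟩ := exists_lintegral_pd_mollifier_le
  refine ⟨3 * K, by positivity, fun f G hf a ha => ?_⟩
  have hψ := isTest_mollifier ha
  have h16 : (1 : ℝ≥0∞) ≤ 6 := by norm_num
  have hpt : ∀ x, ‖moll (lap (mollifier a)) f x‖
      ≤ ‖∑ j, ‖moll (pd j (mollifier a)) G x‖‖ := fun x => by
    rw [moll_lap hψ hf.weak.locallyIntegrable, Real.norm_of_nonneg
      (Finset.sum_nonneg fun j _ => norm_nonneg _)]
    refine (norm_sum_le _ _).trans (Finset.sum_le_sum fun j _ => ?_)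
    rw [hf.weak.moll_pd (hψ.pd j), ← moll_apply_apply (hψ.pd j) hf.weak.locallyIntegrable_grad]
    exact norm_apply_le _ j
  refine (eLpNorm_mono hpt).trans ?_
  have hm : ∀ j, AEStronglyMeasurable (fun x => ‖moll (pd j (mollifier a)) G x‖) volume := fun j =>
    (continuous_moll (hψ.pd j) hf.weak.locallyIntegrable_grad).aestronglyMeasurable.norm
  have h1 := eLpNorm_sum_le (s := Finset.univ) (fun j _ => hm j) h16
  have e : (∑ j, fun x => ‖moll (pd j (mollifier a)) G x‖)
      = fun x => ∑ j, ‖moll (pd j (mollifier a)) G x‖ := by ext x; simp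
  rw [e] at h1
  refine h1.trans ?_
  have h2 : ∀ j, eLpNorm (fun x => ‖moll (pd j (mollifier a)) G x‖) 6 volume
      ≤ ENNReal.ofReal (K * a) * translationModulus 6 G (2 / a) := fun j => by
    rw [eLpNorm_norm]
    exact (eLpNorm_pd_mollifier_le h16 (by simp) hf.memLp_grad ha j).trans
      (mul_le_mul' (h a ha j) le_rfl)
  refine (Finset.sum_le_sum fun j _ => h2 j).trans (le_of_eq ?_)
  rw [Finset.sum_const, Finset.card_univ, Fintype.card_fin, nsmul_eq_mul, mul_assoc 3,
    ENNReal.ofReal_mul (by norm_num : (0 : ℝ) ≤ 3), mul_assoc]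
  norm_num

/-- The part of the energy flux that involves the Laplacian. -/
lemma exists_lintegral_lap_commutator_le : ∃ K : ℝ, 0 < K ∧ ∀ f G, IsSobolev 2 f G →
    IsSobolev 6 f G → ∀ a : ℝ, 0 < a →
    ∫⁻ x, ‖moll (lap (mollifier a)) f x‖ₑ * ‖nonlinearity (moll (mollifier a) f x)
      - moll (mollifier a) (fun y => nonlinearity (f y)) x‖ₑ
      ≤ ENNReal.ofReal K * translationModulus 6 G (2 / a)
        * (eLpNorm G 2 volume * eLpNorm f 6 volume ^ 2
          + eLpNorm G 6 volume * eLpNorm f 6 volume ^ 4) := by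
  obtain ⟨K, hK, h⟩ := eLpNorm_moll_lap_le
  refine ⟨K * 64, by positivity, fun f G h2 h6 a ha => ?_⟩
  have hψ := isTest_mollifier ha
  have hloc := h2.weak.locallyIntegrable
  have hF := integrable_nonlinearity h2.memLp h6.memLp
  have hvc := continuous_moll hψ hloc
  have hRc := continuous_moll hψ hF.locallyIntegrable
  have hLc := continuous_moll hψ.lap hloc
  have h16 : (1 : ℝ≥0∞) ≤ 6 := by norm_num
  have ha2 : 0 ≤ 2 / a := by positivity
  have hdiff : eLpNorm (fun x => nonlinearity (moll (mollifier a) f x)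
      - moll (mollifier a) (fun y => nonlinearity (f y)) x) (6 / 5) volume
      ≤ ENNReal.ofReal (64 / a) * (eLpNorm G 2 volume * eLpNorm f 6 volume ^ 2
          + eLpNorm G 6 volume * eLpNorm f 6 volume ^ 4) := by
    have := eLpNorm_weight_sub_moll_le (wt := fun _ => 1) (V := fun x =>
      nonlinearity (moll (mollifier a) f x)) measurable_const
      (continuous_nonlinearity.comp hvc).measurable hF.locallyIntegrable one_le_six_fifths
      (ENNReal.div_ne_top (by simp) (by simp)) ha
      (M := ENNReal.ofReal (64 / a) * (eLpNorm G 2 volume * eLpNorm f 6 volume ^ 2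
          + eLpNorm G 6 volume * eLpNorm f 6 volume ^ 4)) fun y hy => ?_
    · simpa only [one_smul] using this
    · simp only [one_smul]
      have hy' := h2.memLp.1.comp_measurePreserving (measurePreserving_sub_right' y)
      refine (eLpNorm_nonlinearity_sub_le (b := fun x => f (x - y))
        hvc.aestronglyMeasurable hy').trans ?_
      have b1 := (eLpNorm_moll_sub_translate_le one_le_two (by simp) h2.memLp ha hy).trans
        (mul_le_mul' le_rfl (h2.translationModulus_le one_le_two (by simp) (2 / a)))
      have b2 := (eLpNorm_moll_sub_translate_le h16 (by simp) h6.memLp ha hy).trans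
        (mul_le_mul' le_rfl (h6.translationModulus_le h16 (by simp) (2 / a)))
      have b3 := eLpNorm_norm_add_norm_le h16 (by simp) h2.memLp.1 hloc ha y
      refine (add_le_add (mul_le_mul' b1 (pow_le_pow_left' b3 2))
        (mul_le_mul' b2 (pow_le_pow_left' b3 4))).trans ?_
      have e64 : ENNReal.ofReal (64 / a) = 32 * ENNReal.ofReal (2 / a) := by
        rw [show 64 / a = 32 * (2 / a) by ring, ENNReal.ofReal_mul (by norm_num)]; norm_num
      rw [e64, mul_add]
      refine add_le_add ?_ (le_of_eq (by ring))
      calc _ = 8 * ENNReal.ofReal (2 / a) * (eLpNorm G 2 volume * eLpNorm f 6 volume ^ 2) := by ring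
        _ ≤ _ := by gcongr; norm_num
  have h3 := eLpNorm_norm_mul_le (p := 6) (q := 6 / 5) (r := 1)
    (d := moll (lap (mollifier a)) f)
    (Y := fun x => ‖nonlinearity (moll (mollifier a) f x)
      - moll (mollifier a) (fun y => nonlinearity (f y)) x‖) hLc.aestronglyMeasurable
    ((continuous_nonlinearity.comp hvc).sub hRc).norm.aestronglyMeasurable
  rw [eLpNorm_one_eq_lintegral_enorm, eLpNorm_norm] at h3
  simp only [enorm_mul, enorm_norm] at h3
  refine h3.trans ((mul_le_mul' (h f G h6 a ha) hdiff).trans (le_of_eq ?_))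
  have e1 : ENNReal.ofReal (K * 64) = ENNReal.ofReal (K * a) * ENNReal.ofReal (64 / a) := by
    rw [← ENNReal.ofReal_mul (by positivity)]; congr 1; field_simp
  rw [e1]; ring

/-- The part of the energy flux that involves the nonlinearity alone. -/
lemma lintegral_nonlinearity_commutator_le (h2 : MemLp f 2 volume) (h6 : MemLp f 6 volume)
    (ha : 0 < a) :
    ∫⁻ x, ‖nonlinearity (moll (mollifier a) f x)‖ₑ * ‖nonlinearity (moll (mollifier a) f x)
      - moll (mollifier a) (fun y => nonlinearity (f y)) x‖ₑ
      ≤ 4 * translationModulus 6 f (2 / a)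
        * (32 * eLpNorm f 6 volume ^ 5 + 512 * eLpNorm f (54 / 5) volume ^ 9) := by
  have hψ := isTest_mollifier ha
  have hloc := h2.locallyIntegrable one_le_two
  have hF := integrable_nonlinearity h2 h6
  have hvc := continuous_moll hψ hloc
  have h16 : (1 : ℝ≥0∞) ≤ 6 := by norm_num
  have := eLpNorm_weight_sub_moll_le (wt := fun x => ‖nonlinearity (moll (mollifier a) f x)‖)
    (V := fun x => nonlinearity (moll (mollifier a) f x))
    (continuous_nonlinearity.comp hvc).norm.measurable
    (continuous_nonlinearity.comp hvc).measurable hF.locallyIntegrable le_rfl (by simp) ha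
    (M := 4 * translationModulus 6 f (2 / a)
        * (32 * eLpNorm f 6 volume ^ 5 + 512 * eLpNorm f (54 / 5) volume ^ 9)) fun y hy => ?_
  · rw [eLpNorm_one_eq_lintegral_enorm] at this
    simpa only [enorm_smul, enorm_norm] using this
  · have hy' := h2.1.comp_measurePreserving (measurePreserving_sub_right' y)
    refine (eLpNorm_nonlinearity_mul_sub_le (b := fun x => f (x - y))
      hvc.aestronglyMeasurable hy').trans ?_
    have h154 : (1 : ℝ≥0∞) ≤ 54 / 5 := by
      rw [ENNReal.le_div_iff_mul_le (by simp) (by simp)]; norm_num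
    have b2 := eLpNorm_moll_sub_translate_le h16 (by simp) h6 ha hy
    have b3 := eLpNorm_norm_add_norm_le h16 (by simp) h2.1 hloc ha y
    have b4 := eLpNorm_norm_add_norm_le h154 (ENNReal.div_ne_top (by simp) (by simp)) h2.1 hloc ha y
    refine (mul_le_mul' (mul_le_mul' le_rfl b2) (add_le_add (pow_le_pow_left' b3 5)
      (pow_le_pow_left' b4 9))).trans (le_of_eq ?_)
    ring

end Commutator

/-! ### Mollified solutions -/

lemma pd_pd_eq {φ : Space3 → ℝ} (h : IsTest φ) (i j : Fin 3) (x : Space3) :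
    pd i (pd j φ) x
      = fderiv ℝ (fderiv ℝ φ) x (EuclideanSpace.single i 1) (EuclideanSpace.single j 1) := by
  have hd : DifferentiableAt ℝ (fderiv ℝ φ) x :=
    (h.contDiff.fderiv_right (m := ∞) (by simp)).differentiable (by simp) x
  have := hd.hasFDerivAt.clm_apply
    (hasFDerivAt_const (EuclideanSpace.single j (1 : ℝ) : Space3) x)
  have e : pd j φ = fun y => fderiv ℝ φ y (EuclideanSpace.single j 1) := rfl
  rw [e, pd, this.fderiv]
  simp

lemma pd_comm {φ : Space3 → ℝ} (h : IsTest φ) (i j : Fin 3) (x : Space3) :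
    pd i (pd j φ) x = pd j (pd i φ) x := by
  rw [pd_pd_eq h, pd_pd_eq h]
  exact ((h.contDiff.of_le (m := 2)
    (WithTop.coe_le_coe.2 (le_top : (2 : ℕ∞) ≤ ⊤))).contDiffAt.isSymmSndFDerivAt
    (by simp)) _ _

lemma laplacian_eq_lap {φ : Space3 → ℝ} (h : IsTest φ) (x : Space3) :
    Laplacian.laplacian φ x = lap φ x := by
  rw [InnerProductSpace.laplacian_eq_iteratedFDeriv_orthonormalBasis φ
    (EuclideanSpace.basisFun (Fin 3) ℝ), lap]
  refine Finset.sum_congr rfl fun j _ => ?_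
  rw [iteratedFDeriv_two_apply, pd_pd_eq h]
  simp

lemma lap_comp_sub {φ : Space3 → ℝ} (h : IsTest φ) (x y : Space3) :
    lap (fun z => φ (x - z)) y = lap φ (x - y) := by
  refine Finset.sum_congr rfl fun j _ => ?_
  have e : pd j (fun z => φ (x - z)) = fun z => (-1) * pd j φ (x - z) := by
    ext z; rw [pd_comp_sub h.differentiable]; ring
  rw [e, pd_const_mul ((h.pd j).comp_sub x).differentiable, pd_comp_sub (h.pd j).differentiable]
  ring

lemma lap_pd {φ : Space3 → ℝ} (h : IsTest φ) (j : Fin 3) : lap (pd j φ) = pd j (lap φ) := by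
  ext x
  have e : lap φ = fun x => ∑ i, pd i (pd i φ) x := rfl
  have h1 : HasFDerivAt (lap φ) (∑ i, fderiv ℝ (pd i (pd i φ)) x) x := by
    rw [e]
    exact HasFDerivAt.fun_sum fun i _ => (((h.pd i).pd i).differentiable x).hasFDerivAt
  rw [pd, h1.fderiv, _root_.sum_apply, lap]
  refine Finset.sum_congr rfl fun i _ => ?_
  have e2 : pd i (pd j φ) = pd j (pd i φ) := funext fun y => pd_comm h i j y
  rw [e2, pd_comm (h.pd i) i j]
  rfl

/-- Young's inequality with the integrability placed on the kernel. -/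
lemma eLpNorm_moll_le_mul {ψ : Space3 → ℝ} (hψ : IsTest ψ) {f : Space3 → ℂ} (hf : Integrable f)
    {p : ℝ≥0∞} (hp : 1 ≤ p) (hp' : p ≠ ⊤) :
    eLpNorm (moll ψ f) p volume ≤ eLpNorm f 1 volume * eLpNorm ψ p volume := by
  set g := hf.1.mk f
  have hg : StronglyMeasurable g := hf.1.stronglyMeasurable_mk
  have hfg : f =ᵐ[volume] g := hf.1.ae_eq_mk
  rw [moll_congr _ hfg, eLpNorm_congr_ae hfg, eLpNorm_one_eq_lintegral_enorm]
  refine eLpNorm_le_of_enorm_le_lintegral (a := fun y => ‖g y‖ₑ)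
    (b := fun x y => ‖ψ (x - y)‖ₑ) hg.measurable.enorm ?_ hp hp'
    (Eventually.of_forall fun x => ?_) fun y _ => ?_
  · exact (hψ.continuous.measurable.comp (measurable_fst.sub measurable_snd)).enorm
  · refine (enorm_integral_le_lintegral_enorm _).trans (le_of_eq ?_)
    simp only [enorm_smul, mul_comm]
  · rw [lintegral_enorm_sub_rpow, eLpNorm_rpow_toReal hp hp']

lemma moll_eq_integral_mul (ψ : Space3 → ℝ) (f : Space3 → ℂ) (x : Space3) :
    moll ψ f x = ∫ y, f y * ((ψ (x - y) : ℝ) : ℂ) := by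
  simp only [moll, Complex.real_smul, mul_comm]

lemma exists_memLp_six : ∃ C : ℝ, 0 < C ∧ ∀ f, sobolevNorm 2 f < ⊤ →
    MemLp f 6 volume ∧ eLpNorm f 6 volume ≤ ENNReal.ofReal C * sobolevNorm 2 f := by
  obtain ⟨C, hC, h⟩ := exists_sobolev_le (p := 2) (p' := 6) (by norm_num) (by norm_num)
  refine ⟨C, hC, fun f hf => ?_⟩
  obtain ⟨G, hG⟩ := exists_isSobolev hf
  have h1 : eLpNorm f 6 volume ≤ ENNReal.ofReal C * eLpNorm G 2 volume := h f G hG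
  have h2 : eLpNorm f 6 volume ≤ ENNReal.ofReal C * sobolevNorm 2 f := by
    rw [hG.sobolevNorm_eq]
    exact h1.trans (mul_le_mul' le_rfl le_add_self)
  exact ⟨⟨hG.memLp.1, h2.trans_lt (ENNReal.mul_lt_top ENNReal.ofReal_lt_top hf)⟩, h2⟩

lemma memLp_nonlinearity_sub {a b : Space3 → ℂ} (ha2 : MemLp a 2 volume) (ha6 : MemLp a 6 volume)
    (hb2 : MemLp b 2 volume) (hb6 : MemLp b 6 volume) :
    MemLp (fun x => nonlinearity (a x) - nonlinearity (b x)) (6 / 5) volume := by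
  have hX := (ha6.norm.add hb6.norm).2
  refine ⟨(continuous_nonlinearity.comp_aestronglyMeasurable ha2.1).sub
    (continuous_nonlinearity.comp_aestronglyMeasurable hb2.1),
    (eLpNorm_nonlinearity_sub_le ha2.1 hb2.1).trans_lt (ENNReal.add_lt_top.2
      ⟨ENNReal.mul_lt_top (ha2.sub hb2).2 (ENNReal.pow_lt_top hX),
        ENNReal.mul_lt_top (ha6.sub hb6).2 (ENNReal.pow_lt_top hX)⟩)⟩

lemma memLp_nonlinearity {a : Space3 → ℂ} (ha2 : MemLp a 2 volume) (ha6 : MemLp a 6 volume) :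
    MemLp (fun x => nonlinearity (a x)) (6 / 5) volume := by
  have := memLp_nonlinearity_sub ha2 ha6 (MemLp.zero' (ε := ℂ)) (MemLp.zero' (ε := ℂ))
  simpa only [nonlinearity_zero, sub_zero] using this

/-- The time derivative of the mollified solution `ψ * u(t)`. -/
noncomputable def mollDeriv (ψ : Space3 → ℝ) (f : Space3 → ℂ) (x : Space3) : ℂ :=
  Complex.I * (moll (lap ψ) f x - moll ψ (fun y => nonlinearity (f y)) x)

namespace IsNLSSolution
variable {I : Set ℝ} {u : ℝ → Space3 → ℂ} (h : IsNLSSolution I u)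
include h

lemma memLp_two {t : ℝ} (ht : t ∈ I) : MemLp (u t) 2 volume :=
  (exists_isSobolev (h.mem_sobolev t ht)).choose_spec.memLp

lemma memLp_six {t : ℝ} (ht : t ∈ I) : MemLp (u t) 6 volume :=
  (exists_memLp_six.choose_spec.2 _ (h.mem_sobolev t ht)).1

lemma integrable_nonlinearity {t : ℝ} (ht : t ∈ I) : Integrable fun x => nonlinearity (u t x) :=
  _root_.integrable_nonlinearity (h.memLp_two ht) (h.memLp_six ht)

lemma tendsto_eLpNorm_two {t : ℝ} (ht : t ∈ I) :
    Tendsto (fun s => eLpNorm (fun x => u s x - u t x) 2 volume) (𝓝 t) (𝓝 0) :=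
  tendsto_of_tendsto_of_tendsto_of_le_of_le tendsto_const_nhds (h.continuous_sobolev t ht)
    (fun _ => zero_le) fun _ => le_self_add

lemma tendsto_eLpNorm_six {t : ℝ} (ht : t ∈ I) :
    Tendsto (fun s => eLpNorm (fun x => u s x - u t x) 6 volume) (𝓝 t) (𝓝 0) := by
  obtain ⟨C, _, hC⟩ := exists_memLp_six
  have h1 : Tendsto (fun s => ENNReal.ofReal C * sobolevNorm 2 fun x => u s x - u t x) (𝓝 t)
      (𝓝 0) := by
    simpa using ENNReal.Tendsto.const_mul (h.continuous_sobolev t ht)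
      (Or.inr ENNReal.ofReal_ne_top)
  refine tendsto_of_tendsto_of_tendsto_of_le_of_le' tendsto_const_nhds h1
    (Eventually.of_forall fun _ => zero_le) ?_
  filter_upwards [(h.continuous_sobolev t ht).eventually_lt_const ENNReal.zero_lt_top] with s hs
  exact (hC _ hs).2

lemma tendsto_eLpNorm_nonlinearity {t : ℝ} (ht : t ∈ I) :
    Tendsto (fun s => eLpNorm (fun x => nonlinearity (u s x) - nonlinearity (u t x)) (6 / 5) volume)
      (𝓝 t) (𝓝 0) := by
  set K : ℝ≥0∞ := 1 + 2 * eLpNorm (u t) 6 volume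
  have hK : K ≠ ⊤ := ENNReal.add_ne_top.2 ⟨by simp, ENNReal.mul_ne_top (by simp)
    (h.memLp_six ht).2.ne⟩
  have h1 : Tendsto (fun s => eLpNorm (fun x => u s x - u t x) 2 volume * K ^ 2
      + eLpNorm (fun x => u s x - u t x) 6 volume * K ^ 4) (𝓝 t) (𝓝 0) := by
    have := (ENNReal.Tendsto.mul_const (h.tendsto_eLpNorm_two ht)
      (Or.inr (ENNReal.pow_ne_top hK (n := 2)))).add (ENNReal.Tendsto.mul_const
        (h.tendsto_eLpNorm_six ht) (Or.inr (ENNReal.pow_ne_top hK (n := 4))))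
    simpa using this
  refine tendsto_of_tendsto_of_tendsto_of_le_of_le' tendsto_const_nhds h1
    (Eventually.of_forall fun _ => zero_le) ?_
  filter_upwards [(h.tendsto_eLpNorm_six ht).eventually_le_const one_pos,
    h.isOpen.mem_nhds ht] with s hs hsI
  have hX : eLpNorm (fun x => ‖u s x‖ + ‖u t x‖) 6 volume ≤ K := by
    have e : ∀ x, ‖‖u s x‖ + ‖u t x‖‖ ≤ ‖u s x - u t x‖ + 2 * ‖u t x‖ := fun x => by
      rw [Real.norm_of_nonneg (by positivity)]
      have := norm_sub_norm_le (u s x) (u t x)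
      linarith
    have hd := (h.memLp_six hsI).1.sub (h.memLp_six ht).1
    refine (eLpNorm_mono_real e).trans ((eLpNorm_add_le hd.norm
      ((h.memLp_six ht).1.norm.const_mul 2) (by norm_num)).trans (add_le_add ?_ ?_))
    · exact (eLpNorm_norm _).le.trans hs
    · refine (eLpNorm_const_smul (2 : ℝ) (fun x => ‖u t x‖) 6 volume).le.trans (le_of_eq ?_)
      rw [eLpNorm_norm, Real.enorm_of_nonneg (by norm_num)]
      simp
  refine (eLpNorm_nonlinearity_sub_le (h.memLp_two hsI).1 (h.memLp_two ht).1).trans ?_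
  gcongr

lemma continuousOn_integral_nonlinearity_mul {φ : Space3 → ℝ} (hφ : IsTest φ) :
    ContinuousOn (fun t => ∫ x, nonlinearity (u t x) * ((φ x : ℝ) : ℂ)) I := by
  intro t ht
  refine ContinuousAt.continuousWithinAt ?_
  have h6 := hφ.memLp_ofReal 6
  have key : ∀ s ∈ I, ‖(∫ x, nonlinearity (u s x) * ((φ x : ℝ) : ℂ))
      - ∫ x, nonlinearity (u t x) * ((φ x : ℝ) : ℂ)‖ₑ
      ≤ eLpNorm (fun x => nonlinearity (u s x) - nonlinearity (u t x)) (6 / 5) volume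
        * eLpNorm (fun x => ((φ x : ℝ) : ℂ)) 6 volume := fun s hs => by
    have i : ∀ r ∈ I, Integrable fun x => nonlinearity (u r x) * ((φ x : ℝ) : ℂ) := fun r hr => by
      have := hφ.integrable_smul (h.integrable_nonlinearity hr).locallyIntegrable
      refine this.congr (Eventually.of_forall fun x => ?_)
      beta_reduce
      rw [Complex.real_smul, mul_comm]
    rw [← integral_sub (i s hs) (i t ht)]
    have hF := memLp_nonlinearity_sub (h.memLp_two hs) (h.memLp_six hs) (h.memLp_two ht)
      (h.memLp_six ht)
    have h2 := eLpNorm_norm_mul_le (p := 6) (q := 6 / 5) (r := 1) h6.1 hF.1.norm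
    rw [eLpNorm_one_eq_lintegral_enorm, eLpNorm_norm] at h2
    refine (enorm_integral_le_lintegral_enorm _).trans (le_trans (le_of_eq ?_)
      (h2.trans_eq (mul_comm _ _)))
    refine lintegral_congr fun x => ?_
    rw [← sub_mul, enorm_mul, enorm_mul, enorm_norm, enorm_norm, mul_comm]
  rw [ContinuousAt, tendsto_iff_edist_tendsto_0]
  have h1 := ENNReal.Tendsto.mul_const (h.tendsto_eLpNorm_nonlinearity ht) (Or.inr h6.2.ne)
  rw [zero_mul] at h1
  refine tendsto_of_tendsto_of_tendsto_of_le_of_le' tendsto_const_nhds h1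
    (Eventually.of_forall fun _ => zero_le) ?_
  filter_upwards [h.isOpen.mem_nhds ht] with s hs
  rw [edist_eq_enorm_sub]
  exact key s hs

lemma hasDerivAt_integral_mul {φ : Space3 → ℝ} (hφ : IsTest φ) {t : ℝ} (ht : t ∈ I) :
    HasDerivAt (fun s => ∫ x, u s x * ((φ x : ℝ) : ℂ))
      (Complex.I * ((∫ x, u t x * ((lap φ x : ℝ) : ℂ))
        - ∫ x, nonlinearity (u t x) * ((φ x : ℝ) : ℂ))) t := by
  have := h.equation φ hφ.contDiff hφ.hasCompactSupport t ht
  simpa only [laplacian_eq_lap hφ] using this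

lemma hasDerivAt_moll {ψ : Space3 → ℝ} (hψ : IsTest ψ) {t : ℝ} (ht : t ∈ I) (x : Space3) :
    HasDerivAt (fun s => moll ψ (u s) x) (mollDeriv ψ (u t) x) t := by
  have := h.hasDerivAt_integral_mul (hψ.comp_sub x) ht
  simpa only [mollDeriv, moll_eq_integral_mul, lap_comp_sub hψ] using this

lemma continuousOn_moll {ψ : Space3 → ℝ} (hψ : IsTest ψ) (x : Space3) :
    ContinuousOn (fun t => moll ψ (u t) x) I :=
  fun _ ht => (h.hasDerivAt_moll hψ ht x).continuousAt.continuousWithinAt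

lemma continuousOn_mollDeriv {ψ : Space3 → ℝ} (hψ : IsTest ψ) (x : Space3) :
    ContinuousOn (fun t => mollDeriv ψ (u t) x) I := by
  have := h.continuousOn_integral_nonlinearity_mul (hψ.comp_sub x)
  simp only [mollDeriv]
  refine continuousOn_const.mul ((h.continuousOn_moll hψ.lap x).sub ?_)
  simpa only [moll_eq_integral_mul] using this

lemma exists_eLpNorm_le {s t : ℝ} (hst : Icc s t ⊆ I) : ∃ M : ℝ≥0∞, M ≠ ⊤ ∧ ∀ τ ∈ Icc s t,
    sobolevNorm 2 (u τ) ≤ M ∧ eLpNorm (u τ) 2 volume ≤ M ∧ eLpNorm (u τ) 6 volume ≤ M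
      ∧ eLpNorm (fun x => nonlinearity (u τ x)) 1 volume ≤ M := by
  obtain ⟨C, hC0, hC⟩ := exists_memLp_six
  -- A continuous function with values in the extended half-line is bounded on a compact set.
  have hb : ∃ M : ℝ≥0∞, M ≠ ⊤ ∧ ∀ τ ∈ Icc s t, sobolevNorm 2 (u τ) ≤ M := by
    refine isCompact_Icc.induction_on (p := fun S => ∃ M : ℝ≥0∞, M ≠ ⊤ ∧ ∀ τ ∈ S,
      sobolevNorm 2 (u τ) ≤ M) ⟨0, by simp, by simp⟩ (fun S T hST ⟨M, h1, h2⟩ =>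
        ⟨M, h1, fun τ hτ => h2 τ (hST hτ)⟩) (fun S T ⟨M, h1, h2⟩ ⟨M', h1', h2'⟩ => ⟨M + M',
        ENNReal.add_ne_top.2 ⟨h1, h1'⟩, fun τ hτ => hτ.elim (fun hτ => (h2 τ hτ).trans le_self_add)
          fun hτ => (h2' τ hτ).trans le_add_self⟩) fun r hr => ?_
    have hrI := hst hr
    refine ⟨{τ | τ ∈ I ∧ sobolevNorm 2 (fun x => u τ x - u r x) < 1}, ?_,
      1 + sobolevNorm 2 (u r), ENNReal.add_ne_top.2 ⟨by simp, (h.mem_sobolev r hrI).ne⟩, ?_⟩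
    · refine mem_nhdsWithin_of_mem_nhds ?_
      filter_upwards [(h.continuous_sobolev r hrI).eventually_lt_const one_pos,
        h.isOpen.mem_nhds hrI] with τ h1 h2 using ⟨h2, h1⟩
    · rintro τ ⟨hτ, h1⟩
      obtain ⟨G, hG⟩ := exists_isSobolev (h.mem_sobolev τ hτ)
      obtain ⟨H, hH⟩ := exists_isSobolev (h.mem_sobolev r hrI)
      refine le_trans ?_ (add_le_add_left h1.le _)
      rw [hG.sobolevNorm_eq, hH.sobolevNorm_eq, (hG.sub hH).sobolevNorm_eq]
      have a1 := eLpNorm_add_le (hG.memLp.1.sub hH.memLp.1) hH.memLp.1 one_le_two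
      have a2 := eLpNorm_add_le (hG.memLp_grad.1.sub hH.memLp_grad.1) hH.memLp_grad.1 one_le_two
      rw [sub_add_cancel] at a1 a2
      refine (add_le_add a1 a2).trans (le_of_eq ?_)
      simp only [Pi.sub_def]
      ring
  obtain ⟨M, hM, hb⟩ := hb
  have h6 : ∀ τ ∈ Icc s t, eLpNorm (u τ) 6 volume ≤ ENNReal.ofReal C * M := fun τ hτ =>
    (hC _ (h.mem_sobolev τ (hst hτ))).2.trans (mul_le_mul' le_rfl (hb τ hτ))
  have hCM : ENNReal.ofReal C * M ≠ ⊤ := ENNReal.mul_ne_top ENNReal.ofReal_ne_top hM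
  refine ⟨M + ENNReal.ofReal C * M + 2 * (M ^ 2 + (ENNReal.ofReal C * M) ^ 6),
    ENNReal.add_ne_top.2 ⟨ENNReal.add_ne_top.2 ⟨hM, hCM⟩, ENNReal.mul_ne_top (by simp)
      (ENNReal.add_ne_top.2 ⟨ENNReal.pow_ne_top hM, ENNReal.pow_ne_top hCM⟩)⟩, fun τ hτ => ?_⟩
  have h2 : eLpNorm (u τ) 2 volume ≤ M := le_self_add.trans (hb τ hτ)
  refine ⟨(hb τ hτ).trans (le_self_add.trans le_self_add),
    h2.trans (le_self_add.trans le_self_add), (h6 τ hτ).trans (le_add_self.trans le_self_add),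
    le_trans ?_ le_add_self⟩
  have hτI := hst hτ
  have p2 : ∫⁻ x, ‖u τ x‖ₑ ^ 2 = eLpNorm (u τ) 2 volume ^ 2 := by
    simpa using eLpNorm_rpow_toReal (f := u τ) (μ := volume) (p := 2) one_le_two (by simp)
  have p6 : ∫⁻ x, ‖u τ x‖ₑ ^ 6 = eLpNorm (u τ) 6 volume ^ 6 := by
    simpa using eLpNorm_rpow_toReal (f := u τ) (μ := volume) (p := 6) (by norm_num) (by simp)
  rw [eLpNorm_one_eq_lintegral_enorm]
  calc ∫⁻ x, ‖nonlinearity (u τ x)‖ₑ ≤ ∫⁻ x, 2 * (‖u τ x‖ₑ ^ 2 + ‖u τ x‖ₑ ^ 6) := by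
        refine lintegral_mono fun x => ?_
        have e : ‖nonlinearity (u τ x)‖ ≤ 2 * (‖u τ x‖ ^ 2 + ‖u τ x‖ ^ 6) := by
          refine (norm_nonlinearity_le _).trans ?_
          have := norm_nonneg (u τ x)
          have q1 : 0 ≤ ‖u τ x‖ ^ 2 * (‖u τ x‖ ^ 2 - ‖u τ x‖) ^ 2 := by positivity
          have q2 : 0 ≤ ‖u τ x‖ ^ 2 * (‖u τ x‖ ^ 2 - 1) ^ 2 := by positivity
          have q3 : 0 ≤ ‖u τ x‖ ^ 2 * (‖u τ x‖ - 1) ^ 2 := by positivity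
          nlinarith
        have := ENNReal.ofReal_le_ofReal e
        rwa [ofReal_norm, ENNReal.ofReal_mul (by norm_num), ENNReal.ofReal_add (by positivity)
          (by positivity), ENNReal.ofReal_pow (norm_nonneg _), ENNReal.ofReal_pow (norm_nonneg _),
          ofReal_norm, ENNReal.ofReal_ofNat] at this
    _ = 2 * (eLpNorm (u τ) 2 volume ^ 2 + eLpNorm (u τ) 6 volume ^ 6) := by
        rw [lintegral_const_mul' _ _ (by simp), lintegral_add_left'
          ((h.memLp_two hτI).1.enorm.pow_const 2), p2, p6]
    _ ≤ _ := by
        have := h6 τ hτ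
        gcongr

end IsNLSSolution

/-! ### Integrating a density in time -/

lemma aestronglyMeasurable_uncurry_of_continuousOn {e : ℝ → Space3 → ℝ} {s t : ℝ}
    (h1 : ∀ x, ContinuousOn (fun τ => e τ x) (Icc s t)) (h2 : ∀ τ ∈ Icc s t, Continuous (e τ)) :
    AEStronglyMeasurable (Function.uncurry e) ((volume.restrict (Icc s t)).prod volume) := by
  classical
  set w : Space3 → ℝ → ℝ := fun x => (Icc s t).indicator fun τ => e τ x
  have hw : Measurable (Function.uncurry w) := by
    refine measurable_uncurry_of_continuous_of_measurable (fun τ => ?_) fun x => ?_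
    · by_cases hτ : τ ∈ Icc s t
      · simpa only [w, indicator_of_mem hτ] using h2 τ hτ
      · simpa only [w, indicator_of_notMem hτ] using continuous_const
    · simp only [w, ← piecewise_eq_indicator]
      exact ContinuousOn.measurable_piecewise (h1 x) continuousOn_const measurableSet_Icc
  refine ⟨fun z => Function.uncurry w z.swap, (hw.comp measurable_swap).stronglyMeasurable, ?_⟩
  have hmem : ∀ᵐ z ∂((volume.restrict (Icc s t)).prod (volume : Measure Space3)),
      z.1 ∈ Icc s t :=
    Measure.quasiMeasurePreserving_fst.ae (ae_restrict_mem measurableSet_Icc)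
  filter_upwards [hmem] with z hz
  simp [Function.uncurry, w, indicator_of_mem hz]

lemma integral_sub_integral_eq {e e' : ℝ → Space3 → ℝ} {s t : ℝ} (hst : s ≤ t)
    (hd : ∀ x, ∀ τ ∈ Icc s t, HasDerivAt (fun r => e r x) (e' τ x) τ)
    (h1 : ∀ x, ContinuousOn (fun τ => e' τ x) (Icc s t))
    (h2 : ∀ τ ∈ Icc s t, Continuous (e' τ)) {M : ℝ≥0∞} (hM : M ≠ ⊤)
    (hb : ∀ τ ∈ Icc s t, ∫⁻ x, ‖e' τ x‖ₑ ≤ M) (hs : Integrable (e s)) (ht : Integrable (e t)) :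
    (∫ x, e t x) - ∫ x, e s x = ∫ τ in Icc s t, ∫ x, e' τ x := by
  have hm := aestronglyMeasurable_uncurry_of_continuousOn h1 h2
  have hi : Integrable (Function.uncurry e') ((volume.restrict (Icc s t)).prod volume) := by
    refine ⟨hm, ?_⟩
    rw [HasFiniteIntegral, lintegral_prod _ hm.enorm]
    refine (setLIntegral_mono' measurableSet_Icc hb).trans_lt ?_
    rw [lintegral_const, Measure.restrict_apply_univ, Real.volume_Icc]
    exact ENNReal.mul_lt_top hM.lt_top ENNReal.ofReal_lt_top
  rw [integral_integral_swap hi, ← integral_sub ht hs]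
  refine integral_congr_ae (Eventually.of_forall fun x => ?_)
  beta_reduce
  rw [integral_Icc_eq_integral_Ioc, ← intervalIntegral.integral_of_le hst,
    intervalIntegral.integral_eq_sub_of_hasDerivAt (f := fun r => e r x)
      (by rw [uIcc_of_le hst]; exact hd x) ((h1 x).intervalIntegrable_of_Icc hst)]

/-- Dominated convergence to `0` with a bound that need not be measurable; convergence is needed
only where the bound is finite. -/
lemma tendsto_lintegral_of_le_of_ne_top {s t : ℝ} {f : ℕ → ℝ → ℝ≥0∞} {b : ℝ → ℝ≥0∞}
    (hf : ∀ n, AEMeasurable (f n) (volume.restrict (Icc s t)))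
    (hb : ∀ n, ∀ τ ∈ Icc s t, f n τ ≤ b τ) (hb' : ∫⁻ τ in Icc s t, b τ ≠ ⊤)
    (hlim : ∀ τ ∈ Icc s t, b τ ≠ ⊤ → Tendsto (fun n => f n τ) atTop (𝓝 0)) :
    Tendsto (fun n => ∫⁻ τ in Icc s t, f n τ) atTop (𝓝 0) := by
  set ν := (volume.restrict (Icc s t) : Measure ℝ)
  have hmem : ∀ᵐ τ ∂ν, τ ∈ Icc s t := ae_restrict_mem measurableSet_Icc
  have hg : ∀ᵐ τ ∂ν, ∀ n, f n τ = (hf n).mk (f n) τ := ae_all_iff.2 fun n => (hf n).ae_eq_mk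
  set S := {τ | Tendsto (fun n => (hf n).mk (f n) τ) atTop (𝓝 0)}ᶜ
  have hS : MeasurableSet S := (measurableSet_tendsto _ fun n => (hf n).measurable_mk).compl
  have h1 : ∀ᵐ τ ∂ν.restrict S, (⊤ : ℝ≥0∞) ≤ b τ := by
    rw [ae_restrict_iff' hS]
    filter_upwards [hmem, hg] with τ h1 h2 h3
    by_contra h4
    have h5 := hlim τ h1 fun h => h4 h.ge
    simp only [h2] at h5
    exact h3 h5
  have h2 : ν S = 0 := by
    by_contra h0
    have h3 := (lintegral_mono_ae h1).trans (setLIntegral_le_lintegral S b)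
    rw [lintegral_const, Measure.restrict_apply_univ, ENNReal.top_mul h0] at h3
    exact hb' (top_le_iff.1 h3)
  have := tendsto_lintegral_of_dominated_convergence' (μ := ν) (f := fun _ => 0) b hf
    (fun n => hmem.mono (hb n)) hb' ?_
  · simpa using this
  · have h3 : ∀ᵐ τ ∂ν, τ ∉ S := measure_eq_zero_iff_ae_notMem.1 h2
    filter_upwards [h3, hg] with τ h4 h5
    have h6 := not_not.1 h4
    simpa only [mem_ofPred_eq, ← h5] using h6

/-! ### The energy of a mollified solution -/

instance holderTriple_six_fifths_six : ENNReal.HolderTriple (6 / 5) 6 1 :=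
  ENNReal.HolderTriple.symm (p := 6) (q := 6 / 5)

lemma lintegral_enorm_mul_le {p q : ℝ≥0∞} [ENNReal.HolderTriple p q 1] {f g : Space3 → ℂ}
    (hf : AEStronglyMeasurable f volume) (hg : AEStronglyMeasurable g volume) :
    ∫⁻ x, ‖f x‖ₑ * ‖g x‖ₑ ≤ eLpNorm f p volume * eLpNorm g q volume := by
  have h := eLpNorm_norm_mul_le (p := p) (q := q) (r := 1) hf hg.norm
  rw [eLpNorm_one_eq_lintegral_enorm, eLpNorm_norm] at h
  simpa only [enorm_mul, enorm_norm] using h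

lemma enorm_inner_le (a b : ℂ) : ‖⟪a, b⟫_ℝ‖ₑ ≤ ‖a‖ₑ * ‖b‖ₑ := by
  rw [← enorm_mul, ← ofReal_norm, ← ofReal_norm, norm_mul]
  exact ENNReal.ofReal_le_ofReal (norm_inner_le_norm _ _)

lemma integrable_inner_of_memLp {p q : ℝ≥0∞} [ENNReal.HolderTriple p q 1] {f g : Space3 → ℂ}
    (hf : MemLp f p volume) (hg : MemLp g q volume) : Integrable fun x => ⟪f x, g x⟫_ℝ :=
  ⟨hf.1.inner hg.1, (lintegral_mono fun x => enorm_inner_le (f x) (g x)).trans_lt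
    ((lintegral_enorm_mul_le hf.1 hg.1).trans_lt (ENNReal.mul_lt_top hf.2 hg.2))⟩

/-- Integration by parts for the real inner product on `ℂ`. -/
lemma integral_inner_pd_eq {f g : Space3 → ℂ} (hf : ContDiff ℝ 1 f) (hg : ContDiff ℝ 1 g)
    (j : Fin 3) (hf2 : MemLp f 2 volume) (hg2 : MemLp g 2 volume)
    (hf' : MemLp (pd j f) 2 volume) (hg' : MemLp (pd j g) 2 volume) :
    ∫ x, ⟪f x, pd j g x⟫_ℝ = -∫ x, ⟪pd j f x, g x⟫_ℝ :=
  integral_bilinear_fderiv_right_eq_neg_left_of_integrable (μ := volume)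
    (B := (isBoundedBilinearMap_inner (𝕜 := ℝ) (E := ℂ)).toContinuousLinearMap)
    (v := (EuclideanSpace.single j 1 : Space3))
    (integrable_inner_of_memLp hf' hg2) (integrable_inner_of_memLp hf2 hg')
    (integrable_inner_of_memLp hf2 hg2) (fun x _ => hf.differentiable one_ne_zero x)
    (fun x _ => hg.differentiable one_ne_zero x)

/-- The energy density of `ψ * f`. -/
noncomputable def energyDensity (ψ : Space3 → ℝ) (f : Space3 → ℂ) (x : Space3) : ℝ :=
  (1 / 2) * ∑ j, ‖moll (pd j ψ) f x‖ ^ 2 - (1 / 6) * ‖moll ψ f x‖ ^ 6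
    + (1 / 4) * ‖moll ψ f x‖ ^ 4

/-- The time derivative of the energy density of `ψ * u(t)`, where `f = u(t)`. -/
noncomputable def energyRate (ψ : Space3 → ℝ) (f : Space3 → ℂ) (x : Space3) : ℝ :=
  ∑ j, ⟪moll (pd j ψ) f x, mollDeriv (pd j ψ) f x⟫_ℝ
    + ⟪nonlinearity (moll ψ f x), mollDeriv ψ f x⟫_ℝ

lemma inner_nonlinearity (a b : ℂ) :
    ⟪nonlinearity a, b⟫_ℝ = (‖a‖ ^ 2 - ‖a‖ ^ 4) * ⟪a, b⟫_ℝ := by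
  have : nonlinearity a = (‖a‖ ^ 2 - ‖a‖ ^ 4) • a := by
    rw [nonlinearity, Complex.real_smul]; push_cast; ring
  rw [this, real_inner_smul_left]

lemma IsNLSSolution.hasDerivAt_energyDensity {I : Set ℝ} {u : ℝ → Space3 → ℂ}
    (h : IsNLSSolution I u) {ψ : Space3 → ℝ} (hψ : IsTest ψ) {t : ℝ} (ht : t ∈ I) (x : Space3) :
    HasDerivAt (fun s => energyDensity ψ (u s) x) (energyRate ψ (u t) x) t := by
  have h1 := fun j => (h.hasDerivAt_moll (hψ.pd j) ht x).norm_sq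
  have h0 := (h.hasDerivAt_moll hψ ht x).norm_sq
  have h2 := ((HasDerivAt.fun_sum fun j (_ : j ∈ Finset.univ) => h1 j).const_mul (1 / 2 : ℝ)).sub
    ((h0.fun_pow 3).const_mul (1 / 6 : ℝ)) |>.add ((h0.fun_pow 2).const_mul (1 / 4 : ℝ))
  have e : (fun s => energyDensity ψ (u s) x) = _ := rfl
  refine (h2.congr_of_eventuallyEq (Eventually.of_forall fun s => ?_)).congr_deriv ?_
  · simp only [energyDensity, Pi.add_apply, Pi.sub_apply, ← pow_mul]
  · rw [energyRate, inner_nonlinearity, ← Finset.mul_sum]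
    push_cast
    ring

lemma continuous_mollDeriv {ψ : Space3 → ℝ} (hψ : IsTest ψ) {f : Space3 → ℂ}
    (h2 : MemLp f 2 volume) (h6 : MemLp f 6 volume) : Continuous (mollDeriv ψ f) :=
  continuous_const.mul ((continuous_moll hψ.lap (h2.locallyIntegrable one_le_two)).sub
    (continuous_moll hψ (integrable_nonlinearity h2 h6).locallyIntegrable))

lemma contDiff_mollDeriv {ψ : Space3 → ℝ} (hψ : IsTest ψ) {f : Space3 → ℂ}
    (h2 : MemLp f 2 volume) (h6 : MemLp f 6 volume) : ContDiff ℝ ∞ (mollDeriv ψ f) :=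
  contDiff_const.mul ((contDiff_moll hψ.lap (h2.locallyIntegrable one_le_two)).sub
    (contDiff_moll hψ (integrable_nonlinearity h2 h6).locallyIntegrable))

lemma pd_mollDeriv {ψ : Space3 → ℝ} (hψ : IsTest ψ) {f : Space3 → ℂ}
    (h2 : MemLp f 2 volume) (h6 : MemLp f 6 volume) (j : Fin 3) (x : Space3) :
    pd j (mollDeriv ψ f) x = mollDeriv (pd j ψ) f x := by
  have l1 := h2.locallyIntegrable one_le_two
  have l2 := (integrable_nonlinearity h2 h6).locallyIntegrable
  have d1 := ((contDiff_moll hψ.lap l1).differentiable (by simp) x).hasFDerivAt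
  have d2 := ((contDiff_moll hψ l2).differentiable (by simp) x).hasFDerivAt
  have d3 : HasFDerivAt (mollDeriv ψ f) _ x := (d1.sub d2).const_mul Complex.I
  have e1 := pd_moll hψ.lap l1 j x
  have e2 := pd_moll hψ l2 j x
  rw [pd] at e1 e2
  rw [pd, d3.fderiv, mollDeriv, lap_pd hψ, ← e1, ← e2]
  simp

lemma memLp_moll {ψ : Space3 → ℝ} (hψ : IsTest ψ) {f : Space3 → ℂ} {p : ℝ≥0∞} (hp : 1 ≤ p)
    (hp' : p ≠ ⊤) (hf : MemLp f p volume) : MemLp (moll ψ f) p volume :=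
  ⟨(continuous_moll hψ (hf.locallyIntegrable hp)).aestronglyMeasurable,
    (eLpNorm_moll_le hψ.continuous hf.1 hp hp').trans_lt
      (ENNReal.mul_lt_top hψ.integrable.2 hf.2)⟩

lemma eLpNorm_mollDeriv_le {ψ : Space3 → ℝ} (hψ : IsTest ψ) {f : Space3 → ℂ}
    (h2 : MemLp f 2 volume) (h6 : MemLp f 6 volume) {p : ℝ≥0∞} (hp : 1 ≤ p) (hp' : p ≠ ⊤) :
    eLpNorm (mollDeriv ψ f) p volume ≤ (∫⁻ y, ‖lap ψ y‖ₑ) * eLpNorm f p volume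
      + eLpNorm (fun x => nonlinearity (f x)) 1 volume * eLpNorm ψ p volume := by
  have hF := integrable_nonlinearity h2 h6
  have l1 := continuous_moll hψ.lap (h2.locallyIntegrable one_le_two)
  have l2 := continuous_moll hψ hF.locallyIntegrable
  have e := eLpNorm_const_smul Complex.I (fun x => moll (lap ψ) f x
    - moll ψ (fun y => nonlinearity (f y)) x) p (volume : Measure Space3)
  have e1 : ‖Complex.I‖ₑ = 1 := by rw [← ofReal_norm]; simp
  rw [e1, one_mul] at e
  refine e.le.trans ((eLpNorm_sub_le l1.aestronglyMeasurable l2.aestronglyMeasurable hp).trans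
    (add_le_add (eLpNorm_moll_le hψ.lap.continuous h2.1 hp hp') (eLpNorm_moll_le_mul hψ hF hp hp')))

lemma memLp_mollDeriv {ψ : Space3 → ℝ} (hψ : IsTest ψ) {f : Space3 → ℂ}
    (h2 : MemLp f 2 volume) (h6 : MemLp f 6 volume) {p : ℝ≥0∞} (hp : 1 ≤ p) (hp' : p ≠ ⊤)
    (hf : MemLp f p volume) : MemLp (mollDeriv ψ f) p volume :=
  ⟨(continuous_mollDeriv hψ h2 h6).aestronglyMeasurable,
    (eLpNorm_mollDeriv_le hψ h2 h6 hp hp').trans_lt (ENNReal.add_lt_top.2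
      ⟨ENNReal.mul_lt_top hψ.lap.integrable.2 hf.2,
        ENNReal.mul_lt_top (memLp_one_iff_integrable.2 (integrable_nonlinearity h2 h6)).2
          (hψ.memLp p).2⟩)⟩

lemma continuous_energyRate {ψ : Space3 → ℝ} (hψ : IsTest ψ) {f : Space3 → ℂ}
    (h2 : MemLp f 2 volume) (h6 : MemLp f 6 volume) : Continuous (energyRate ψ f) := by
  have l := h2.locallyIntegrable one_le_two
  exact (continuous_finsetSum _ fun j _ => (continuous_moll (hψ.pd j) l).inner
    (continuous_mollDeriv (hψ.pd j) h2 h6)).add ((continuous_nonlinearity.comp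
      (continuous_moll hψ l)).inner (continuous_mollDeriv hψ h2 h6))

lemma exists_lintegral_energyRate_le {ψ : Space3 → ℝ} (hψ : IsTest ψ) {M : ℝ≥0∞} (hM : M ≠ ⊤) :
    ∃ K : ℝ≥0∞, K ≠ ⊤ ∧ ∀ f : Space3 → ℂ, MemLp f 2 volume → MemLp f 6 volume →
      eLpNorm f 2 volume ≤ M → eLpNorm f 6 volume ≤ M →
      eLpNorm (fun x => nonlinearity (f x)) 1 volume ≤ M → ∫⁻ x, ‖energyRate ψ f x‖ₑ ≤ K := by
  set c : (Space3 → ℝ) → ℝ≥0∞ := fun φ =>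
    (∫⁻ y, ‖φ y‖ₑ) + (∫⁻ y, ‖lap φ y‖ₑ) + eLpNorm φ 2 volume + eLpNorm φ 6 volume
  have hc : ∀ φ, IsTest φ → c φ ≠ ⊤ := fun φ hφ => by
    simp only [c, ENNReal.add_ne_top]
    exact ⟨⟨⟨hφ.integrable.2.ne, hφ.lap.integrable.2.ne⟩, (hφ.memLp 2).2.ne⟩, (hφ.memLp 6).2.ne⟩
  set c' : Fin 3 → ℝ≥0∞ := fun j => c (pd j ψ) * M * (c (pd j ψ) * M + M * c (pd j ψ))
  set K' := (c ψ * M * (c ψ * M) ^ 2 + c ψ * M * (c ψ * M) ^ 4) * (c ψ * M + M * c ψ)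
  have hcM : ∀ φ, IsTest φ → c φ * M ≠ ⊤ := fun φ hφ => ENNReal.mul_ne_top (hc φ hφ) hM
  have hcM' : ∀ φ, IsTest φ → M * c φ ≠ ⊤ := fun φ hφ => ENNReal.mul_ne_top hM (hc φ hφ)
  refine ⟨∑ j, c' j + K', ENNReal.add_ne_top.2 ⟨ENNReal.sum_ne_top.2 fun j _ =>
    ENNReal.mul_ne_top (hcM _ (hψ.pd j)) (ENNReal.add_ne_top.2 ⟨hcM _ (hψ.pd j), hcM' _ (hψ.pd j)⟩),
    ENNReal.mul_ne_top (ENNReal.add_ne_top.2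
    ⟨ENNReal.mul_ne_top (hcM _ hψ) (ENNReal.pow_ne_top (hcM _ hψ)),
      ENNReal.mul_ne_top (hcM _ hψ) (ENNReal.pow_ne_top (hcM _ hψ))⟩)
      (ENNReal.add_ne_top.2 ⟨hcM _ hψ, hcM' _ hψ⟩)⟩, fun f h2 h6 b2 b6 b1 => ?_⟩
  have l := h2.locallyIntegrable one_le_two
  have i1 : ∀ φ : Space3 → ℝ, (∫⁻ y, ‖φ y‖ₑ) ≤ c φ := fun φ =>
    le_self_add.trans (le_self_add.trans le_self_add)
  have i2 : ∀ φ : Space3 → ℝ, (∫⁻ y, ‖lap φ y‖ₑ) ≤ c φ := fun φ =>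
    le_add_self.trans (le_self_add.trans le_self_add)
  have m2 : ∀ φ, IsTest φ → eLpNorm (moll φ f) 2 volume ≤ c φ * M := fun φ hφ =>
    (eLpNorm_moll_le hφ.continuous h2.1 one_le_two (by simp)).trans (mul_le_mul' (i1 φ) b2)
  have m6 : eLpNorm (moll ψ f) 6 volume ≤ c ψ * M :=
    (eLpNorm_moll_le hψ.continuous h2.1 (by norm_num) (by simp)).trans (mul_le_mul' (i1 ψ) b6)
  have d2 : ∀ φ, IsTest φ → eLpNorm (mollDeriv φ f) 2 volume ≤ c φ * M + M * c φ := fun φ hφ =>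
    (eLpNorm_mollDeriv_le hφ h2 h6 one_le_two (by simp)).trans
      (add_le_add (mul_le_mul' (i2 φ) b2) (mul_le_mul' b1 (le_add_self.trans le_self_add)))
  have d6 : eLpNorm (mollDeriv ψ f) 6 volume ≤ c ψ * M + M * c ψ :=
    (eLpNorm_mollDeriv_le hψ h2 h6 (by norm_num) (by simp)).trans
      (add_le_add (mul_le_mul' (i2 ψ) b6) (mul_le_mul' b1 le_add_self))
  have hv := continuous_moll hψ l
  have hF : eLpNorm (fun x => nonlinearity (moll ψ f x)) (6 / 5) volume
      ≤ c ψ * M * (c ψ * M) ^ 2 + c ψ * M * (c ψ * M) ^ 4 := by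
    have := eLpNorm_nonlinearity_sub_le (hv.aestronglyMeasurable (μ := volume))
      (aestronglyMeasurable_const (b := (0 : ℂ)) (μ := (volume : Measure Space3)))
    simp only [nonlinearity_zero, sub_zero, norm_zero, add_zero] at this
    rw [eLpNorm_norm] at this
    have e2 := m2 ψ hψ
    refine this.trans ?_
    gcongr
  have hj := fun j => lintegral_enorm_mul_le (p := 2) (q := 2)
    (continuous_moll (hψ.pd j) l).aestronglyMeasurable
    (continuous_mollDeriv (hψ.pd j) h2 h6).aestronglyMeasurable
  have h0 := lintegral_enorm_mul_le (p := 6 / 5) (q := 6)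
    (continuous_nonlinearity.comp hv).aestronglyMeasurable
    (continuous_mollDeriv hψ h2 h6).aestronglyMeasurable
  calc ∫⁻ x, ‖energyRate ψ f x‖ₑ
      ≤ ∫⁻ x, (∑ j, ‖moll (pd j ψ) f x‖ₑ * ‖mollDeriv (pd j ψ) f x‖ₑ
        + ‖nonlinearity (moll ψ f x)‖ₑ * ‖mollDeriv ψ f x‖ₑ) := by
        refine lintegral_mono fun x => (enorm_add_le _ _).trans (add_le_add
          ((enorm_sum_le _ _).trans (Finset.sum_le_sum fun j _ => enorm_inner_le _ _))
          (enorm_inner_le _ _))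
    _ = ∑ j, (∫⁻ x, ‖moll (pd j ψ) f x‖ₑ * ‖mollDeriv (pd j ψ) f x‖ₑ)
        + ∫⁻ x, ‖nonlinearity (moll ψ f x)‖ₑ * ‖mollDeriv ψ f x‖ₑ := by
        have hm : ∀ j, Measurable fun x => ‖moll (pd j ψ) f x‖ₑ * ‖mollDeriv (pd j ψ) f x‖ₑ :=
          fun j => (continuous_moll (hψ.pd j) l).measurable.enorm.mul
            (continuous_mollDeriv (hψ.pd j) h2 h6).measurable.enorm
        rw [lintegral_add_left (Finset.measurable_fun_sum _ fun j _ => hm j),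
          lintegral_finsetSum _ fun j _ => hm j]
    _ ≤ _ := by
        refine add_le_add (Finset.sum_le_sum fun j _ => (hj j).trans
          (mul_le_mul' (m2 _ (hψ.pd j)) (d2 _ (hψ.pd j)))) (h0.trans (mul_le_mul' hF d6))

lemma integrable_energyDensity {ψ : Space3 → ℝ} (hψ : IsTest ψ) {f : Space3 → ℂ}
    (h2 : MemLp f 2 volume) (h6 : MemLp f 6 volume) : Integrable (energyDensity ψ f) := by
  have m2 := memLp_moll hψ one_le_two (by simp) h2
  have m6 := memLp_moll hψ (by norm_num) (by simp) h6
  have i6 : Integrable fun x => ‖moll ψ f x‖ ^ 6 := m6.integrable_norm_pow (by norm_num)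
  have i4 : Integrable fun x => ‖moll ψ f x‖ ^ 4 :=
    (memLp_four m2 m6).integrable_norm_pow (by norm_num)
  refine (((integrable_finsetSum _ fun j _ => ?_).const_mul _).sub (i6.const_mul _)).add
    (i4.const_mul _)
  exact (memLp_moll (hψ.pd j) one_le_two (by simp) h2).integrable_norm_pow (by norm_num)

lemma integral_energyDensity {ψ : Space3 → ℝ} (hψ : IsTest ψ) {f : Space3 → ℂ}
    (h2 : MemLp f 2 volume) (h6 : MemLp f 6 volume) :
    ∫ x, energyDensity ψ f x = energy (moll ψ f) := by
  have l := h2.locallyIntegrable one_le_two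
  have m2 := memLp_moll hψ one_le_two (by simp) h2
  have m6 := memLp_moll hψ (by norm_num) (by simp) h6
  have i6 : Integrable fun x => ‖moll ψ f x‖ ^ 6 := m6.integrable_norm_pow (by norm_num)
  have i4 : Integrable fun x => ‖moll ψ f x‖ ^ 4 :=
    (memLp_four m2 m6).integrable_norm_pow (by norm_num)
  have i2 : Integrable fun x => ∑ j, ‖moll (pd j ψ) f x‖ ^ 2 := integrable_finsetSum _ fun j _ =>
    (memLp_moll (hψ.pd j) one_le_two (by simp) h2).integrable_norm_pow (by norm_num)
  have hc := contDiff_one_of_infty (contDiff_moll hψ l)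
  have e1 : (hDotNorm (moll ψ f)).toReal ^ 2 = ∫ x, ∑ j, ‖moll (pd j ψ) f x‖ ^ 2 := by
    rw [hDotNorm, (hasWeakGradient_cgrad hc).gradNorm_eq, toReal_eLpNorm
      (continuous_cgrad hc).aestronglyMeasurable,
      lpNorm_two_sq (continuous_cgrad hc).aestronglyMeasurable]
    simp only [norm_sq_cgrad, pd_moll hψ l]
  rw [energy, e1, ← integral_const_mul, ← integral_const_mul, ← integral_const_mul,
    ← integral_sub (i2.const_mul _) (i6.const_mul _)]
  exact integral_add ((i2.const_mul _).sub (i6.const_mul _)) (i4.const_mul _)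

/-- The energy of the mollified solution changes only through the commutator of the nonlinearity
with the mollification. -/
lemma enorm_integral_energyRate_le {ψ : Space3 → ℝ} (hψ : IsTest ψ) {f : Space3 → ℂ}
    (h2 : MemLp f 2 volume) (h6 : MemLp f 6 volume) :
    ‖∫ x, energyRate ψ f x‖ₑ
      ≤ (∫⁻ x, ‖moll (lap ψ) f x‖ₑ * ‖nonlinearity (moll ψ f x)
          - moll ψ (fun y => nonlinearity (f y)) x‖ₑ)
        + ∫⁻ x, ‖nonlinearity (moll ψ f x)‖ₑ * ‖nonlinearity (moll ψ f x)
          - moll ψ (fun y => nonlinearity (f y)) x‖ₑ := by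
  have l := h2.locallyIntegrable one_le_two
  have hF := integrable_nonlinearity h2 h6
  have m : ∀ φ, IsTest φ → MemLp (moll φ f) 2 volume := fun φ hφ =>
    memLp_moll hφ one_le_two (by simp) h2
  have d : ∀ φ, IsTest φ → MemLp (mollDeriv φ f) 2 volume := fun φ hφ =>
    memLp_mollDeriv hφ h2 h6 one_le_two (by simp) h2
  have d6 := memLp_mollDeriv hψ h2 h6 (by norm_num) (by simp) h6
  have mF := memLp_nonlinearity (m ψ hψ) (memLp_moll hψ (by norm_num) (by simp) h6)
  have iF := integrable_inner_of_memLp mF d6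
  have ij := fun j => integrable_inner_of_memLp (m _ (hψ.pd j)) (d _ (hψ.pd j))
  have hibp : ∀ j, ∫ x, ⟪moll (pd j ψ) f x, mollDeriv (pd j ψ) f x⟫_ℝ
      = -∫ x, ⟪moll (pd j (pd j ψ)) f x, mollDeriv ψ f x⟫_ℝ := fun j => by
    have e1 : pd j (mollDeriv ψ f) = mollDeriv (pd j ψ) f := funext (pd_mollDeriv hψ h2 h6 j)
    have e2 : pd j (moll (pd j ψ) f) = moll (pd j (pd j ψ)) f := funext (pd_moll (hψ.pd j) l j)
    have := integral_inner_pd_eq (contDiff_one_of_infty (contDiff_moll (hψ.pd j) l))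
      (contDiff_one_of_infty (contDiff_mollDeriv hψ h2 h6)) j (m _ (hψ.pd j)) (d _ hψ)
      (by rw [e2]; exact m _ ((hψ.pd j).pd j)) (by rw [e1]; exact d _ (hψ.pd j))
    rwa [e1, e2] at this
  have hL : ∫ x, ⟪moll (lap ψ) f x, mollDeriv ψ f x⟫_ℝ
      = ∑ j, ∫ x, ⟪moll (pd j (pd j ψ)) f x, mollDeriv ψ f x⟫_ℝ := by
    rw [← integral_finsetSum _ fun j _ =>
      integrable_inner_of_memLp (m _ ((hψ.pd j).pd j)) (d _ hψ)]
    refine integral_congr_ae (Eventually.of_forall fun x => ?_)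
    beta_reduce
    rw [moll_lap hψ l, sum_inner]
  have e : ∫ x, energyRate ψ f x = ∫ x, (⟪nonlinearity (moll ψ f x), mollDeriv ψ f x⟫_ℝ
      - ⟪moll (lap ψ) f x, mollDeriv ψ f x⟫_ℝ) := by
    rw [integral_sub iF (integrable_inner_of_memLp (m _ hψ.lap) (d _ hψ)), hL]
    simp only [energyRate]
    rw [integral_add (integrable_finsetSum _ fun j _ => ij j) iF,
      integral_finsetSum _ fun j _ => ij j]
    simp only [hibp, Finset.sum_neg_distrib]
    ring
  -- Replacing `i (L - R)` by `i (F - R)` changes the pairing with `F - L` by a purely imaginary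
  -- multiple of `|F - L|²`.
  have hpt : ∀ x, ⟪nonlinearity (moll ψ f x), mollDeriv ψ f x⟫_ℝ
      - ⟪moll (lap ψ) f x, mollDeriv ψ f x⟫_ℝ
      = ⟪nonlinearity (moll ψ f x) - moll (lap ψ) f x, Complex.I * (nonlinearity (moll ψ f x)
          - moll ψ (fun y => nonlinearity (f y)) x)⟫_ℝ := fun x => by
    rw [← inner_sub_left, mollDeriv]
    simp only [Complex.inner, Complex.mul_re, Complex.mul_im, Complex.conj_re, Complex.conj_im,
      Complex.sub_re, Complex.sub_im, Complex.I_re, Complex.I_im]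
    ring
  rw [e]
  refine (enorm_integral_le_lintegral_enorm _).trans ?_
  have hm : Measurable fun x => ‖moll (lap ψ) f x‖ₑ * ‖nonlinearity (moll ψ f x)
      - moll ψ (fun y => nonlinearity (f y)) x‖ₑ :=
    (continuous_moll hψ.lap l).measurable.enorm.mul
      ((continuous_nonlinearity.comp (continuous_moll hψ l)).sub
        (continuous_moll hψ hF.locallyIntegrable)).measurable.enorm
  rw [← lintegral_add_left hm]
  refine lintegral_mono fun x => ?_
  rw [hpt]
  refine (enorm_inner_le _ _).trans ?_
  have e1 : ‖Complex.I‖ₑ = 1 := by rw [← ofReal_norm]; simp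
  rw [enorm_mul, e1, one_mul, ← add_mul, add_comm]
  exact mul_le_mul' (enorm_sub_le ..) le_rfl

/-! ### Conservation of energy -/

lemma IsSobolev.energy_eq {f : Space3 → ℂ} {G : Space3 → EuclideanSpace ℂ (Fin 3)}
    (h : IsSobolev 2 f G) : energy f = (1 / 2) * lpNorm G 2 volume ^ 2
      - (1 / 6) * lpNorm f 6 volume ^ 6 + (1 / 4) * lpNorm f 4 volume ^ 4 := by
  rw [energy, h.hDotNorm_eq, lpNorm_six_pow h.memLp.1, lpNorm_four_pow h.memLp.1]

lemma tendsto_lpNorm_mollifier {F : Type*} [NormedAddCommGroup F] [NormedSpace ℝ F]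
    [CompleteSpace F] {f : Space3 → F} {p : ℝ≥0∞} (hp : 1 ≤ p) (hp' : p ≠ ⊤)
    (hf : MemLp f p volume) :
    Tendsto (fun n : ℕ => lpNorm (moll (mollifier (n + 1)) f) p volume) atTop
      (𝓝 (lpNorm f p volume)) := by
  have hm := fun n : ℕ => memLp_mollifier hp hp' hf (Nat.cast_add_one_pos (α := ℝ) n)
  exact tendsto_lpNorm hp hm hf (tendsto_lpNorm_of_eLpNorm (fun n => (hm n).sub hf)
    ((tendsto_eLpNorm_mollifier_sub hp hp' hf).comp tendsto_natCast_add_one))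

lemma tendsto_energy_mollifier {f : Space3 → ℂ} {G : Space3 → EuclideanSpace ℂ (Fin 3)}
    (h : IsSobolev 2 f G) (h6 : MemLp f 6 volume) :
    Tendsto (fun n : ℕ => energy (moll (mollifier (n + 1)) f)) atTop (𝓝 (energy f)) := by
  have e : ∀ n : ℕ, energy (moll (mollifier (n + 1)) f)
      = (1 / 2) * lpNorm (moll (mollifier (n + 1)) G) 2 volume ^ 2
      - (1 / 6) * lpNorm (moll (mollifier (n + 1)) f) 6 volume ^ 6
      + (1 / 4) * lpNorm (moll (mollifier (n + 1)) f) 4 volume ^ 4 := fun n => by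
    have hn := Nat.cast_add_one_pos (α := ℝ) n
    rw [(h.moll one_le_two (by simp) hn).energy_eq, h.weak.cgrad_moll (isTest_mollifier hn)]
  simp only [e]
  rw [h.energy_eq]
  exact ((((tendsto_lpNorm_mollifier one_le_two (by simp) h.memLp_grad).pow 2).const_mul _).sub
    (((tendsto_lpNorm_mollifier (by norm_num) (by simp) h6).pow 6).const_mul _)).add
    (((tendsto_lpNorm_mollifier (by norm_num) (by simp) (memLp_four h.memLp h6)).pow 4).const_mul _)

lemma isAdmissible_two_six : IsAdmissible 2 6 :=
  ⟨le_rfl, by norm_num, ennreal_eq_of_toReal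
    (ENNReal.add_ne_top.2 ⟨ENNReal.div_ne_top (by simp) (by simp), ENNReal.div_ne_top (by simp)
      (by simp)⟩) (ENNReal.div_ne_top (by simp) (by simp)) (by
      rw [ENNReal.toReal_add (ENNReal.div_ne_top (by simp) (by simp))
        (ENNReal.div_ne_top (by simp) (by simp))]
      norm_num [ENNReal.toReal_div])⟩

lemma isAdmissible_nine : IsAdmissible 9 (54 / 23) := by
  have h0 : (54 / 23 : ℝ≥0∞) ≠ 0 := (ENNReal.div_pos (by simp) (by simp)).ne'
  refine ⟨by norm_num, ?_, ennreal_eq_of_toReal (ENNReal.add_ne_top.2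
    ⟨ENNReal.div_ne_top (by simp) (by simp), ENNReal.div_ne_top (by simp) h0⟩)
    (ENNReal.div_ne_top (by simp) (by simp)) ?_⟩
  · rw [ENNReal.le_div_iff_mul_le (by simp) (by simp)]; norm_num
  · rw [ENNReal.toReal_add (ENNReal.div_ne_top (by simp) (by simp))
      (ENNReal.div_ne_top (by simp) h0)]
    norm_num [ENNReal.toReal_div]

lemma ennreal_le_one_add_pow (x : ℝ≥0∞) {n : ℕ} (hn : n ≠ 0) : x ≤ 1 + x ^ n := by
  rcases le_total x 1 with h | h
  · exact h.trans le_self_add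
  · exact (le_self_pow₀ h hn).trans le_add_self

lemma lintegral_const_mul_one_add_pow_ne_top {s t : ℝ} {N : ℝ → ℝ≥0∞} {c : ℝ≥0∞} (hc : c ≠ ⊤)
    {k : ℕ} (hk : k ≠ 0) (h : eLpNorm N k (volume.restrict (Icc s t)) < ⊤) :
    ∫⁻ τ in Icc s t, c * (1 + N τ ^ k) ≠ ⊤ := by
  have h1 := lintegral_rpow_enorm_lt_top_of_eLpNorm_lt_top (by exact_mod_cast hk) (by simp) h
  simp only [ENNReal.toReal_natCast, ENNReal.rpow_natCast, enorm_eq_self] at h1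
  rw [lintegral_const_mul' _ _ hc, lintegral_add_left measurable_const, lintegral_one,
    Measure.restrict_apply_univ, Real.volume_Icc]
  exact ENNReal.mul_ne_top hc (ENNReal.add_ne_top.2 ⟨ENNReal.ofReal_ne_top, h1.ne⟩)

lemma tendsto_translationModulus_natCast {F : Type*} [NormedAddCommGroup F] {p : ℝ≥0∞}
    (hp : 1 ≤ p) (hp' : p ≠ ⊤) {f : Space3 → F} (hf : MemLp f p volume) :
    Tendsto (fun n : ℕ => translationModulus p f (2 / ((n : ℝ) + 1))) atTop (𝓝 0) :=
  (tendsto_translationModulus_two_div hp hp' hf).comp tendsto_natCast_add_one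

namespace IsNLSSolution
variable {I : Set ℝ} {u : ℝ → Space3 → ℂ} (h : IsNLSSolution I u)
include h

lemma continuousOn_moll_nonlinearity {ψ : Space3 → ℝ} (hψ : IsTest ψ) (x : Space3) :
    ContinuousOn (fun t => moll ψ (fun y => nonlinearity (u t y)) x) I := by
  simpa only [moll_eq_integral_mul] using h.continuousOn_integral_nonlinearity_mul (hψ.comp_sub x)

lemma aemeasurable_lintegral_commutator {ψ : Space3 → ℝ} (hψ : IsTest ψ)
    {w : ℝ → Space3 → ℂ} {s t : ℝ} (hst : Icc s t ⊆ I)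
    (hw1 : ∀ x, ContinuousOn (fun τ => w τ x) I) (hw2 : ∀ τ ∈ I, Continuous (w τ)) :
    AEMeasurable (fun τ => ∫⁻ x, ‖w τ x‖ₑ * ‖nonlinearity (moll ψ (u τ) x)
      - moll ψ (fun y => nonlinearity (u τ y)) x‖ₑ) (volume.restrict (Icc s t)) := by
  have hm := aestronglyMeasurable_uncurry_of_continuousOn (s := s) (t := t)
    (e := fun τ x => ‖w τ x‖ * ‖nonlinearity (moll ψ (u τ) x)
      - moll ψ (fun y => nonlinearity (u τ y)) x‖)
    (fun x => ((hw1 x).norm.mul ((continuous_nonlinearity.comp_continuousOn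
      (h.continuousOn_moll hψ x)).sub (h.continuousOn_moll_nonlinearity hψ x)).norm).mono hst)
    (fun τ hτ => (hw2 τ (hst hτ)).norm.mul ((continuous_nonlinearity.comp (continuous_moll hψ
      ((h.memLp_two (hst hτ)).locallyIntegrable one_le_two))).sub (continuous_moll hψ
      (h.integrable_nonlinearity (hst hτ)).locallyIntegrable)).norm)
  have := hm.enorm.lintegral_prod_right'
  simpa only [Function.uncurry, enorm_mul, enorm_norm] using this

lemma tendsto_lintegral_lap_commutator {s t : ℝ} (hst : Icc s t ⊆ I) :
    Tendsto (fun n : ℕ => ∫⁻ τ in Icc s t, ∫⁻ x, ‖moll (lap (mollifier (n + 1))) (u τ) x‖ₑ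
      * ‖nonlinearity (moll (mollifier (n + 1)) (u τ) x)
        - moll (mollifier (n + 1)) (fun y => nonlinearity (u τ y)) x‖ₑ) atTop (𝓝 0) := by
  obtain ⟨K, hK, hbound⟩ := exists_lintegral_lap_commutator_le
  obtain ⟨M, hM, hM'⟩ := h.exists_eLpNorm_le hst
  have hn := fun n : ℕ => Nat.cast_add_one_pos (α := ℝ) n
  set c : ℝ≥0∞ := 4 * ENNReal.ofReal K * (M ^ 3 + M ^ 4) + 1
  have hc : c ≠ ⊤ := ENNReal.add_ne_top.2 ⟨ENNReal.mul_ne_top (ENNReal.mul_ne_top (by simp)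
    ENNReal.ofReal_ne_top) (ENNReal.add_ne_top.2 ⟨ENNReal.pow_ne_top hM, ENNReal.pow_ne_top hM⟩),
    by simp⟩
  have hc0 : c ≠ 0 := (one_pos.trans_le le_add_self).ne'
  have hsob : ∀ τ ∈ Icc s t, sobolevNorm 6 (u τ) ≠ ⊤ → ∃ G, IsSobolev 2 (u τ) G ∧
      IsSobolev 6 (u τ) G := fun τ hτ h6 => by
    obtain ⟨G, hG⟩ := exists_isSobolev (h.mem_sobolev τ (hst hτ))
    obtain ⟨H, hH⟩ := exists_isSobolev h6.lt_top
    exact ⟨G, hG, hG.weak, hH.memLp, hH.memLp_grad.ae_eq (hH.weak.ae_unique hG.weak)⟩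
  have hfin : ∀ τ, c * (1 + sobolevNorm 6 (u τ) ^ 2) ≠ ⊤ → sobolevNorm 6 (u τ) ≠ ⊤ :=
    fun τ h1 h2 => h1 (by rw [h2]; simp [hc0])
  refine tendsto_lintegral_of_le_of_ne_top (b := fun τ => c * (1 + sobolevNorm 6 (u τ) ^ 2))
    (fun n => ?_) (fun n τ hτ => ?_)
    (lintegral_const_mul_one_add_pow_ne_top hc two_ne_zero
      (h.strichartz s t hst 2 6 isAdmissible_two_six)) fun τ hτ hb => ?_
  · have hψ := isTest_mollifier (hn n)
    exact h.aemeasurable_lintegral_commutator hψ hst (h.continuousOn_moll hψ.lap) fun τ hτ =>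
      continuous_moll hψ.lap ((h.memLp_two hτ).locallyIntegrable one_le_two)
  · by_cases hb : c * (1 + sobolevNorm 6 (u τ) ^ 2) = ⊤
    · rw [hb]; exact le_top
    obtain ⟨G, h2, h6⟩ := hsob τ hτ (hfin τ hb)
    refine (hbound _ G h2 h6 _ (hn n)).trans ?_
    obtain ⟨b1, b2, b6, -⟩ := hM' τ hτ
    have g2 : eLpNorm G 2 volume ≤ M := by
      rw [h2.sobolevNorm_eq] at b1; exact le_add_self.trans b1
    set N := sobolevNorm 6 (u τ)
    have g6 : eLpNorm G 6 volume ≤ N := by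
      simp only [N]; rw [h6.sobolevNorm_eq]; exact le_add_self
    have t6 := (translationModulus_le (p := 6) (by norm_num) h6.memLp_grad.1
      (2 / ((n : ℝ) + 1))).trans (mul_le_mul' le_rfl g6)
    calc _ ≤ ENNReal.ofReal K * (2 * N) * (M * M ^ 2 + N * M ^ 4) := by gcongr
      _ = 2 * ENNReal.ofReal K * (M ^ 3 * N + M ^ 4 * N ^ 2) := by ring
      _ ≤ 2 * ENNReal.ofReal K * (M ^ 3 * (1 + N ^ 2) + M ^ 4 * (1 + N ^ 2)) := by
          have := ennreal_le_one_add_pow N two_ne_zero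
          gcongr
          exact le_add_self
      _ = 2 * ENNReal.ofReal K * (M ^ 3 + M ^ 4) * (1 + N ^ 2) := by ring
      _ ≤ c * (1 + N ^ 2) := by
          gcongr
          refine le_trans ?_ le_self_add
          gcongr
          norm_num
  · obtain ⟨G, h2, h6⟩ := hsob τ hτ (hfin τ hb)
    have h1 := ENNReal.Tendsto.mul_const (ENNReal.Tendsto.const_mul
      (tendsto_translationModulus_natCast (by norm_num) (by simp) h6.memLp_grad)
      (Or.inr (ENNReal.ofReal_ne_top (r := K)))) (b := eLpNorm G 2 volume
        * eLpNorm (u τ) 6 volume ^ 2 + eLpNorm G 6 volume * eLpNorm (u τ) 6 volume ^ 4)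
      (Or.inr (ENNReal.add_ne_top.2 ⟨ENNReal.mul_ne_top h2.memLp_grad.2.ne
        (ENNReal.pow_ne_top h6.memLp.2.ne), ENNReal.mul_ne_top h6.memLp_grad.2.ne
        (ENNReal.pow_ne_top h6.memLp.2.ne)⟩))
    rw [mul_zero, zero_mul] at h1
    exact tendsto_of_tendsto_of_tendsto_of_le_of_le tendsto_const_nhds h1 (fun _ => zero_le)
      fun n => hbound _ G h2 h6 _ (hn n)

lemma tendsto_lintegral_nonlinearity_commutator {s t : ℝ} (hst : Icc s t ⊆ I) :
    Tendsto (fun n : ℕ => ∫⁻ τ in Icc s t, ∫⁻ x,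
      ‖nonlinearity (moll (mollifier (n + 1)) (u τ) x)‖ₑ
      * ‖nonlinearity (moll (mollifier (n + 1)) (u τ) x)
        - moll (mollifier (n + 1)) (fun y => nonlinearity (u τ y)) x‖ₑ) atTop (𝓝 0) := by
  obtain ⟨C, hC, hsob⟩ := exists_sobolev_le (p := 54 / 23) (p' := 54 / 5)
    (by rw [le_div_iff₀ (by norm_num)]; norm_num) (by push_cast; norm_num)
  have e1 : ((54 / 23 : NNReal) : ℝ≥0∞) = 54 / 23 := by
    rw [ENNReal.coe_div (by norm_num)]; simp
  have e2 : ((54 / 5 : NNReal) : ℝ≥0∞) = 54 / 5 := by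
    rw [ENNReal.coe_div (by norm_num)]; simp
  rw [e1, e2] at hsob
  obtain ⟨M, hM, hM'⟩ := h.exists_eLpNorm_le hst
  have hn := fun n : ℕ => Nat.cast_add_one_pos (α := ℝ) n
  set D := ENNReal.ofReal C
  have hD : D ≠ ⊤ := ENNReal.ofReal_ne_top
  set c : ℝ≥0∞ := 8 * M * (32 * M ^ 5 + 512 * D ^ 9) + 1
  have hc : c ≠ ⊤ := ENNReal.add_ne_top.2 ⟨ENNReal.mul_ne_top (ENNReal.mul_ne_top (by simp) hM)
    (ENNReal.add_ne_top.2 ⟨ENNReal.mul_ne_top (by simp) (ENNReal.pow_ne_top hM),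
      ENNReal.mul_ne_top (by simp) (ENNReal.pow_ne_top hD)⟩), by simp⟩
  have hc0 : c ≠ 0 := (one_pos.trans_le le_add_self).ne'
  have hbound := fun (τ : ℝ) (hτ : τ ∈ Icc s t) (n : ℕ) => lintegral_nonlinearity_commutator_le
    (h.memLp_two (hst hτ)) (h.memLp_six (hst hτ)) (hn n)
  have hlp : ∀ τ, sobolevNorm (54 / 23) (u τ) ≠ ⊤ →
      eLpNorm (u τ) (54 / 5) volume ≤ D * sobolevNorm (54 / 23) (u τ) := fun τ hτ => by
    obtain ⟨G, hG⟩ := exists_isSobolev hτ.lt_top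
    rw [hG.sobolevNorm_eq]
    exact (hsob _ G hG).trans (mul_le_mul' le_rfl le_add_self)
  have hfin : ∀ τ, c * (1 + sobolevNorm (54 / 23) (u τ) ^ 9) ≠ ⊤ →
      sobolevNorm (54 / 23) (u τ) ≠ ⊤ := fun τ h1 h2 => h1 (by rw [h2]; simp [hc0])
  refine tendsto_lintegral_of_le_of_ne_top (b := fun τ => c * (1 + sobolevNorm (54 / 23) (u τ) ^ 9))
    (fun n => ?_) (fun n τ hτ => ?_)
    (lintegral_const_mul_one_add_pow_ne_top hc (by norm_num : 9 ≠ 0)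
      (h.strichartz s t hst 9 (54 / 23) isAdmissible_nine)) fun τ hτ hb => ?_
  · have hψ := isTest_mollifier (hn n)
    exact h.aemeasurable_lintegral_commutator hψ hst
      (w := fun τ x => nonlinearity (moll (mollifier (n + 1)) (u τ) x))
      (fun x => continuous_nonlinearity.comp_continuousOn (h.continuousOn_moll hψ x)) fun τ hτ =>
      continuous_nonlinearity.comp
        (continuous_moll hψ ((h.memLp_two hτ).locallyIntegrable one_le_two))
  · by_cases hb : c * (1 + sobolevNorm (54 / 23) (u τ) ^ 9) = ⊤
    · rw [hb]; exact le_top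
    refine (hbound τ hτ n).trans ?_
    have hl := hlp τ (hfin τ hb)
    obtain ⟨-, b2, b6, -⟩ := hM' τ hτ
    set N := sobolevNorm (54 / 23) (u τ)
    have t6 := (translationModulus_le (p := 6) (by norm_num) (h.memLp_two (hst hτ)).1
      (2 / ((n : ℝ) + 1))).trans (mul_le_mul' le_rfl b6)
    calc _ ≤ 4 * (2 * M) * (32 * M ^ 5 + 512 * (D * N) ^ 9) := by gcongr
      _ = 8 * M * (32 * M ^ 5 * 1 + 512 * D ^ 9 * N ^ 9) := by ring
      _ ≤ 8 * M * (32 * M ^ 5 * (1 + N ^ 9) + 512 * D ^ 9 * (1 + N ^ 9)) := by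
          gcongr
          · exact le_self_add
          · exact le_add_self
      _ = 8 * M * (32 * M ^ 5 + 512 * D ^ 9) * (1 + N ^ 9) := by ring
      _ ≤ c * (1 + N ^ 9) := by
          gcongr
          exact le_self_add
  · have hl := hlp τ (hfin τ hb)
    have h1 := ENNReal.Tendsto.mul_const (ENNReal.Tendsto.const_mul (a := 4)
      (tendsto_translationModulus_natCast (by norm_num) (by simp) (h.memLp_six (hst hτ)))
      (Or.inr (by simp))) (b := 32 * eLpNorm (u τ) 6 volume ^ 5
        + 512 * eLpNorm (u τ) (54 / 5) volume ^ 9)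
      (Or.inr (ENNReal.add_ne_top.2 ⟨ENNReal.mul_ne_top (by simp)
        (ENNReal.pow_ne_top (h.memLp_six (hst hτ)).2.ne), ENNReal.mul_ne_top (by simp)
        (ENNReal.pow_ne_top (ne_top_of_le_ne_top (ENNReal.mul_ne_top hD (hfin τ hb)) hl))⟩))
    rw [mul_zero, zero_mul] at h1
    exact tendsto_of_tendsto_of_tendsto_of_le_of_le tendsto_const_nhds h1 (fun _ => zero_le)
      (hbound τ hτ)

/-- The energy of the mollified solution varies in time by at most the integrated commutator
terms. -/
lemma enorm_energy_sub_le {s t : ℝ} (hs : s ≤ t) (hst : Icc s t ⊆ I) {ψ : Space3 → ℝ}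
    (hψ : IsTest ψ) : ‖energy (moll ψ (u t)) - energy (moll ψ (u s))‖ₑ
      ≤ (∫⁻ τ in Icc s t, ∫⁻ x, ‖moll (lap ψ) (u τ) x‖ₑ * ‖nonlinearity (moll ψ (u τ) x)
        - moll ψ (fun y => nonlinearity (u τ y)) x‖ₑ)
      + ∫⁻ τ in Icc s t, ∫⁻ x, ‖nonlinearity (moll ψ (u τ) x)‖ₑ * ‖nonlinearity (moll ψ (u τ) x)
        - moll ψ (fun y => nonlinearity (u τ y)) x‖ₑ := by
  have hsI := hst (left_mem_Icc.2 hs)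
  have htI := hst (right_mem_Icc.2 hs)
  obtain ⟨M, hM, hM'⟩ := h.exists_eLpNorm_le hst
  obtain ⟨K, hK, hK'⟩ := exists_lintegral_energyRate_le hψ hM
  have key := integral_sub_integral_eq (e := fun τ => energyDensity ψ (u τ))
    (e' := fun τ => energyRate ψ (u τ)) hs
    (fun x τ hτ => h.hasDerivAt_energyDensity hψ (hst hτ) x)
    (fun x => ((continuousOn_finsetSum _ fun j _ => (h.continuousOn_moll (hψ.pd j) x).inner
      (h.continuousOn_mollDeriv (hψ.pd j) x)).add ((continuous_nonlinearity.comp_continuousOn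
      (h.continuousOn_moll hψ x)).inner (h.continuousOn_mollDeriv hψ x))).mono hst)
    (fun τ hτ => continuous_energyRate hψ (h.memLp_two (hst hτ)) (h.memLp_six (hst hτ))) hK
    (fun τ hτ => hK' _ (h.memLp_two (hst hτ)) (h.memLp_six (hst hτ)) (hM' τ hτ).2.1
      (hM' τ hτ).2.2.1 (hM' τ hτ).2.2.2)
    (integrable_energyDensity hψ (h.memLp_two hsI) (h.memLp_six hsI))
    (integrable_energyDensity hψ (h.memLp_two htI) (h.memLp_six htI))
  rw [integral_energyDensity hψ (h.memLp_two hsI) (h.memLp_six hsI),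
    integral_energyDensity hψ (h.memLp_two htI) (h.memLp_six htI)] at key
  rw [key, ← lintegral_add_left' (h.aemeasurable_lintegral_commutator hψ hst
    (h.continuousOn_moll hψ.lap) fun τ hτ => continuous_moll hψ.lap
      ((h.memLp_two hτ).locallyIntegrable one_le_two))]
  exact (enorm_integral_le_lintegral_enorm _).trans (setLIntegral_mono' measurableSet_Icc
    fun τ hτ => enorm_integral_energyRate_le hψ (h.memLp_two (hst hτ)) (h.memLp_six (hst hτ)))

lemma energy_eq_of_le {s t : ℝ} (hs : s ≤ t) (hst : Icc s t ⊆ I) : energy (u t) = energy (u s) := by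
  have htend : ∀ r ∈ I, Tendsto (fun n : ℕ => energy (moll (mollifier (n + 1)) (u r))) atTop
      (𝓝 (energy (u r))) := fun r hr => by
    obtain ⟨G, hG⟩ := exists_isSobolev (h.mem_sobolev r hr)
    exact tendsto_energy_mollifier hG (h.memLp_six hr)
  have h1 := (htend t (hst (right_mem_Icc.2 hs))).sub (htend s (hst (left_mem_Icc.2 hs)))
  have h2 := (h.tendsto_lintegral_lap_commutator hst).add
    (h.tendsto_lintegral_nonlinearity_commutator hst)
  rw [add_zero] at h2
  have h3 : Tendsto (fun n : ℕ => ‖energy (moll (mollifier (n + 1)) (u t))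
      - energy (moll (mollifier (n + 1)) (u s))‖ₑ) atTop (𝓝 0) :=
    tendsto_of_tendsto_of_tendsto_of_le_of_le tendsto_const_nhds h2 (fun _ => zero_le) fun n =>
      h.enorm_energy_sub_le hs hst (isTest_mollifier (Nat.cast_add_one_pos (α := ℝ) n))
  have h4 := tendsto_nhds_unique h1.enorm h3
  rw [enorm_eq_zero] at h4
  linarith

/-- Conservation of energy. -/
theorem energy_eq {t : ℝ} (ht : t ∈ I) : energy (u t) = energy (u 0) := by
  rcases le_total 0 t with h0 | h0
  · exact h.energy_eq_of_le h0 (h.ordConnected.out h.zero_mem ht)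
  · exact (h.energy_eq_of_le h0 (h.ordConnected.out ht h.zero_mem)).symm

end IsNLSSolution

/-! ### The family of rescaled bubbles -/

lemma bubble_eq (μ : ℝ) (x : Space3) :
    bubble μ x = ((√μ * realGroundState (μ • x) : ℝ) : ℂ) := by
  rw [bubble, groundState_eq]; push_cast; rfl

lemma norm_bubble (μ : ℝ) (x : Space3) : ‖bubble μ x‖ = √μ * realGroundState (μ • x) := by
  rw [bubble_eq, Complex.norm_real, Real.norm_of_nonneg
    (mul_nonneg (Real.sqrt_nonneg _) (realGroundState_pos _).le)]

lemma pd_bubble {μ : ℝ} (hμ : 0 < μ) (j : Fin 3) (x : Space3) :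
    pd j (bubble μ) x = ((-(μ * ‖bubble μ x‖ ^ 3 / 3) * x j : ℝ) : ℂ) := by
  have h := congrFun (congrArg WithLp.ofLp (cgrad_bubble μ x)) j
  rw [cgrad_apply] at h
  rw [h, norm_bubble]
  simp only [PiLp.smul_apply, cgrad_apply, pd_groundState, smul_eq_mul, Complex.real_smul]
  have e : (√μ) ^ 3 = √μ * μ := by rw [pow_succ', Real.sq_sqrt hμ.le]
  rw [← Complex.ofReal_mul, ← Complex.ofReal_mul, mul_pow, e]
  congr 1
  ring

lemma bubble_sq {μ : ℝ} (hμ : 0 < μ) (x : Space3) :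
    ‖bubble μ x‖ ^ 2 * (1 / μ + μ * (‖x‖ ^ 2 / 3)) = 1 := by
  have h := realGroundState_sq (μ • x)
  rw [norm_smul, Real.norm_of_nonneg hμ.le] at h
  have h1 : μ * (1 / μ) = 1 := by field_simp
  rw [norm_bubble, mul_pow, Real.sq_sqrt hμ.le]
  linear_combination h + realGroundState (μ • x) ^ 2 * h1

/-- Here `p` and `w` are the moduli of the bubbles of frequencies `μ` and `ν` at a point with
`‖x‖² / 3 = s`, and `μ p³`, up to the factor `‖x‖ / 3`, is the size of the gradient. -/
lemma bubble_cube_sub_le {μ ν p w s : ℝ} (hν : 0 < ν) (hp : 0 ≤ p) (hw : 0 < w) (hs : 0 ≤ s)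
    (hpe : p ^ 2 * (1 / μ + μ * s) = 1) (hwe : w ^ 2 * (1 / ν + ν * s) = 1) {ε : ℝ}
    (hε : |μ - ν| = ε * ν) (hε' : ε ≤ 1 / 2) :
    |μ * p ^ 3 - ν * w ^ 3| ≤ 36 * ε * (ν * w ^ 3) := by
  have hε0 : 0 ≤ ε := by
    by_contra h
    have := abs_nonneg (μ - ν)
    rw [hε] at this
    exact absurd (mul_neg_of_neg_of_pos (not_le.1 h) hν) (not_lt.2 this)
  obtain ⟨h1, h2⟩ := abs_le.1 hε.le
  have hμ1 : ν / 2 ≤ μ := by nlinarith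
  have hμ2 : μ ≤ 3 / 2 * ν := by nlinarith
  have hμ : 0 < μ := by linarith
  have i1 : 1 / μ ≤ 2 * (1 / ν) := by rw [div_le_iff₀ hμ]; field_simp; linarith
  have i2 : 1 / ν ≤ 3 / 2 * (1 / μ) := by rw [div_le_iff₀ hν]; field_simp; linarith
  have q0 : 0 < 1 / ν + ν * s := by positivity
  have q1 : 1 / ν + ν * s ≤ 2 * (1 / μ + μ * s) := by
    have := mul_le_mul_of_nonneg_right hμ1 hs
    have : 0 < 1 / μ := by positivity
    linarith
  have q2 : |(1 / ν + ν * s) - (1 / μ + μ * s)| ≤ 2 * ε * (1 / ν + ν * s) := by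
    have e : (1 / ν + ν * s) - (1 / μ + μ * s) = (μ - ν) * (1 / (μ * ν) - s) := by
      field_simp; ring
    have h3 : |1 / (μ * ν) - s| ≤ 1 / (μ * ν) + s :=
      (abs_sub _ _).trans (by rw [abs_of_nonneg hs, abs_of_pos (by positivity)])
    rw [e, abs_mul, hε]
    calc ε * ν * |1 / (μ * ν) - s| ≤ ε * ν * (1 / (μ * ν) + s) := by gcongr
      _ = ε * (1 / μ + ν * s) := by field_simp
      _ ≤ ε * (2 * (1 / ν) + 2 * (ν * s)) := by
          have : 0 ≤ ν * s := by positivity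
          exact mul_le_mul_of_nonneg_left (by linarith) hε0
      _ = _ := by ring
  have p2 : p ^ 2 ≤ 2 * w ^ 2 := by
    have : p ^ 2 * (1 / ν + ν * s) ≤ 2 := by nlinarith [sq_nonneg p]
    have h4 : p ^ 2 * (1 / ν + ν * s) ≤ 2 * w ^ 2 * (1 / ν + ν * s) := by linarith
    exact le_of_mul_le_mul_right h4 q0
  have hpw : p ≤ 2 * w := by
    refine le_of_pow_le_pow_left₀ two_ne_zero (by positivity) ?_
    rw [mul_pow]; nlinarith [sq_nonneg w]
  have d2 : |p ^ 2 - w ^ 2| ≤ 4 * ε * w ^ 2 := by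
    have e : p ^ 2 - w ^ 2 = p ^ 2 * w ^ 2 * ((1 / ν + ν * s) - (1 / μ + μ * s)) := by
      linear_combination (-(p ^ 2)) * hwe + w ^ 2 * hpe
    rw [e, abs_mul, abs_of_nonneg (by positivity)]
    calc _ ≤ p ^ 2 * w ^ 2 * (2 * ε * (1 / ν + ν * s)) := by gcongr
      _ = 2 * ε * p ^ 2 := by linear_combination (2 * ε * p ^ 2) * hwe
      _ ≤ 2 * ε * (2 * w ^ 2) := by gcongr
      _ = _ := by ring
  have d1 : |p - w| ≤ 4 * ε * w := by
    have e : |p ^ 2 - w ^ 2| = |p - w| * (p + w) := by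
      rw [show p ^ 2 - w ^ 2 = (p - w) * (p + w) by ring, abs_mul,
        abs_of_nonneg (by positivity : 0 ≤ p + w)]
    have h5 : |p - w| * w ≤ 4 * ε * w * w := by
      have := mul_nonneg (abs_nonneg (p - w)) hp
      nlinarith
    exact le_of_mul_le_mul_right h5 hw
  have e : μ * p ^ 3 - ν * w ^ 3 = (μ - ν) * p ^ 3 + ν * ((p - w) * (p ^ 2 + p * w + w ^ 2)) := by
    ring
  rw [e]
  refine (abs_add_le _ _).trans ?_
  rw [abs_mul, abs_mul, abs_mul, hε, abs_of_nonneg (by positivity : 0 ≤ p ^ 3), abs_of_pos hν,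
    abs_of_nonneg (by positivity : 0 ≤ p ^ 2 + p * w + w ^ 2)]
  calc _ ≤ ε * ν * (2 * w) ^ 3 + ν * (4 * ε * w * ((2 * w) ^ 2 + 2 * w * w + w ^ 2)) := by gcongr
    _ = _ := by ring

lemma lpNorm_cgrad_bubble_sub_le {μ ν : ℝ} (hν : 0 < ν) (h : |μ / ν - 1| ≤ 1 / 2) :
    lpNorm (fun x => cgrad (bubble μ) x - cgrad (bubble ν) x) 2 volume
      ≤ 36 * |μ / ν - 1| * √bubbleMass := by
  have hε : |μ - ν| = |μ / ν - 1| * ν := by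
    rw [← abs_of_pos hν, ← abs_mul, abs_of_pos hν]; congr 1; field_simp
  set ε := |μ / ν - 1|
  have hε0 : 0 ≤ ε := abs_nonneg _
  have hμ : 0 < μ := by
    have := (abs_le.1 hε.le).1
    nlinarith
  have hpt : ∀ x, ‖cgrad (bubble μ) x - cgrad (bubble ν) x‖ ≤ ‖(36 * ε) • cgrad (bubble ν) x‖ :=
    fun x => by
      have hw : 0 < ‖bubble ν x‖ := by
        rw [norm_bubble]; exact mul_pos (Real.sqrt_pos.2 hν) (realGroundState_pos _)
      have key := bubble_cube_sub_le hν (norm_nonneg (bubble μ x)) hw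
        (by positivity : 0 ≤ ‖x‖ ^ 2 / 3) (bubble_sq hμ x) (bubble_sq hν x) hε h
      rw [EuclideanSpace.norm_eq, EuclideanSpace.norm_eq]
      refine Real.sqrt_le_sqrt (Finset.sum_le_sum fun j _ => pow_le_pow_left₀ (norm_nonneg _) ?_ 2)
      rw [PiLp.sub_apply, PiLp.smul_apply, cgrad_apply, cgrad_apply, pd_bubble hμ, pd_bubble hν,
        ← Complex.ofReal_sub, Complex.real_smul, norm_mul, Complex.norm_real, Complex.norm_real,
        Complex.norm_real, Real.norm_eq_abs, Real.norm_eq_abs, Real.norm_eq_abs,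
        abs_of_nonneg (by positivity : 0 ≤ 36 * ε)]
      have e1 : -(μ * ‖bubble μ x‖ ^ 3 / 3) * x j - -(ν * ‖bubble ν x‖ ^ 3 / 3) * x j
          = (μ * ‖bubble μ x‖ ^ 3 - ν * ‖bubble ν x‖ ^ 3) * (-(x j) / 3) := by ring
      have e2 : -(ν * ‖bubble ν x‖ ^ 3 / 3) * x j = (ν * ‖bubble ν x‖ ^ 3) * (-(x j) / 3) := by ring
      rw [e1, e2, abs_mul, abs_mul, abs_of_nonneg (by positivity : 0 ≤ ν * ‖bubble ν x‖ ^ 3),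
        ← mul_assoc]
      gcongr
  have hm := (memLp_cgrad_bubble hν.ne').const_smul (36 * ε)
  have h2 : lpNorm (cgrad (bubble ν)) 2 volume = √bubbleMass := by
    rw [← lpNorm_cgrad_bubble_sq hν, Real.sqrt_sq lpNorm_nonneg]
  have h3 := lpNorm_mono_real hm.norm hpt
  have h4 : lpNorm (fun x => ‖((36 * ε) • cgrad (bubble ν)) x‖) 2 volume
      = 36 * ε * √bubbleMass := by
    rw [lpNorm_norm hm.1, lpNorm_const_smul, h2]
    congr 1
    rw [coe_nnnorm, Real.norm_of_nonneg (by positivity)]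
  exact h3.trans_eq h4

lemma sum_pd_pd_groundState (x : Space3) :
    ∑ j, pd j (pd j groundState) x = ((-(realGroundState x ^ 5) : ℝ) : ℂ) := by
  have h : ∀ j, pd j (pd j groundState) x = ((-(realGroundState x ^ 3 / 3)
      + x j ^ 2 * realGroundState x ^ 5 / 3 : ℝ) : ℂ) := fun j => by
    have e : pd j groundState = fun y => ((-(y j * realGroundState y ^ 3 / 3) : ℝ) : ℂ) :=
      funext fun y => pd_groundState j y
    have h1 : HasFDerivAt (fun y : Space3 => y j) (EuclideanSpace.proj j : Space3 →L[ℝ] ℝ) x :=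
      (EuclideanSpace.proj j : Space3 →L[ℝ] ℝ).hasFDerivAt
    have h2 := ((h1.mul ((hasFDerivAt_realGroundState x).pow 3)).mul_const (1 / 3 : ℝ)).neg
    have h3 : HasFDerivAt (fun y : Space3 => -(y j * realGroundState y ^ 3 / 3)) _ x :=
      h2.congr_of_eventuallyEq (Eventually.of_forall fun y => by
        simp only [Pi.neg_apply, Pi.mul_apply]; ring)
    rw [e, pd_ofReal h3.differentiableAt, pd, h3.fderiv]
    congr 1
    simp [EuclideanSpace.inner_single_right]
    ring
  simp only [h]
  rw [← Complex.ofReal_sum, Finset.sum_add_distrib, ← Finset.sum_div, ← Finset.sum_mul]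
  congr 1
  have h4 := EuclideanSpace.norm_sq_eq x
  simp only [Real.norm_eq_abs, sq_abs] at h4
  rw [← h4, Finset.sum_const, Finset.card_univ, Fintype.card_fin]
  simp only [nsmul_eq_mul, Nat.cast_ofNat]
  linear_combination (realGroundState x ^ 3) * realGroundState_sq x

/-- The bubbles solve `ΔW + W⁵ = 0`, tested against smooth functions. -/
lemma integral_bubble_mul_lap {μ : ℝ} (hμ : 0 < μ) {φ : Space3 → ℝ} (hφ : IsTest φ) :
    ∫ x, bubble μ x * (lap φ x : ℂ)
      = -∫ x, ((‖bubble μ x‖ ^ 4 : ℝ) : ℂ) * bubble μ x * (φ x : ℂ) := by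
  have hc : ContDiff ℝ ∞ (bubble μ) := contDiff_bubble μ
  have e1 : ∀ j, pd j (bubble μ) = fun y => (√μ * μ) • pd j groundState (μ • y) := fun j => by
    ext x
    have h := congrFun (congrArg WithLp.ofLp (cgrad_bubble μ x)) j
    rw [cgrad_apply] at h
    simpa [cgrad_apply, mul_assoc] using h
  have hW : ∀ j, ContDiff ℝ ∞ (pd j groundState) := fun j =>
    (contDiff_groundState.fderiv_right (m := ∞) (by simp)).clm_apply contDiff_const
  have hcj : ∀ j, ContDiff ℝ ∞ (pd j (bubble μ)) := fun j => by
    rw [e1]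
    exact ((hW j).comp (contDiff_const_smul μ)).const_smul (√μ * μ)
  have e2 : ∀ j x, pd j (pd j (bubble μ)) x = (√μ * μ ^ 2) • pd j (pd j groundState) (μ • x) :=
    fun j x => by
      have hd : DifferentiableAt ℝ (fun y => pd j groundState (μ • y)) x :=
        ((hW j).comp (contDiff_const_smul μ)).differentiable (by simp) x
      have := pd_comp_smul (pd j groundState) j μ x
      rw [pd] at this
      rw [e1, pd, fderiv_fun_const_smul hd, _root_.smul_apply, this, smul_smul]
      congr 1
      ring
  have ibp : ∀ j, ∫ x, pd j (pd j φ) x • bubble μ x = ∫ x, φ x • pd j (pd j (bubble μ)) x :=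
    fun j => by
      rw [integral_pd_smul_eq (hφ.pd j) (contDiff_one_of_infty hc),
        integral_pd_smul_eq hφ (contDiff_one_of_infty (hcj j)), neg_neg]
  have i1 : ∀ j, Integrable fun x => pd j (pd j φ) x • bubble μ x := fun j =>
    ((hφ.pd j).pd j).integrable_smul hc.continuous.locallyIntegrable
  have hcjj : ∀ j, Continuous (pd j (pd j (bubble μ))) := fun j =>
    continuous_pd (contDiff_one_of_infty (hcj j)) j
  have i2 : ∀ j, Integrable fun x => φ x • pd j (pd j (bubble μ)) x := fun j =>
    hφ.integrable_smul (hcjj j).locallyIntegrable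
  calc ∫ x, bubble μ x * (lap φ x : ℂ) = ∫ x, ∑ j, pd j (pd j φ) x • bubble μ x := by
        refine integral_congr_ae (Eventually.of_forall fun x => ?_)
        simp only [Complex.real_smul, lap, Complex.ofReal_sum, Finset.mul_sum, mul_comm]
    _ = ∫ x, ∑ j, φ x • pd j (pd j (bubble μ)) x := by
        rw [integral_finsetSum _ fun j _ => i1 j, integral_finsetSum _ fun j _ => i2 j]
        simp only [ibp]
    _ = _ := by
        rw [← integral_neg]
        refine integral_congr_ae (Eventually.of_forall fun x => ?_)
        beta_reduce
        simp only [e2]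
        rw [← Finset.smul_sum, ← Finset.smul_sum, sum_pd_pd_groundState, norm_bubble, bubble_eq,
          Complex.real_smul, Complex.real_smul]
        have e : (√μ) ^ 4 = μ ^ 2 := by
          rw [show (4 : ℕ) = 2 * 2 from rfl, pow_mul, Real.sq_sqrt hμ.le]
        rw [mul_pow, e]
        push_cast
        ring

/-! ### Testing against rescaled bumps -/

/-- The pairing of `f` with the bump living at scale `1 / a`, normalised as the dual of `Ḣ¹`. -/
noncomputable def bumpTransform (f : Space3 → ℂ) (a : ℝ) : ℂ := ∫ x, f x * (dilate a bump x : ℂ)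

/-- The time derivative of `bumpTransform (u t) a` along a solution, where `f = u t`. -/
noncomputable def bumpTransformDeriv (f : Space3 → ℂ) (a : ℝ) : ℂ :=
  Complex.I * ((∫ x, f x * (lap (dilate a bump) x : ℂ))
    - ∫ x, nonlinearity (f x) * (dilate a bump x : ℂ))

lemma lap_dilate {φ : Space3 → ℝ} (hφ : IsTest φ) {a : ℝ} (ha : 0 < a) (x : Space3) :
    lap (dilate a φ) x = a ^ 2 * dilate a (lap φ) x := by
  have h1 : ∀ {ψ : Space3 → ℝ}, IsTest ψ → ∀ j,
      pd j (dilate a ψ) = fun y => a * dilate a (pd j ψ) y := fun {ψ} hψ j => by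
      ext y
      have e : dilate a ψ = fun y => (√a * a ^ 2) * ψ (a • y) := rfl
      rw [e, pd_const_mul (hψ.comp_smul ha.ne').differentiable, pd_comp_smul, dilate, smul_eq_mul]
      ring
  simp only [lap, dilate, Finset.mul_sum]
  refine Finset.sum_congr rfl fun j _ => ?_
  rw [h1 hφ, pd_const_mul ((hφ.pd j).dilate ha).differentiable, h1 (hφ.pd j)]
  simp only [dilate]
  ring

lemma continuousOn_integral_mul_dilate {f : Space3 → ℂ} (hf : LocallyIntegrable f volume)
    {φ : Space3 → ℝ} (hφ : IsTest φ) :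
    ContinuousOn (fun a => ∫ x, f x * (dilate a φ x : ℂ)) (Ioi 0) := by
  intro b hb
  have hb' : 0 < b := hb
  obtain ⟨M, hM⟩ := hφ.continuous.bounded_above_of_compact_support hφ.hasCompactSupport
  obtain ⟨R, hR⟩ := hφ.hasCompactSupport.isBounded.subset_closedBall (0 : Space3)
  have hM0 : 0 ≤ M := (norm_nonneg _).trans (hM 0)
  have hN : Ioo (b / 2) (2 * b) ∈ 𝓝 b := Ioo_mem_nhds (by linarith) (by linarith)
  refine (continuousAt_of_dominated (bound := (Metric.closedBall (0 : Space3) (2 * R / b)).indicator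
    fun x => ‖f x‖ * (√(2 * b) * (2 * b) ^ 2 * M)) ?_ ?_ ?_ ?_).continuousWithinAt
  · filter_upwards [hN] with a ha
    exact hf.aestronglyMeasurable.mul
      ((hφ.dilate (by linarith [ha.1])).memLp_ofReal 1).1
  · filter_upwards [hN] with a ha
    have ha0 : 0 < a := by linarith [ha.1]
    refine Eventually.of_forall fun x => ?_
    by_cases hx : φ (a • x) = 0
    · rw [dilate, hx, mul_zero, Complex.ofReal_zero, mul_zero, norm_zero]
      exact indicator_nonneg (fun x _ => by positivity) x
    · have h1 := mem_closedBall_zero_iff.1 (hR (subset_tsupport φ hx))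
      rw [norm_smul, Real.norm_of_nonneg ha0.le] at h1
      have h2 : x ∈ Metric.closedBall (0 : Space3) (2 * R / b) := by
        rw [mem_closedBall_zero_iff, le_div_iff₀ hb']
        nlinarith [ha.1, norm_nonneg x]
      rw [indicator_of_mem h2, norm_mul, Complex.norm_real, dilate, norm_mul, norm_mul,
        Real.norm_of_nonneg (Real.sqrt_nonneg a), Real.norm_of_nonneg (by positivity : 0 ≤ a ^ 2)]
      have h3 := hM (a • x)
      have h4 := ha.2.le
      gcongr
  · rw [integrable_indicator_iff Metric.isClosed_closedBall.measurableSet]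
    exact (hf.integrableOn_isCompact (isCompact_closedBall _ _)).norm.mul_const _
  · refine Eventually.of_forall fun x => ContinuousAt.mul continuousAt_const ?_
    refine Complex.continuous_ofReal.continuousAt.comp (Continuous.continuousAt ?_)
    have := hφ.continuous
    unfold dilate
    fun_prop

lemma continuousOn_bumpTransform {f : Space3 → ℂ} (hf : LocallyIntegrable f volume) :
    ContinuousOn (bumpTransform f) (Ioi 0) := continuousOn_integral_mul_dilate hf isTest_bump

lemma continuousOn_bumpTransformDeriv {f : Space3 → ℂ} (h2 : MemLp f 2 volume)
    (h6 : MemLp f 6 volume) : ContinuousOn (bumpTransformDeriv f) (Ioi 0) := by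
  have h1 := continuousOn_integral_mul_dilate (h2.locallyIntegrable one_le_two) isTest_bump.lap
  have h3 := continuousOn_integral_mul_dilate (integrable_nonlinearity h2 h6).locallyIntegrable
    isTest_bump
  have h4 : ContinuousOn (fun a : ℝ => ((a ^ 2 : ℝ) : ℂ)) (Ioi 0) := by fun_prop
  refine ((continuousOn_const (c := Complex.I)).mul ((h4.mul h1).sub h3)).congr fun a ha => ?_
  rw [bumpTransformDeriv]
  simp only [lap_dilate isTest_bump ha]
  congr 2
  rw [Pi.mul_apply, ← integral_const_mul]
  refine integral_congr_ae (Eventually.of_forall fun x => ?_)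
  push_cast
  ring

/-- The norm of the bump in the dual of `L⁶`. -/
noncomputable def bumpNorm : ℝ := lpNorm (fun x => (bump x : ℂ)) (6 / 5) volume

lemma bumpNorm_nonneg : 0 ≤ bumpNorm := lpNorm_nonneg

lemma norm_bumpTransform_le {f : Space3 → ℂ} (hf : MemLp f 6 volume) {a : ℝ} (ha : 0 < a) :
    ‖bumpTransform f a‖ ≤ lpNorm f 6 volume * bumpNorm := by
  have := norm_integral_mul_le hf ((isTest_bump.dilate ha).memLp_ofReal (6 / 5))
  rwa [lpNorm_dilate_six_fifths isTest_bump ha] at this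

lemma integrable_mul_dilate {f : Space3 → ℂ} (hf : MemLp f 6 volume) {a : ℝ} (ha : 0 < a) :
    Integrable fun x => f x * (dilate a bump x : ℂ) :=
  memLp_one_iff_integrable.1 (((isTest_bump.dilate ha).memLp_ofReal (6 / 5)).mul hf)

lemma bumpTransform_bubble {a μ : ℝ} (ha : 0 < a) (hμ : 0 < μ) :
    bumpTransform (bubble μ) a = bumpPairing (a / μ) := by
  rw [bumpTransform, integral_bubble_mul_dilate _ ha hμ, integral_groundState_mul_dilate]

lemma norm_bumpTransform_sub_le {f : Space3 → ℂ} (hf : MemLp f 6 volume) {a μ : ℝ} (ha : 0 < a)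
    (hμ : 0 < μ) (e : ℂ) : ‖bumpTransform f a - e * bumpPairing (a / μ)‖
      ≤ lpNorm (fun x => f x - e * bubble μ x) 6 volume * bumpNorm := by
  have hb := memLp_bubble hμ.ne'
  have h := norm_bumpTransform_le (hf.sub (hb.const_smul e)) ha
  refine le_trans (le_of_eq ?_) h
  rw [← bumpTransform_bubble ha hμ, bumpTransform, bumpTransform, bumpTransform,
    ← integral_const_mul, ← integral_sub (integrable_mul_dilate hf ha)
      ((integrable_mul_dilate hb ha).const_mul e)]
  congr 2
  ext x
  simp only [Pi.sub_apply, Pi.smul_apply, smul_eq_mul]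
  ring

lemma continuousOn_bumpPairing : ContinuousOn bumpPairing (Ioi 0) := by
  have h := continuousOn_bumpTransform contDiff_groundState.continuous.locallyIntegrable
  have e : bumpPairing = fun b => (bumpTransform groundState b).re := by
    ext b; rw [bumpTransform, integral_groundState_mul_dilate, Complex.ofReal_re]
  rw [e]
  exact Complex.continuous_re.comp_continuousOn h

lemma bumpPairing_mul_sqrt_le {b w : ℝ} (hb : 0 < b)
    (h : ∀ x, bump (b • x) ≠ 0 → realGroundState x ≤ w) :
    bumpPairing b * √b ≤ w * ∫ x, bump x := by
  have ht := isTest_bump.dilate hb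
  have h1 : bumpPairing b ≤ ∫ x, w * dilate b bump x := by
    refine integral_mono_of_nonneg (Eventually.of_forall fun x => mul_nonneg
      (realGroundState_pos x).le (mul_nonneg (by positivity) (bump_nonneg _)))
      (ht.integrable.const_mul w) (Eventually.of_forall fun x => ?_)
    by_cases hx : bump (b • x) = 0
    · simp [dilate, hx]
    · exact mul_le_mul_of_nonneg_right (h x hx) (mul_nonneg (by positivity) (bump_nonneg _))
  have h2 : ∫ x, w * dilate b bump x = w * (√b * b ^ 2 * ((b ^ 3)⁻¹ * ∫ x, bump x)) := by
    rw [integral_const_mul]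
    simp only [dilate]
    rw [integral_const_mul, integral_comp_smul_space3 _ hb, smul_eq_mul]
  rw [h2] at h1
  have h3 := mul_le_mul_of_nonneg_right h1 (Real.sqrt_nonneg b)
  refine h3.trans (le_of_eq ?_)
  have h4 : √b * √b = b := Real.mul_self_sqrt hb.le
  have h5 : b ^ 2 * ((b ^ 3)⁻¹) * b = 1 := by field_simp
  linear_combination (w * b ^ 2 * (b ^ 3)⁻¹ * ∫ x, bump x) * h4 + (w * ∫ x, bump x) * h5

/-- The pairing of the ground state with the bump at scale `1 / b` is small unless `b` is of order
one. -/
lemma exists_mem_of_le_bumpPairing : ∃ K : ℝ, 1 ≤ K ∧ ∀ b : ℝ, 0 < b →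
    bumpPairing 1 / 4 ≤ bumpPairing b → K⁻¹ ≤ b ∧ b ≤ K := by
  have hp := bumpPairing_pos one_pos
  set c := bumpPairing 1 / 4
  have hc : 0 < c := by positivity
  set B := ∫ x, bump x
  have hB : 0 ≤ B := integral_nonneg bump_nonneg
  have hK : 1 ≤ (2 * B / c) ^ 2 + 1 := le_add_of_nonneg_left (sq_nonneg _)
  refine ⟨(2 * B / c) ^ 2 + 1, hK, fun b hb hcb => ?_⟩
  have hs := Real.sqrt_pos.2 hb
  have hsq := Real.sq_sqrt hb.le
  -- `W ≤ 1` excludes large `b`, and `W x ≤ 2 / ‖x‖` excludes small `b`.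
  have h1 : c * √b ≤ B := by
    have := bumpPairing_mul_sqrt_le (w := 1) hb fun x _ => by
      have := realGroundState_sq x
      have := realGroundState_pos x
      have : 0 ≤ realGroundState x ^ 2 * (‖x‖ ^ 2 / 3) := by positivity
      nlinarith
    nlinarith
  have h2 : c ≤ 2 * B * √b := by
    have := bumpPairing_mul_sqrt_le (w := 2 * b) hb fun x hx => by
      have h3 := (norm_mem_of_bump_ne_zero hx).1
      rw [norm_smul, Real.norm_of_nonneg hb.le] at h3
      refine (realGroundState_le x).trans ?_
      rw [← div_eq_mul_inv, div_le_iff₀ (by positivity)]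
      nlinarith
    have h5 : c * √b ≤ (2 * B * √b) * √b := by nlinarith
    exact le_of_mul_le_mul_right h5 hs
  constructor
  · refine inv_le_of_inv_le₀ hb ?_
    have h3 : c ^ 2 ≤ (2 * B) ^ 2 * b := by
      have := pow_le_pow_left₀ hc.le h2 2
      rwa [mul_pow, hsq] at this
    rw [div_pow]
    have : b⁻¹ ≤ (2 * B) ^ 2 / c ^ 2 := by
      rw [inv_eq_one_div, div_le_div_iff₀ hb (by positivity)]; linarith
    linarith
  · have h3 : c ^ 2 * b ≤ B ^ 2 := by
      have := pow_le_pow_left₀ (by positivity) h1 2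
      rwa [mul_pow, hsq] at this
    have : b ≤ (2 * B / c) ^ 2 := by
      rw [div_pow, le_div_iff₀ (by positivity)]; nlinarith [sq_nonneg B]
    linarith

instance holderTriple_four_thirds : ENNReal.HolderTriple (4 / 3) 4 1 :=
  ENNReal.HolderTriple.symm (p := 4) (q := 4 / 3)

lemma memLp_cubic {f : Space3 → ℂ} (h4 : MemLp f 4 volume) :
    MemLp (fun x => ((‖f x‖ ^ 2 : ℝ) : ℂ) * f x) (4 / 3) volume ∧
      lpNorm (fun x => ((‖f x‖ ^ 2 : ℝ) : ℂ) * f x) (4 / 3) volume = lpNorm f 4 volume ^ 3 := by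
  have hm : AEStronglyMeasurable (fun x => ((‖f x‖ ^ 2 : ℝ) : ℂ) * f x) volume :=
    (Complex.continuous_ofReal.comp_aestronglyMeasurable (h4.1.norm.pow 2)).mul h4.1
  have e43 : (4 / 3 : ℝ≥0∞) * (3 : ℕ) = 4 := ennreal_eq_of_toReal
    (ENNReal.mul_ne_top (ENNReal.div_ne_top (by simp) (by simp)) (by simp)) (by simp) (by norm_num)
  have e : eLpNorm (fun x => ((‖f x‖ ^ 2 : ℝ) : ℂ) * f x) (4 / 3) volume
      = eLpNorm f 4 volume ^ 3 := by
    have h1 := eLpNorm_pow_eq (fun x => ‖f x‖) three_ne_zero (4 / 3)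
    rw [e43, eLpNorm_norm] at h1
    rw [← h1]
    refine eLpNorm_congr_norm_ae (Eventually.of_forall fun x => ?_)
    rw [norm_mul, Complex.norm_real, norm_pow, norm_pow, norm_norm]
    ring
  refine ⟨⟨hm, e.trans_lt (ENNReal.pow_lt_top h4.2)⟩, ?_⟩
  rw [← toReal_eLpNorm hm, ← toReal_eLpNorm h4.1, e, ENNReal.toReal_pow]

lemma memLp_quintic_sub {f w : Space3 → ℂ} (hf : MemLp f 6 volume) (hw : MemLp w 6 volume) :
    MemLp (fun x => ((‖f x‖ ^ 4 : ℝ) : ℂ) * f x - ((‖w x‖ ^ 4 : ℝ) : ℂ) * w x) (6 / 5) volume ∧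
      lpNorm (fun x => ((‖f x‖ ^ 4 : ℝ) : ℂ) * f x - ((‖w x‖ ^ 4 : ℝ) : ℂ) * w x) (6 / 5) volume
        ≤ lpNorm (fun x => f x - w x) 6 volume
          * (lpNorm (fun x => f x - w x) 6 volume + 2 * lpNorm w 6 volume) ^ 4 := by
  have hm : ∀ {g : Space3 → ℂ}, MemLp g 6 volume →
      AEStronglyMeasurable (fun x => ((‖g x‖ ^ 4 : ℝ) : ℂ) * g x) volume := fun hg =>
    (Complex.continuous_ofReal.comp_aestronglyMeasurable (hg.1.norm.pow 4)).mul hg.1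
  have hd : MemLp (fun x => f x - w x) 6 volume := hf.sub hw
  have hX : MemLp (fun x => ‖f x - w x‖ + 2 * ‖w x‖) 6 volume := hd.norm.add (hw.norm.const_mul 2)
  have e2 : (3 / 2 : ℝ≥0∞) * (4 : ℕ) = 6 := ennreal_eq_of_toReal
    (ENNReal.mul_ne_top (ENNReal.div_ne_top (by simp) (by simp)) (by simp)) (by simp) (by norm_num)
  have h2 := eLpNorm_norm_mul_le (p := 6) (q := 3 / 2) (r := 6 / 5) hd.1 (hX.1.pow 4)
  have h4 : eLpNorm ((fun x => ‖f x - w x‖ + 2 * ‖w x‖) ^ 4) (3 / 2) volume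
      = eLpNorm (fun x => ‖f x - w x‖ + 2 * ‖w x‖) 6 volume ^ 4 := by
    rw [← e2]; exact eLpNorm_pow_eq _ four_ne_zero _
  rw [h4] at h2
  have h5 : eLpNorm (fun x => ((‖f x‖ ^ 4 : ℝ) : ℂ) * f x - ((‖w x‖ ^ 4 : ℝ) : ℂ) * w x) (6 / 5)
      volume ≤ eLpNorm (fun x => f x - w x) 6 volume
        * eLpNorm (fun x => ‖f x - w x‖ + 2 * ‖w x‖) 6 volume ^ 4 := by
    refine (eLpNorm_mono_real fun x => ?_).trans h2
    refine (norm_quintic_sub_le (f x) (w x)).trans ?_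
    rw [Pi.pow_apply]
    have := norm_sub_norm_le (f x) (w x)
    have : ‖f x‖ + ‖w x‖ ≤ ‖f x - w x‖ + 2 * ‖w x‖ := by linarith
    gcongr
  have hfin := ENNReal.mul_lt_top hd.2 (ENNReal.pow_lt_top (n := 4) hX.2)
  have hm' : AEStronglyMeasurable
      (fun x => ((‖f x‖ ^ 4 : ℝ) : ℂ) * f x - ((‖w x‖ ^ 4 : ℝ) : ℂ) * w x) volume :=
    (hm hf).sub (hm hw)
  refine ⟨⟨hm', h5.trans_lt hfin⟩, ?_⟩
  have h6 := ENNReal.toReal_mono hfin.ne h5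
  rw [toReal_eLpNorm hm', ENNReal.toReal_mul, ENNReal.toReal_pow,
    toReal_eLpNorm hd.1, toReal_eLpNorm hX.1] at h6
  refine h6.trans ?_
  have h7 : lpNorm (fun x => ‖f x - w x‖ + 2 * ‖w x‖) 6 volume
      ≤ lpNorm (fun x => f x - w x) 6 volume + 2 * lpNorm w 6 volume := by
    refine (lpNorm_add_le hd.norm (by norm_num)).trans (add_le_add (lpNorm_norm hd.1 _).le ?_)
    refine (lpNorm_const_smul (2 : ℝ) (fun x => ‖w x‖) volume).le.trans (le_of_eq ?_)
    rw [lpNorm_norm hw.1]; simp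
  gcongr
  · exact lpNorm_nonneg
  · exact lpNorm_nonneg

/-- Near a bubble, the bump transform moves slowly: the bubble is a stationary state of the quintic
equation, and the cubic term is controlled by the `L⁴` norm. -/
lemma exists_norm_bumpTransformDeriv_le : ∃ C : ℝ, 0 < C ∧ ∀ (f : Space3 → ℂ) (e : ℂ) (μ a : ℝ),
    MemLp f 2 volume → MemLp f 6 volume → ‖e‖ = 1 → 0 < μ → 1 ≤ a →
    ‖bumpTransformDeriv f a‖ ≤ C * a ^ 2 * (lpNorm (fun x => f x - e * bubble μ x) 6 volume
      * (1 + lpNorm (fun x => f x - e * bubble μ x) 6 volume) ^ 4 + lpNorm f 4 volume ^ 3) := by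
  set S := bubbleMass ^ (1 / 6 : ℝ)
  have hS0 : 0 ≤ S := Real.rpow_nonneg bubbleMass_pos.le _
  set B1 := lpNorm (fun x => (lap bump x : ℂ)) (6 / 5) volume
  set B2 := lpNorm (fun x => (bump x : ℂ)) 6 volume
  set B3 := lpNorm (fun x => (bump x : ℂ)) 4 volume
  have hB1 : 0 ≤ B1 := lpNorm_nonneg
  have hB2 : 0 ≤ B2 := lpNorm_nonneg
  have hB3 : 0 ≤ B3 := lpNorm_nonneg
  refine ⟨B1 + (1 + 2 * S) ^ 4 * B2 + B3 + 1, by positivity, fun f e μ a h2 h6 he hμ ha => ?_⟩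
  have ha0 : 0 < a := one_pos.trans_le ha
  have hb6 := memLp_bubble hμ.ne'
  have hw6 : MemLp (fun x => e * bubble μ x) 6 volume := hb6.const_mul e
  have hS : lpNorm (fun x => e * bubble μ x) 6 volume = S := by
    have e1 : lpNorm (fun x => e * bubble μ x) 6 volume = lpNorm (bubble μ) 6 volume := by
      refine (lpNorm_const_smul e (bubble μ) volume).trans ?_
      rw [coe_nnnorm, he, one_mul]
    rw [e1]
    simp only [S]
    rw [← lpNorm_bubble_six hμ, ← Real.rpow_natCast, ← Real.rpow_mul lpNorm_nonneg]
    norm_num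
  have h4 := memLp_four h2 h6
  obtain ⟨c1, c2⟩ := memLp_cubic h4
  obtain ⟨q1, q2⟩ := memLp_quintic_sub h6 hw6
  rw [hS] at q2
  have hd : MemLp (fun x => f x - e * bubble μ x) 6 volume := h6.sub hw6
  set d := lpNorm (fun x => f x - e * bubble μ x) 6 volume
  have hd0 : 0 ≤ d := lpNorm_nonneg
  have hχ := isTest_bump.dilate ha0
  have hlχ : IsTest (dilate a (lap bump)) := isTest_bump.lap.dilate ha0
  have n1 := norm_integral_mul_le hd (hlχ.memLp_ofReal (6 / 5))
  rw [lpNorm_dilate_six_fifths isTest_bump.lap ha0] at n1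
  have n2 := norm_integral_mul_le q1 (hχ.memLp_ofReal 6)
  rw [lpNorm_dilate_six isTest_bump ha0] at n2
  have n3 := norm_integral_mul_le c1 (hχ.memLp_ofReal 4)
  rw [lpNorm_dilate_four isTest_bump ha0, c2] at n3
  have i1 : Integrable fun x => (f x - e * bubble μ x) * (lap (dilate a bump) x : ℂ) :=
    memLp_one_iff_integrable.1 ((hχ.lap.memLp_ofReal (6 / 5)).mul hd)
  have i1' : Integrable fun x => bubble μ x * (lap (dilate a bump) x : ℂ) :=
    memLp_one_iff_integrable.1 ((hχ.lap.memLp_ofReal (6 / 5)).mul hb6)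
  have i2 : Integrable fun x => (((‖f x‖ ^ 4 : ℝ) : ℂ) * f x
      - ((‖e * bubble μ x‖ ^ 4 : ℝ) : ℂ) * (e * bubble μ x)) * (dilate a bump x : ℂ) :=
    memLp_one_iff_integrable.1 ((hχ.memLp_ofReal 6).mul q1)
  have i2' : Integrable fun x =>
      ((‖bubble μ x‖ ^ 4 : ℝ) : ℂ) * bubble μ x * (dilate a bump x : ℂ) := by
    have hc := (contDiff_bubble μ).continuous
    have := hχ.integrable_smul (f := fun x => ((‖bubble μ x‖ ^ 4 : ℝ) : ℂ) * bubble μ x)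
      (Continuous.locallyIntegrable (by fun_prop))
    refine this.congr (Eventually.of_forall fun x => ?_)
    beta_reduce
    rw [Complex.real_smul, mul_comm]
  have i3 : Integrable fun x => (((‖f x‖ ^ 2 : ℝ) : ℂ) * f x) * (dilate a bump x : ℂ) :=
    memLp_one_iff_integrable.1 ((hχ.memLp_ofReal 4).mul c1)
  have weak := integral_bubble_mul_lap hμ hχ
  have key : bumpTransformDeriv f a = Complex.I *
      ((∫ x, (f x - e * bubble μ x) * (lap (dilate a bump) x : ℂ))
      + (∫ x, (((‖f x‖ ^ 4 : ℝ) : ℂ) * f x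
      - ((‖e * bubble μ x‖ ^ 4 : ℝ) : ℂ) * (e * bubble μ x)) * (dilate a bump x : ℂ))
      - ∫ x, (((‖f x‖ ^ 2 : ℝ) : ℂ) * f x) * (dilate a bump x : ℂ)) := by
    have k1 : ∫ x, f x * (lap (dilate a bump) x : ℂ)
        = (∫ x, (f x - e * bubble μ x) * (lap (dilate a bump) x : ℂ))
          + e * ∫ x, bubble μ x * (lap (dilate a bump) x : ℂ) := by
      rw [← integral_const_mul, ← integral_add i1 (i1'.const_mul e)]
      congr 1; ext x; ring
    have k2 : ∫ x, nonlinearity (f x) * (dilate a bump x : ℂ)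
        = (∫ x, (((‖f x‖ ^ 2 : ℝ) : ℂ) * f x) * (dilate a bump x : ℂ))
          - (∫ x, (((‖f x‖ ^ 4 : ℝ) : ℂ) * f x
            - ((‖e * bubble μ x‖ ^ 4 : ℝ) : ℂ) * (e * bubble μ x)) * (dilate a bump x : ℂ))
          - e * ∫ x, ((‖bubble μ x‖ ^ 4 : ℝ) : ℂ) * bubble μ x * (dilate a bump x : ℂ) := by
      rw [← integral_const_mul, ← integral_sub i3 i2]
      refine Eq.trans ?_ (integral_sub (i3.sub i2) (i2'.const_mul e))
      congr 1; ext x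
      simp only [nonlinearity, norm_mul, he, one_mul]
      ring
    rw [bumpTransformDeriv, k1, k2, weak]
    ring
  have hlap : ∫ x, (f x - e * bubble μ x) * (lap (dilate a bump) x : ℂ)
      = ((a ^ 2 : ℝ) : ℂ) * ∫ x, (f x - e * bubble μ x) * (dilate a (lap bump) x : ℂ) := by
    rw [← integral_const_mul]
    congr 1; ext x
    rw [lap_dilate isTest_bump ha0]; push_cast; ring
  rw [key, norm_mul, Complex.norm_I, one_mul, hlap]
  refine (norm_sub_le _ _).trans (le_trans (add_le_add_left (norm_add_le _ _) _) ?_)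
  rw [norm_mul, Complex.norm_real, Real.norm_of_nonneg (by positivity)]
  have ha74 : a ^ (7 / 4 : ℝ) ≤ a ^ 2 := by
    rw [← Real.rpow_natCast]
    exact Real.rpow_le_rpow_of_exponent_le ha (by norm_num)
  have hds : (d + 2 * S) ^ 4 ≤ (1 + 2 * S) ^ 4 * (1 + d) ^ 4 := by
    rw [← mul_pow]; gcongr; nlinarith
  have hl0 : 0 ≤ lpNorm f 4 volume := lpNorm_nonneg
  have g1 : 1 ≤ (1 + d) ^ 4 := one_le_pow₀ (by linarith)
  set L := lpNorm f 4 volume ^ 3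
  have hL : 0 ≤ L := by positivity
  set E := (1 + d) ^ 4
  have hE : 0 ≤ E := by positivity
  have m1 : a ^ 2 * ‖∫ x, (f x - e * bubble μ x) * (dilate a (lap bump) x : ℂ)‖
      ≤ a ^ 2 * (d * E * B1) := by
    gcongr
    refine n1.trans ?_
    gcongr
    exact le_mul_of_one_le_right hd0 g1
  have m2 := n2.trans (mul_le_mul_of_nonneg_right (q2.trans (mul_le_mul_of_nonneg_left hds hd0))
    (by positivity : 0 ≤ a ^ 2 * B2))
  have m3 : L * (a ^ (7 / 4 : ℝ) * B3) ≤ L * (a ^ 2 * B3) := by gcongr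
  have m4 : 0 ≤ a ^ 2 * (d * E * (B3 + 1) + L * (B1 + (1 + 2 * S) ^ 4 * B2 + 1)) := by positivity
  calc _ ≤ a ^ 2 * (d * E * B1) + d * ((1 + 2 * S) ^ 4 * E) * (a ^ 2 * B2) + L * (a ^ 2 * B3) :=
        add_le_add (add_le_add m1 m2) (n3.trans m3)
    _ ≤ _ := by linarith

/-! ### Continuously differentiable phases -/

lemma contDiffAt_one_of_hasDerivAt {E : Type*} [NormedAddCommGroup E] [NormedSpace ℝ E]
    {f f' : ℝ → E} {S : Set ℝ} (hS : IsOpen S) (h : ∀ t ∈ S, HasDerivAt f (f' t) t)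
    (hc : ContinuousOn f' S) {t : ℝ} (ht : t ∈ S) : ContDiffAt ℝ 1 f t := by
  refine ContDiffOn.contDiffAt ((contDiffOn_one_iff_derivWithin hS.uniqueDiffOn).2
    ⟨fun s hs => (h s hs).differentiableAt.differentiableWithinAt, hc.congr fun s hs => ?_⟩)
    (hS.mem_nhds ht)
  rw [derivWithin_of_isOpen hS hs, (h s hs).deriv]

/-- A nonvanishing `C¹` curve in `ℂ`, defined on an open set of times, has a `C¹` phase. -/
lemma exists_phase {S : Set ℝ} (hS : IsOpen S) {Z : ℝ → ℂ} (hZ : ∀ t ∈ S, ContDiffAt ℝ 1 Z t)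
    (h0 : ∀ t ∈ S, Z t ≠ 0) : ∃ θ : ℝ → ℝ, ∀ t ∈ S, ContDiffAt ℝ 1 θ t ∧
      Z t = ‖Z t‖ * Complex.exp (Complex.I * θ t) := by
  classical
  set q : ℝ → ℂ := fun t => deriv Z t / Z t
  have hq : ContinuousOn q S := by
    have h1 : ContDiffOn ℝ 1 Z S := fun t ht => (hZ t ht).contDiffWithinAt
    exact (h1.continuousOn_deriv_of_isOpen hS le_rfl).div h1.continuousOn h0
  -- The phase is the integral of `Im (Z' / Z)` from a base point chosen in each component.
  set base : Set ℝ → ℝ := fun A => if h : A.Nonempty then h.some else 0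
  refine ⟨fun t => (Z (base (connectedComponentIn S t))).arg
    + (∫ s in base (connectedComponentIn S t)..t, q s).im, fun t₀ ht₀ => ?_⟩
  set A := connectedComponentIn S t₀
  have hAo : IsOpen A := hS.connectedComponentIn
  have hAS : A ⊆ S := connectedComponentIn_subset S t₀
  have hAp : IsPreconnected A := isPreconnected_connectedComponentIn
  have ht₀A : t₀ ∈ A := mem_connectedComponentIn ht₀
  have hb : base A ∈ A := by
    have hne : A.Nonempty := ⟨t₀, ht₀A⟩
    simp only [base, hne, dif_pos]; exact hne.some_mem
  have hcomp : ∀ t ∈ A, connectedComponentIn S t = A :=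
    fun t ht => (connectedComponentIn_eq ht).symm
  set b := base A
  set w : ℝ → ℂ := fun t => ∫ s in b..t, q s
  have hw : ∀ t ∈ A, HasDerivAt w (q t) t := fun t ht =>
    intervalIntegral.integral_hasDerivAt_right
      ((hq.mono ((hAp.ordConnected.uIcc_subset hb ht).trans hAS)).intervalIntegrable)
      (hq.stronglyMeasurableAtFilter hS t (hAS ht)) (hq.continuousAt (hS.mem_nhds (hAS ht)))
  have hθ : ∀ t ∈ A, HasDerivAt (fun t => (Z b).arg + (w t).im) (q t).im t := fun t ht =>
    (Complex.imCLM.hasFDerivAt.comp_hasDerivAt t (hw t ht)).const_add _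
  have hev : (fun t => (Z (base (connectedComponentIn S t))).arg
      + (∫ s in base (connectedComponentIn S t)..t, q s).im)
      =ᶠ[𝓝 t₀] fun t => (Z b).arg + (w t).im := by
    filter_upwards [hAo.mem_nhds ht₀A] with t ht
    rw [hcomp t ht]
  refine ⟨(contDiffAt_one_of_hasDerivAt hAo hθ
    (Complex.continuous_im.comp_continuousOn (hq.mono hAS)) ht₀A).congr_of_eventuallyEq hev, ?_⟩
  have hd : ∀ t ∈ A, HasDerivAt (fun t => Z t * Complex.exp (-w t)) 0 t := fun t ht => by
    have h1 := ((hZ t (hAS ht)).differentiableAt one_ne_zero).hasDerivAt.mul (hw t ht).fun_neg.cexp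
    refine h1.congr_deriv ?_
    have := h0 t (hAS ht)
    simp only [q]
    field_simp
    ring
  have h2 := hAo.is_const_of_deriv_eq_zero hAp
    (fun t ht => (hd t ht).differentiableAt.differentiableWithinAt)
    (fun t ht => (hd t ht).deriv) ht₀A hb
  have h3 : w b = 0 := intervalIntegral.integral_same
  beta_reduce at h2
  rw [h3, neg_zero, Complex.exp_zero, mul_one, Complex.exp_neg] at h2
  have h4 : Z t₀ = Z b * Complex.exp (w t₀) := by
    rw [← h2, mul_assoc, inv_mul_cancel₀ (Complex.exp_ne_zero _), mul_one]
  have h5 : Complex.exp (w t₀) = Real.exp (w t₀).re * Complex.exp (Complex.I * (w t₀).im) := by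
    conv_lhs => rw [← Complex.re_add_im (w t₀), Complex.exp_add]
    rw [Complex.ofReal_exp, mul_comm Complex.I]
  have h6 : ‖Z t₀‖ = ‖Z b‖ * Real.exp (w t₀).re := by
    rw [h4, norm_mul, Complex.norm_exp]
  beta_reduce
  rw [h6, h4, h5]
  conv_lhs => rw [← Complex.norm_mul_exp_arg_mul_I (Z b)]
  push_cast
  rw [mul_add, Complex.exp_add, mul_comm Complex.I ((Z b).arg : ℂ)]
  ring

/-! ### Averages over the scales -/

/-- The pairing of the ground state with the bump at scale `1 / b` exceeds a quarter of its value at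
`b = 1` only for `b` in `[bumpRange⁻¹, bumpRange]`. -/
noncomputable def bumpRange : ℝ := exists_mem_of_le_bumpPairing.choose

lemma one_le_bumpRange : 1 ≤ bumpRange := exists_mem_of_le_bumpPairing.choose_spec.1

/-- The scales at which the bump detects a bubble of frequency `μ`. -/
noncomputable def bubbleWindow (μ : ℝ) : Set ℝ := Icc (bumpRange⁻¹ * μ) (bumpRange * μ)

lemma bubbleWindow_subset {μ : ℝ} (hμ : 0 < μ) : bubbleWindow μ ⊆ Ioi 0 := fun _ ha =>
  (mul_pos (inv_pos.2 (one_pos.trans_le one_le_bumpRange)) hμ).trans_le ha.1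

lemma mem_bubbleWindow {a μ : ℝ} (ha : 0 < a) (hμ : 0 < μ)
    (h : bumpPairing 1 / 4 ≤ bumpPairing (a / μ)) : a ∈ bubbleWindow μ := by
  obtain ⟨h1, h2⟩ := exists_mem_of_le_bumpPairing.choose_spec.2 _ (div_pos ha hμ) h
  exact ⟨(le_div_iff₀ hμ).1 h1, (div_le_iff₀ hμ).1 h2⟩

/-- The distance to a bubble below which the bump transform is close to that of the bubble. -/
noncomputable def bubbleRadius : ℝ := min 1 (bumpPairing 1 / 4 / (bumpNorm + 1))

lemma bubbleRadius_pos : 0 < bubbleRadius := by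
  have := bumpPairing_pos one_pos
  have := bumpNorm_nonneg
  exact lt_min one_pos (by positivity)

lemma bubbleRadius_le_one : bubbleRadius ≤ 1 := min_le_left _ _

lemma mul_bumpNorm_le {d : ℝ} (h : d ≤ bubbleRadius) : d * bumpNorm ≤ bumpPairing 1 / 4 := by
  have h1 := bumpNorm_nonneg
  have h2 := h.trans (min_le_right _ _)
  rw [le_div_iff₀ (by positivity)] at h2
  have h3 := bumpPairing_pos one_pos
  rcases le_total d 0 with h4 | h4 <;> nlinarith

section Average
variable {E : Type*} [NormedAddCommGroup E] [NormedSpace ℝ E]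

/-- The average of a function of the bump transform over all scales. -/
noncomputable def scaleIntegral (Ψ : ℂ → E) (f : Space3 → ℂ) : E :=
  ∫ a in Ioi (0 : ℝ), Ψ (bumpTransform f a)

variable {Ψ : ℂ → E} {f : Space3 → ℂ} {e : ℂ} {μ : ℝ}

lemma comp_bumpTransform_eq_zero {F : Type*} [Zero F] {Φ : ℂ → F}
    (hΦ : ∀ z, ‖z‖ ≤ bumpPairing 1 / 2 → Φ z = 0)
    (hf : MemLp f 6 volume) (he : ‖e‖ = 1) (hμ : 0 < μ)
    (hd : lpNorm (fun x => f x - e * bubble μ x) 6 volume ≤ bubbleRadius) {a : ℝ}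
    (ha : a ∈ Ioi 0 \ bubbleWindow μ) : Φ (bumpTransform f a) = 0 := by
  have ha0 : 0 < a := ha.1
  refine hΦ _ (not_lt.1 fun h => ha.2 (mem_bubbleWindow ha0 hμ ?_))
  have h1 := (norm_bumpTransform_sub_le hf ha0 hμ e).trans (mul_bumpNorm_le hd)
  have h2 := norm_sub_norm_le (bumpTransform f a) (e * bumpPairing (a / μ))
  rw [norm_mul, he, one_mul, Complex.norm_real,
    Real.norm_of_nonneg (bumpPairing_pos (div_pos ha0 hμ)).le] at h2
  linarith

lemma scaleIntegral_eq (hΨ : ∀ z, ‖z‖ ≤ bumpPairing 1 / 2 → Ψ z = 0)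
    (hf : MemLp f 6 volume) (he : ‖e‖ = 1) (hμ : 0 < μ)
    (hd : lpNorm (fun x => f x - e * bubble μ x) 6 volume ≤ bubbleRadius) :
    scaleIntegral Ψ f = ∫ a in bubbleWindow μ, Ψ (bumpTransform f a) :=
  setIntegral_eq_of_subset_of_forall_sdiff_eq_zero measurableSet_Ioi (bubbleWindow_subset hμ)
    fun _ ha => comp_bumpTransform_eq_zero hΨ hf he hμ hd ha

lemma volume_bubbleWindow_lt_top (μ : ℝ) : volume (bubbleWindow μ) < ⊤ := by
  rw [bubbleWindow, Real.volume_Icc]; exact ENNReal.ofReal_lt_top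

lemma volume_real_bubbleWindow_le (hμ : 0 < μ) :
    (volume : Measure ℝ).real (bubbleWindow μ) ≤ bumpRange * μ := by
  have h1 := one_le_bumpRange
  have h2 : 0 < bumpRange⁻¹ * μ := mul_pos (inv_pos.2 (one_pos.trans_le h1)) hμ
  rw [measureReal_def, bubbleWindow, Real.volume_Icc]
  have h3 : bumpRange⁻¹ ≤ bumpRange := (inv_le_one_of_one_le₀ h1).trans h1
  rw [ENNReal.toReal_ofReal (by nlinarith)]
  linarith

lemma exists_lipschitz_on_ball (hΨ : ContDiff ℝ 1 Ψ) (R : ℝ) : ∃ L : ℝ, 0 < L ∧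
    (∀ z, ‖z‖ ≤ R → ‖fderiv ℝ Ψ z‖ ≤ L) ∧
    ∀ z w, ‖z‖ ≤ R → ‖w‖ ≤ R → ‖Ψ z - Ψ w‖ ≤ L * ‖z - w‖ := by
  obtain ⟨L, hL⟩ := (isCompact_closedBall (0 : ℂ) R).exists_bound_of_continuousOn
    (hΨ.continuous_fderiv one_ne_zero).continuousOn
  have h1 : ∀ z, ‖z‖ ≤ R → ‖fderiv ℝ Ψ z‖ ≤ |L| + 1 := fun z hz =>
    (hL z (mem_closedBall_zero_iff.2 hz)).trans ((le_abs_self L).trans (by linarith))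
  refine ⟨|L| + 1, by positivity, h1, fun z w hz hw => ?_⟩
  exact (convex_closedBall (0 : ℂ) R).norm_image_sub_le_of_norm_fderiv_le
    (fun z _ => hΨ.differentiable one_ne_zero z)
    (fun z hz => h1 z (mem_closedBall_zero_iff.1 hz)) (mem_closedBall_zero_iff.2 hw)
    (mem_closedBall_zero_iff.2 hz)

/-- A bound for the bump transform near a bubble. -/
noncomputable def transformBound : ℝ := (lpNorm groundState 6 volume + 1) * bumpNorm

lemma bumpPairing_le {b : ℝ} (hb : 0 < b) :
    bumpPairing b ≤ lpNorm groundState 6 volume * bumpNorm := by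
  have := norm_bumpTransform_le memLp_groundState hb
  rwa [bumpTransform, integral_groundState_mul_dilate, Complex.norm_real,
    Real.norm_of_nonneg (bumpPairing_pos hb).le] at this

lemma norm_mul_bumpPairing_le (he : ‖e‖ = 1) {b : ℝ} (hb : 0 < b) :
    ‖e * bumpPairing b‖ ≤ transformBound := by
  have h1 := bumpNorm_nonneg
  rw [norm_mul, he, one_mul, Complex.norm_real, Real.norm_of_nonneg (bumpPairing_pos hb).le]
  exact (bumpPairing_le hb).trans (by rw [transformBound]; linarith)

lemma norm_bumpTransform_le_transformBound (hf : MemLp f 6 volume) (he : ‖e‖ = 1) (hμ : 0 < μ)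
    (hd : lpNorm (fun x => f x - e * bubble μ x) 6 volume ≤ bubbleRadius) {a : ℝ} (ha : 0 < a) :
    ‖bumpTransform f a‖ ≤ transformBound := by
  have h1 := norm_bumpTransform_sub_le hf ha hμ e
  have h2 := norm_sub_norm_le (bumpTransform f a) (e * bumpPairing (a / μ))
  have hp := bumpPairing_pos (div_pos ha hμ)
  rw [norm_mul, he, one_mul, Complex.norm_real, Real.norm_of_nonneg hp.le] at h2
  have h3 := bumpPairing_le (div_pos ha hμ)
  have h4 := mul_le_mul_of_nonneg_right (hd.trans (min_le_left _ _)) bumpNorm_nonneg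
  rw [transformBound]
  linarith

lemma setIntegral_comp_bumpPairing (e : ℂ) (hμ : 0 < μ) :
    ∫ a in Ioi (0 : ℝ), Ψ (e * bumpPairing (a / μ))
      = μ • ∫ b in Ioi (0 : ℝ), Ψ (e * bumpPairing b) := by
  have := integral_comp_mul_left_Ioi (fun b => Ψ (e * bumpPairing b)) 0 (inv_pos.2 hμ)
  rw [inv_inv, mul_zero] at this
  rw [← this]
  simp only [div_eq_inv_mul]

lemma continuousOn_comp_bumpTransform (hΨ : ContDiff ℝ 1 Ψ) (hf : MemLp f 6 volume) :
    ContinuousOn (fun a => Ψ (bumpTransform f a)) (Ioi 0) :=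
  hΨ.continuous.comp_continuousOn (continuousOn_bumpTransform (hf.locallyIntegrable (by norm_num)))

lemma integrableOn_comp_bumpTransform (hΨ : ContDiff ℝ 1 Ψ) (hf : MemLp f 6 volume) (hμ : 0 < μ) :
    IntegrableOn (fun a => Ψ (bumpTransform f a)) (bubbleWindow μ) :=
  ((continuousOn_comp_bumpTransform hΨ hf).mono (bubbleWindow_subset hμ)).integrableOn_Icc

lemma exists_norm_scaleIntegral_sub_le (hΨ : ContDiff ℝ 1 Ψ)
    (hΨ0 : ∀ z, ‖z‖ ≤ bumpPairing 1 / 2 → Ψ z = 0) :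
    ∃ C : ℝ, 0 < C ∧ ∀ (f : Space3 → ℂ) (e : ℂ) (μ : ℝ), MemLp f 6 volume → ‖e‖ = 1 → 0 < μ →
      lpNorm (fun x => f x - e * bubble μ x) 6 volume ≤ bubbleRadius →
      ‖scaleIntegral Ψ f - μ • ∫ b in Ioi (0 : ℝ), Ψ (e * bumpPairing b)‖
        ≤ C * μ * lpNorm (fun x => f x - e * bubble μ x) 6 volume := by
  obtain ⟨L, hL, -, hlip⟩ := exists_lipschitz_on_ball hΨ transformBound
  have hR := one_le_bumpRange
  have hB := bumpNorm_nonneg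
  refine ⟨L * (bumpNorm + 1) * bumpRange, by positivity, fun f e μ hf he hμ hd => ?_⟩
  have hbub : ∀ {a : ℝ}, 0 < a → bumpTransform (fun x => e * bubble μ x) a
      = e * bumpPairing (a / μ) := fun ha => by
    rw [← bumpTransform_bubble ha hμ, bumpTransform, bumpTransform, ← integral_const_mul]
    simp only [mul_assoc]
  have hmb : MemLp (fun x => e * bubble μ x) 6 volume := (memLp_bubble hμ.ne').const_mul e
  set d := lpNorm (fun x => f x - e * bubble μ x) 6 volume
  have hd0 : 0 ≤ d := lpNorm_nonneg
  have h1 : ∫ a in Ioi (0 : ℝ), Ψ (e * bumpPairing (a / μ))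
      = scaleIntegral Ψ fun x => e * bubble μ x :=
    setIntegral_congr_fun measurableSet_Ioi fun a ha => by rw [hbub ha]
  have h0 : lpNorm (fun x => e * bubble μ x - e * bubble μ x) 6 volume ≤ bubbleRadius := by
    simp only [sub_self]
    exact (lpNorm_zero _ _).le.trans bubbleRadius_pos.le
  rw [← setIntegral_comp_bumpPairing e hμ, h1, scaleIntegral_eq hΨ0 hf he hμ hd,
    scaleIntegral_eq hΨ0 hmb he hμ h0, ← integral_sub (integrableOn_comp_bumpTransform hΨ hf hμ)
      (integrableOn_comp_bumpTransform hΨ hmb hμ)]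
  refine (norm_setIntegral_le_of_norm_le_const (C := L * (d * bumpNorm))
    (volume_bubbleWindow_lt_top μ) fun a ha => ?_).trans ?_
  · have ha0 : 0 < a := bubbleWindow_subset hμ ha
    rw [hbub ha0]
    exact (hlip _ _ (norm_bumpTransform_le_transformBound hf he hμ hd ha0)
      (norm_mul_bumpPairing_le he (div_pos ha0 hμ))).trans
      (mul_le_mul_of_nonneg_left (norm_bumpTransform_sub_le hf ha0 hμ e) hL.le)
  · calc _ ≤ L * (d * (bumpNorm + 1)) * (bumpRange * μ) := by
          gcongr
          · linarith
          · exact volume_real_bubbleWindow_le hμ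
      _ = _ := by ring

lemma lpNorm_four_pow_three_le {f : Space3 → ℂ} (h2 : MemLp f 2 volume) (h6 : MemLp f 6 volume) :
    lpNorm f 4 volume ^ 3 ≤ 1 + (lpNorm f 2 volume ^ 2 + lpNorm f 6 volume ^ 6) := by
  have i2 : Integrable fun x => ‖f x‖ ^ 2 := h2.integrable_norm_pow (by norm_num)
  have i6 : Integrable fun x => ‖f x‖ ^ 6 := h6.integrable_norm_pow (by norm_num)
  have h : lpNorm f 4 volume ^ 4 ≤ lpNorm f 2 volume ^ 2 + lpNorm f 6 volume ^ 6 := by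
    rw [lpNorm_four_pow h2.1, lpNorm_two_sq h2.1, lpNorm_six_pow h2.1, ← integral_add i2 i6]
    refine integral_mono_of_nonneg (Eventually.of_forall fun x => by positivity) (i2.add i6)
      (Eventually.of_forall fun x => ?_)
    beta_reduce
    nlinarith [mul_nonneg (sq_nonneg ‖f x‖) (sq_nonneg (‖f x‖ ^ 2 - 1)), sq_nonneg ‖f x‖]
  have h0 : 0 ≤ lpNorm f 4 volume := lpNorm_nonneg
  have h3 : lpNorm f 4 volume ^ 3 ≤ 1 + lpNorm f 4 volume ^ 4 := by
    rcases le_total (lpNorm f 4 volume) 1 with h1 | h1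
    · have := pow_le_one₀ h0 h1 (n := 3)
      have : 0 ≤ lpNorm f 4 volume ^ 4 := by positivity
      linarith
    · have := pow_le_pow_right₀ h1 (by norm_num : 3 ≤ 4)
      linarith
  linarith

variable {I : Set ℝ} {u : ℝ → Space3 → ℂ}

lemma IsNLSSolution.tendsto_lpNorm_six (h : IsNLSSolution I u) {t : ℝ} (ht : t ∈ I) :
    Tendsto (fun s => lpNorm (fun x => u s x - u t x) 6 volume) (𝓝 t) (𝓝 0) := by
  have h1 := (ENNReal.tendsto_toReal ENNReal.zero_ne_top).comp (h.tendsto_eLpNorm_six ht)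
  refine h1.congr' ?_
  filter_upwards [h.isOpen.mem_nhds ht] with s hs
  exact toReal_eLpNorm ((h.memLp_six hs).sub (h.memLp_six ht)).1

/-- Near a time at which the solution is close to a bubble, all scales seen by the average lie in a
fixed window, and the bump transform has a bounded time derivative there. -/
lemma IsNLSSolution.exists_nhds_bubble (h : IsNLSSolution I u) {t₀ : ℝ} (ht₀ : t₀ ∈ I)
    (he : ‖e‖ = 1) (hμ : bumpRange ≤ μ)
    (hd : lpNorm (fun x => u t₀ x - e * bubble μ x) 6 volume ≤ bubbleRadius / 2) :
    ∃ (N : Set ℝ) (M : ℝ), IsOpen N ∧ t₀ ∈ N ∧ ∀ t ∈ N, t ∈ I ∧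
      lpNorm (fun x => u t x - e * bubble μ x) 6 volume ≤ bubbleRadius ∧
      ∀ a ∈ bubbleWindow μ, ‖bumpTransformDeriv (u t) a‖ ≤ M := by
  obtain ⟨C, hC, hbound⟩ := exists_norm_bumpTransformDeriv_le
  obtain ⟨r, hr, hrI⟩ := Metric.nhds_basis_closedBall.mem_iff.1 (h.isOpen.mem_nhds ht₀)
  rw [Real.closedBall_eq_Icc] at hrI
  obtain ⟨Q, hQ, hQ'⟩ := h.exists_eLpNorm_le hrI
  have hR := one_le_bumpRange
  have hμ0 : 0 < μ := by linarith
  have hev : ∀ᶠ t in 𝓝 t₀, t ∈ Icc (t₀ - r) (t₀ + r) ∧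
      lpNorm (fun x => u t x - e * bubble μ x) 6 volume ≤ bubbleRadius := by
    filter_upwards [Icc_mem_nhds (by linarith : t₀ - r < t₀) (by linarith : t₀ < t₀ + r),
      (h.tendsto_lpNorm_six ht₀).eventually_le_const (half_pos bubbleRadius_pos)] with t h1 h2
    refine ⟨h1, ?_⟩
    have hs : MemLp (fun x => u t x - u t₀ x) 6 volume :=
      (h.memLp_six (hrI h1)).sub (h.memLp_six ht₀)
    have h3 := lpNorm_add_le (g := fun x => u t₀ x - e * bubble μ x) hs (by norm_num)
    have e1 : (fun x => u t x - u t₀ x) + (fun x => u t₀ x - e * bubble μ x)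
        = fun x => u t x - e * bubble μ x := by
      ext x; simp
    rw [e1] at h3
    linarith
  obtain ⟨N, hN, hNo, hNt⟩ := mem_nhds_iff.1 hev
  refine ⟨N, C * (bumpRange * μ) ^ 2 * (1 * (1 + 1) ^ 4 + (1 + (Q.toReal ^ 2 + Q.toReal ^ 6))), hNo,
    hNt, fun t ht => ⟨hrI (hN ht).1, (hN ht).2, fun a ha => ?_⟩⟩
  have htI := hrI (hN ht).1
  have h2 := h.memLp_two htI
  have h6 := h.memLp_six htI
  have ha1 : 1 ≤ a := by
    refine le_trans ?_ ha.1
    rw [inv_mul_eq_div, le_div_iff₀ (by linarith), one_mul]; exact hμ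
  obtain ⟨-, b2, b6, -⟩ := hQ' t (hN ht).1
  have c2 : lpNorm (u t) 2 volume ≤ Q.toReal := by
    rw [← toReal_eLpNorm h2.1]; exact ENNReal.toReal_mono hQ b2
  have c6 : lpNorm (u t) 6 volume ≤ Q.toReal := by
    rw [← toReal_eLpNorm h6.1]; exact ENNReal.toReal_mono hQ b6
  have hd1 := (hN ht).2.trans (min_le_left _ _)
  have hd0 : 0 ≤ lpNorm (fun x => u t x - e * bubble μ x) 6 volume := lpNorm_nonneg
  have n2 : 0 ≤ lpNorm (u t) 2 volume := lpNorm_nonneg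
  have n6 : 0 ≤ lpNorm (u t) 6 volume := lpNorm_nonneg
  have n4 : 0 ≤ lpNorm (u t) 4 volume := lpNorm_nonneg
  refine (hbound (u t) e μ a h2 h6 he hμ0 ha1).trans ?_
  have ha2 := ha.2
  have h43 : lpNorm (u t) 4 volume ^ 3 ≤ 1 + (Q.toReal ^ 2 + Q.toReal ^ 6) :=
    (lpNorm_four_pow_three_le h2 h6).trans (by gcongr)
  gcongr

lemma IsNLSSolution.hasDerivAt_bumpTransform (h : IsNLSSolution I u) {t a : ℝ} (ht : t ∈ I)
    (ha : 0 < a) :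
    HasDerivAt (fun s => bumpTransform (u s) a) (bumpTransformDeriv (u t) a) t :=
  h.hasDerivAt_integral_mul (isTest_bump.dilate ha) ht

lemma IsNLSSolution.continuousOn_bumpTransformDeriv (h : IsNLSSolution I u) {a : ℝ} (ha : 0 < a) :
    ContinuousOn (fun t => bumpTransformDeriv (u t) a) I := by
  have hχ := isTest_bump.dilate ha
  exact continuousOn_const.mul (ContinuousOn.sub
    (fun t ht => (h.hasDerivAt_integral_mul hχ.lap ht).continuousAt.continuousWithinAt)
    (h.continuousOn_integral_nonlinearity_mul hχ))

/-- The averages over the scales are `C¹` in time, with derivative controlled by that of the bump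
transform in the window of the nearby bubble. -/
lemma exists_norm_deriv_scaleIntegral_le (hΨ : ContDiff ℝ 1 Ψ)
    (hΨ0 : ∀ z, ‖z‖ ≤ bumpPairing 1 / 2 → Ψ z = 0) :
    ∃ C : ℝ, 0 < C ∧ ∀ (I : Set ℝ) (u : ℝ → Space3 → ℂ), IsNLSSolution I u → ∀ t₀ ∈ I,
      ∀ (e : ℂ) (μ : ℝ), ‖e‖ = 1 → bumpRange ≤ μ →
      lpNorm (fun x => u t₀ x - e * bubble μ x) 6 volume ≤ bubbleRadius / 2 →
      ContDiffAt ℝ 1 (fun t => scaleIntegral Ψ (u t)) t₀ ∧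
      ∀ M : ℝ, (∀ a ∈ bubbleWindow μ, ‖bumpTransformDeriv (u t₀) a‖ ≤ M) →
        ‖deriv (fun t => scaleIntegral Ψ (u t)) t₀‖ ≤ C * M * μ := by
  obtain ⟨L, hL, hfd, -⟩ := exists_lipschitz_on_ball hΨ transformBound
  have hR := one_le_bumpRange
  refine ⟨L * bumpRange, by positivity, fun I u h t₀ ht₀ e μ he hμ hd => ?_⟩
  have hμ0 : 0 < μ := by linarith
  obtain ⟨N, M, hNo, hNt, hN⟩ := h.exists_nhds_bubble ht₀ he hμ hd
  have hwin := bubbleWindow_subset hμ0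
  have hms : MeasurableSet (bubbleWindow μ) := measurableSet_Icc
  have hTb : ∀ t ∈ N, ∀ a ∈ bubbleWindow μ, ‖bumpTransform (u t) a‖ ≤ transformBound :=
    fun t ht a ha => norm_bumpTransform_le_transformBound (h.memLp_six (hN t ht).1) he hμ0
      (hN t ht).2.1 (hwin ha)
  set D : ℝ → ℝ → E := fun t a => fderiv ℝ Ψ (bumpTransform (u t) a) (bumpTransformDeriv (u t) a)
  have hDle : ∀ t ∈ N, ∀ a ∈ bubbleWindow μ, ∀ m, ‖bumpTransformDeriv (u t) a‖ ≤ m →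
      ‖D t a‖ ≤ L * m := fun t ht a ha m hm =>
    (ContinuousLinearMap.le_opNorm _ _).trans
      (mul_le_mul (hfd _ (hTb t ht a ha)) hm (norm_nonneg _) hL.le)
  have hDm : ∀ t ∈ N, AEStronglyMeasurable (D t) (volume.restrict (bubbleWindow μ)) :=
    fun t ht => by
      have h2 := h.memLp_two (hN t ht).1
      have h6 := h.memLp_six (hN t ht).1
      refine ContinuousOn.aestronglyMeasurable (ContinuousOn.clm_apply
        ((hΨ.continuous_fderiv one_ne_zero).comp_continuousOn ?_) ?_) hms
      · exact (continuousOn_bumpTransform (h2.locallyIntegrable one_le_two)).mono hwin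
      · exact (_root_.continuousOn_bumpTransformDeriv h2 h6).mono hwin
  have hder : ∀ t ∈ N, HasDerivAt (fun t => scaleIntegral Ψ (u t))
      (∫ a in bubbleWindow μ, D t a) t := fun t ht => by
    have hev : (fun t => scaleIntegral Ψ (u t))
        =ᶠ[𝓝 t] fun t => ∫ a in bubbleWindow μ, Ψ (bumpTransform (u t) a) := by
      filter_upwards [hNo.mem_nhds ht] with s hs
      exact scaleIntegral_eq hΨ0 (h.memLp_six (hN s hs).1) he hμ0 (hN s hs).2.1
    refine HasDerivAt.congr_of_eventuallyEq ?_ hev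
    refine (hasDerivAt_integral_of_dominated_loc_of_deriv_le (bound := fun _ => L * M)
      (μ := volume.restrict (bubbleWindow μ)) (F := fun t a => Ψ (bumpTransform (u t) a))
      (F' := D) (hNo.mem_nhds ht) ?_ (integrableOn_comp_bumpTransform hΨ
        (h.memLp_six (hN t ht).1) hμ0) (hDm t ht) ?_
      (integrableOn_const (volume_bubbleWindow_lt_top μ).ne) ?_).2
    · filter_upwards [hNo.mem_nhds ht] with s hs
      exact (integrableOn_comp_bumpTransform hΨ (h.memLp_six (hN s hs).1) hμ0).1
    · filter_upwards [ae_restrict_mem hms] with a ha s hs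
      exact hDle s hs a ha M ((hN s hs).2.2 a ha)
    · filter_upwards [ae_restrict_mem hms] with a ha s hs
      exact (hΨ.differentiable one_ne_zero _).hasFDerivAt.comp_hasDerivAt s
        (h.hasDerivAt_bumpTransform (hN s hs).1 (hwin ha))
  have hcont : ContinuousOn (fun t => ∫ a in bubbleWindow μ, D t a) N := by
    refine continuousOn_of_dominated (bound := fun _ => L * M) hDm (fun t ht => ?_)
      (integrableOn_const (volume_bubbleWindow_lt_top μ).ne) ?_
    · filter_upwards [ae_restrict_mem hms] with a ha
      exact hDle t ht a ha M ((hN t ht).2.2 a ha)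
    · filter_upwards [ae_restrict_mem hms] with a ha
      refine ContinuousOn.clm_apply ((hΨ.continuous_fderiv one_ne_zero).comp_continuousOn
        fun t ht => ?_) ((h.continuousOn_bumpTransformDeriv (hwin ha)).mono fun t ht => (hN t ht).1)
      exact (h.hasDerivAt_bumpTransform (hN t ht).1 (hwin ha)).continuousAt.continuousWithinAt
  refine ⟨contDiffAt_one_of_hasDerivAt hNo hder hcont hNt, fun m hm => ?_⟩
  rw [(hder t₀ hNt).deriv]
  have hm0 : 0 ≤ m := (norm_nonneg _).trans (hm μ ⟨by
    rw [inv_mul_le_iff₀ (by linarith)]; nlinarith, by nlinarith⟩)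
  refine (norm_setIntegral_le_of_norm_le_const (volume_bubbleWindow_lt_top μ)
    fun a ha => hDle t₀ hNt a ha m (hm a ha)).trans ?_
  calc _ ≤ L * m * (bumpRange * μ) := by gcongr; exact volume_real_bubbleWindow_le hμ0
    _ = _ := by ring

end Average

/-! ### The modulation parameters -/

/-- A smooth function of the modulus that keeps only the scales at which the bump transform is
large. -/
noncomputable def scaleWeight (z : ℂ) : ℝ :=
  Real.smoothTransition (‖z‖ ^ 2 - (bumpPairing 1 / 2) ^ 2)

lemma contDiff_scaleWeight : ContDiff ℝ 1 scaleWeight :=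
  Real.smoothTransition.contDiff.comp ((contDiff_norm_sq ℝ).sub contDiff_const)

lemma scaleWeight_nonneg (z : ℂ) : 0 ≤ scaleWeight z := Real.smoothTransition.nonneg _

lemma scaleWeight_eq_zero (z : ℂ) (h : ‖z‖ ≤ bumpPairing 1 / 2) : scaleWeight z = 0 :=
  Real.smoothTransition.zero_of_nonpos (sub_nonpos.2 (pow_le_pow_left₀ (norm_nonneg z) h 2))

lemma scaleWeight_bumpPairing_one_pos : 0 < scaleWeight (bumpPairing 1) := by
  have h := bumpPairing_pos one_pos
  refine Real.smoothTransition.pos_of_pos ?_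
  rw [Complex.norm_real, Real.norm_of_nonneg h.le]
  nlinarith

/-- The bump transform, cut off to the scales at which it is large. -/
noncomputable def phaseWeight (z : ℂ) : ℂ := scaleWeight z • z

lemma contDiff_phaseWeight : ContDiff ℝ 1 phaseWeight := contDiff_scaleWeight.smul contDiff_id

lemma phaseWeight_eq_zero (z : ℂ) (h : ‖z‖ ≤ bumpPairing 1 / 2) : phaseWeight z = 0 := by
  rw [phaseWeight, scaleWeight_eq_zero z h, zero_smul]

lemma integral_pos_of_bubbleWindow {F : ℝ → ℝ} (hF : ContinuousOn F (Ioi 0))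
    (h0 : ∀ b, 0 < b → 0 ≤ F b) (h1 : 0 < F 1)
    (hw : ∀ b, 0 < b → b ∉ bubbleWindow 1 → F b = 0) : 0 < ∫ b in Ioi (0 : ℝ), F b := by
  have hi : IntegrableOn F (Ioi 0) :=
    ((hF.mono (bubbleWindow_subset one_pos)).integrableOn_Icc).of_forall_sdiff_eq_zero
      measurableSet_Ioi fun b hb => hw b hb.1 hb.2
  refine (setIntegral_pos_iff_support_of_nonneg_ae
    ((ae_restrict_mem measurableSet_Ioi).mono fun b hb => h0 b hb) hi).2 ?_
  have ho : IsOpen (Ioi 0 ∩ F ⁻¹' Ioi 0) := hF.isOpen_inter_preimage isOpen_Ioi isOpen_Ioi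
  exact (ho.measure_pos volume ⟨1, mem_Ioi.2 one_pos, h1⟩).trans_le
    (measure_mono fun b hb => ⟨(ne_of_gt hb.2), hb.1⟩)

lemma scaleWeight_bumpPairing_eq_zero {b : ℝ} (hb : 0 < b) (hw : b ∉ bubbleWindow 1) :
    scaleWeight (bumpPairing b) = 0 := by
  have h1 := bumpPairing_pos one_pos
  refine scaleWeight_eq_zero _ (not_lt.1 fun h => hw (mem_bubbleWindow hb one_pos ?_))
  rw [Complex.norm_real, Real.norm_of_nonneg (bumpPairing_pos hb).le] at h
  rw [div_one]
  linarith

lemma continuousOn_scaleWeight_bumpPairing :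
    ContinuousOn (fun b => scaleWeight (bumpPairing b)) (Ioi 0) :=
  contDiff_scaleWeight.continuous.comp_continuousOn
    (Complex.continuous_ofReal.comp_continuousOn continuousOn_bumpPairing)

/-- The average of `scaleWeight` over the scales of the ground state. -/
noncomputable def scaleMass : ℝ := ∫ b in Ioi (0 : ℝ), scaleWeight (bumpPairing b)

/-- The average of `phaseWeight` over the scales of the ground state. -/
noncomputable def phaseMass : ℝ := ∫ b in Ioi (0 : ℝ), scaleWeight (bumpPairing b) * bumpPairing b

lemma scaleMass_pos : 0 < scaleMass :=
  integral_pos_of_bubbleWindow continuousOn_scaleWeight_bumpPairing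
    (fun _ _ => scaleWeight_nonneg _) scaleWeight_bumpPairing_one_pos
    fun _ => scaleWeight_bumpPairing_eq_zero

lemma phaseMass_pos : 0 < phaseMass :=
  integral_pos_of_bubbleWindow (continuousOn_scaleWeight_bumpPairing.mul continuousOn_bumpPairing)
    (fun _ hb => mul_nonneg (scaleWeight_nonneg _) (bumpPairing_pos hb).le)
    (mul_pos scaleWeight_bumpPairing_one_pos (bumpPairing_pos one_pos))
    fun _ hb hw => by rw [scaleWeight_bumpPairing_eq_zero hb hw, zero_mul]

lemma scaleWeight_mul {e : ℂ} (he : ‖e‖ = 1) (z : ℂ) : scaleWeight (e * z) = scaleWeight z := by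
  rw [scaleWeight, norm_mul, he, one_mul, scaleWeight]

lemma integral_scaleWeight_mul {e : ℂ} (he : ‖e‖ = 1) :
    ∫ b in Ioi (0 : ℝ), scaleWeight (e * bumpPairing b) = scaleMass := by
  simp only [scaleWeight_mul he, scaleMass]

lemma integral_phaseWeight_mul {e : ℂ} (he : ‖e‖ = 1) :
    ∫ b in Ioi (0 : ℝ), phaseWeight (e * bumpPairing b) = e * phaseMass := by
  rw [phaseMass, ← integral_complex_ofReal, ← integral_const_mul]
  refine integral_congr_ae (Eventually.of_forall fun b => ?_)
  simp only [phaseWeight, scaleWeight_mul he, Complex.real_smul]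
  push_cast
  ring

/-- The phase of a complex number close to a unit vector is close to it. -/
lemma norm_exp_sub_le {Z e : ℂ} {θ η : ℝ} (he : ‖e‖ = 1) (h : ‖Z - e‖ ≤ η)
    (hθ : Z = ‖Z‖ * Complex.exp (Complex.I * θ)) : ‖e - Complex.exp (Complex.I * θ)‖ ≤ 2 * η := by
  set E := Complex.exp (Complex.I * θ)
  have hE : ‖E‖ = 1 := Complex.norm_exp_I_mul_ofReal θ
  have h1 : ‖Z - E‖ ≤ η := by
    have e1 : Z - E = ((‖Z‖ - 1 : ℝ) : ℂ) * E := by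
      conv_lhs => rw [hθ]
      push_cast
      ring
    have h2 := abs_norm_sub_norm_le Z e
    rw [he] at h2
    rw [e1, norm_mul, hE, mul_one, Complex.norm_real, Real.norm_eq_abs]
    exact h2.trans h
  have h3 := norm_sub_le (Z - E) (Z - e)
  rw [sub_sub_sub_cancel_left] at h3
  linarith

/-- Near a bubble, the averages over the scales recover its frequency and its phase. -/
lemma exists_modulation_le : ∃ C : ℝ, 0 < C ∧ ∀ (f : Space3 → ℂ) (e : ℂ) (ν d : ℝ),
    MemLp f 6 volume → ‖e‖ = 1 → 0 < ν →
    lpNorm (fun x => f x - e * bubble ν x) 6 volume ≤ d → d ≤ bubbleRadius → C * d ≤ 1 / 2 →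
    |scaleIntegral scaleWeight f / scaleMass / ν - 1| ≤ C * d ∧
    scaleIntegral phaseWeight f ≠ 0 ∧
    ∀ θ : ℝ, scaleIntegral phaseWeight f
        = ‖scaleIntegral phaseWeight f‖ * Complex.exp (Complex.I * θ) →
      ‖e - Complex.exp (Complex.I * θ)‖ ≤ 2 * (C * d) := by
  obtain ⟨C₁, hC₁, h₁⟩ := exists_norm_scaleIntegral_sub_le contDiff_scaleWeight scaleWeight_eq_zero
  obtain ⟨C₂, hC₂, h₂⟩ := exists_norm_scaleIntegral_sub_le contDiff_phaseWeight phaseWeight_eq_zero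
  have hm := scaleMass_pos
  have hp := phaseMass_pos
  refine ⟨C₁ / scaleMass + C₂ / phaseMass, by positivity, fun f e ν d hf he hν hfd hdr hd => ?_⟩
  have hd0 : 0 ≤ d := lpNorm_nonneg.trans hfd
  have k1 := h₁ f e ν hf he hν (hfd.trans hdr)
  have k2 := h₂ f e ν hf he hν (hfd.trans hdr)
  rw [integral_scaleWeight_mul he, smul_eq_mul, Real.norm_eq_abs] at k1
  rw [integral_phaseWeight_mul he, Complex.real_smul] at k2
  have k1' := k1.trans (mul_le_mul_of_nonneg_left hfd (by positivity))
  have k2' := k2.trans (mul_le_mul_of_nonneg_left hfd (by positivity))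
  set s := scaleIntegral scaleWeight f
  set Z := scaleIntegral phaseWeight f
  have q1 : 0 ≤ C₁ / scaleMass * d := by positivity
  have q2 : 0 ≤ C₂ / phaseMass * d := by positivity
  have hpC : (phaseMass : ℂ) ≠ 0 := Complex.ofReal_ne_zero.2 hp.ne'
  have hνC : (ν : ℂ) ≠ 0 := Complex.ofReal_ne_zero.2 hν.ne'
  set c : ℝ := (ν * phaseMass)⁻¹
  have hc : 0 < c := by positivity
  have z1 : ‖c * Z - e‖ ≤ C₂ / phaseMass * d := by
    have e1 : c * Z - e = c * (Z - ν * (e * phaseMass)) := by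
      simp only [c]; push_cast; field_simp
    rw [e1, norm_mul, Complex.norm_real, Real.norm_of_nonneg hc.le]
    refine (mul_le_mul_of_nonneg_left k2' hc.le).trans (le_of_eq ?_)
    simp only [c]; field_simp
  refine ⟨?_, fun h0 => ?_, fun θ hθ => ?_⟩
  · have e1 : s / scaleMass / ν - 1 = (s - ν * scaleMass) / (scaleMass * ν) := by field_simp
    rw [e1, abs_div, abs_of_pos (by positivity : 0 < scaleMass * ν)]
    refine (div_le_div_of_nonneg_right k1' (by positivity)).trans ?_
    have e2 : C₁ * ν * d / (scaleMass * ν) = C₁ / scaleMass * d := by field_simp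
    rw [e2]
    linarith
  · rw [h0, mul_zero, zero_sub, norm_neg, he] at z1
    linarith
  · refine (norm_exp_sub_le (Z := c * Z) he z1 ?_).trans (by linarith)
    rw [norm_mul, Complex.norm_real, Real.norm_of_nonneg hc.le, Complex.ofReal_mul, mul_assoc, ← hθ]

/-! ### The decomposition of the solution -/

lemma IsNLSSolution.continuousAt_gradGap {I : Set ℝ} {u : ℝ → Space3 → ℂ} (h : IsNLSSolution I u)
    {t : ℝ} (ht : t ∈ I) : ContinuousAt (fun s => gradGap (u s)) t := by
  obtain ⟨G, hG⟩ := exists_isSobolev (h.mem_sobolev t ht)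
  have hgrad : Tendsto (fun s => (hDotNorm fun x => u s x - u t x).toReal) (𝓝 t) (𝓝 0) :=
    (ENNReal.tendsto_toReal ENNReal.zero_ne_top).comp
      (tendsto_of_tendsto_of_tendsto_of_le_of_le tendsto_const_nhds (h.continuous_sobolev t ht)
        (fun _ => zero_le) fun _ => le_add_self)
  have hc : ContinuousAt (fun s => (hDotNorm (u s)).toReal) t := by
    refine tendsto_iff_dist_tendsto_zero.2
      (squeeze_zero' (Eventually.of_forall fun _ => dist_nonneg) ?_ hgrad)
    filter_upwards [h.isOpen.mem_nhds ht] with s hs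
    obtain ⟨H, hH⟩ := exists_isSobolev (h.mem_sobolev s hs)
    rw [(hH.sub hG).hDotNorm_eq, hH.hDotNorm_eq, hG.hDotNorm_eq, Real.dist_eq, abs_sub_le_iff]
    have h1 := lpNorm_le_lpNorm_add_lpNorm_sub' (f := H) hG.memLp_grad one_le_two
    have h2 := lpNorm_le_lpNorm_add_lpNorm_sub (f := G) hH.memLp_grad one_le_two
    exact ⟨sub_le_iff_le_add'.2 h1, sub_le_iff_le_add'.2 h2⟩
  exact (continuousAt_const.sub (hc.pow 2)).abs

/-- The remainder of `f` after removing a modulated bubble and undoing the modulation of phase. -/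
noncomputable def remainder (f : Space3 → ℂ) (θ μ : ℝ) (x : Space3) : ℂ :=
  Complex.exp (-(Complex.I * θ)) * f x - bubble μ x

lemma eq_exp_mul_remainder_add (f : Space3 → ℂ) (θ μ : ℝ) (x : Space3) :
    f x = Complex.exp (Complex.I * θ) * (remainder f θ μ x + bubble μ x) := by
  rw [remainder, sub_add_cancel, ← mul_assoc, ← Complex.exp_add, add_neg_cancel, Complex.exp_zero,
    one_mul]

section Remainder
variable {f : Space3 → ℂ} {G : Space3 → EuclideanSpace ℂ (Fin 3)}

lemma IsSobolev.memLp_grad_sub (h : IsSobolev 2 f G) (c : ℂ) {μ : ℝ} (hμ : 0 < μ) :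
    MemLp (fun x => G x - c • cgrad (bubble μ) x) 2 volume :=
  h.memLp_grad.sub ((memLp_cgrad_bubble hμ.ne').const_smul c)

lemma IsSobolev.hDotNorm_remainder (h : IsSobolev 2 f G) (θ : ℝ) {μ : ℝ} (hμ : 0 < μ) :
    hDotNorm (remainder f θ μ) = ENNReal.ofReal
      (lpNorm (fun x => G x - Complex.exp (Complex.I * θ) • cgrad (bubble μ) x) 2 volume) := by
  rw [ofReal_lpNorm (h.memLp_grad_sub _ hμ), hDotNorm]
  have h1 := ((h.weak.const_mul (Complex.exp (-(Complex.I * θ)))).sub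
    (hasWeakGradient_bubble μ)).gradNorm_eq 2
  refine h1.trans (eLpNorm_congr_norm_ae (Eventually.of_forall fun x => ?_))
  have e1 : Complex.exp (-(Complex.I * θ)) • G x - cgrad (bubble μ) x
      = Complex.exp (-(Complex.I * θ))
        • (G x - Complex.exp (Complex.I * θ) • cgrad (bubble μ) x) := by
    rw [smul_sub, smul_smul, ← Complex.exp_add, neg_add_cancel, Complex.exp_zero, one_smul]
  have e2 : ‖Complex.exp (-(Complex.I * θ))‖ = 1 := by
    rw [← mul_neg, ← Complex.ofReal_neg]; exact Complex.norm_exp_I_mul_ofReal _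
  beta_reduce
  rw [e1, norm_smul, e2, one_mul]

/-- The gap is controlled by the size of the remainder, whichever bubble is removed. -/
lemma IsSobolev.gradGap_le (h : IsSobolev 2 f G) (hg : gradGap f ≤ 1) {c : ℂ} (hc : ‖c‖ = 1)
    {μ : ℝ} (hμ : 0 < μ) : gradGap f ≤ (√bubbleMass + √(bubbleMass + 1))
      * lpNorm (fun x => G x - c • cgrad (bubble μ) x) 2 volume := by
  set b : Space3 → EuclideanSpace ℂ (Fin 3) := c • cgrad (bubble μ)
  have hb : MemLp b 2 volume := (memLp_cgrad_bubble hμ.ne').const_smul c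
  have hbn : lpNorm b 2 volume = √bubbleMass := by
    rw [← lpNorm_cgrad_bubble_sq hμ, Real.sqrt_sq lpNorm_nonneg, lpNorm_const_smul, coe_nnnorm, hc,
      one_mul]
  have hgap : gradGap f = |√bubbleMass ^ 2 - lpNorm G 2 volume ^ 2| := by
    rw [gradGap, hDotNorm_groundState_sq, h.hDotNorm_eq, Real.sq_sqrt bubbleMass_pos.le]
  have hGn : lpNorm G 2 volume ≤ √(bubbleMass + 1) := by
    refine Real.le_sqrt_of_sq_le ?_
    rw [hgap, Real.sq_sqrt bubbleMass_pos.le] at hg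
    linarith [(abs_le.1 hg).1]
  have h1 := lpNorm_le_lpNorm_add_lpNorm_sub' (f := G) hb one_le_two
  have h2 := lpNorm_le_lpNorm_add_lpNorm_sub (f := b) h.memLp_grad one_le_two
  rw [hbn] at h1 h2
  change _ ≤ _ * lpNorm (G - b) 2 volume
  have h0 : 0 ≤ lpNorm G 2 volume := lpNorm_nonneg
  have hM := Real.sqrt_nonneg bubbleMass
  rw [hgap, show √bubbleMass ^ 2 - lpNorm G 2 volume ^ 2
    = (√bubbleMass + lpNorm G 2 volume) * (√bubbleMass - lpNorm G 2 volume) by ring, abs_mul,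
    abs_of_nonneg (by positivity)]
  exact mul_le_mul (by linarith) (abs_sub_le_iff.2 ⟨by linarith, by linarith⟩) (abs_nonneg _)
    (by positivity)

/-- Moving the frequency and the phase of a bubble slightly changes the remainder slightly. -/
lemma IsSobolev.lpNorm_grad_sub_le (h : IsSobolev 2 f G) {c e : ℂ} (he : ‖e‖ = 1) {μ ν η : ℝ}
    (hν : 0 < ν) (hη : |μ / ν - 1| ≤ η) (hη' : η ≤ 1 / 2) (hce : ‖c - e‖ ≤ 2 * η) :
    lpNorm (fun x => G x - e • cgrad (bubble μ) x) 2 volume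
      ≤ lpNorm (fun x => G x - c • cgrad (bubble ν) x) 2 volume + 38 * η * √bubbleMass := by
  have hb := memLp_cgrad_bubble hν.ne'
  have h1 := lpNorm_sub_smul_le one_le_two h.memLp_grad hb c e
  have h2 := lpNorm_cgrad_bubble_sub_le hν (hη.trans hη')
  have hbn : lpNorm (cgrad (bubble ν)) 2 volume = √bubbleMass := by
    rw [← lpNorm_cgrad_bubble_sq hν, Real.sqrt_sq lpNorm_nonneg]
  have h3 := lpNorm_sub_le (f := fun x => G x - e • cgrad (bubble ν) x)
    (g := e • (fun x => cgrad (bubble μ) x - cgrad (bubble ν) x)) (h.memLp_grad_sub e hν) one_le_two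
  have e1 : (fun x => G x - e • cgrad (bubble ν) x)
      - e • (fun x => cgrad (bubble μ) x - cgrad (bubble ν) x)
      = fun x => G x - e • cgrad (bubble μ) x := by
    ext1 x
    simp only [Pi.sub_apply, Pi.smul_apply, smul_sub]
    abel
  rw [e1, lpNorm_const_smul, coe_nnnorm, he, one_mul] at h3
  rw [hbn] at h1
  have hM := Real.sqrt_nonneg bubbleMass
  nlinarith [mul_le_mul_of_nonneg_right hη hM, mul_le_mul_of_nonneg_right hce hM]

end Remainder

/-- The pointwise-in-time form of the modulation estimates: `e` and `ν` are the phase and frequency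
of some bubble near `u t`, and `μ` is the frequency read off from the averages over the scales. -/
lemma exists_abs_deriv_scale_le : ∃ C : ℝ, 0 < C ∧ ∀ (I : Set ℝ) (u : ℝ → Space3 → ℂ),
    IsNLSSolution I u → ∀ t ∈ I, ∀ (e : ℂ) (ν d : ℝ), ‖e‖ = 1 → bumpRange ≤ ν →
    lpNorm (fun x => u t x - e * bubble ν x) 6 volume ≤ d → lpNorm (u t) 4 volume ^ 2 ≤ d →
    d ≤ bubbleRadius / 2 → |scaleIntegral scaleWeight (u t) / scaleMass / ν - 1| ≤ 1 / 2 →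
    |deriv (fun s => scaleIntegral scaleWeight (u s) / scaleMass) t
        / (scaleIntegral scaleWeight (u t) / scaleMass)|
      ≤ C * (scaleIntegral scaleWeight (u t) / scaleMass) ^ 2 * d := by
  obtain ⟨C₁, hC₁, h₁⟩ := exists_norm_deriv_scaleIntegral_le contDiff_scaleWeight
    scaleWeight_eq_zero
  obtain ⟨C₂, hC₂, h₂⟩ := exists_norm_bumpTransformDeriv_le
  have hm := scaleMass_pos
  have hR := one_le_bumpRange
  refine ⟨C₁ * (C₂ * bumpRange ^ 2 * 17) / scaleMass * 8, by positivity,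
    fun I u h t ht e ν d he hν hd h4 hdr hs => ?_⟩
  set s := scaleIntegral scaleWeight (u t) / scaleMass
  have hν0 : 0 < ν := by linarith
  have hd6 : 0 ≤ lpNorm (fun x => u t x - e * bubble ν x) 6 volume := lpNorm_nonneg
  have hd0 : 0 ≤ d := hd6.trans hd
  have hd1 : d ≤ 1 := by linarith [bubbleRadius_le_one]
  have hs2 : ν / 2 ≤ s := by
    have := (abs_le.1 hs).1
    have h3 : 1 / 2 ≤ s / ν := by linarith
    rw [le_div_iff₀ hν0] at h3
    linarith
  have hs0 : 0 < s := by linarith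
  have h40 : 0 ≤ lpNorm (u t) 4 volume := lpNorm_nonneg
  have h43 : lpNorm (u t) 4 volume ^ 3 ≤ d := by
    have h41 : lpNorm (u t) 4 volume ≤ 1 := by nlinarith
    nlinarith [sq_nonneg (lpNorm (u t) 4 volume)]
  -- All scales in the window are at least `1` because `bumpRange ≤ ν`.
  have hM : ∀ a ∈ bubbleWindow ν, ‖bumpTransformDeriv (u t) a‖
      ≤ C₂ * (bumpRange * ν) ^ 2 * (d * (1 + 1) ^ 4 + d) := fun a ha => by
    have ha1 : 1 ≤ a := by
      refine le_trans ?_ ha.1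
      rw [inv_mul_eq_div, le_div_iff₀ (by linarith), one_mul]; exact hν
    refine (h₂ (u t) e ν a (h.memLp_two ht) (h.memLp_six ht) he hν0 ha1).trans ?_
    have ha2 := ha.2
    have := hd.trans hd1
    gcongr
  have k := (h₁ I u h t ht e ν he hν (hd.trans hdr)).2 _ hM
  rw [deriv_div_const, abs_div, abs_div, abs_of_pos hm, abs_of_pos hs0, div_le_iff₀ hs0,
    div_le_iff₀ hm, ← Real.norm_eq_abs]
  refine k.trans ?_
  have hcube : ν ^ 3 ≤ 8 * s ^ 3 := by
    have := pow_le_pow_left₀ hν0.le (by linarith : ν ≤ 2 * s) 3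
    linarith [mul_pow 2 s 3]
  calc _ = C₁ * (C₂ * bumpRange ^ 2 * 17) * d * ν ^ 3 := by ring
    _ ≤ C₁ * (C₂ * bumpRange ^ 2 * 17) * d * (8 * s ^ 3) := by gcongr
    _ = _ := by field_simp

theorem proposition3p1 :
    ∃ δ₀ : ℝ, 0 < δ₀ ∧ ∃ C : ℝ, 0 < C ∧
      ∀ (I : Set ℝ) (u : ℝ → Space3 → ℂ), IsNLSSolution I u →
        (∀ t ∈ I, IsRadial (u t)) →
        energy (u 0) = criticalEnergy groundState →
        ∃ (θ μ : ℝ → ℝ) (g : ℝ → Space3 → ℂ),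
          ∀ t ∈ I, gradGap (u t) < δ₀ →
            ContDiffAt ℝ 1 θ t ∧ ContDiffAt ℝ 1 μ t ∧ 0 < μ t ∧
            (∀ x : Space3, u t x = Complex.exp (Complex.I * (θ t : ℂ)) *
              (g t x + ((Real.sqrt (μ t) : ℝ) : ℂ) * groundState (μ t • x))) ∧
            eLpNorm (u t) 4 volume ^ 2 + ENNReal.ofReal (1 / (1 + μ t))
              ≤ ENNReal.ofReal (C * gradGap (u t)) ∧
            ENNReal.ofReal (gradGap (u t)) ≤ ENNReal.ofReal C * hDotNorm (g t) ∧
            hDotNorm (g t) ≤ ENNReal.ofReal (C * gradGap (u t)) ∧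
            |deriv μ t / μ t| ≤ C * μ t ^ 2 * gradGap (u t) := by
  obtain ⟨δ₁, C₁, hδ₁, hC₁, hnear⟩ := exists_near_bubble_of_energy
  obtain ⟨C₂, hC₂, hmod⟩ := exists_modulation_le
  obtain ⟨C₃, hC₃, hder⟩ := exists_abs_deriv_scale_le
  obtain ⟨C₄, hC₄, hreg⟩ := exists_norm_deriv_scaleIntegral_le contDiff_scaleWeight
    scaleWeight_eq_zero
  obtain ⟨C₅, hC₅, hreg'⟩ := exists_norm_deriv_scaleIntegral_le contDiff_phaseWeight
    phaseWeight_eq_zero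
  have hrad := bubbleRadius_pos
  have hR := one_le_bumpRange
  have hR0 : 0 < bumpRange := one_pos.trans_le hR
  set A := √bubbleMass with hA
  set B := A + √(bubbleMass + 1) with hB
  have hA0 : 0 ≤ A := Real.sqrt_nonneg _
  have hB0 : 0 ≤ B := add_nonneg hA0 (Real.sqrt_nonneg _)
  -- The gap is restricted so that `C₁ * gradGap (u t) ≤ ρ`: the nearby bubble then has frequency at
  -- least `bumpRange`, and the modulation estimates apply.
  set ρ := min (bubbleRadius / 2) (min (1 / bumpRange) (1 / (2 * C₂))) with hρ
  have hρ0 : 0 < ρ := lt_min (by positivity) (lt_min (by positivity) (by positivity))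
  refine ⟨min (min δ₁ 1) (ρ / C₁), lt_min (lt_min hδ₁ one_pos) (by positivity),
    3 * C₁ + B + (C₁ + 38 * (C₂ * C₁) * A) + C₃ * C₁, by positivity, fun I u h hu hE => ?_⟩
  set δ₀ := min (min δ₁ 1) (ρ / C₁)
  set S : Set ℝ := {t | t ∈ I ∧ gradGap (u t) < δ₀}
  have hS : IsOpen S := isOpen_iff_mem_nhds.2 fun t ht =>
    inter_mem (h.isOpen.mem_nhds ht.1)
      ((h.continuousAt_gradGap ht.1).eventually_lt_const ht.2)
  have hbub : ∀ t ∈ S, ∃ (G : Space3 → EuclideanSpace ℂ (Fin 3)) (e : ℂ) (ν : ℝ),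
      IsSobolev 2 (u t) G ∧ ‖e‖ = 1 ∧ bumpRange ≤ ν ∧ 1 / ν ≤ C₁ * gradGap (u t) ∧
      lpNorm (u t) 4 volume ^ 2 ≤ C₁ * gradGap (u t) ∧
      lpNorm (fun x => G x - e • cgrad (bubble ν) x) 2 volume ≤ C₁ * gradGap (u t) ∧
      lpNorm (fun x => u t x - e * bubble ν x) 6 volume ≤ C₁ * gradGap (u t) ∧
      C₁ * gradGap (u t) ≤ bubbleRadius / 2 ∧ C₂ * (C₁ * gradGap (u t)) ≤ 1 / 2 := by
    intro t ht
    obtain ⟨G, hG⟩ := exists_isSobolev (h.mem_sobolev t ht.1)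
    have hsmall : C₁ * gradGap (u t) ≤ ρ := by
      have := (ht.2.trans_le (min_le_right _ _)).le
      rwa [le_div_iff₀ hC₁, mul_comm] at this
    obtain ⟨-, h4, θ, ν, hν, hν', hd2, hd6⟩ := hnear (u t) G hG (hu t ht.1)
      ((h.energy_eq ht.1).trans hE)
      (ht.2.trans_le ((min_le_left _ _).trans (min_le_left _ _)))
    refine ⟨G, Complex.exp (Complex.I * θ), ν, hG, Complex.norm_exp_I_mul_ofReal θ, ?_, hν', h4,
      hd2, hd6, hsmall.trans (min_le_left _ _), ?_⟩
    · have h1 := (hν'.trans hsmall).trans ((min_le_right _ _).trans (min_le_left _ _))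
      exact (one_div_le_one_div hν hR0).1 h1
    · have h1 := hsmall.trans ((min_le_right _ _).trans (min_le_right _ _))
      rw [le_div_iff₀ (by positivity)] at h1
      linarith
  obtain ⟨θ, hθ⟩ := exists_phase (Z := fun t => scaleIntegral phaseWeight (u t)) hS
    (fun t ht => by
      obtain ⟨G, e, ν, hG, he, hν, -, -, -, hd6, hr, -⟩ := hbub t ht
      exact (hreg' I u h t ht.1 e ν he hν (hd6.trans hr)).1)
    (fun t ht => by
      obtain ⟨G, e, ν, hG, he, hν, -, -, -, hd6, hr, hr'⟩ := hbub t ht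
      exact (hmod (u t) e ν _ (h.memLp_six ht.1) he (hR0.trans_le hν) hd6 (by linarith) hr').2.1)
  set μ : ℝ → ℝ := fun t => scaleIntegral scaleWeight (u t) / scaleMass with hμdef
  refine ⟨θ, μ, fun t => remainder (u t) (θ t) (μ t), fun t htI htδ => ?_⟩
  have ht : t ∈ S := ⟨htI, htδ⟩
  obtain ⟨G, e, ν, hG, he, hν, hν', h4, hd2, hd6, hr, hr'⟩ := hbub t ht
  set δ := gradGap (u t)
  have hδ0 : 0 ≤ δ := abs_nonneg _
  have hν0 : 0 < ν := hR0.trans_le hν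
  obtain ⟨m1, -, m3⟩ := hmod (u t) e ν _ (h.memLp_six htI) he hν0 hd6 (by linarith) hr'
  replace m3 := m3 (θ t) (hθ t ht).2
  change |μ t / ν - 1| ≤ _ at m1
  have hμν : ν / 2 ≤ μ t := by
    have h1 := (abs_le.1 (m1.trans hr')).1
    have h2 : 1 / 2 ≤ μ t / ν := by linarith
    rw [le_div_iff₀ hν0] at h2
    linarith
  have hμ0 : 0 < μ t := by linarith
  have hE1 : ‖Complex.exp (Complex.I * (θ t))‖ = 1 := Complex.norm_exp_I_mul_ofReal _
  refine ⟨(hθ t ht).1, (hreg I u h t htI e ν he hν (hd6.trans hr)).1.div_const _, hμ0,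
    eq_exp_mul_remainder_add (u t) (θ t) (μ t), ?_, ?_, ?_, ?_⟩
  · rw [← ofReal_lpNorm (memLp_four (h.memLp_two htI) (h.memLp_six htI)),
      ← ENNReal.ofReal_pow lpNorm_nonneg, ← ENNReal.ofReal_add (by positivity) (by positivity)]
    refine ENNReal.ofReal_le_ofReal ?_
    have h1 : 1 / (1 + μ t) ≤ 2 * (1 / ν) := by
      rw [mul_one_div, div_le_div_iff₀ (by positivity) hν0]
      linarith
    have h2 : 0 ≤ (B + (C₁ + 38 * (C₂ * C₁) * A) + C₃ * C₁) * δ := by positivity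
    linarith
  · rw [hG.hDotNorm_remainder (θ t) hμ0, ← ENNReal.ofReal_mul (by positivity)]
    refine ENNReal.ofReal_le_ofReal ((hG.gradGap_le ?_ hE1 hμ0).trans
      (mul_le_mul_of_nonneg_right ?_ lpNorm_nonneg))
    · exact (htδ.trans_le ((min_le_left _ _).trans (min_le_right _ _))).le
    · have : 0 ≤ 3 * C₁ + (C₁ + 38 * (C₂ * C₁) * A) + C₃ * C₁ := by positivity
      linarith
  · rw [hG.hDotNorm_remainder (θ t) hμ0]
    refine ENNReal.ofReal_le_ofReal ((hG.lpNorm_grad_sub_le hE1 hν0 m1 hr' m3).trans ?_)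
    have : 0 ≤ (3 * C₁ + B + C₃ * C₁) * δ := by positivity
    linarith
  · refine (hder I u h t htI e ν _ he hν hd6 h4 hr (m1.trans hr')).trans ?_
    have : 0 ≤ (3 * C₁ + B + (C₁ + 38 * (C₂ * C₁) * A)) * (μ t ^ 2 * δ) := by positivity
    change C₃ * μ t ^ 2 * (C₁ * δ) ≤ _
    linarith
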